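/- Let $n\in\mathbb N$, $n\ge 1$, let $E\neq\{0\}$ be a complex Banach space with unit sphere $U_E=\{x\in E:\|x\|=1\}$, and fix $d>1$. Let $\mathcal S'(\mathbb R^n,E)$ be the space of continuous linear maps $\mathcal S(\mathbb R^n)\to E$ with pointwise convergence. **Function spaces.** The Fourier transform is $\hat\varphi(\xi)=(2\pi)^{-n/2}\int\varphi(x)e^{-ix\xi}\,dx$, extended to $\mathcal S'(\mathbb R^n,E)$ by $\hat f(\varphi)=f(\hat\varphi)$. Let $(\varphi_j)_{j\ge 0}\subset\mathcal S(\mathbb R^n)$ be a smooth dyadic resolution of unity, i.e. $\operatorname{supp}\varphi_0\subset\{|\xi|\le 2\}$, $\operatorname{supp}\varphi_j\subset\{2^{j-1}\le|\xi|\le 2^{j+1}\}$ for $j\ge1$, $\sum_j\varphi_j=1$, and $|D^\alpha\varphi_j|\le c_\alpha2^{-j|\alpha|}$ for all $\alpha\in\mathbb N_0^n$. For $f\in\mathcal S'(\mathbb R^n,E)$ put $$\|f|B^s_{p,q}(E)\|=\Big(\sum_{j\ge0}2^{jsq}\,\|(\varphi_j\hat f)\check{\ }|L_p(E)\|^q\Big)^{1/q},\qquad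 \|f|F^s_{p,q}(E)\|=\Big\|\Big(\sum_{j\ge0}2^{jsq}\,\|(\varphi_j\hat f)\check{\ }(\cdot)|E\|^q\Big)^{1/q}\Big|L_p\Big\|$$ (supremum if $q=\infty$); the space consists of those $f$ with finite quasi-norm. **Numbers, cubes, sequence spaces.** $\sigma_p=n(\frac1p-1)_+$ and $\sigma_{p,q}=n(\frac1{\min(p,q)}-1)_+$. For $\nu\in\mathbb N_0$, $m\in\mathbb Z^n$, $d\cdot Q_{\nu,m}$ is the closed cube with centre $2^{-\nu}m$, sides parallel to the axes and side length $d2^{-\nu}$, and $\chi^{(p)}_{\nu,m}=2^{\nu n/p}\chi_{Q_{\nu,m}}$. For $\lambda=(\lambda_{\nu,m})\subset\mathbb C$, $$\|\lambda|b_{p,q}\|=\Big(\sum_{\nu}\Big(\sum_m|\lambda_{\nu,m}|^p\Big)^{q/p}\Big)^{1/q},\qquad \|\lambda|f_{p,q}\|=\Big\|\Big(\sum_{\nu,m}|\lambda_{\nu,m}\chi^{(p)}_{\nu,m}(\cdot)|^q\Big)^{1/q}\Big|L_p\Big\|$$ (suprema if $p=\infty$ or $q=\infty$). **Atoms.** For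 $\sigma\in\mathbb R$, $K\in\mathbb N_0$, $L\ge-1$ an integer, a $(\sigma,p)_{K,L}$-atom at $Q_{\nu,m}$ is a $K$ times differentiable (continuous if $K=0$) function $a:\mathbb R^n\to\mathbb C$ with $\operatorname{supp}a\subset d\cdot Q_{\nu,m}$, $|D^\alpha a(x)|\le2^{-\nu(\sigma-n/p)+|\alpha|\nu}$ for $|\alpha|\le K$, and $\int x^\beta a(x)\,dx=0$ for $|\beta|\le L$. **Theorem.** (i) Let $\frac n{n+1}<p\le\infty$, $0<q\le\infty$, $s\in\mathbb R$. Let $M\in\mathbb N$ with $M>\sigma_p$ and $M>s$, $K\in\mathbb N_0$ with $K\ge\lfloor s\rfloor+1$, and $L$ with $\frac{L+1}2\in\mathbb N_0$ and $L\ge\lfloor\sigma_p-s\rfloor$. Then there is $\varkappa>0$ such that for all real $\mu\ge\varkappa$ and every smooth dyadic resolution of unity the following holds. An $f\in\mathcal S'(\mathbb R^n,E)$ belongs to $B^s_{p,q}(E)$ if and only if it can be represented as $$f=\sum_{\gamma\in\mathbb N_0^n}\sum_{\nu=0}^\infty\sum_{m\in\mathbb Z^n}\big(\varrho^\gamma_{\nu,m}e^\gamma_{\nu,m}a^\gamma_{\nu,m}+\lambda^\gamma_{\nu,m}e^{\gamma,L}_{\nu,m}a^{\gamma,L}_{\nu,m}\big)\quad\text{unconditionally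 in }\mathcal S'(\mathbb R^n,E),\tag{1}$$ where $\varrho^\gamma_{\nu,m},\lambda^\gamma_{\nu,m}\in\mathbb C$, $e^\gamma_{\nu,m},e^{\gamma,L}_{\nu,m}\in U_E$, $a^\gamma_{\nu,m}$ and $a^{\gamma,L}_{\nu,m}$ are $(M,p)_{K,-1}$- and $(s,p)_{K,L}$-atoms at $Q_{\nu,m}$ respectively, and $$\sup_{\gamma}2^{\mu|\gamma|}\big(\|\varrho^\gamma|b_{p,q}\|+\|\lambda^\gamma|b_{p,q}\|\big)<\infty.\tag{2}$$ Moreover there are constants $c,C>0$, independent of $f$, such that for all $f\in B^s_{p,q}(E)$ $$c\,\|f|B^s_{p,q}(E)\|\le\inf\ \sup_\gamma2^{\mu|\gamma|}\big(\|\varrho^\gamma|b_{p,q}\|+\|\lambda^\gamma|b_{p,q}\|\big)\le C\,\|f|B^s_{p,q}(E)\|,$$ the infimum being taken over all representations (1) of $f$ with (2). (ii) Let in addition $p<\infty$. With $\sigma_p$ replaced by $\sigma_{p,q}$ in the conditions on $M$ and $L$, the same assertion holds with $F^s_{p,q}(E)$ in place of $B^s_{p,q}(E)$ and $f_{p,q}$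 in place of $b_{p,q}$. -/

import Mathlib

open MeasureTheory SchwartzMap
open scoped ENNReal FourierTransform

noncomputable section

namespace AtomicDecomp

/-- `ℝⁿ` with its Euclidean norm. -/
abbrev Rn (n : ℕ) := EuclideanSpace ℝ (Fin n)

/-! ### Fourier transform and convolution, normalised by `(2π)^{-n/2}` -/

/-- The dilation `x ↦ (2π)⁻¹ x` as a continuous linear equivalence. -/
def dilTwoPi (n : ℕ) : Rn n ≃L[ℝ] Rn n :=
  ContinuousLinearEquiv.smulLeft (Units.mk0 ((2 * Real.pi)⁻¹ : ℝ) (by positivity))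

/-- The inverse Fourier transform
`φ̌(x) = (2π)^{-n/2} ∫ φ(ξ) e^{i⟨x,ξ⟩} dξ` on scalar Schwartz functions, obtained from Mathlib's
`𝓕⁻` (whose kernel is `e^{2πi⟨x,ξ⟩}`) by rescaling. -/
def invFourier {n : ℕ} (φ : 𝓢(Rn n, ℂ)) : 𝓢(Rn n, ℂ) :=
  (((2 * Real.pi) ^ (-(n : ℝ) / 2) : ℝ) : ℂ) •
    compCLMOfContinuousLinearEquiv ℂ (dilTwoPi n) (𝓕⁻ φ)

theorem invFourier_apply {n : ℕ} (φ : 𝓢(Rn n, ℂ)) (x : Rn n) :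
    invFourier φ x = (((2 * Real.pi) ^ (-(n : ℝ) / 2) : ℝ) : ℂ) *
      ∫ ξ : Rn n, Complex.exp (((inner ℝ x ξ : ℝ) : ℂ) * Complex.I) * φ ξ := by
  have hpi : (2 * Real.pi : ℝ) ≠ 0 := by positivity
  simp only [invFourier, smul_apply, smul_eq_mul,
    compCLMOfContinuousLinearEquiv_apply, Function.comp, SchwartzMap.fourierInv_coe,
    Real.fourierInv_eq']
  congr 2
  ext ξ
  congr 3
  have h : (dilTwoPi n) x = ((2 * Real.pi)⁻¹ : ℝ) • x := rfl
  rw [h, inner_smul_right, ← mul_assoc, mul_inv_cancel₀ hpi, one_mul, real_inner_comm]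

/-- The Schwartz function `y ↦ ψ(x - y)`. -/
def reflTranslate {n : ℕ} (ψ : 𝓢(Rn n, ℂ)) (x : Rn n) : 𝓢(Rn n, ℂ) :=
  compSubConstCLM ℂ x (compCLMOfContinuousLinearEquiv ℂ (ContinuousLinearEquiv.neg ℝ) ψ)

theorem reflTranslate_apply {n : ℕ} (ψ : 𝓢(Rn n, ℂ)) (x y : Rn n) :
    reflTranslate ψ x y = ψ (x - y) := by
  simp [reflTranslate]

section Spaces

variable {n : ℕ} {E : Type*} [NormedAddCommGroup E] [NormedSpace ℂ E]

/-- The convolution `(ψ * f)(x) = (2π)^{-n/2} f(ψ(x - ·))` of a Schwartz function with an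
`E`-valued tempered distribution. -/
def conv (ψ : 𝓢(Rn n, ℂ)) (f : 𝓢'(Rn n, E)) (x : Rn n) : E :=
  (((2 * Real.pi) ^ (-(n : ℝ) / 2) : ℝ) : ℂ) • f (reflTranslate ψ x)

/-! ### Smooth dyadic resolutions of unity -/

/-- The iterated partial derivative `∂_{i₁} ⋯ ∂_{i_k} g (x)`. As `i` runs through all maps
`Fin k → Fin n` these are exactly the derivatives `D^α g (x)` with `|α| = k`. -/
def pderiv {F : Type*} [NormedAddCommGroup F] [NormedSpace ℝ F] {k : ℕ} (i : Fin k → Fin n)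
    (g : Rn n → F) (x : Rn n) : F :=
  iteratedFDeriv ℝ k g x (fun j => EuclideanSpace.single (i j) (1 : ℝ))

/-- Smooth dyadic resolutions of unity `(φ_j)_{j ≥ 0}` on `ℝⁿ`. -/
structure IsDyadicResolution (φ : ℕ → 𝓢(Rn n, ℂ)) : Prop where
  supp_zero : tsupport (φ 0 : Rn n → ℂ) ⊆ {ξ | ‖ξ‖ ≤ 2}
  supp_succ : ∀ j : ℕ, 1 ≤ j →
    tsupport (φ j : Rn n → ℂ) ⊆ {ξ | (2 : ℝ) ^ ((j : ℤ) - 1) ≤ ‖ξ‖ ∧ ‖ξ‖ ≤ (2 : ℝ) ^ (j + 1)}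
  sum_eq_one : ∀ ξ : Rn n, HasSum (fun j => φ j ξ) 1
  deriv_le : ∀ (k : ℕ) (i : Fin k → Fin n), ∃ c : ℝ, ∀ (j : ℕ) (ξ : Rn n),
    ‖pderiv i (φ j : Rn n → ℂ) ξ‖ ≤ c * (2 : ℝ) ^ (-((j : ℤ) * (k : ℤ)))

/-! ### The function spaces -/

/-- The `ℓ_q` quasi-norm of a family of extended non-negative reals (the supremum if
`q = ∞`). -/
def lqNorm {ι : Type*} (q : ℝ≥0∞) (a : ι → ℝ≥0∞) : ℝ≥0∞ :=
  if q = ∞ then ⨆ i, a i else (∑' i, a i ^ q.toReal) ^ (1 / q.toReal)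

/-- The function `(φ_j f̂)ˇ`. Since the Fourier transform of `φ̌_j * f` is `φ_j f̂`, this smooth
function is `φ̌_j * f`. -/
def dyadicBlock (φ : ℕ → 𝓢(Rn n, ℂ)) (f : 𝓢'(Rn n, E)) (j : ℕ) (x : Rn n) : E :=
  conv (invFourier (φ j)) f x

/-- `‖f | B^s_{p,q}(E)‖ = (∑_j 2^{jsq} ‖(φ_j f̂)ˇ | L_p(E)‖^q)^{1/q}`. -/
def besovNorm (φ : ℕ → 𝓢(Rn n, ℂ)) (s : ℝ) (p q : ℝ≥0∞) (f : 𝓢'(Rn n, E)) : ℝ≥0∞ :=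
  lqNorm q fun j : ℕ =>
    ENNReal.ofReal ((2 : ℝ) ^ ((j : ℝ) * s)) * eLpNorm (dyadicBlock φ f j) p volume

/-- `‖f | F^s_{p,q}(E)‖ = ‖(∑_j 2^{jsq} ‖(φ_j f̂)ˇ(·) | E‖^q)^{1/q} | L_p‖`. -/
def triebelLizorkinNorm (φ : ℕ → 𝓢(Rn n, ℂ)) (s : ℝ) (p q : ℝ≥0∞) (f : 𝓢'(Rn n, E)) :
    ℝ≥0∞ :=
  eLpNorm (fun x : Rn n => lqNorm q fun j : ℕ =>
    ENNReal.ofReal ((2 : ℝ) ^ ((j : ℝ) * s)) * ‖dyadicBlock φ f j x‖ₑ) p volume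

/-- `f ∈ B^s_{p,q}(E)`. -/
def MemBesov (φ : ℕ → 𝓢(Rn n, ℂ)) (s : ℝ) (p q : ℝ≥0∞) (f : 𝓢'(Rn n, E)) : Prop :=
  besovNorm φ s p q f < ∞

/-- `f ∈ F^s_{p,q}(E)`. -/
def MemTriebelLizorkin (φ : ℕ → 𝓢(Rn n, ℂ)) (s : ℝ) (p q : ℝ≥0∞) (f : 𝓢'(Rn n, E)) :
    Prop :=
  triebelLizorkinNorm φ s p q f < ∞

end Spaces

/-- `σ_p = n (1/p - 1)_+`. The number `σ_{p,q}` is `sigma n (min p q)`. -/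
def sigma (n : ℕ) (p : ℝ≥0∞) : ℝ := n * max ((p⁻¹).toReal - 1) 0

/-! ### Atoms -/

/-- The cube `d · Q_{ν,m}`: centre `2^{-ν} m`, sides parallel to the axes, of length
`d 2^{-ν}`. -/
def cube {n : ℕ} (d : ℝ) (ν : ℕ) (m : Fin n → ℤ) : Set (Rn n) :=
  {x | ∀ i, |x i - (2 : ℝ) ^ (-(ν : ℤ)) * m i| ≤ d * (2 : ℝ) ^ (-(ν : ℤ) - 1)}

/-- `a` is an `F`-valued `(s,p)_{K,L}`-atom located at `Q_{ν,m}`, with support in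
`d · Q_{ν,m}`. -/
structure IsAtom {n : ℕ} {F : Type*} [NormedAddCommGroup F] [NormedSpace ℝ F]
    (d s : ℝ) (p : ℝ≥0∞) (K : ℕ) (L : ℤ) (ν : ℕ) (m : Fin n → ℤ) (a : Rn n → F) : Prop where
  continuous : Continuous a
  /-- `a` is `K` times differentiable. -/
  differentiable : ∀ k < K, Differentiable ℝ (iteratedFDeriv ℝ k a)
  supp : tsupport a ⊆ cube d ν m
  deriv_le : ∀ k ≤ K, ∀ (i : Fin k → Fin n) (x : Rn n),
    ‖pderiv i a x‖ ≤ (2 : ℝ) ^ (-(ν : ℝ) * (s - n * (p⁻¹).toReal) + k * ν)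
  moments : ∀ β : Fin n → ℕ, ((∑ i, β i : ℕ) : ℤ) ≤ L →
    ∫ x : Rn n, (∏ i, x i ^ β i) • a x = 0

/-! ### Sequence spaces -/

/-- `‖λ | b_{p,q}‖ = (∑_ν (∑_m |λ_{ν,m}|^p)^{q/p})^{1/q}`. -/
def bNorm {n : ℕ} (p q : ℝ≥0∞) (l : ℕ → (Fin n → ℤ) → ℂ) : ℝ≥0∞ :=
  lqNorm q fun ν : ℕ => lqNorm p fun m : Fin n → ℤ => ‖l ν m‖ₑ

/-- The `L_p`-normalised characteristic function `χ^{(p)}_{ν,m} = 2^{νn/p} χ_{Q_{ν,m}}`. -/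
def chiNormalized {n : ℕ} (p : ℝ≥0∞) (ν : ℕ) (m : Fin n → ℤ) : Rn n → ℝ≥0∞ :=
  (cube 1 ν m).indicator
    fun _ => ENNReal.ofReal ((2 : ℝ) ^ ((ν : ℝ) * (n * (p⁻¹).toReal)))

/-- `‖λ | f_{p,q}‖ = ‖(∑_{ν,m} |λ_{ν,m} χ^{(p)}_{ν,m}(·)|^q)^{1/q} | L_p‖`. -/
def fNorm {n : ℕ} (p q : ℝ≥0∞) (l : ℕ → (Fin n → ℤ) → ℂ) : ℝ≥0∞ :=
  eLpNorm (fun x : Rn n => lqNorm q fun i : ℕ × (Fin n → ℤ) =>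
    ‖l i.1 i.2‖ₑ * chiNormalized p i.1 i.2 x) p volume

/-! ### Representations by atoms -/

/-- The data of a series
`∑_γ ∑_ν ∑_m (ϱ^γ_{ν,m} e^γ_{ν,m} a^γ_{ν,m} + λ^γ_{ν,m} e^{γ,L}_{ν,m} a^{γ,L}_{ν,m})`,
with `γ ∈ ℕ₀ⁿ`, `ν ∈ ℕ₀`, `m ∈ ℤⁿ`. -/
structure AtomicSeries (n : ℕ) (E : Type*) where
  rho : (Fin n → ℕ) → ℕ → (Fin n → ℤ) → ℂ
  lam : (Fin n → ℕ) → ℕ → (Fin n → ℤ) → ℂ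
  e : (Fin n → ℕ) → ℕ → (Fin n → ℤ) → E
  eL : (Fin n → ℕ) → ℕ → (Fin n → ℤ) → E
  a : (Fin n → ℕ) → ℕ → (Fin n → ℤ) → Rn n → ℂ
  aL : (Fin n → ℕ) → ℕ → (Fin n → ℤ) → Rn n → ℂ

namespace AtomicSeries

variable {n : ℕ} {E : Type*} [NormedAddCommGroup E] [NormedSpace ℂ E]

/-- The `(γ, ν, m)`-th term of the series, as a function `ℝⁿ → E`. -/
def term (R : AtomicSeries n E) (γ : Fin n → ℕ) (ν : ℕ) (m : Fin n → ℤ) (x : Rn n) : E :=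
  (R.rho γ ν m * R.a γ ν m x) • R.e γ ν m + (R.lam γ ν m * R.aL γ ν m x) • R.eL γ ν m

/-- The series consists of scalar `(M,p)_{K,-1}`- and `(s,p)_{K,L}`-atoms times unit vectors of
`E`, and it converges unconditionally to `f` in `𝓢'(ℝⁿ, E)`. -/
structure Represents (R : AtomicSeries n E) (d : ℝ) (M : ℕ) (s : ℝ) (p : ℝ≥0∞) (K : ℕ) (L : ℤ)
    (f : 𝓢'(Rn n, E)) : Prop where
  norm_e : ∀ γ ν m, ‖R.e γ ν m‖ = 1
  norm_eL : ∀ γ ν m, ‖R.eL γ ν m‖ = 1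
  atom : ∀ γ ν m, IsAtom d (M : ℝ) p K (-1) ν m (R.a γ ν m)
  atomL : ∀ γ ν m, IsAtom d s p K L ν m (R.aL γ ν m)
  hasSum : ∀ θ : 𝓢(Rn n, ℂ),
    HasSum (fun i : (Fin n → ℕ) × ℕ × (Fin n → ℤ) =>
      ∫ x : Rn n, θ x • R.term i.1 i.2.1 i.2.2 x) (f θ)

/-- `sup_γ 2^{μ|γ|} (N(ϱ^γ) + N(λ^γ))` for a quasi-norm `N` on sequences. -/
def size (N : (ℕ → (Fin n → ℤ) → ℂ) → ℝ≥0∞) (μ : ℝ) (R : AtomicSeries n E) : ℝ≥0∞ :=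
  ⨆ γ : Fin n → ℕ,
    ENNReal.ofReal ((2 : ℝ) ^ (μ * ((∑ i, γ i : ℕ) : ℝ))) * (N (R.rho γ) + N (R.lam γ))

/-- The admissible representations of `f`: those of finite size. -/
def admissible (N : (ℕ → (Fin n → ℤ) → ℂ) → ℝ≥0∞) (μ d : ℝ) (M : ℕ) (s : ℝ) (p : ℝ≥0∞)
    (K : ℕ) (L : ℤ) (f : 𝓢'(Rn n, E)) : Set (AtomicSeries n E) :=
  {R | R.Represents d M s p K L f ∧ R.size N μ < ∞}

/-- The infimum of the size over all admissible representations of `f`. -/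
def infSize (N : (ℕ → (Fin n → ℤ) → ℂ) → ℝ≥0∞) (μ d : ℝ) (M : ℕ) (s : ℝ) (p : ℝ≥0∞)
    (K : ℕ) (L : ℤ) (f : 𝓢'(Rn n, E)) : ℝ≥0∞ :=
  ⨅ R ∈ admissible N μ d M s p K L f, R.size N μ

end AtomicSeries

end AtomicDecomp

end

noncomputable section

namespace AtomicDecomp

/-! ### Lebesgue quasi-norms of `[0, ∞]`-valued functions -/

section LpENNReal

variable {α : Type*} [MeasurableSpace α] {μ : Measure α}

/-! Put t = p in the Besov case and t = min(p,q) in the Triebel–Lizorkin case, and choose r <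
min(1,t) so close to min(1,t) that n(1/r-1) is still below both M and s+L+1 (`exists_exponent_lt`).
All estimates are expressed by the averages `avg r j G` = (η_j * G^r)^{1/r}, where η_j lives at
scale 2^{-j}. They are bounded in ℓ_q(L_p) by Jensen's inequality. In L_p(ℓ_q) they are bounded by a
vector-valued inequality obtained from duality and the Hardy–Littlewood maximal theorem
(`exists_mixedNorm_etaConv_le`). `IsFunctionNorm` records the few properties of these two
quasi-norms that matter, so both halves of the theorem follow from the single statement
`IsFunctionNorm.atomic_characterization`.

From atoms to the function space (`IsFunctionNorm.exists_synthesis_le`): convolve the series with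
φ̌_j. If an atom is finer than 2^{-j}, its vanishing moments are played against the smoothness of
φ̌_j; if it is coarser, its K derivatives are played against the vanishing moments of φ̌_j. Summing
over the cubes of one generation costs 2^{kn/r} when the cubes are 2^k times finer than the kernel,
and this is what forces n(1/r-1) < M for the first family and n(1/r-1) < s+L+1 for the second. What
remains decays like 2^{-δ|j-ν|}, so the sum over ν is controlled by averages of step functions, and
the factor 2^{-μ|γ|} sums the families in γ (`IsKernelFamily.exists_tsum_enorm_integral_atom_le`,
`IsFunctionNorm.exists_offDiagonal_le`).

From the function space to atoms (`IsFunctionNorm.exists_analysis_le`): write f as the sum of its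
dyadic blocks. For j ≥ 1 the frequencies of the j-th block stay away from 0, so the block is, up to
a factor 2^{-2jk}, the k-th power of the Laplacian applied to a band-limited function g; here 2k =
L+1, which is where the parity of L enters. A band-limited function is entire and may be expanded in
Taylor series around the centres of the cubes of side 2^{-j}. Multiplying by a smooth partition of
unity of integer translates gives g as a sum over γ and m of dilated translates of x^γ ψ(x)/γ!. The
Laplacian moved onto these functions produces vanishing moments up to order L, while the block j = 0
needs none and goes into the first family. The functions x^γ ψ/γ! have Schwartz norms of size
B^{|γ|}/γ!, and the Taylor coefficients grow at most exponentially in |γ| relative to averages of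
the block (`IsDyadicResolution.exists_enorm_taylorAt_le`, which rests on Peetre's sub-mean value
argument `polyConv_le_avg`). The factorials beat 2^{μ|γ|} for every μ, so every positive μ is
admissible.

Two technical points support this. A tempered distribution has to be exchanged with an integral of
Schwartz functions (`integral_smul_waveCLM`); this is done by extending functionals to a Banach
space of weighted jets. Unconditional convergence follows from absolute convergence: a fixed test
function is regarded as a one-member family of kernels, and the estimates of the first direction
apply to it (`IsFunctionNorm.tsum_enorm_integral_term_ne_top`). -/

theorem iSup_rpow {ι : Sort*} (f : ι → ℝ≥0∞) {t : ℝ} (ht : 0 < t) :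
    (⨆ i, f i) ^ t = ⨆ i, f i ^ t :=
  (ENNReal.orderIsoRpow t ht).map_iSup f

theorem tsum_rpow_le {ι : Type*} (f : ι → ℝ≥0∞) {t : ℝ} (ht : 0 < t) (ht1 : t ≤ 1) :
    (∑' i, f i) ^ t ≤ ∑' i, f i ^ t := by
  rw [ENNReal.tsum_eq_iSup_sum, iSup_rpow _ ht]
  refine iSup_le fun s => le_trans ?_ (ENNReal.sum_le_tsum s)
  exact Finset.le_sum_of_subadditive (fun x : ℝ≥0∞ => x ^ t) (by simp [ht])
    (fun x y => ENNReal.rpow_add_le_add_rpow x y ht.le ht1) s f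

theorem eLpNorm_ennreal_mono {f g : α → ℝ≥0∞} {p : ℝ≥0∞} (h : ∀ x, f x ≤ g x) :
    eLpNorm f p μ ≤ eLpNorm g p μ :=
  eLpNorm_mono_enorm (by simpa using h)

theorem eLpNorm_ennreal_eq {f : α → ℝ≥0∞} {p : ℝ≥0∞} (h0 : p ≠ 0) (hp : p ≠ ∞) :
    eLpNorm f p μ = (∫⁻ x, f x ^ p.toReal ∂μ) ^ (1 / p.toReal) := by
  simp [eLpNorm_eq_lintegral_rpow_enorm_toReal h0 hp]

theorem eLpNorm_ennreal_rpow (f : α → ℝ≥0∞) {p : ℝ≥0∞} {t : ℝ} (ht : 0 < t) :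
    eLpNorm (fun x => f x ^ t) (p / ENNReal.ofReal t) μ = eLpNorm f p μ ^ t := by
  have h := eLpNorm_enorm_rpow (μ := μ) (p := p / ENNReal.ofReal t) f ht
  simp only [enorm_eq_self] at h
  rw [h, ENNReal.div_mul_cancel (by simpa using ht) ENNReal.ofReal_ne_top]

theorem eLpNorm_ennreal_const_mul (f : α → ℝ≥0∞) {p : ℝ≥0∞} {c : ℝ≥0∞} (hc : c ≠ ∞) :
    eLpNorm (fun x => c * f x) p μ ≤ c * eLpNorm f p μ := by
  lift c to NNReal using hc
  have := eLpNorm_le_nnreal_smul_eLpNorm_of_ae_le_mul' (μ := μ) (f := fun x => (c : ℝ≥0∞) * f x)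
    (g := f) (c := c) (by simp) p
  simpa [ENNReal.smul_def] using this

/-- Minkowski's inequality passes from finite to countable sums by monotone convergence along the
directed set of finite subsets. For p = ∞ countability is used instead, to discard one common null
set. -/
theorem eLpNorm_tsum_le {ι : Type*} [Countable ι] {f : ι → α → ℝ≥0∞}
    (hf : ∀ i, Measurable (f i)) {p : ℝ≥0∞} (hp : 1 ≤ p) :
    eLpNorm (fun x => ∑' i, f i x) p μ ≤ ∑' i, eLpNorm (f i) p μ := by
  rcases eq_or_ne p ∞ with rfl | hpt
  · simp only [eLpNorm_exponent_top]
    have h : ∀ᵐ x ∂μ, ∀ i, f i x ≤ eLpNormEssSup (f i) μ := by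
      rw [ae_all_iff]
      intro i
      simpa using enorm_ae_le_eLpNormEssSup (f i) μ
    refine essSup_le_of_ae_le _ ?_
    filter_upwards [h] with x hx
    simpa using ENNReal.tsum_le_tsum hx
  · have hp0 : 0 < p.toReal := ENNReal.toReal_pos (by positivity) hpt
    have hp0' : p ≠ 0 := (zero_lt_one.trans_le hp).ne'
    have key : ∀ s : Finset ι, eLpNorm (fun x => ∑ i ∈ s, f i x) p μ ≤ ∑' i, eLpNorm (f i) p μ := by
      intro s
      have := eLpNorm_sum_le (μ := μ) (s := s) (f := f)
        (fun i _ => (hf i).aestronglyMeasurable) hp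
      refine le_trans (le_of_eq ?_) (this.trans (ENNReal.sum_le_tsum s))
      congr 1
      ext x
      simp
    rw [eLpNorm_ennreal_eq hp0' hpt]
    have e : ∀ x, (∑' i, f i x) ^ p.toReal = ⨆ s : Finset ι, (∑ i ∈ s, f i x) ^ p.toReal :=
      fun x => by rw [ENNReal.tsum_eq_iSup_sum, iSup_rpow _ hp0]
    simp_rw [e]
    rw [lintegral_iSup_directed, iSup_rpow _ (by positivity)]
    · refine iSup_le fun s => ?_
      have := key s
      rwa [eLpNorm_ennreal_eq hp0' hpt] at this
    · intro s
      exact ((Finset.measurable_sum s fun i _ => hf i).pow_const _).aemeasurable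
    · refine Monotone.directed_le fun s t hst x => ?_
      exact ENNReal.rpow_le_rpow (Finset.sum_le_sum_of_subset hst) hp0.le

/-- The `t`-triangle inequality in `L_p`, `t ≤ min(1, p)`. -/
theorem eLpNorm_tsum_rpow_le {ι : Type*} [Countable ι] {f : ι → α → ℝ≥0∞}
    (hf : ∀ i, Measurable (f i)) {p : ℝ≥0∞} {t : ℝ} (ht : 0 < t) (ht1 : t ≤ 1)
    (htp : ENNReal.ofReal t ≤ p) :
    eLpNorm (fun x => ∑' i, f i x) p μ ^ t ≤ ∑' i, eLpNorm (f i) p μ ^ t := by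
  simp_rw [← eLpNorm_ennreal_rpow _ ht]
  refine (eLpNorm_ennreal_mono fun x => tsum_rpow_le _ ht ht1).trans ?_
  refine eLpNorm_tsum_le (fun i => (hf i).pow_const _) ?_
  rw [ENNReal.le_div_iff_mul_le (by simp [ht]) (by simp)]
  simpa using htp

/-- With the discrete σ-algebra and counting measure, the t-triangle inequality and the power rule
for sequences become instances of those for functions. -/
theorem lqNorm_eq_eLpNorm {ι : Type*} [MeasurableSpace ι] [MeasurableSingletonClass ι] {q : ℝ≥0∞}
    (hq : q ≠ 0) (a : ι → ℝ≥0∞) : lqNorm q a = eLpNorm a q Measure.count := by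
  unfold lqNorm
  split_ifs with h
  · subst h
    simp [eLpNormEssSup, essSup_count]
  · rw [eLpNorm_ennreal_eq hq h, lintegral_count]

theorem lqNorm_mono {ι : Type*} {q : ℝ≥0∞} {a b : ι → ℝ≥0∞} (h : ∀ i, a i ≤ b i) :
    lqNorm q a ≤ lqNorm q b := by
  unfold lqNorm
  split_ifs with hq
  · exact iSup_mono h
  · gcongr with i
    exact h i

theorem lqNorm_const_mul {ι : Type*} {q : ℝ≥0∞} (hq : q ≠ 0) (c : ℝ≥0∞) (a : ι → ℝ≥0∞) :
    lqNorm q (fun i => c * a i) = c * lqNorm q a := by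
  unfold lqNorm
  split_ifs with h
  · rw [ENNReal.mul_iSup]
  · have hq0 := ENNReal.toReal_pos hq h
    simp_rw [ENNReal.mul_rpow_of_nonneg _ _ hq0.le]
    rw [ENNReal.tsum_mul_left, ENNReal.mul_rpow_of_nonneg _ _ (by positivity), ← ENNReal.rpow_mul,
      mul_one_div_cancel hq0.ne', ENNReal.rpow_one]

theorem lqNorm_comp_le {ι κ : Type*} {q : ℝ≥0∞} (a : κ → ℝ≥0∞) {g : ι → κ}
    (hg : Function.Injective g) : lqNorm q (fun i => a (g i)) ≤ lqNorm q a := by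
  unfold lqNorm
  split_ifs with h
  · exact iSup_comp_le a g
  · gcongr
    exact ENNReal.tsum_comp_le_tsum_of_injective hg fun k => a k ^ q.toReal

theorem le_lqNorm {ι : Type*} {q : ℝ≥0∞} (hq : q ≠ 0) (a : ι → ℝ≥0∞) (i : ι) :
    a i ≤ lqNorm q a := by
  unfold lqNorm
  split_ifs with h
  · exact le_iSup a i
  · have hq0 := ENNReal.toReal_pos hq h
    calc a i = (a i ^ q.toReal) ^ (1 / q.toReal) := by
          rw [← ENNReal.rpow_mul, mul_one_div_cancel hq0.ne', ENNReal.rpow_one]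
      _ ≤ _ := by
          gcongr
          exact ENNReal.le_tsum (f := fun i => a i ^ q.toReal) i

theorem measurable_lqNorm {ι : Type*} [Countable ι] {q : ℝ≥0∞} {a : ι → α → ℝ≥0∞}
    (ha : ∀ i, Measurable (a i)) : Measurable fun x => lqNorm q fun i => a i x := by
  unfold lqNorm
  split_ifs with h
  · exact Measurable.iSup ha
  · exact (Measurable.tsum fun i => (ha i).pow_const _).pow_const _

theorem lqNorm_tsum_rpow_le {κ : Type*} {ι : Type*} [Countable ι] {f : ι → κ → ℝ≥0∞}
    {q : ℝ≥0∞} {t : ℝ} (ht : 0 < t) (ht1 : t ≤ 1) (htq : ENNReal.ofReal t ≤ q) :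
    lqNorm q (fun k => ∑' i, f i k) ^ t ≤ ∑' i, lqNorm q (f i) ^ t := by
  let _ : MeasurableSpace κ := ⊤
  have hq : q ≠ 0 := ((ENNReal.ofReal_pos.2 ht).trans_le htq).ne'
  simp_rw [lqNorm_eq_eLpNorm hq]
  exact eLpNorm_tsum_rpow_le (fun i => measurable_from_top) ht ht1 htq

theorem lqNorm_rpow {ι : Type*} {q : ℝ≥0∞} (hq : q ≠ 0) (a : ι → ℝ≥0∞) {t : ℝ} (ht : 0 < t) :
    lqNorm (q / ENNReal.ofReal t) (fun i => a i ^ t) = lqNorm q a ^ t := by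
  let _ : MeasurableSpace ι := ⊤
  rw [lqNorm_eq_eLpNorm hq, lqNorm_eq_eLpNorm, eLpNorm_ennreal_rpow _ ht]
  simpa using hq

end LpENNReal

/-! ### The dyadic averaging kernels and the Hardy–Littlewood maximal function -/

variable {n : ℕ}

/-- The kernel `η_j(z) = 2^{jn} (1 + 2^j |z|)^{-(n+1)}`. -/
def eta (j : ℕ) (z : Rn n) : ℝ≥0∞ :=
  ENNReal.ofReal (((2 : ℝ) ^ j) ^ n * ((1 + 2 ^ j * ‖z‖) ^ (n + 1))⁻¹)

theorem measurable_eta (j : ℕ) : Measurable (eta j : Rn n → ℝ≥0∞) := by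
  unfold eta; fun_prop

theorem eta_sub_comm (j : ℕ) (x y : Rn n) : eta j (x - y) = eta j (y - x) := by
  simp [eta, norm_sub_rev]

theorem lintegral_comp_two_pow_smul (j : ℕ) {g : Rn n → ℝ≥0∞} (hg : Measurable g) :
    ∫⁻ x, ENNReal.ofReal (((2 : ℝ) ^ j) ^ n) * g ((2 : ℝ) ^ j • x) = ∫⁻ x, g x := by
  have h2 : (0 : ℝ) < 2 ^ j := by positivity
  have hg' : Measurable fun x : Rn n => g ((2 : ℝ) ^ j • x) :=
    hg.comp (measurable_const_smul _)
  rw [lintegral_const_mul _ hg', ← lintegral_map hg (measurable_const_smul _),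
    Measure.map_addHaar_smul _ h2.ne', lintegral_smul_measure, finrank_euclideanSpace_fin,
    abs_of_pos (by positivity), smul_eq_mul, ← mul_assoc, ← ENNReal.ofReal_mul (by positivity),
    mul_inv_cancel₀ (by positivity), ENNReal.ofReal_one, one_mul]

/-- The mass `∫ η_j`, which does not depend on `j`. -/
def etaMass (n : ℕ) : ℝ≥0∞ := ∫⁻ x : Rn n, eta 0 x

theorem lintegral_eta (j : ℕ) : ∫⁻ x : Rn n, eta j x = etaMass n := by
  rw [etaMass, ← lintegral_comp_two_pow_smul j (measurable_eta 0)]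
  congr 1
  ext x
  rw [eta, eta, ← ENNReal.ofReal_mul (by positivity)]
  simp [norm_smul]

theorem etaMass_ne_top : etaMass n ≠ ∞ := by
  have h := finite_integral_one_add_norm (E := Rn n) (μ := volume) (r := (n : ℝ) + 1) (by simp)
  refine ne_of_lt (lt_of_le_of_lt (le_of_eq ?_) h)
  unfold etaMass eta
  congr 1
  ext x
  have : (0 : ℝ) ≤ 1 + ‖x‖ := by positivity
  rw [Real.rpow_neg this]
  norm_cast
  simp

theorem lintegral_eta_sub (j : ℕ) (x : Rn n) : ∫⁻ y : Rn n, eta j (x - y) = etaMass n := by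
  rw [lintegral_sub_left_eq_self (eta j) x, lintegral_eta]

/-- The average `η_j * G`. -/
def etaConv (j : ℕ) (G : Rn n → ℝ≥0∞) (x : Rn n) : ℝ≥0∞ := ∫⁻ y, eta j (x - y) * G y

theorem measurable_etaConv (j : ℕ) {G : Rn n → ℝ≥0∞} (hG : Measurable G) :
    Measurable (etaConv j G) := by
  have h : Measurable fun z : Rn n × Rn n => eta j (z.1 - z.2) * G z.2 :=
    ((measurable_eta j).comp (measurable_fst.sub measurable_snd)).mul (hG.comp measurable_snd)
  exact h.lintegral_prod_right'

theorem etaConv_mono (j : ℕ) {G H : Rn n → ℝ≥0∞} (h : ∀ x, G x ≤ H x) (x : Rn n) :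
    etaConv j G x ≤ etaConv j H x :=
  lintegral_mono fun y => mul_le_mul_right (h y) _

/-- Self-adjointness of the average: Tonelli, and η_j is even. It drives both duality arguments for
the vector-valued inequality. -/
theorem lintegral_mul_etaConv (j : ℕ) {G H : Rn n → ℝ≥0∞} (hG : Measurable G)
    (hH : Measurable H) : ∫⁻ x, etaConv j G x * H x = ∫⁻ x, G x * etaConv j H x := by
  have m1 : Measurable fun z : Rn n × Rn n => eta j (z.1 - z.2) * G z.2 * H z.1 :=
    (((measurable_eta j).comp (measurable_fst.sub measurable_snd)).mul
      (hG.comp measurable_snd)).mul (hH.comp measurable_fst)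
  have e1 : ∀ x : Rn n, Measurable fun y => eta j (x - y) * G y := fun x =>
    ((measurable_eta j).comp (measurable_const.sub measurable_id)).mul hG
  have e2 : ∀ x : Rn n, Measurable fun y => eta j (x - y) * H y := fun x =>
    ((measurable_eta j).comp (measurable_const.sub measurable_id)).mul hH
  simp only [etaConv]
  simp_rw [← lintegral_mul_const _ (e1 _), ← lintegral_const_mul _ (e2 _)]
  rw [lintegral_lintegral_swap m1.aemeasurable]
  refine lintegral_congr fun y => lintegral_congr fun x => ?_
  rw [eta_sub_comm]
  ring

theorem lintegral_mul_le_Lp {a a' : ℝ} (ha : a.HolderConjugate a') {α : Type*} [MeasurableSpace α]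
    {μ : Measure α} {f g : α → ℝ≥0∞} (hf : Measurable f) (hg : Measurable g) :
    ∫⁻ x, f x * g x ∂μ ≤ (∫⁻ x, f x ^ a ∂μ) ^ (1 / a) * (∫⁻ x, g x ^ a' ∂μ) ^ (1 / a') :=
  ENNReal.lintegral_mul_le_Lp_mul_Lq μ ha hf.aemeasurable hg.aemeasurable

/-- Jensen's inequality for the measure η_j(x-y)dy, whose mass is `etaMass n`; it is obtained from
Hölder after splitting η_j into its powers 1/b' and 1/b. -/
theorem etaConv_rpow_le (j : ℕ) {G : Rn n → ℝ≥0∞} (hG : Measurable G) {b : ℝ} (hb : 1 ≤ b)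
    (x : Rn n) :
    etaConv j G x ^ b ≤ etaMass n ^ (b - 1) * etaConv j (fun y => G y ^ b) x := by
  rcases hb.eq_or_lt with rfl | hb
  · simp
  have hc := Real.HolderConjugate.conjExponent hb
  set b' := Real.conjExponent b
  have hb0 : 0 < b := by linarith
  have hb'0 : 0 < b' := hc.symm.pos
  have me : Measurable fun y : Rn n => eta j (x - y) :=
    (measurable_eta j).comp (measurable_const.sub measurable_id)
  have h := lintegral_mul_le_Lp (μ := volume) hc.symm (me.pow_const (1 / b'))
    ((me.pow_const (1 / b)).mul hG)
  have e1 : ∀ y : Rn n, eta j (x - y) ^ (1 / b') * (eta j (x - y) ^ (1 / b) * G y)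
      = eta j (x - y) * G y := by
    intro y
    rw [← mul_assoc, ← ENNReal.rpow_add_of_nonneg _ _ (by positivity) (by positivity)]
    have : 1 / b' + 1 / b = 1 := by have := hc.symm.inv_add_inv_eq_one; simpa using this
    rw [this, ENNReal.rpow_one]
  have e2 : ∀ y : Rn n, (eta j (x - y) ^ (1 / b) * G y) ^ b = eta j (x - y) * G y ^ b := by
    intro y
    rw [ENNReal.mul_rpow_of_nonneg _ _ hb0.le, ← ENNReal.rpow_mul, one_div_mul_cancel hb0.ne',
      ENNReal.rpow_one]
  have e3 : ∀ y : Rn n, (eta j (x - y) ^ (1 / b')) ^ b' = eta j (x - y) := by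
    intro y
    rw [← ENNReal.rpow_mul, one_div_mul_cancel hb'0.ne', ENNReal.rpow_one]
  simp only [Pi.mul_apply] at h
  simp_rw [e1, e2, e3, lintegral_eta_sub] at h
  calc etaConv j G x ^ b ≤ _ := ENNReal.rpow_le_rpow h hb0.le
    _ = _ := by
      rw [ENNReal.mul_rpow_of_nonneg _ _ hb0.le, ← ENNReal.rpow_mul, ← ENNReal.rpow_mul,
        one_div_mul_cancel hb0.ne', ENNReal.rpow_one]
      congr 2
      have := hc.sub_one_mul_conj
      field_simp
      linarith

/-- The Hardy–Littlewood maximal function over balls with dyadic radii. -/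
def maximalFn (w : Rn n → ℝ≥0∞) (x : Rn n) : ℝ≥0∞ :=
  ⨆ i : ℤ, (volume (Metric.closedBall x ((2 : ℝ) ^ i)))⁻¹ *
    ∫⁻ y in Metric.closedBall x ((2 : ℝ) ^ i), w y

theorem volume_closedBall_zpow (x : Rn n) (i : ℤ) :
    volume (Metric.closedBall x ((2 : ℝ) ^ i)) =
      ENNReal.ofReal (((2 : ℝ) ^ i) ^ n) * volume (Metric.ball (0 : Rn n) 1) := by
  rw [Measure.addHaar_closedBall _ _ (by positivity), finrank_euclideanSpace_fin]

theorem volume_closedBall_ne_zero (x : Rn n) (i : ℤ) :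
    volume (Metric.closedBall x ((2 : ℝ) ^ i)) ≠ 0 :=
  (Metric.measure_closedBall_pos _ _ (by positivity)).ne'

theorem setLIntegral_closedBall_le_maximalFn (w : Rn n → ℝ≥0∞) (x : Rn n) (i : ℤ) :
    ∫⁻ y in Metric.closedBall x ((2 : ℝ) ^ i), w y ≤
      volume (Metric.closedBall x ((2 : ℝ) ^ i)) * maximalFn w x := by
  calc _ = volume (Metric.closedBall x ((2 : ℝ) ^ i)) *
        ((volume (Metric.closedBall x ((2 : ℝ) ^ i)))⁻¹ *
          ∫⁻ y in Metric.closedBall x ((2 : ℝ) ^ i), w y) := by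
        rw [← mul_assoc, ENNReal.mul_inv_cancel (volume_closedBall_ne_zero x i)
          measure_closedBall_lt_top.ne, one_mul]
    _ ≤ _ := by
        gcongr
        exact le_iSup (fun i : ℤ => (volume (Metric.closedBall x ((2 : ℝ) ^ i)))⁻¹ *
          ∫⁻ y in Metric.closedBall x ((2 : ℝ) ^ i), w y) i

/-- Only countably many radii enter, and for each of them the integral over the ball is a parameter
integral of a jointly measurable function. -/
theorem measurable_maximalFn {w : Rn n → ℝ≥0∞} (hw : Measurable w) :
    Measurable (maximalFn w) := by
  refine Measurable.iSup fun i => ?_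
  simp_rw [volume_closedBall_zpow]
  refine Measurable.const_mul ?_ _
  have h : Measurable fun z : Rn n × Rn n =>
      ({z : Rn n × Rn n | dist z.2 z.1 ≤ (2 : ℝ) ^ i}.indicator fun z => w z.2) z :=
    Measurable.indicator (hw.comp measurable_snd)
      (measurableSet_le (measurable_snd.dist measurable_fst) measurable_const)
  have h2 := h.lintegral_prod_right' (ν := (volume : Measure (Rn n)))
  convert h2 using 2 with x
  rw [← lintegral_indicator Metric.isClosed_closedBall.measurableSet]
  rfl

theorem maximalFn_mono {v w : Rn n → ℝ≥0∞} (h : ∀ x, v x ≤ w x) (x : Rn n) :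
    maximalFn v x ≤ maximalFn w x :=
  iSup_mono fun _ => mul_le_mul_right (lintegral_mono fun y => h y) _

theorem maximalFn_add_const_le {v : Rn n → ℝ≥0∞} (hv : Measurable v) (c : ℝ≥0∞) (x : Rn n) :
    maximalFn (fun y => v y + c) x ≤ maximalFn v x + c := by
  refine iSup_le fun i => ?_
  rw [lintegral_add_left hv, mul_add, lintegral_const, Measure.restrict_apply_univ, mul_comm c,
    ← mul_assoc _ _ c, ENNReal.inv_mul_cancel (volume_closedBall_ne_zero x i)
      measure_closedBall_lt_top.ne, one_mul]
  gcongr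
  exact le_iSup (fun i : ℤ => (volume (Metric.closedBall x ((2 : ℝ) ^ i)))⁻¹ *
          ∫⁻ y in Metric.closedBall x ((2 : ℝ) ^ i), v y) i

/-- Dyadic shells: z lies in the shell 2^i ≤ 1 + 2^j|z| < 2^{i+1} for some i, and the i-th term
alone already dominates. -/
theorem eta_le_tsum (j : ℕ) (z : Rn n) :
    eta j z ≤ ∑' i : ℕ, ENNReal.ofReal (((2 : ℝ) ^ j) ^ n * ((2 ^ i) ^ (n + 1))⁻¹) *
      (Metric.closedBall (0 : Rn n) ((2 : ℝ) ^ ((i : ℤ) + 1 - j))).indicator 1 z := by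
  obtain ⟨i, hi1, hi2⟩ := exists_nat_pow_near (x := 1 + 2 ^ j * ‖z‖) (y := (2 : ℝ))
    (by simp) (by norm_num)
  refine le_trans ?_ (ENNReal.le_tsum i)
  rw [Set.indicator_of_mem]
  · simp only [Pi.one_apply, mul_one, eta]
    gcongr
  · rw [mem_closedBall_zero_iff, zpow_sub₀ (by norm_num), le_div_iff₀ (by positivity)]
    have : (2 : ℝ) ^ ((i : ℤ) + 1) = 2 ^ (i + 1) := by norm_cast
    rw [this, zpow_natCast]
    nlinarith [norm_nonneg z]

/-- On the i-th shell the kernel has size 2^{jn} 2^{-i(n+1)}, and the ball containing the shell has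
volume proportional to 2^{(i+1-j)n}. The product leaves a geometric factor 2^{-i}, independent of j.
-/
theorem etaConv_le_maximalFn : ∃ C : ℝ≥0∞, C ≠ ∞ ∧ ∀ (j : ℕ) (w : Rn n → ℝ≥0∞), Measurable w →
    ∀ x, etaConv j w x ≤ C * maximalFn w x := by
  set v := volume (Metric.ball (0 : Rn n) 1)
  have hv : v ≠ ∞ := measure_ball_lt_top.ne
  refine ⟨∑' i : ℕ, ENNReal.ofReal ((2 : ℝ) ^ n * (1 / 2) ^ i) * v, ?_, fun j w hw x => ?_⟩
  · rw [ENNReal.tsum_mul_right]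
    refine ENNReal.mul_ne_top ?_ hv
    have : Summable fun i : ℕ => (2 : ℝ) ^ n * (1 / 2) ^ i := summable_geometric_two.mul_left _
    exact this.tsum_ofReal_ne_top
  calc etaConv j w x ≤ ∫⁻ y, ∑' i : ℕ, ENNReal.ofReal (((2 : ℝ) ^ j) ^ n * ((2 ^ i) ^ (n + 1))⁻¹) *
      (Metric.closedBall x ((2 : ℝ) ^ ((i : ℤ) + 1 - j))).indicator w y := by
        refine lintegral_mono fun y => ?_
        refine (mul_le_mul_left (eta_le_tsum j (x - y)) _).trans (le_of_eq ?_)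
        rw [← ENNReal.tsum_mul_right]
        congr 1
        ext i
        rw [mul_assoc]
        congr 1
        by_cases h : y ∈ Metric.closedBall x ((2 : ℝ) ^ ((i : ℤ) + 1 - j))
        · rw [Set.indicator_of_mem h, Set.indicator_of_mem]
          · simp
          · rw [mem_closedBall_zero_iff]; rwa [Metric.mem_closedBall, dist_eq_norm, norm_sub_rev] at h
        · rw [Set.indicator_of_notMem h, Set.indicator_of_notMem]
          · simp
          · rw [mem_closedBall_zero_iff]; rwa [Metric.mem_closedBall, dist_eq_norm, norm_sub_rev] at h
    _ = ∑' i : ℕ, ENNReal.ofReal (((2 : ℝ) ^ j) ^ n * ((2 ^ i) ^ (n + 1))⁻¹) *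
        ∫⁻ y in Metric.closedBall x ((2 : ℝ) ^ ((i : ℤ) + 1 - j)), w y := by
        have hm : ∀ i : ℕ, Measurable
            ((Metric.closedBall x ((2 : ℝ) ^ ((i : ℤ) + 1 - j))).indicator w) := fun i =>
          hw.indicator Metric.isClosed_closedBall.measurableSet
        rw [lintegral_tsum fun i => ((hm i).const_mul _).aemeasurable]
        congr 1
        ext i
        rw [lintegral_const_mul _ (hm i),
          lintegral_indicator Metric.isClosed_closedBall.measurableSet]
    _ ≤ ∑' i : ℕ, ENNReal.ofReal ((2 : ℝ) ^ n * (1 / 2) ^ i) * v * maximalFn w x := by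
        refine ENNReal.tsum_le_tsum fun i => ?_
        refine (mul_le_mul_right (setLIntegral_closedBall_le_maximalFn w x _) _).trans ?_
        rw [volume_closedBall_zpow, ← mul_assoc, ← mul_assoc, ← ENNReal.ofReal_mul (by positivity)]
        refine le_of_eq ?_
        congr 3
        rw [zpow_sub₀ (by norm_num), zpow_add₀ (by norm_num), zpow_natCast, zpow_natCast, zpow_one,
          div_pow, mul_pow, pow_succ (2 ^ i : ℝ) n]
        field_simp
        rw [← mul_pow]
        norm_num
    _ = _ := by rw [ENNReal.tsum_mul_right]

/-- Vitali's covering argument with fivefold enlargement. Vitali needs bounded radii, so the level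
set is exhausted by the sets `T N` on which a ball of radius at most 2^N already witnesses the large
average. -/
theorem maximalFn_weak_type {w : Rn n → ℝ≥0∞} {l : ℝ≥0∞} (hl : l ≠ 0) (hl' : l ≠ ∞) :
    volume {x | l < maximalFn w x} ≤ 5 ^ n * l⁻¹ * ∫⁻ y, w y := by
  let T : ℕ → Set (Rn n) := fun N => {x | ∃ i : ℤ, i ≤ N ∧
    l * volume (Metric.closedBall x ((2 : ℝ) ^ i)) < ∫⁻ y in Metric.closedBall x ((2 : ℝ) ^ i), w y}
  have hT : {x | l < maximalFn w x} ⊆ ⋃ N, T N := by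
    intro x hx
    obtain ⟨i, hi⟩ := lt_iSup_iff.1 (show l < maximalFn w x from hx)
    refine Set.mem_iUnion.2 ⟨i.toNat, i, Int.self_le_toNat i, ?_⟩
    rw [mul_comm] at hi
    rwa [← div_eq_mul_inv, ENNReal.lt_div_iff_mul_lt (Or.inl (volume_closedBall_ne_zero x i))
      (Or.inl measure_closedBall_lt_top.ne)] at hi
  have hmono : Monotone T := by
    intro N N' hNN' x ⟨i, hi, h⟩
    exact ⟨i, hi.trans (by exact_mod_cast hNN'), h⟩
  refine (measure_mono hT).trans ?_
  rw [hmono.measure_iUnion]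
  refine iSup_le fun N => ?_
  choose! r hr1 hr2 using fun x (hx : x ∈ T N) => hx
  obtain ⟨u, huT, hdisj, hcov⟩ := Vitali.exists_disjoint_subfamily_covering_enlargement_closedBall
    (T N) id (fun x => (2 : ℝ) ^ (r x)) ((2 : ℝ) ^ (N : ℤ))
    (fun x hx => zpow_le_zpow_right₀ (by norm_num) (hr1 x hx)) 5 (by norm_num)
  have hcount : u.Countable := by
    refine hdisj.countable_of_nonempty_interior fun x _ => ?_
    exact ⟨x, Metric.ball_subset_interior_closedBall (Metric.mem_ball_self (by positivity))⟩
  have := hcount.to_subtype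
  have hsub : T N ⊆ ⋃ b : u, Metric.closedBall (b : Rn n) (5 * (2 : ℝ) ^ (r b)) := by
    intro x hx
    obtain ⟨b, hb, h⟩ := hcov x hx
    exact Set.mem_iUnion.2 ⟨⟨b, hb⟩, h (Metric.mem_closedBall_self (by positivity))⟩
  calc volume (T N) ≤ ∑' b : u, volume (Metric.closedBall (b : Rn n) (5 * (2 : ℝ) ^ (r b))) :=
        (measure_mono hsub).trans (measure_iUnion_le _)
    _ = ∑' b : u, 5 ^ n * volume (Metric.closedBall (b : Rn n) ((2 : ℝ) ^ (r b))) := by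
        congr 1
        ext b
        rw [Measure.addHaar_closedBall _ _ (by positivity), volume_closedBall_zpow,
          finrank_euclideanSpace_fin, mul_pow, ENNReal.ofReal_mul (by positivity), mul_assoc]
        congr 1
        rw [ENNReal.ofReal_pow (by norm_num)]
        norm_num
    _ ≤ ∑' b : u, 5 ^ n * (l⁻¹ * ∫⁻ y in Metric.closedBall (b : Rn n) ((2 : ℝ) ^ (r b)), w y) := by
        refine ENNReal.tsum_le_tsum fun b => ?_
        gcongr
        rw [← ENNReal.mul_le_iff_le_inv hl hl']
        exact (hr2 b (huT b.2)).le
    _ = 5 ^ n * l⁻¹ * ∫⁻ y in ⋃ b : u, Metric.closedBall (b : Rn n) ((2 : ℝ) ^ (r b)), w y := by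
        rw [ENNReal.tsum_mul_left, ENNReal.tsum_mul_left, mul_assoc,
          lintegral_iUnion (fun b => Metric.isClosed_closedBall.measurableSet)]
        intro a b hab
        exact hdisj a.2 b.2 (fun h => hab (Subtype.ext h))
    _ ≤ _ := by gcongr; exact Measure.restrict_le_self

/-! ### From the weak type to the strong type maximal inequality -/

variable {n : ℕ}

/-- This is the inner integral ∫_0^a s^{t-2} ds left by the interpolation argument once the order of
integration has been exchanged; t > 1 makes it converge at 0. -/
theorem lintegral_layer_le {t : ℝ} (ht : 1 < t) (a : ℝ≥0∞) :
    ∫⁻ s in Set.Ioi (0 : ℝ), {s : ℝ | ENNReal.ofReal s < a}.indicator 1 s * ENNReal.ofReal (s ^ (t - 2))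
      ≤ ENNReal.ofReal (1 / (t - 1)) * a ^ (t - 1) := by
  have ht0 : 0 < t - 1 := by linarith
  induction a with
  | top =>
    rw [ENNReal.top_rpow_of_pos ht0, ENNReal.mul_top (by simpa using ht)]
    exact le_top
  | coe a =>
    have h1 : ∫⁻ s in Set.Ioi (0 : ℝ),
        {s : ℝ | ENNReal.ofReal s < a}.indicator 1 s * ENNReal.ofReal (s ^ (t - 2)) =
        ∫⁻ s in Set.Ioc (0 : ℝ) a, ENNReal.ofReal (s ^ (t - 2)) := by
      rw [← setLIntegral_congr Ioo_ae_eq_Ioc, ← lintegral_indicator measurableSet_Ioi,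
        ← lintegral_indicator measurableSet_Ioo]
      congr 1
      ext s
      by_cases hs : 0 < s
      · by_cases hsa : s < a
        · have : ENNReal.ofReal s < a := by
            rw [ENNReal.ofReal_lt_coe_iff]
            · exact hsa
            · exact hs.le
          simp [Set.indicator, hs, hsa, this]
        · have : ¬ ENNReal.ofReal s < a := by
            rw [ENNReal.ofReal_lt_coe_iff]
            · exact hsa
            · exact hs.le
          simp [Set.indicator, hs, hsa, this]
      · simp [Set.indicator, hs]
    rw [h1, ← ofReal_integral_eq_lintegral_ofReal, ← intervalIntegral.integral_of_le (NNReal.coe_nonneg a),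
      integral_rpow (Or.inl (by linarith))]
    · rw [← ENNReal.ofReal_coe_nnreal, ENNReal.ofReal_rpow_of_nonneg (NNReal.coe_nonneg a) ht0.le,
        ← ENNReal.ofReal_mul (by positivity)]
      apply ENNReal.ofReal_le_ofReal
      have : t - 2 + 1 = t - 1 := by ring
      rw [this, Real.zero_rpow ht0.ne', sub_zero]
      apply le_of_eq
      field_simp
    · exact (intervalIntegral.intervalIntegrable_rpow' (by linarith)).1
    · filter_upwards [ae_restrict_mem measurableSet_Ioc] with s hs
      exact Real.rpow_nonneg hs.1.le _

/-- Monotone convergence over truncations. It permits the use of the layer-cake formula for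
real-valued functions although the maximal function may be infinite. -/
theorem lintegral_rpow_le_of_min_le {α : Type*} [MeasurableSpace α] {μ : Measure α} {f : α → ℝ≥0∞}
    (hf : Measurable f) {t : ℝ} (ht : 0 < t) {B : ℝ≥0∞}
    (h : ∀ N : ℕ, ∫⁻ x, (min (f x) N) ^ t ∂μ ≤ B) : ∫⁻ x, f x ^ t ∂μ ≤ B := by
  have e : ∀ x, f x ^ t = ⨆ N : ℕ, (min (f x) N) ^ t := by
    intro x
    rw [← iSup_rpow _ ht, ← inf_iSup_eq, ENNReal.iSup_natCast]
    simp
  simp_rw [e]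
  rw [lintegral_iSup]
  · exact iSup_le h
  · exact fun N => (hf.min measurable_const).pow_const _
  · intro N N' h x
    exact ENNReal.rpow_le_rpow (min_le_min le_rfl (by exact_mod_cast h)) ht.le

/-- The Hardy–Littlewood maximal theorem. -/
theorem maximalFn_strong_type {t : ℝ} (ht : 1 < t) : ∃ C : ℝ≥0∞, C ≠ ∞ ∧
    ∀ w : Rn n → ℝ≥0∞, Measurable w → ∫⁻ x, maximalFn w x ^ t ≤ C * ∫⁻ x, w x ^ t := by
  have ht0 : 0 < t := by linarith
  refine ⟨ENNReal.ofReal t * (2 * 5 ^ n * (ENNReal.ofReal (1 / (t - 1)) * 2 ^ (t - 1))), ?_,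
    fun w hw => ?_⟩
  · have : (2 : ℝ≥0∞) ^ (t - 1) ≠ ∞ := ENNReal.rpow_ne_top_of_nonneg (by linarith) (by simp)
    finiteness
  have hM := measurable_maximalFn hw
  refine lintegral_rpow_le_of_min_le hM ht0 fun N => ?_
  have hfin : ∀ x, min (maximalFn w x) (N : ℝ≥0∞) ≠ ∞ := fun x =>
    ne_top_of_le_ne_top (ENNReal.natCast_ne_top N) (min_le_right _ _)
  have e1 : ∀ x, (min (maximalFn w x) (N : ℝ≥0∞)) ^ t =
      ENNReal.ofReal ((min (maximalFn w x) (N : ℝ≥0∞)).toReal ^ t) := by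
    intro x
    rw [← ENNReal.ofReal_rpow_of_nonneg ENNReal.toReal_nonneg ht0.le, ENNReal.ofReal_toReal (hfin x)]
  simp_rw [e1]
  rw [lintegral_rpow_eq_lintegral_meas_lt_mul volume
    (Filter.Eventually.of_forall fun x => ENNReal.toReal_nonneg)
    (hM.min measurable_const).ennreal_toReal.aemeasurable ht0, mul_assoc]
  refine mul_le_mul_right ?_ _
  -- Marcinkiewicz's splitting at height s: only the part v of w exceeding s/2 matters, because the
  -- rest raises the maximal function by at most s/2. The weak type estimate is applied to v at
  -- level l = s/2.
  have key : ∀ s ∈ Set.Ioi (0 : ℝ),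
      volume {x | s < (min (maximalFn w x) (N : ℝ≥0∞)).toReal} * ENNReal.ofReal (s ^ (t - 1)) ≤
      2 * 5 ^ n * ∫⁻ y, w y * ({s : ℝ | ENNReal.ofReal s < 2 * w y}.indicator 1 s *
        ENNReal.ofReal (s ^ (t - 2))) := by
    intro s hs
    have hs0 : (0 : ℝ) < s := hs
    set l := ENNReal.ofReal s / 2 with hl
    have hl0 : l ≠ 0 := by simp [hl, hs0]
    have hlt : l ≠ ∞ := by simp [hl, ENNReal.div_eq_top]
    let v : Rn n → ℝ≥0∞ := fun y => w y * {s : ℝ | ENNReal.ofReal s < 2 * w y}.indicator 1 s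
    have hv : Measurable v := by
      refine hw.mul ?_
      have : Measurable ({y : Rn n | ENNReal.ofReal s < 2 * w y}.indicator (1 : Rn n → ℝ≥0∞)) :=
        measurable_one.indicator (measurableSet_lt measurable_const (hw.const_mul 2))
      exact this
    have hwv : ∀ y, w y ≤ v y + l := by
      intro y
      by_cases h : ENNReal.ofReal s < 2 * w y
      · simp [v, Set.indicator, h]
      · simp only [v, Set.indicator, Set.mem_ofPred_eq, h, if_false, mul_zero, zero_add]
        rw [hl, ENNReal.le_div_iff_mul_le (by simp) (by simp), mul_comm]
        exact not_lt.1 h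
    have hsub : {x | s < (min (maximalFn w x) (N : ℝ≥0∞)).toReal} ⊆ {x | l < maximalFn v x} := by
      intro x hx
      have h1 : ENNReal.ofReal s < maximalFn w x := by
        have := (ENNReal.ofReal_lt_iff_lt_toReal hs0.le (hfin x)).2 hx
        exact this.trans_le (min_le_left _ _)
      have h2 : maximalFn w x ≤ maximalFn v x + l :=
        (maximalFn_mono hwv x).trans (maximalFn_add_const_le hv l x)
      have h3 : l + l < maximalFn v x + l := by
        rw [hl, ENNReal.add_halves]
        exact h1.trans_le h2
      exact (ENNReal.add_lt_add_iff_right hlt).1 h3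
    have e2 : ∫⁻ y, w y * ({s : ℝ | ENNReal.ofReal s < 2 * w y}.indicator 1 s *
        ENNReal.ofReal (s ^ (t - 2))) = (∫⁻ y, v y) * ENNReal.ofReal (s ^ (t - 2)) := by
      rw [← lintegral_mul_const _ hv]
      congr 1
      ext y
      simp only [v]
      ring
    have e3 : l⁻¹ * ENNReal.ofReal (s ^ (t - 1)) = 2 * ENNReal.ofReal (s ^ (t - 2)) := by
      have : t - 1 = 1 + (t - 2) := by ring
      rw [this, Real.rpow_add hs0, Real.rpow_one, ENNReal.ofReal_mul hs0.le, hl,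
        ENNReal.inv_div (by simp) (by simp), ← mul_assoc, ENNReal.div_mul_cancel] <;> simp [hs0]
    calc _ ≤ (5 ^ n * l⁻¹ * ∫⁻ y, v y) * ENNReal.ofReal (s ^ (t - 1)) := by
          gcongr
          exact (measure_mono hsub).trans (maximalFn_weak_type hl0 hlt)
      _ = 5 ^ n * (l⁻¹ * ENNReal.ofReal (s ^ (t - 1))) * ∫⁻ y, v y := by ring
      _ = _ := by rw [e2, e3]; ring
  have hmeas : Measurable fun z : ℝ × Rn n => w z.2 *
      ({s : ℝ | ENNReal.ofReal s < 2 * w z.2}.indicator 1 z.1 * ENNReal.ofReal (z.1 ^ (t - 2))) := by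
    refine (hw.comp measurable_snd).mul (Measurable.mul ?_ ?_)
    · have : Measurable ({z : ℝ × Rn n | ENNReal.ofReal z.1 < 2 * w z.2}.indicator
          (1 : ℝ × Rn n → ℝ≥0∞)) :=
        measurable_one.indicator (measurableSet_lt (ENNReal.measurable_ofReal.comp measurable_fst)
          ((hw.comp measurable_snd).const_mul 2))
      exact this
    · exact (measurable_fst.pow_const _).ennreal_ofReal
  have hmeas' : ∀ y : Rn n, Measurable fun s : ℝ => {s : ℝ | ENNReal.ofReal s < 2 * w y}.indicator
      (1 : ℝ → ℝ≥0∞) s * ENNReal.ofReal (s ^ (t - 2)) := by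
    intro y
    refine Measurable.mul ?_ (measurable_id.pow_const _).ennreal_ofReal
    exact measurable_one.indicator (measurableSet_lt ENNReal.measurable_ofReal measurable_const)
  calc _ ≤ ∫⁻ s in Set.Ioi (0 : ℝ), 2 * 5 ^ n * ∫⁻ y, w y *
        ({s : ℝ | ENNReal.ofReal s < 2 * w y}.indicator 1 s * ENNReal.ofReal (s ^ (t - 2))) :=
        setLIntegral_mono' measurableSet_Ioi key
    _ = 2 * 5 ^ n * ∫⁻ y, w y * ∫⁻ s in Set.Ioi (0 : ℝ),
        ({s : ℝ | ENNReal.ofReal s < 2 * w y}.indicator 1 s * ENNReal.ofReal (s ^ (t - 2))) := by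
        rw [lintegral_const_mul _ hmeas.lintegral_prod_right',
          lintegral_lintegral_swap hmeas.aemeasurable]
        congr 2
        ext y
        dsimp only
        exact lintegral_const_mul (w y) (hmeas' y)
    _ ≤ 2 * 5 ^ n * ∫⁻ y, (ENNReal.ofReal (1 / (t - 1)) * 2 ^ (t - 1)) * w y ^ t := by
        refine mul_le_mul_right (lintegral_mono fun y => ?_) _
        refine (mul_le_mul_right (lintegral_layer_le ht _) _).trans (le_of_eq ?_)
        rw [ENNReal.mul_rpow_of_nonneg _ _ (by linarith)]
        have : w y ^ t = w y * w y ^ (t - 1) := by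
          have h := ENNReal.rpow_add_of_nonneg (x := w y) 1 (t - 1) zero_le_one (by linarith)
          rw [ENNReal.rpow_one] at h
          rw [← h]
          congr 1
          ring
        rw [this]
        ring
    _ = _ := by rw [lintegral_const_mul _ (hw.pow_const _)]; ring

variable {n : ℕ}

/-! ### Vector-valued inequalities for the averaging kernels -/

theorem lintegral_tsum_mul {α ι : Type*} [MeasurableSpace α] [Countable ι] {μ : Measure α}
    {f g : ι → α → ℝ≥0∞} (hf : ∀ i, Measurable (f i)) (hg : ∀ i, Measurable (g i)) :
    ∫⁻ x, ∑' i, f i x * g i x ∂μ = ∑' i, ∫⁻ x, f i x * g i x ∂μ :=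
  lintegral_tsum fun i => ((hf i).mul (hg i)).aemeasurable

/-- Truncation of a sequence of functions. -/
def truncSeq (H : ℕ → Rn n → ℝ≥0∞) (N j : ℕ) (x : Rn n) : ℝ≥0∞ :=
  if j < N then (Metric.ball (0 : Rn n) N).indicator (fun x => min (H j x) N) x else 0

theorem measurable_truncSeq {H : ℕ → Rn n → ℝ≥0∞} (hH : ∀ j, Measurable (H j)) (N j : ℕ) :
    Measurable (truncSeq H N j) := by
  unfold truncSeq
  split_ifs
  · exact ((hH j).min measurable_const).indicator Metric.isOpen_ball.measurableSet
  · exact measurable_const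

theorem truncSeq_le (H : ℕ → Rn n → ℝ≥0∞) (N j : ℕ) (x : Rn n) : truncSeq H N j x ≤ H j x := by
  unfold truncSeq
  split_ifs
  · exact Set.indicator_le (fun x _ => min_le_left _ _) x
  · exact zero_le

theorem truncSeq_mono (H : ℕ → Rn n → ℝ≥0∞) (j : ℕ) (x : Rn n) :
    Monotone fun N => truncSeq H N j x := by
  intro N N' h
  have h' : (N : ℝ≥0∞) ≤ N' := by exact_mod_cast h
  simp only [truncSeq]
  split_ifs with h1 h2
  · by_cases hx : x ∈ Metric.ball (0 : Rn n) N
    · have hx' : x ∈ Metric.ball (0 : Rn n) N' := Metric.ball_subset_ball (by exact_mod_cast h) hx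
      rw [Set.indicator_of_mem hx, Set.indicator_of_mem hx']
      exact min_le_min le_rfl h'
    · rw [Set.indicator_of_notMem hx]
      exact zero_le
  · omega
  · exact zero_le
  · exact le_rfl

theorem iSup_truncSeq (H : ℕ → Rn n → ℝ≥0∞) (j : ℕ) (x : Rn n) :
    ⨆ N, truncSeq H N j x = H j x := by
  refine le_antisymm (iSup_le fun N => truncSeq_le H N j x) ?_
  have e : ⨆ N : ℕ, min (H j x) N = H j x := by
    rw [← inf_iSup_eq, ENNReal.iSup_natCast]
    simp
  rw [← e]
  refine iSup_le fun N => ?_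
  obtain ⟨N', hN'⟩ := exists_nat_gt ‖x‖
  let N'' := max N (max N' (j + 1))
  refine le_trans ?_ (le_iSup _ N'')
  have h1 : j < N'' := by simp [N'']
  have h2 : x ∈ Metric.ball (0 : Rn n) N'' := by
    rw [mem_ball_zero_iff]
    refine hN'.trans_le ?_
    simp [N'']
  unfold truncSeq
  rw [if_pos h1, Set.indicator_of_mem h2]
  refine min_le_min le_rfl ?_
  exact_mod_cast le_max_left _ _

theorem iSup_tsum_truncSeq_rpow (H : ℕ → Rn n → ℝ≥0∞) {b : ℝ} (hb : 0 < b) (x : Rn n) :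
    ⨆ N, ∑' j, truncSeq H N j x ^ b = ∑' j, H j x ^ b := by
  refine le_antisymm (iSup_le fun N => ENNReal.tsum_le_tsum fun j =>
    ENNReal.rpow_le_rpow (truncSeq_le H N j x) hb.le) ?_
  rw [ENNReal.tsum_eq_iSup_sum]
  refine iSup_le fun s => ?_
  have e : ∑ j ∈ s, H j x ^ b = ⨆ N, ∑ j ∈ s, truncSeq H N j x ^ b := by
    rw [← ENNReal.finsetSum_iSup_of_monotone
      fun j _ _ h => ENNReal.rpow_le_rpow (truncSeq_mono H j x h) hb.le]
    refine Finset.sum_congr rfl fun j _ => ?_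
    rw [← iSup_rpow _ hb, iSup_truncSeq]
  rw [e]
  exact iSup_mono fun N => ENNReal.sum_le_tsum s

/-- The mixed quasi-norm of `L_a(ℓ_b)` for real exponents. -/
def mixedNorm (a b : ℝ) (H : ℕ → Rn n → ℝ≥0∞) : ℝ≥0∞ :=
  (∫⁻ x, (∑' j, H j x ^ b) ^ (a / b)) ^ (1 / a)

/-- Divide by I^{1/a'}. Finiteness of I is indispensable here and is the reason for truncating in
the duality argument. -/
theorem le_of_le_mul_rpow {a a' : ℝ} (ha : a.HolderConjugate a') {I B : ℝ≥0∞} (hI : I ≠ ∞)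
    (h : I ≤ B * I ^ (1 / a')) : I ^ (1 / a) ≤ B := by
  rcases eq_or_ne I 0 with rfl | h0
  · rw [ENNReal.zero_rpow_of_pos (one_div_pos.2 ha.pos)]
    exact zero_le
  have e : I = I ^ (1 / a) * I ^ (1 / a') := by
    rw [← ENNReal.rpow_add _ _ h0 hI]
    have := ha.inv_add_inv_eq_one
    simp [this]
  nth_rewrite 1 [e] at h
  refine (ENNReal.mul_le_mul_iff_left ?_ ?_).1 h
  · exact (ENNReal.rpow_pos (pos_iff_ne_zero.2 h0) hI).ne'
  · exact ENNReal.rpow_ne_top_of_nonneg (one_div_nonneg.2 ha.symm.nonneg) hI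

/-- The converse of Hölder's inequality in `L_a(ℓ_b)`. -/
theorem mixedNorm_le_of_dual {a a' b b' : ℝ} (ha : a.HolderConjugate a')
    (hb : b.HolderConjugate b') {H : ℕ → Rn n → ℝ≥0∞} (hH : ∀ j, Measurable (H j)) {B : ℝ≥0∞}
    (h : ∀ V : ℕ → Rn n → ℝ≥0∞, (∀ j, Measurable (V j)) →
      ∑' j, ∫⁻ x, H j x * V j x ≤ B * mixedNorm a' b' V) : mixedNorm a b H ≤ B := by
  have ha0 := ha.pos
  have hb0 := hb.pos
  have ha'0 := ha.symm.pos
  have hb'0 := hb.symm.pos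
  have hab : 0 < a / b := by positivity
  have trunc : ∀ N, mixedNorm a b (truncSeq H N) ≤ B := by
    intro N
    set T : Rn n → ℝ≥0∞ := fun x => ∑' j, truncSeq H N j x ^ b with hT
    have hTm : Measurable T := .tsum fun j => (measurable_truncSeq hH N j).pow_const _
    have hTsum : ∀ x, T x = ∑ j ∈ Finset.range N, truncSeq H N j x ^ b := by
      intro x
      refine tsum_eq_sum fun j hj => ?_
      have : ¬ j < N := by simpa using hj
      simp [truncSeq, this, hb0]
    have hTball : ∀ x, T x ≤ (Metric.ball (0 : Rn n) N).indicator (fun _ => (N : ℝ≥0∞) * N ^ b) x := by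
      intro x
      rw [hTsum]
      by_cases hx : x ∈ Metric.ball (0 : Rn n) N
      · rw [Set.indicator_of_mem hx]
        calc _ ≤ ∑ j ∈ Finset.range N, (N : ℝ≥0∞) ^ b := by
              refine Finset.sum_le_sum fun j hj => ENNReal.rpow_le_rpow ?_ hb0.le
              unfold truncSeq
              rw [if_pos (by simpa using hj), Set.indicator_of_mem hx]
              exact min_le_right _ _
          _ = _ := by simp
      · rw [Set.indicator_of_notMem hx]
        refine le_of_eq (Finset.sum_eq_zero fun j _ => ?_)
        unfold truncSeq
        rw [Set.indicator_of_notMem hx]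
        simp [hb0]
    have hNfin : (N : ℝ≥0∞) * N ^ b ≠ ∞ :=
      ENNReal.mul_ne_top (by simp) (ENNReal.rpow_ne_top_of_nonneg hb0.le (by simp))
    have hTfin : ∀ x, T x ≠ ∞ := fun x => ne_top_of_le_ne_top hNfin
      ((hTball x).trans (Set.indicator_le_self _ _ x))
    have hI : ∫⁻ x, T x ^ (a / b) ≠ ∞ := by
      refine ne_top_of_le_ne_top (b := ∫⁻ x in Metric.ball (0 : Rn n) N, ((N : ℝ≥0∞) * N ^ b) ^ (a / b))
        ?_ ?_
      · rw [lintegral_const, Measure.restrict_apply_univ]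
        exact ENNReal.mul_ne_top (ENNReal.rpow_ne_top_of_nonneg hab.le hNfin) measure_ball_lt_top.ne
      · rw [← lintegral_indicator Metric.isOpen_ball.measurableSet]
        refine lintegral_mono fun x => (ENNReal.rpow_le_rpow (hTball x) hab.le).trans ?_
        by_cases hx : x ∈ Metric.ball (0 : Rn n) N <;> simp [hx, hab]
    -- The extremal function of Hölder's inequality in L_a(ℓ_b): its pairing with the truncated
    -- sequence and the a'-th power of its own dual norm both equal ∫ T^{a/b}.
    let V : ℕ → Rn n → ℝ≥0∞ := fun j x => truncSeq H N j x ^ (b - 1) * T x ^ ((a - b) / b)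
    have hVm : ∀ j, Measurable (V j) := fun j =>
      ((measurable_truncSeq hH N j).pow_const _).mul (hTm.pow_const _)
    have hb1 : 0 < b - 1 := by linarith [hb.lt]
    have ha1 : 0 < a - 1 := by linarith [ha.lt]
    have hzero : ∀ x, T x = 0 → ∀ j, truncSeq H N j x = 0 := by
      intro x hx j
      have := ENNReal.tsum_eq_zero.1 hx j
      rwa [ENNReal.rpow_eq_zero_iff_of_pos hb0] at this
    have e1 : ∀ x, ∑' j, truncSeq H N j x * V j x = T x ^ (a / b) := by
      intro x
      rcases eq_or_ne (T x) 0 with h0 | h0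
      · simp [hzero x h0, h0, hab]
      · have : ∀ j, truncSeq H N j x * V j x = truncSeq H N j x ^ b * T x ^ ((a - b) / b) := by
          intro j
          have h := ENNReal.rpow_add_of_nonneg (x := truncSeq H N j x) 1 (b - 1) zero_le_one hb1.le
          rw [ENNReal.rpow_one, add_sub_cancel] at h
          simp only [V]
          rw [← mul_assoc, ← h]
        simp_rw [this]
        rw [ENNReal.tsum_mul_right]
        change T x * _ = _
        nth_rewrite 1 [← ENNReal.rpow_one (T x)]
        rw [← ENNReal.rpow_add _ _ h0 (hTfin x)]
        congr 1
        field_simp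
        ring
    have e2 : ∀ x, (∑' j, V j x ^ b') ^ (a' / b') = T x ^ (a / b) := by
      intro x
      have h1 : (b - 1) * b' = b := hb.sub_one_mul_conj
      have h2 : (a - 1) * a' = a := ha.sub_one_mul_conj
      rcases eq_or_ne (T x) 0 with h0 | h0
      · have : ∀ j, V j x = 0 := fun j => by simp [V, hzero x h0 j, hb1]
        have h3 : 0 < a' / b' := by positivity
        simp [this, h0, hab, hb'0, h3]
      · have : ∀ j, V j x ^ b' = truncSeq H N j x ^ b * T x ^ ((a - b) / b * b') := by
          intro j
          simp only [V]
          rw [ENNReal.mul_rpow_of_nonneg _ _ hb'0.le, ← ENNReal.rpow_mul, ← ENNReal.rpow_mul, h1]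
        simp_rw [this]
        rw [ENNReal.tsum_mul_right]
        change (T x * _) ^ _ = _
        nth_rewrite 1 [← ENNReal.rpow_one (T x)]
        rw [← ENNReal.rpow_add _ _ h0 (hTfin x), ← ENNReal.rpow_mul]
        congr 1
        have h4 : b = (b - 1) * b' := h1.symm
        have h5 : a = (a - 1) * a' := h2.symm
        field_simp
        nlinarith [mul_comm a b]
    have h3 := h V hVm
    have h4 : ∫⁻ x, T x ^ (a / b) ≤ ∑' j, ∫⁻ x, H j x * V j x := by
      simp_rw [← e1]
      rw [lintegral_tsum_mul (measurable_truncSeq hH N) hVm]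
      exact ENNReal.tsum_le_tsum fun j => lintegral_mono fun x =>
        mul_le_mul_left (truncSeq_le H N j x) _
    have h5 := h4.trans h3
    unfold mixedNorm at h5
    simp_rw [e2] at h5
    exact le_of_le_mul_rpow ha hI h5
  have hmono : ∀ x, Monotone fun N => ∑' j, truncSeq H N j x ^ b := fun x N N' hN =>
    ENNReal.tsum_le_tsum fun j => ENNReal.rpow_le_rpow (truncSeq_mono H j x hN) hb0.le
  unfold mixedNorm
  simp_rw [← iSup_tsum_truncSeq_rpow H hb0, iSup_rpow _ hab]
  rw [lintegral_iSup, iSup_rpow _ (one_div_pos.2 ha0)]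
  · exact iSup_le trunc
  · exact fun N => (Measurable.tsum fun j => (measurable_truncSeq hH N j).pow_const _).pow_const _
  · exact fun N N' hN x => ENNReal.rpow_le_rpow (hmono x hN) hab.le

/-- The scalar converse of Hölder is the mixed one for a sequence with a single nonzero member; the
inner exponent 2 is then immaterial. -/
theorem lintegral_rpow_le_of_dual {c c' : ℝ} (hc : c.HolderConjugate c') {H : Rn n → ℝ≥0∞}
    (hH : Measurable H) {B : ℝ≥0∞} (h : ∀ w : Rn n → ℝ≥0∞, Measurable w →
      ∫⁻ x, H x * w x ≤ B * (∫⁻ x, w x ^ c') ^ (1 / c')) :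
    (∫⁻ x, H x ^ c) ^ (1 / c) ≤ B := by
  have h2 : Real.HolderConjugate 2 2 := ⟨by norm_num, by norm_num, by norm_num⟩
  let H' : ℕ → Rn n → ℝ≥0∞ := fun j => if j = 0 then H else 0
  have hH' : ∀ j, Measurable (H' j) := fun j => by
    simp only [H']; split_ifs; exacts [hH, measurable_zero]
  have key := mixedNorm_le_of_dual hc h2 hH' (B := B) fun V hV => by
    rw [tsum_eq_single 0 fun j hj => by simp [H', hj]]
    refine (h (V 0) (hV 0)).trans (mul_le_mul_right ?_ _)
    unfold mixedNorm
    refine ENNReal.rpow_le_rpow (lintegral_mono fun x => ?_) (one_div_nonneg.2 hc.symm.nonneg)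
    calc V 0 x ^ c' = (V 0 x ^ (2 : ℝ)) ^ (c' / 2) := by
          rw [← ENNReal.rpow_mul]; congr 1; ring
      _ ≤ _ := ENNReal.rpow_le_rpow (ENNReal.le_tsum (f := fun j => V j x ^ (2 : ℝ)) 0)
          (by have := hc.symm.pos; positivity)
  unfold mixedNorm at key
  refine le_trans (le_of_eq ?_) key
  congr 2
  ext x
  rw [tsum_eq_single 0 fun j hj => by simp [H', hj]]
  simp only [H', if_true]
  rw [← ENNReal.rpow_mul]
  congr 1
  ring

/-- The argument of Fefferman and Stein. Test ∑_j (η_j * G_j)^b against w in the dual of L_{a/b}.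
Jensen and self-adjointness move η_j onto w, where it is dominated by the maximal function of w
uniformly in j. The scalar maximal theorem in the dual exponent finishes. -/
theorem exists_mixedNorm_etaConv_le_of_le {a b : ℝ} (hb : 1 ≤ b) (hab : b ≤ a) :
    ∃ C : ℝ≥0∞, C ≠ ∞ ∧ ∀ G : ℕ → Rn n → ℝ≥0∞, (∀ j, Measurable (G j)) →
      mixedNorm a b (fun j => etaConv j (G j)) ≤ C * mixedNorm a b G := by
  have hb0 : 0 < b := by linarith
  have ha0 : 0 < a := by linarith
  have hmass : etaMass n ^ (b - 1) ≠ ∞ :=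
    ENNReal.rpow_ne_top_of_nonneg (by linarith) etaMass_ne_top
  suffices h : ∃ C : ℝ≥0∞, C ≠ ∞ ∧ ∀ G : ℕ → Rn n → ℝ≥0∞, (∀ j, Measurable (G j)) →
      (∫⁻ x, (∑' j, etaConv j (G j) x ^ b) ^ (a / b)) ^ (1 / (a / b)) ≤
        C * (∫⁻ x, (∑' j, G j x ^ b) ^ (a / b)) ^ (1 / (a / b)) by
    obtain ⟨C, hC, h⟩ := h
    refine ⟨C ^ (1 / b), ENNReal.rpow_ne_top_of_nonneg (by positivity) hC, fun G hG => ?_⟩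
    have := ENNReal.rpow_le_rpow (h G hG) (one_div_nonneg.2 hb0.le)
    rw [ENNReal.mul_rpow_of_nonneg _ _ (by positivity), ← ENNReal.rpow_mul, ← ENNReal.rpow_mul] at this
    have e : 1 / (a / b) * (1 / b) = 1 / a := by field_simp
    rwa [e] at this
  have pair : ∀ G : ℕ → Rn n → ℝ≥0∞, (∀ j, Measurable (G j)) → ∀ w : Rn n → ℝ≥0∞, Measurable w →
      ∫⁻ x, (∑' j, etaConv j (G j) x ^ b) * w x ≤
        etaMass n ^ (b - 1) * ∑' j, ∫⁻ x, G j x ^ b * etaConv j w x := by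
    intro G hG w hw
    simp_rw [← ENNReal.tsum_mul_right]
    rw [lintegral_tsum_mul (fun j => (measurable_etaConv j (hG j)).pow_const _) fun _ => hw,
      ← ENNReal.tsum_mul_left]
    refine ENNReal.tsum_le_tsum fun j => ?_
    rw [← lintegral_mul_etaConv j ((hG j).pow_const b) hw, ← lintegral_const_mul' _ _ hmass]
    refine lintegral_mono fun x => ?_
    rw [← mul_assoc]
    exact mul_le_mul_left (etaConv_rpow_le j (hG j) hb x) _
  rcases hab.eq_or_lt with rfl | hab
  -- For a = b the quantity is a plain integral, so w = 1 suffices and no maximal function is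
  -- needed.
  · refine ⟨etaMass n ^ (b - 1) * etaMass n, ENNReal.mul_ne_top hmass etaMass_ne_top, fun G hG => ?_⟩
    have := pair G hG 1 measurable_one
    simp only [Pi.one_apply, mul_one] at this
    rw [div_self hb0.ne']
    simp only [ENNReal.rpow_one, div_one]
    refine this.trans (le_of_eq ?_)
    rw [mul_assoc, lintegral_tsum fun j => ((hG j).pow_const _).aemeasurable]
    congr 1
    rw [← ENNReal.tsum_mul_left]
    congr 1
    ext j
    rw [← lintegral_const_mul _ ((hG j).pow_const _)]
    congr 1
    ext x
    simp only [etaConv, Pi.one_apply, mul_one]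
    rw [lintegral_eta_sub, mul_comm]
  · have hc1 : 1 < a / b := by rwa [one_lt_div hb0]
    have hc := Real.HolderConjugate.conjExponent hc1
    set c := a / b
    set c' := Real.conjExponent c
    obtain ⟨C1, hC1, h1⟩ := etaConv_le_maximalFn (n := n)
    obtain ⟨C2, hC2, h2⟩ := maximalFn_strong_type (n := n) hc.symm.lt
    refine ⟨etaMass n ^ (b - 1) * C1 * C2 ^ (1 / c'), ENNReal.mul_ne_top (ENNReal.mul_ne_top hmass hC1)
      (ENNReal.rpow_ne_top_of_nonneg (one_div_nonneg.2 hc.symm.nonneg) hC2), fun G hG => ?_⟩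
    have hm : Measurable fun x => ∑' j, G j x ^ b := .tsum fun j => (hG j).pow_const _
    refine lintegral_rpow_le_of_dual hc (.tsum fun j => (measurable_etaConv j (hG j)).pow_const _)
      fun w hw => (pair G hG w hw).trans ?_
    calc etaMass n ^ (b - 1) * ∑' j, ∫⁻ x, G j x ^ b * etaConv j w x
        ≤ etaMass n ^ (b - 1) * ∑' j, ∫⁻ x, G j x ^ b * (C1 * maximalFn w x) := by
          gcongr with j x
          exact h1 j w hw x
      _ = etaMass n ^ (b - 1) * (C1 * ∫⁻ x, (∑' j, G j x ^ b) * maximalFn w x) := by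
          congr 1
          simp_rw [← ENNReal.tsum_mul_right]
          rw [lintegral_tsum_mul (fun j => (hG j).pow_const _) fun _ => measurable_maximalFn hw,
            ← ENNReal.tsum_mul_left]
          congr 1
          ext j
          rw [← lintegral_const_mul' _ _ hC1]
          congr 1
          ext x
          ring
      _ ≤ etaMass n ^ (b - 1) * (C1 * ((∫⁻ x, (∑' j, G j x ^ b) ^ c) ^ (1 / c) *
            (C2 * ∫⁻ x, w x ^ c') ^ (1 / c'))) := by
          gcongr
          refine (lintegral_mul_le_Lp hc hm (measurable_maximalFn hw)).trans ?_
          gcongr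
          · exact one_div_nonneg.2 hc.symm.nonneg
          · exact h2 w hw
      _ = _ := by
          rw [ENNReal.mul_rpow_of_nonneg _ _ (one_div_nonneg.2 hc.symm.nonneg)]
          ring

theorem tsum_mul_le_Lp {b b' : ℝ} (hb : b.HolderConjugate b') (f g : ℕ → ℝ≥0∞) :
    ∑' j, f j * g j ≤ (∑' j, f j ^ b) ^ (1 / b) * (∑' j, g j ^ b') ^ (1 / b') := by
  have := lintegral_mul_le_Lp (μ := Measure.count) hb (measurable_from_top (f := f))
    (measurable_from_top (f := g))
  simpa [lintegral_count] using this

theorem tsum_lintegral_mul_le {a a' b b' : ℝ} (ha : a.HolderConjugate a')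
    (hb : b.HolderConjugate b') {G V : ℕ → Rn n → ℝ≥0∞} (hG : ∀ j, Measurable (G j))
    (hV : ∀ j, Measurable (V j)) :
    ∑' j, ∫⁻ x, G j x * V j x ≤ mixedNorm a b G * mixedNorm a' b' V := by
  rw [← lintegral_tsum_mul hG hV]
  refine (lintegral_mono fun x => tsum_mul_le_Lp hb (fun j => G j x) fun j => V j x).trans ?_
  refine (lintegral_mul_le_Lp ha ((Measurable.tsum fun j => (hG j).pow_const _).pow_const _)
    ((Measurable.tsum fun j => (hV j).pow_const _).pow_const _)).trans (le_of_eq ?_)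
  unfold mixedNorm
  simp_rw [← ENNReal.rpow_mul]
  congr 4
  · ext x; congr 1; ring
  · ext x; congr 1; ring

/-- The vector-valued inequality for the averages `η_j * G_j` in `L_a(ℓ_b)`, `1 < a, b < ∞`. -/
theorem exists_mixedNorm_etaConv_le {a b : ℝ} (ha : 1 < a) (hb : 1 < b) :
    ∃ C : ℝ≥0∞, C ≠ ∞ ∧ ∀ G : ℕ → Rn n → ℝ≥0∞, (∀ j, Measurable (G j)) →
      mixedNorm a b (fun j => etaConv j (G j)) ≤ C * mixedNorm a b G := by
  rcases le_total b a with hab | hab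
  · exact exists_mixedNorm_etaConv_le_of_le hb.le hab
  -- The remaining case a ≤ b is dual to the one just treated: the conjugate exponents satisfy b' ≤
  -- a', and η_j is self-adjoint.
  have ha' := Real.HolderConjugate.conjExponent ha
  have hb' := Real.HolderConjugate.conjExponent hb
  set a' := Real.conjExponent a
  set b' := Real.conjExponent b
  have hab' : b' ≤ a' := by
    have h1 := ha'.inv_add_inv_eq_one
    have h2 := hb'.inv_add_inv_eq_one
    have h3 : b⁻¹ ≤ a⁻¹ := inv_anti₀ (by linarith) hab
    exact (inv_le_inv₀ ha'.symm.pos hb'.symm.pos).1 (by linarith)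
  obtain ⟨C, hC, h⟩ := exists_mixedNorm_etaConv_le_of_le (n := n) hb'.symm.lt.le hab'
  refine ⟨C, hC, fun G hG => ?_⟩
  refine mixedNorm_le_of_dual ha' hb' (fun j => measurable_etaConv j (hG j)) fun V hV => ?_
  simp_rw [lintegral_mul_etaConv _ (hG _) (hV _)]
  calc _ ≤ mixedNorm a b G * mixedNorm a' b' fun j => etaConv j (V j) :=
        tsum_lintegral_mul_le ha' hb' hG fun j => measurable_etaConv j (hV j)
    _ ≤ mixedNorm a b G * (C * mixedNorm a' b' V) := by gcongr; exact h V hV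
    _ = _ := by ring

variable {n : ℕ}

/-! ### Mapping properties of the averages in `ℓ_q(L_p)` and `L_p(ℓ_q)` -/

theorem eLpNorm_etaConv_le (j : ℕ) {G : Rn n → ℝ≥0∞} (hG : Measurable G) {a : ℝ≥0∞} (ha : 1 ≤ a) :
    eLpNorm (etaConv j G) a volume ≤ etaMass n * eLpNorm G a volume := by
  rcases eq_or_ne a ∞ with rfl | hat
  · simp only [eLpNorm_exponent_top]
    refine essSup_le_of_ae_le _ (Filter.Eventually.of_forall fun x => ?_)
    simp only [enorm_eq_self]
    calc etaConv j G x ≤ ∫⁻ y, eta j (x - y) * eLpNormEssSup G volume := by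
          refine lintegral_mono_ae ?_
          filter_upwards [enorm_ae_le_eLpNormEssSup G volume] with y hy
          gcongr
          simpa using hy
      _ = _ := by
          have hm : Measurable fun y : Rn n => eta j (x - y) :=
            (measurable_eta j).comp (measurable_const.sub measurable_id)
          rw [lintegral_mul_const _ hm, lintegral_eta_sub]
  · have ha0 : a ≠ 0 := (zero_lt_one.trans_le ha).ne'
    have ha1 : 1 ≤ a.toReal := by
      rw [← ENNReal.toReal_one]; exact ENNReal.toReal_mono hat ha
    have hm : etaMass n ^ (a.toReal - 1) ≠ ∞ :=
      ENNReal.rpow_ne_top_of_nonneg (by linarith) etaMass_ne_top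
    rw [eLpNorm_ennreal_eq ha0 hat, eLpNorm_ennreal_eq ha0 hat]
    have h : ∫⁻ x, etaConv j G x ^ a.toReal ≤ etaMass n ^ a.toReal * ∫⁻ x, G x ^ a.toReal := by
      calc _ ≤ ∫⁻ x, etaMass n ^ (a.toReal - 1) * etaConv j (fun y => G y ^ a.toReal) x :=
            lintegral_mono fun x => etaConv_rpow_le j hG ha1 x
        _ = etaMass n ^ (a.toReal - 1) * ∫⁻ x, etaConv j (fun y => G y ^ a.toReal) x * 1 := by
            rw [lintegral_const_mul' _ _ hm]; simp
        _ = etaMass n ^ (a.toReal - 1) * (etaMass n * ∫⁻ x, G x ^ a.toReal) := by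
            have := lintegral_mul_etaConv j (hG.pow_const a.toReal) (H := fun _ => 1) measurable_const
            rw [this]
            simp only [etaConv, mul_one, lintegral_eta_sub]
            rw [lintegral_mul_const' _ _ etaMass_ne_top, mul_comm (etaMass n)]
        _ = _ := by
            rw [← mul_assoc]
            congr 1
            have h := ENNReal.rpow_add_of_nonneg (x := etaMass n) (a.toReal - 1) 1 (by linarith)
              zero_le_one
            rw [ENNReal.rpow_one] at h
            rw [← h]
            congr 1
            ring
    refine (ENNReal.rpow_le_rpow h (by positivity)).trans (le_of_eq ?_)
    rw [ENNReal.mul_rpow_of_nonneg _ _ (by positivity), ← ENNReal.rpow_mul,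
      mul_one_div_cancel (by linarith), ENNReal.rpow_one]

theorem eLpNorm_lqNorm_eq_mixedNorm {a b : ℝ≥0∞} (ha0 : a ≠ 0) (hat : a ≠ ∞) (hbt : b ≠ ∞)
    (G : ℕ → Rn n → ℝ≥0∞) :
    eLpNorm (fun x => lqNorm b fun j => G j x) a volume = mixedNorm a.toReal b.toReal G := by
  rw [eLpNorm_ennreal_eq ha0 hat, mixedNorm]
  congr 2
  ext x
  rw [lqNorm, if_neg hbt, ← ENNReal.rpow_mul]
  congr 1
  ring

/-- The new case is b = ∞, where sup_j η_j * G_j is dominated by the maximal function of sup_j G_j.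
-/
theorem exists_eLpNorm_lqNorm_etaConv_le {a b : ℝ≥0∞} (ha : 1 < a) (hat : a ≠ ∞) (hb : 1 < b) :
    ∃ C : ℝ≥0∞, C ≠ ∞ ∧ ∀ G : ℕ → Rn n → ℝ≥0∞, (∀ j, Measurable (G j)) →
      eLpNorm (fun x => lqNorm b fun j => etaConv j (G j) x) a volume ≤
        C * eLpNorm (fun x => lqNorm b fun j => G j x) a volume := by
  have ha0 : a ≠ 0 := (zero_lt_one.trans ha).ne'
  have ha1 : 1 < a.toReal := by
    rw [← ENNReal.toReal_one]; exact (ENNReal.toReal_lt_toReal (by simp) hat).2 ha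
  rcases eq_or_ne b ∞ with rfl | hbt
  · obtain ⟨C1, hC1, h1⟩ := etaConv_le_maximalFn (n := n)
    obtain ⟨C2, hC2, h2⟩ := maximalFn_strong_type (n := n) ha1
    refine ⟨C1 * C2 ^ (1 / a.toReal), ENNReal.mul_ne_top hC1
      (ENNReal.rpow_ne_top_of_nonneg (by positivity) hC2), fun G hG => ?_⟩
    simp only [lqNorm, if_true]
    have hm : Measurable fun x => ⨆ j, G j x := .iSup hG
    calc _ ≤ eLpNorm (fun x => C1 * maximalFn (fun x => ⨆ j, G j x) x) a volume := by
          refine eLpNorm_ennreal_mono fun x => iSup_le fun j => ?_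
          exact (etaConv_mono j (fun y => le_iSup (fun j => G j y) j) x).trans (h1 j _ hm x)
      _ ≤ C1 * eLpNorm (maximalFn fun x => ⨆ j, G j x) a volume := eLpNorm_ennreal_const_mul _ hC1
      _ ≤ _ := by
          rw [mul_assoc]
          gcongr
          rw [eLpNorm_ennreal_eq ha0 hat, eLpNorm_ennreal_eq ha0 hat,
            ← ENNReal.mul_rpow_of_nonneg _ _ (by positivity)]
          exact ENNReal.rpow_le_rpow (h2 _ hm) (by positivity)
  · have hb1 : 1 < b.toReal := by
      rw [← ENNReal.toReal_one]; exact (ENNReal.toReal_lt_toReal (by simp) hbt).2 hb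
    obtain ⟨C, hC, h⟩ := exists_mixedNorm_etaConv_le (n := n) ha1 hb1
    refine ⟨C, hC, fun G hG => ?_⟩
    rw [eLpNorm_lqNorm_eq_mixedNorm ha0 hat hbt, eLpNorm_lqNorm_eq_mixedNorm ha0 hat hbt]
    exact h G hG

/-- The average `(η_j * G^r)^{1/r}`. -/
def avg (r : ℝ) (j : ℕ) (G : Rn n → ℝ≥0∞) (x : Rn n) : ℝ≥0∞ :=
  etaConv j (fun y => G y ^ r) x ^ (1 / r)

theorem avg_rpow {r : ℝ} (hr : 0 < r) (j : ℕ) (G : Rn n → ℝ≥0∞) (x : Rn n) :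
    avg r j G x ^ r = etaConv j (fun y => G y ^ r) x := by
  rw [avg, ← ENNReal.rpow_mul, one_div_mul_cancel hr.ne', ENNReal.rpow_one]

theorem measurable_avg (r : ℝ) (j : ℕ) {G : Rn n → ℝ≥0∞} (hG : Measurable G) :
    Measurable (avg r j G) :=
  (measurable_etaConv j (hG.pow_const r)).pow_const _

theorem le_rpow_mul_of_rpow_le {x y C : ℝ≥0∞} {r : ℝ} (hr : 0 < r) (h : x ^ r ≤ C * y ^ r) :
    x ≤ C ^ (1 / r) * y := by
  have := ENNReal.rpow_le_rpow h (one_div_nonneg.2 hr.le)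
  rwa [ENNReal.mul_rpow_of_nonneg _ _ (by positivity), ← ENNReal.rpow_mul, ← ENNReal.rpow_mul,
    mul_one_div_cancel hr.ne', ENNReal.rpow_one, ENNReal.rpow_one] at this

theorem eLpNorm_avg_le {r : ℝ} (hr : 0 < r) {p : ℝ≥0∞} (hrp : ENNReal.ofReal r ≤ p) (j : ℕ)
    {G : Rn n → ℝ≥0∞} (hG : Measurable G) :
    eLpNorm (avg r j G) p volume ≤ etaMass n ^ (1 / r) * eLpNorm G p volume := by
  refine le_rpow_mul_of_rpow_le hr ?_
  simp_rw [← eLpNorm_ennreal_rpow _ hr, avg_rpow hr]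
  refine eLpNorm_etaConv_le j (hG.pow_const r) ?_
  rw [ENNReal.le_div_iff_mul_le (by simp [hr]) (by simp)]
  simpa using hrp

/-- Raising to the power r replaces p and q by p/r and q/r. Both exceed 1 precisely because r is
strictly smaller than p and q. -/
theorem exists_eLpNorm_lqNorm_avg_le {r : ℝ} (hr : 0 < r) {p q : ℝ≥0∞} (hpt : p ≠ ∞)
    (hrp : ENNReal.ofReal r < p) (hrq : ENNReal.ofReal r < q) :
    ∃ C : ℝ≥0∞, C ≠ ∞ ∧ ∀ G : ℕ → Rn n → ℝ≥0∞, (∀ j, Measurable (G j)) →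
      eLpNorm (fun x => lqNorm q fun j => avg r j (G j) x) p volume ≤
        C * eLpNorm (fun x => lqNorm q fun j => G j x) p volume := by
  have hr' : ENNReal.ofReal r ≠ 0 := by simp [hr]
  have one_lt : ∀ {p}, ENNReal.ofReal r < p → 1 < p / ENNReal.ofReal r := fun h => by
    rw [ENNReal.lt_div_iff_mul_lt (Or.inl hr') (Or.inl (by simp))]
    simpa using h
  obtain ⟨C, hC, h⟩ := exists_eLpNorm_lqNorm_etaConv_le (n := n) (one_lt hrp)
    (ENNReal.div_ne_top hpt hr') (one_lt hrq)
  refine ⟨C ^ (1 / r), ENNReal.rpow_ne_top_of_nonneg (by positivity) hC, fun G hG => ?_⟩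
  have hq : q ≠ 0 := (zero_le.trans_lt hrq).ne'
  refine le_rpow_mul_of_rpow_le hr ?_
  simp_rw [← eLpNorm_ennreal_rpow _ hr, ← lqNorm_rpow hq _ hr, avg_rpow hr]
  exact h _ fun j => (hG j).pow_const r

/-! ### Step functions attached to sequences -/

/-- The index `m` of a dyadic cube `Q_{ν,m}` containing `x`. -/
def cubeIndex (ν : ℕ) (x : Rn n) (i : Fin n) : ℤ := round ((2 : ℝ) ^ ν * x i)

theorem mem_cube_iff {d : ℝ} {ν : ℕ} {m : Fin n → ℤ} {x : Rn n} :
    x ∈ cube d ν m ↔ ∀ i, |(2 : ℝ) ^ ν * x i - m i| ≤ d / 2 := by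
  have h2 : (0 : ℝ) < 2 ^ ν := by positivity
  refine forall_congr' fun i => ?_
  have e : (2 : ℝ) ^ ν * x i - m i = 2 ^ ν * (x i - (2 : ℝ) ^ (-(ν : ℤ)) * m i) := by
    rw [zpow_neg, zpow_natCast]; field_simp
  rw [e, abs_mul, abs_of_pos h2, zpow_sub₀ (by norm_num), zpow_neg, zpow_natCast, zpow_one]
  rw [← le_div_iff₀' h2]
  have : d * (((2 : ℝ) ^ ν)⁻¹ / 2) = d / 2 / 2 ^ ν := by field_simp
  rw [this]

theorem mem_cube_cubeIndex (ν : ℕ) (x : Rn n) : x ∈ cube 1 ν (cubeIndex ν x) := by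
  rw [mem_cube_iff]
  exact fun i => abs_sub_round _

theorem measurable_cubeIndex (ν : ℕ) : Measurable (cubeIndex ν : Rn n → Fin n → ℤ) := by
  refine measurable_pi_lambda _ fun i => ?_
  unfold cubeIndex
  have h : Measurable fun x : Rn n => (2 : ℝ) ^ ν * x i :=
    (measurable_const.mul (by fun_prop))
  have hr : Measurable (round : ℝ → ℤ) := by
    have : (round : ℝ → ℤ) = fun x => ⌊x + 1 / 2⌋ := by ext x; exact round_eq x
    rw [this]
    exact Int.measurable_floor.comp (measurable_id.add_const _)
  exact hr.comp h

/-- Bounded overlap: each coordinate of m is confined to a closed interval of length d, which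
contains at most ⌊d⌋+1 integers. -/
theorem card_cube_le {d : ℝ} (hd : 0 ≤ d) (ν : ℕ) (x : Rn n) :
    ∑' m : Fin n → ℤ, (cube d ν m).indicator (1 : Rn n → ℝ≥0∞) x ≤ ((⌊d⌋₊ + 1 : ℕ) : ℝ≥0∞) ^ n := by
  let s : Finset (Fin n → ℤ) := Fintype.piFinset fun i =>
    Finset.Icc ⌈(2 : ℝ) ^ ν * x i - d / 2⌉ ⌊(2 : ℝ) ^ ν * x i + d / 2⌋
  have hs : ∀ m ∉ s, (cube d ν m).indicator (1 : Rn n → ℝ≥0∞) x = 0 := by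
    intro m hm
    refine Set.indicator_of_notMem (fun hx => hm ?_) _
    rw [mem_cube_iff] at hx
    refine Fintype.mem_piFinset.2 fun i => Finset.mem_Icc.2 ?_
    have := abs_le.1 (hx i)
    exact ⟨Int.ceil_le.2 (by linarith), Int.le_floor.2 (by linarith)⟩
  rw [tsum_eq_sum hs]
  calc ∑ m ∈ s, (cube d ν m).indicator (1 : Rn n → ℝ≥0∞) x ≤ ∑ m ∈ s, (1 : ℝ≥0∞) :=
        Finset.sum_le_sum fun m _ => Set.indicator_le_self _ _ _
    _ = (s.card : ℝ≥0∞) := by simp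
    _ ≤ (((⌊d⌋₊ + 1) ^ n : ℕ) : ℝ≥0∞) := by
        gcongr
        rw [Fintype.card_piFinset]
        refine (Finset.prod_le_pow_card _ _ (⌊d⌋₊ + 1) fun i _ => ?_).trans (by simp)
        rw [Int.card_Icc, Int.toNat_le]
        have h1 : (⌊(2 : ℝ) ^ ν * x i + d / 2⌋ : ℝ) ≤ (2 : ℝ) ^ ν * x i + d / 2 := Int.floor_le _
        have h2 : (2 : ℝ) ^ ν * x i - d / 2 ≤ ⌈(2 : ℝ) ^ ν * x i - d / 2⌉ := Int.le_ceil _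
        have h3 : ⌊(2 : ℝ) ^ ν * x i + d / 2⌋ - ⌈(2 : ℝ) ^ ν * x i - d / 2⌉ ≤ ⌊d⌋ := by
          rw [Int.le_floor]; push_cast; linarith
        have h4 : ((⌊d⌋₊ : ℕ) : ℤ) = ⌊d⌋ := Int.natCast_floor_eq_floor hd
        push_cast
        rw [h4]
        linarith
    _ = _ := by push_cast; rfl

/-- The normalising factor `2^{νn/p}`. -/
def amplitude (n : ℕ) (p : ℝ≥0∞) (ν : ℕ) : ℝ≥0∞ :=
  ENNReal.ofReal ((2 : ℝ) ^ ((ν : ℝ) * (n * (p⁻¹).toReal)))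

/-- The step function `∑_m |l_{ν,m}| χ^{(p)}_{ν,m}`, the cubes being made disjoint. -/
def step (p : ℝ≥0∞) (l : ℕ → (Fin n → ℤ) → ℂ) (ν : ℕ) (x : Rn n) : ℝ≥0∞ :=
  ‖l ν (cubeIndex ν x)‖ₑ * amplitude n p ν

theorem measurable_step (p : ℝ≥0∞) (l : ℕ → (Fin n → ℤ) → ℂ) (ν : ℕ) :
    Measurable (step p l ν) :=
  ((Measurable.of_discrete (f := fun m => ‖l ν m‖ₑ)).comp (measurable_cubeIndex ν)).mul_const _

theorem volume_cubeIndex_preimage (ν : ℕ) (m : Fin n → ℤ) :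
    volume (cubeIndex ν ⁻¹' {m}) = ENNReal.ofReal (((2 : ℝ) ^ ν) ^ n)⁻¹ := by
  have h2 : (0 : ℝ) < 2 ^ ν := by positivity
  have e : (cubeIndex ν ⁻¹' {m} : Set (Rn n)) =
      (MeasurableEquiv.toLp 2 (Fin n → ℝ)).symm ⁻¹' (Set.univ.pi fun i =>
        Set.Ico (((m i : ℝ) - 1 / 2) / 2 ^ ν) (((m i : ℝ) + 1 / 2) / 2 ^ ν)) := by
    ext x
    simp only [Set.mem_preimage, Set.mem_singleton_iff, Set.mem_univ_pi, Set.mem_Ico, funext_iff]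
    refine forall_congr' fun i => ?_
    rw [cubeIndex, round_eq, Int.floor_eq_iff, div_le_iff₀' h2, lt_div_iff₀' h2]
    change _ ↔ _ ≤ 2 ^ ν * x i ∧ 2 ^ ν * x i < _
    constructor <;> rintro ⟨h, h'⟩ <;> constructor <;> linarith
  rw [e, (EuclideanSpace.volume_preserving_symm_measurableEquiv_toLp (Fin n)).measure_preimage
    (MeasurableSet.univ_pi fun i => measurableSet_Ico).nullMeasurableSet, Real.volume_pi_Ico]
  have : ∀ i, ((m i : ℝ) + 1 / 2) / 2 ^ ν - ((m i : ℝ) - 1 / 2) / 2 ^ ν = (2 ^ ν)⁻¹ := fun i => by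
    field_simp; ring
  simp only [this, Finset.prod_const, Finset.card_univ, Fintype.card_fin]
  rw [← ENNReal.ofReal_pow (by positivity), inv_pow]

/-- The cells have volume 2^{-νn}, which the factor 2^{νn/p} compensates exactly. For p = ∞ one only
needs that no cell is a null set. -/
theorem eLpNorm_step {p : ℝ≥0∞} (hp : p ≠ 0) (l : ℕ → (Fin n → ℤ) → ℂ) (ν : ℕ) :
    eLpNorm (step p l ν) p volume = lqNorm p fun m => ‖l ν m‖ₑ := by
  have hvol : ∀ m : Fin n → ℤ, volume (cubeIndex ν ⁻¹' {m} : Set (Rn n)) ≠ 0 := fun m => by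
    rw [volume_cubeIndex_preimage]; simp
  rcases eq_or_ne p ∞ with rfl | hpt
  · simp only [eLpNorm_exponent_top, lqNorm, if_true]
    have e : step ∞ l ν = fun x : Rn n => ‖l ν (cubeIndex ν x)‖ₑ := by
      ext x; simp [step, amplitude]
    rw [e]
    refine le_antisymm (essSup_le_of_ae_le _ (Filter.Eventually.of_forall fun x => ?_))
      (iSup_le fun m => ?_)
    · simpa using le_iSup (fun m => ‖l ν m‖ₑ) (cubeIndex ν x)
    · by_contra! h
      refine hvol m (measure_mono_null ?_ (ae_iff.1 (enorm_ae_le_eLpNormEssSup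
        (fun x : Rn n => ‖l ν (cubeIndex ν x)‖ₑ) volume)))
      intro x hx
      have hx' : cubeIndex ν x = m := hx
      change ¬ _
      rw [hx', not_le]
      simpa using h
  · have hp0 := ENNReal.toReal_pos hp hpt
    rw [eLpNorm_ennreal_eq hp hpt, lqNorm, if_neg hpt]
    congr 1
    have hg : Measurable fun m : Fin n → ℤ => (‖l ν m‖ₑ * amplitude n p ν) ^ p.toReal :=
      Measurable.of_discrete
    change ∫⁻ x : Rn n, (fun m : Fin n → ℤ => (‖l ν m‖ₑ * amplitude n p ν) ^ p.toReal)
      (cubeIndex ν x) = _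
    rw [← lintegral_map hg (measurable_cubeIndex ν), lintegral_countable']
    congr 1
    ext m
    rw [Measure.map_apply (measurable_cubeIndex ν) (measurableSet_singleton m),
      volume_cubeIndex_preimage, ENNReal.mul_rpow_of_nonneg _ _ hp0.le, mul_assoc]
    have : amplitude n p ν ^ p.toReal * ENNReal.ofReal (((2 : ℝ) ^ ν) ^ n)⁻¹ = 1 := by
      rw [amplitude, ENNReal.ofReal_rpow_of_pos (by positivity), ← Real.rpow_mul (by norm_num),
        ← ENNReal.ofReal_mul (by positivity)]
      have : (ν : ℝ) * (n * (p⁻¹).toReal) * p.toReal = ((ν * n : ℕ) : ℝ) := by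
        rw [ENNReal.toReal_inv]
        push_cast
        field_simp
      rw [this, Real.rpow_natCast, pow_mul, mul_inv_cancel₀ (by positivity), ENNReal.ofReal_one]
    rw [this, mul_one]

variable {n : ℕ}

/-! ### The quasi-norms of `ℓ_q(L_p)` and `L_p(ℓ_q)` -/

/-- The properties shared by the quasi-norms of `ℓ_q(L_p)` and `L_p(ℓ_q)` (called `N`) and the
associated sequence space quasi-norms `b_{p,q}` and `f_{p,q}` (called `S`). -/
structure IsFunctionNorm (n : ℕ) (p : ℝ≥0∞) (r : ℝ) (N : (ℕ → Rn n → ℝ≥0∞) → ℝ≥0∞)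
    (S : (ℕ → (Fin n → ℤ) → ℂ) → ℝ≥0∞) : Prop where
  mono : ∀ {G H : ℕ → Rn n → ℝ≥0∞}, (∀ j x, G j x ≤ H j x) → N G ≤ N H
  tsum_le : ∃ t : ℝ, 0 < t ∧ t ≤ 1 ∧ ∀ {ι : Type} [Countable ι] (G : ι → ℕ → Rn n → ℝ≥0∞),
    (∀ i j, Measurable (G i j)) → N (fun j x => ∑' i, G i j x) ^ t ≤ ∑' i, N (G i) ^ t
  const_mul_le : ∀ (G : ℕ → Rn n → ℝ≥0∞) {c : ℝ≥0∞}, c ≠ ∞ → N (fun j x => c * G j x) ≤ c * N G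
  avg_le : ∃ C : ℝ≥0∞, C ≠ ∞ ∧ ∀ G : ℕ → Rn n → ℝ≥0∞, (∀ j, Measurable (G j)) →
    N (fun j => avg r j (G j)) ≤ C * N G
  shift_left_le : ∀ (G : ℕ → Rn n → ℝ≥0∞) (k : ℕ), N (fun j => G (j + k)) ≤ N G
  shift_right_le : ∀ (G : ℕ → Rn n → ℝ≥0∞) (k : ℕ),
    N (fun j => if k ≤ j then G (j - k) else 0) ≤ N G
  eLpNorm_le : ∀ (G : ℕ → Rn n → ℝ≥0∞) (j : ℕ), eLpNorm (G j) p volume ≤ N G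
  step_le : ∀ l, N (step p l) ≤ S l
  le_step : ∃ C : ℝ≥0∞, C ≠ ∞ ∧ ∀ (l : ℕ → (Fin n → ℤ) → ℂ) (H : ℕ → Rn n → ℝ≥0∞),
    (∀ ν m, ∀ x ∈ cube 1 ν m, ‖l ν m‖ₑ * amplitude n p ν ≤ H ν x) → S l ≤ C * N H

/-- The quasi-norm of `ℓ_q(L_p)`. -/
def lqLpNorm (p q : ℝ≥0∞) (G : ℕ → Rn n → ℝ≥0∞) : ℝ≥0∞ :=
  lqNorm q fun j => eLpNorm (G j) p volume

/-- The quasi-norm of `L_p(ℓ_q)`. -/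
def lpLqNorm (p q : ℝ≥0∞) (G : ℕ → Rn n → ℝ≥0∞) : ℝ≥0∞ :=
  eLpNorm (fun x => lqNorm q fun j => G j x) p volume

theorem lqNorm_shift_right {q : ℝ≥0∞} (hq : q ≠ 0) (a : ℕ → ℝ≥0∞) (k : ℕ) :
    lqNorm q (fun j => if k ≤ j then a (j - k) else 0) ≤ lqNorm q a := by
  unfold lqNorm
  split_ifs with h
  · refine iSup_le fun j => ?_
    dsimp only
    split_ifs
    · exact le_iSup a (j - k)
    · exact zero_le
  · have hq0 := ENNReal.toReal_pos hq h
    refine ENNReal.rpow_le_rpow ?_ (by positivity)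
    rw [← (add_left_injective k).tsum_eq]
    · simp
    · intro j hj
      by_cases hk : k ≤ j
      · exact ⟨j - k, Nat.sub_add_cancel hk⟩
      · simp [hk, hq0] at hj

theorem exists_triangle_exponent {p q : ℝ≥0∞} (hp : p ≠ 0) (hq : q ≠ 0) :
    ∃ t : ℝ, 0 < t ∧ t ≤ 1 ∧ ENNReal.ofReal t ≤ p ∧ ENNReal.ofReal t ≤ q := by
  have h1 : min 1 (min p q) ≠ ∞ := ne_top_of_le_ne_top (by simp) (min_le_left _ _)
  have h0 : min 1 (min p q) ≠ 0 := by
    exact (lt_min one_pos (lt_min (pos_iff_ne_zero.2 hp) (pos_iff_ne_zero.2 hq))).ne'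
  refine ⟨(min 1 (min p q)).toReal, ENNReal.toReal_pos h0 h1, ?_, ?_, ?_⟩
  · rw [← ENNReal.toReal_one]
    exact ENNReal.toReal_mono (by simp) (min_le_left _ _)
  · rw [ENNReal.ofReal_toReal h1]
    exact (min_le_right _ _).trans (min_le_left _ _)
  · rw [ENNReal.ofReal_toReal h1]
    exact (min_le_right _ _).trans (min_le_right _ _)

theorem eLpNorm_shift_right_eq (p : ℝ≥0∞) (G : ℕ → Rn n → ℝ≥0∞) (k j : ℕ) :
    eLpNorm (if k ≤ j then G (j - k) else 0) p volume =
      if k ≤ j then eLpNorm (G (j - k)) p volume else 0 := by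
  split_ifs <;> simp

/-- Here the averages act on each L_p norm separately, so r ≤ p is enough and no relation between r
and q enters. -/
theorem isFunctionNorm_lqLpNorm {p q : ℝ≥0∞} (hq : q ≠ 0) {r : ℝ} (hr : 0 < r)
    (hrp : ENNReal.ofReal r ≤ p) : IsFunctionNorm n p r (lqLpNorm p q) (bNorm p q) where
  mono h := lqNorm_mono fun j => eLpNorm_ennreal_mono (h j)
  tsum_le := by
    have hp : p ≠ 0 := ((ENNReal.ofReal_pos.2 hr).trans_le hrp).ne'
    obtain ⟨t, ht, ht1, htp, htq⟩ := exists_triangle_exponent hp hq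
    refine ⟨t, ht, ht1, fun G hG => ?_⟩
    simp only [lqLpNorm]
    simp_rw [← lqNorm_rpow hq _ ht]
    have hq' : ENNReal.ofReal 1 ≤ q / ENNReal.ofReal t := by
      rw [ENNReal.le_div_iff_mul_le (by simp [ht]) (by simp)]
      simpa using htq
    have := lqNorm_tsum_rpow_le (f := fun i j => eLpNorm (G i j) p volume ^ t) one_pos le_rfl hq'
    simp only [ENNReal.rpow_one] at this
    exact (lqNorm_mono fun j => eLpNorm_tsum_rpow_le (fun i => hG i j) ht ht1 htp).trans this
  const_mul_le G c hc := by
    refine (lqNorm_mono fun j => eLpNorm_ennreal_const_mul (G j) hc).trans ?_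
    rw [lqNorm_const_mul hq]
    rfl
  avg_le := by
    refine ⟨etaMass n ^ (1 / r), ENNReal.rpow_ne_top_of_nonneg (by positivity) etaMass_ne_top,
      fun G hG => ?_⟩
    refine (lqNorm_mono fun j => eLpNorm_avg_le hr hrp j (hG j)).trans ?_
    rw [lqNorm_const_mul hq]
    rfl
  shift_left_le G k := lqNorm_comp_le (fun j => eLpNorm (G j) p volume) (add_left_injective k)
  shift_right_le G k := by
    simp only [lqLpNorm, eLpNorm_shift_right_eq]
    exact lqNorm_shift_right hq (fun j => eLpNorm (G j) p volume) k
  eLpNorm_le G j := le_lqNorm hq (fun j => eLpNorm (G j) p volume) j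
  step_le l := by
    have hp : p ≠ 0 := ((ENNReal.ofReal_pos.2 hr).trans_le hrp).ne'
    simp only [lqLpNorm, eLpNorm_step hp]
    exact le_rfl
  le_step := by
    have hp : p ≠ 0 := ((ENNReal.ofReal_pos.2 hr).trans_le hrp).ne'
    refine ⟨1, by simp, fun l H h => ?_⟩
    rw [one_mul]
    refine lqNorm_mono fun ν => ?_
    rw [← eLpNorm_step hp]
    exact eLpNorm_ennreal_mono fun x => h ν _ x (mem_cube_cubeIndex ν x)

theorem chiNormalized_eq (p : ℝ≥0∞) (ν : ℕ) (m : Fin n → ℤ) (x : Rn n) :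
    chiNormalized p ν m x = (cube 1 ν m).indicator 1 x * amplitude n p ν := by
  by_cases h : x ∈ cube 1 ν m <;> simp [chiNormalized, amplitude, h]

theorem isFunctionNorm_lpLqNorm {p q : ℝ≥0∞} (hpt : p ≠ ∞) {r : ℝ} (hr : 0 < r)
    (hrp : ENNReal.ofReal r < p) (hrq : ENNReal.ofReal r < q) :
    IsFunctionNorm n p r (lpLqNorm p q) (fNorm p q) where
  mono h := eLpNorm_ennreal_mono fun x => lqNorm_mono fun j => h j x
  tsum_le := by
    have hp : p ≠ 0 := (zero_le.trans_lt hrp).ne'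
    have hq : q ≠ 0 := (zero_le.trans_lt hrq).ne'
    obtain ⟨t, ht, ht1, htp, htq⟩ := exists_triangle_exponent hp hq
    refine ⟨t, ht, ht1, fun G hG => ?_⟩
    simp only [lpLqNorm]
    simp_rw [← eLpNorm_ennreal_rpow _ ht]
    refine (eLpNorm_ennreal_mono fun x => lqNorm_tsum_rpow_le
      (f := fun i j => G i j x) ht ht1 htq).trans ?_
    refine eLpNorm_tsum_le (fun i => (measurable_lqNorm (hG i)).pow_const _) ?_
    rw [ENNReal.le_div_iff_mul_le (by simp [ht]) (by simp)]
    simpa using htp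
  const_mul_le G c hc := by
    have hq : q ≠ 0 := (zero_le.trans_lt hrq).ne'
    simp only [lpLqNorm, lqNorm_const_mul hq]
    exact eLpNorm_ennreal_const_mul _ hc
  avg_le := exists_eLpNorm_lqNorm_avg_le hr hpt hrp hrq
  shift_left_le G k := eLpNorm_ennreal_mono fun x =>
    lqNorm_comp_le (fun j => G j x) (add_left_injective k)
  shift_right_le G k := by
    have hq : q ≠ 0 := (zero_le.trans_lt hrq).ne'
    refine eLpNorm_ennreal_mono fun x => le_trans (lqNorm_mono fun j => ?_)
      (lqNorm_shift_right hq (fun j => G j x) k)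
    by_cases h : k ≤ j <;> simp [h]
  eLpNorm_le G j := eLpNorm_ennreal_mono fun x =>
    le_lqNorm (zero_le.trans_lt hrq).ne' (fun j => G j x) j
  step_le l := by
    refine eLpNorm_ennreal_mono fun x => ?_
    -- The step functions select one cube per generation from all the closed cubes containing x.
    have hinj : Function.Injective fun ν : ℕ => (ν, cubeIndex ν x) := fun a b h =>
      congrArg Prod.fst h
    refine le_trans (le_of_eq ?_) (lqNorm_comp_le (fun i : ℕ × (Fin n → ℤ) =>
      ‖l i.1 i.2‖ₑ * chiNormalized p i.1 i.2 x) hinj)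
    congr 1
    ext ν
    simp [step, chiNormalized_eq, mem_cube_cubeIndex]
  le_step := by
    have hq : q ≠ 0 := (zero_le.trans_lt hrq).ne'
    -- Closed cubes of one generation share faces, so a point may be counted up to 2^n times.
    set C : ℝ≥0∞ := ((⌊(1 : ℝ)⌋₊ + 1 : ℕ) : ℝ≥0∞) ^ n
    have hC : C ≠ ∞ := ENNReal.pow_ne_top (by simp)
    have hC1 : 1 ≤ C := one_le_pow₀ (by simp)
    refine ⟨C ^ (1 / q.toReal), ENNReal.rpow_ne_top_of_nonneg (by positivity) hC, fun l H h => ?_⟩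
    have pt : ∀ x (i : ℕ × (Fin n → ℤ)), ‖l i.1 i.2‖ₑ * chiNormalized p i.1 i.2 x ≤
        (cube 1 i.1 i.2).indicator 1 x * H i.1 x := by
      intro x i
      rw [chiNormalized_eq]
      by_cases hx : x ∈ cube 1 i.1 i.2
      · simpa [hx] using h i.1 i.2 x hx
      · simp [hx]
    refine le_trans (eLpNorm_ennreal_mono fun x => ?_)
      (eLpNorm_ennreal_const_mul _ (ENNReal.rpow_ne_top_of_nonneg (by positivity) hC))
    refine (lqNorm_mono (pt x)).trans ?_
    unfold lqNorm
    split_ifs with hqt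
    · refine iSup_le fun i => ?_
      subst hqt
      simp only [ENNReal.toReal_top, div_zero, ENNReal.rpow_zero, one_mul]
      refine le_trans ?_ (le_iSup (fun j => H j x) i.1)
      by_cases hx : x ∈ cube 1 i.1 i.2 <;> simp [hx]
    · have hq0 := ENNReal.toReal_pos hq hqt
      rw [← ENNReal.mul_rpow_of_nonneg _ _ (by positivity), ← ENNReal.tsum_mul_left]
      gcongr
      rw [ENNReal.tsum_prod']
      refine ENNReal.tsum_le_tsum fun ν => ?_
      calc _ = ∑' m : Fin n → ℤ, (cube 1 ν m).indicator (1 : Rn n → ℝ≥0∞) x * H ν x ^ q.toReal := by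
            congr 1
            ext m
            by_cases hx : x ∈ cube 1 ν m <;> simp [hx, hq0]
        _ ≤ _ := by
            rw [ENNReal.tsum_mul_right]
            gcongr
            exact card_cube_le zero_le_one ν x

open scoped LineDeriv

variable {n : ℕ}

/-! ### Seminorm estimates on the Schwartz space -/

/-- The increasing family of Schwartz seminorms. -/
def schwartzNorm (k : ℕ) : Seminorm ℂ 𝓢(Rn n, ℂ) :=
  (Finset.Iic (k, k)).sup fun m => SchwartzMap.seminorm ℂ m.1 m.2

theorem seminorm_le_schwartzNorm {a b k : ℕ} (ha : a ≤ k) (hb : b ≤ k) (φ : 𝓢(Rn n, ℂ)) :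
    SchwartzMap.seminorm ℂ a b φ ≤ schwartzNorm k φ := by
  apply Seminorm.le_def.1
  exact Finset.le_sup (f := fun m : ℕ × ℕ => SchwartzMap.seminorm ℂ m.1 m.2 (E := Rn n) (F := ℂ))
    (b := (a, b)) (Finset.mem_Iic.2 (Prod.mk_le_mk.2 ⟨ha, hb⟩))

theorem schwartzNorm_mono {k k' : ℕ} (h : k ≤ k') (φ : 𝓢(Rn n, ℂ)) :
    schwartzNorm k φ ≤ schwartzNorm k' φ := by
  apply Seminorm.le_def.1
  refine Finset.sup_le fun m hm => ?_
  obtain ⟨h1, h2⟩ := Prod.mk_le_mk.1 (Finset.mem_Iic.1 hm)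
  exact fun φ => seminorm_le_schwartzNorm (h1.trans h) (h2.trans h) φ

theorem schwartzNorm_le {k : ℕ} {φ : 𝓢(Rn n, ℂ)} {C : ℝ} (hC : 0 ≤ C)
    (h : ∀ a ≤ k, ∀ b ≤ k, SchwartzMap.seminorm ℂ a b φ ≤ C) : schwartzNorm k φ ≤ C := by
  refine Seminorm.finset_sup_apply_le hC fun m hm => ?_
  obtain ⟨h1, h2⟩ := Prod.mk_le_mk.1 (Finset.mem_Iic.1 hm)
  exact h _ h1 _ h2

theorem continuous_schwartzNorm (k : ℕ) : Continuous (schwartzNorm k : 𝓢(Rn n, ℂ) → ℝ) := by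
  refine Seminorm.continuous_finsetSup fun m _ => ?_
  exact (schwartz_withSeminorms ℂ (Rn n) ℂ).continuous_seminorm m

theorem one_add_pow_mul_le (k l : ℕ) (φ : 𝓢(Rn n, ℂ)) (x : Rn n) :
    (1 + ‖x‖) ^ k * ‖iteratedFDeriv ℝ l φ x‖ ≤ 2 ^ (max k l) * schwartzNorm (max k l) φ :=
  one_add_le_sup_seminorm_apply (𝕜 := ℂ) (m := (max k l, max k l)) (le_max_left _ _)
    (le_max_right _ _) φ x

theorem Seminorm.le_schwartzNorm {q : Seminorm ℂ 𝓢(Rn n, ℂ)} (hq : Continuous q) :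
    ∃ (k : ℕ) (C : ℝ), 0 ≤ C ∧ ∀ φ, q φ ≤ C * schwartzNorm k φ := by
  obtain ⟨s, C, _, h⟩ := Seminorm.bound_of_continuous (schwartz_withSeminorms ℂ (Rn n) ℂ) q hq
  refine ⟨s.sup fun m => max m.1 m.2, C, C.2, fun φ => ?_⟩
  refine (h φ).trans ?_
  change (C : ℝ) * _ ≤ _
  gcongr
  refine Seminorm.finset_sup_apply_le (apply_nonneg _ _) fun m hm => ?_
  have := Finset.le_sup (f := fun m : ℕ × ℕ => max m.1 m.2) hm
  exact seminorm_le_schwartzNorm ((le_max_left _ _).trans this) ((le_max_right _ _).trans this) φ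

section

variable {E : Type*} [NormedAddCommGroup E] [NormedSpace ℂ E]

theorem exists_norm_le_schwartzNorm (f : 𝓢(Rn n, ℂ) →L[ℂ] E) :
    ∃ (k : ℕ) (C : ℝ), 0 ≤ C ∧ ∀ φ, ‖f φ‖ ≤ C * schwartzNorm k φ :=
  Seminorm.le_schwartzNorm (q := (normSeminorm ℂ E).comp f.toLinearMap)
    (continuous_norm.comp f.continuous)

theorem exists_schwartzNorm_le (T : 𝓢(Rn n, ℂ) →L[ℂ] 𝓢(Rn n, ℂ)) (l : ℕ) :
    ∃ (k : ℕ) (C : ℝ), 0 ≤ C ∧ ∀ φ, schwartzNorm l (T φ) ≤ C * schwartzNorm k φ :=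
  Seminorm.le_schwartzNorm (q := (schwartzNorm l).comp T.toLinearMap)
    ((continuous_schwartzNorm l).comp T.continuous)

end

theorem iteratedFDeriv_compSubConstCLM (ψ : 𝓢(Rn n, ℂ)) (x y : Rn n) (l : ℕ) :
    iteratedFDeriv ℝ l (compSubConstCLM ℂ x ψ) y = iteratedFDeriv ℝ l ψ (y - x) := by
  have : ⇑(compSubConstCLM ℂ x ψ) = fun z => ψ (z - x) := by ext z; simp
  rw [this, iteratedFDeriv_comp_sub]

theorem schwartzNorm_compSubConstCLM_le (k : ℕ) (ψ : 𝓢(Rn n, ℂ)) (x : Rn n) :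
    schwartzNorm k (compSubConstCLM ℂ x ψ) ≤ 2 ^ k * schwartzNorm k ψ * (1 + ‖x‖) ^ k := by
  have h0 : 0 ≤ schwartzNorm k ψ := apply_nonneg _ _
  refine schwartzNorm_le (by positivity) fun a ha b hb => ?_
  refine SchwartzMap.seminorm_le_bound ℂ a b _ (by positivity) fun y => ?_
  rw [iteratedFDeriv_compSubConstCLM]
  have h1 : ‖y‖ ≤ (1 + ‖y - x‖) * (1 + ‖x‖) := by
    have := norm_add_le (y - x) x
    rw [sub_add_cancel] at this
    nlinarith [norm_nonneg (y - x), norm_nonneg x]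
  calc ‖y‖ ^ a * ‖iteratedFDeriv ℝ b ψ (y - x)‖
      ≤ ((1 + ‖y - x‖) * (1 + ‖x‖)) ^ a * ‖iteratedFDeriv ℝ b ψ (y - x)‖ := by gcongr
    _ = ((1 + ‖y - x‖) ^ a * ‖iteratedFDeriv ℝ b ψ (y - x)‖) * (1 + ‖x‖) ^ a := by rw [mul_pow]; ring
    _ ≤ (2 ^ k * schwartzNorm k ψ) * (1 + ‖x‖) ^ k := by
        have hk : max a b ≤ k := max_le ha hb
        refine mul_le_mul ((one_add_pow_mul_le a b ψ _).trans ?_)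
          (pow_le_pow_right₀ (by linarith [norm_nonneg x]) ha) (by positivity) (by positivity)
        exact mul_le_mul (pow_le_pow_right₀ (by norm_num) hk) (schwartzNorm_mono hk ψ)
          (apply_nonneg _ _) (by positivity)

/-- By the group law it suffices to let the translation tend to 0. There the mean value inequality
applies, since for |h| ≤ 1 the weights 1+|y| at points of the unit ball around y are comparable.
This continuity provides the measurability and integrability of x ↦ f(`waveCLM` x φ). -/
theorem continuous_compSubConstCLM (ψ : 𝓢(Rn n, ℂ)) :
    Continuous fun x : Rn n => compSubConstCLM ℂ x ψ := by
  have key : ∀ ψ : 𝓢(Rn n, ℂ), Filter.Tendsto (fun h : Rn n => compSubConstCLM ℂ h ψ) (nhds 0)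
      (nhds ψ) := by
    intro ψ
    rw [(schwartz_withSeminorms ℂ (Rn n) ℂ).tendsto_nhds]
    rintro ⟨k, l⟩ ε hε
    set C := 2 ^ k * (2 ^ (max k (l + 1)) * schwartzNorm (max k (l + 1)) ψ) with hCdef
    have hC : 0 ≤ C := by have : 0 ≤ schwartzNorm (max k (l + 1)) ψ := apply_nonneg _ _; positivity
    have bound : ∀ h : Rn n, ‖h‖ ≤ 1 →
        SchwartzMap.seminorm ℂ k l (compSubConstCLM ℂ h ψ - ψ) ≤ C * ‖h‖ := by
      intro h hh
      refine SchwartzMap.seminorm_le_bound ℂ k l _ (by positivity) fun y => ?_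
      have e : iteratedFDeriv ℝ l (⇑(compSubConstCLM ℂ h ψ - ψ)) y =
          iteratedFDeriv ℝ l ψ (y - h) - iteratedFDeriv ℝ l ψ y := by
        rw [FunLike.coe_sub, iteratedFDeriv_sub_apply ((compSubConstCLM ℂ h ψ).contDiffAt _)
          (ψ.contDiffAt _), iteratedFDeriv_compSubConstCLM]
      rw [e]
      have mv := (convex_closedBall y 1).norm_image_sub_le_of_norm_fderiv_le (𝕜 := ℝ)
        (f := iteratedFDeriv ℝ l ψ) (C := (2 ^ (max k (l + 1)) * schwartzNorm (max k (l + 1)) ψ) *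
          2 ^ k / (1 + ‖y‖) ^ k) (x := y) (y := y - h)
        (fun z _ => ((ψ.smooth ⊤).differentiable_iteratedFDeriv (mod_cast ENat.natCast_lt_top l)) z)
        (fun z hz => by
          rw [norm_fderiv_iteratedFDeriv, le_div_iff₀ (by positivity)]
          have hzy : 1 + ‖y‖ ≤ 2 * (1 + ‖z‖) := by
            have h1 : ‖y‖ ≤ ‖z‖ + ‖z - y‖ := by
              have := norm_sub_norm_le y z
              rw [norm_sub_rev] at this
              linarith
            have h2 : ‖z - y‖ ≤ 1 := by simpa [dist_eq_norm] using hz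
            linarith [norm_nonneg z]
          calc _ ≤ ‖iteratedFDeriv ℝ (l + 1) ψ z‖ * (2 * (1 + ‖z‖)) ^ k := by gcongr
            _ = ((1 + ‖z‖) ^ k * ‖iteratedFDeriv ℝ (l + 1) ψ z‖) * 2 ^ k := by rw [mul_pow]; ring
            _ ≤ _ := mul_le_mul_of_nonneg_right (one_add_pow_mul_le k (l + 1) ψ z) (by positivity))
        (Metric.mem_closedBall_self zero_le_one) (by simpa using hh)
      rw [sub_sub_cancel_left, norm_neg] at mv
      calc ‖y‖ ^ k * _ ≤ (1 + ‖y‖) ^ k * (_ * ‖h‖) := by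
            gcongr
            linarith
        _ = C * ‖h‖ := by rw [hCdef]; field_simp
    have hev : ∀ᶠ h : Rn n in nhds 0, ‖h‖ < min 1 (ε / (C + 1)) := by
      have := Metric.ball_mem_nhds (0 : Rn n) (ε := min 1 (ε / (C + 1))) (by positivity)
      filter_upwards [this] with h hh
      simpa using hh
    filter_upwards [hev] with h hh
    have h1 : ‖h‖ < 1 := hh.trans_le (min_le_left _ _)
    have h2 : ‖h‖ < ε / (C + 1) := hh.trans_le (min_le_right _ _)
    rw [lt_div_iff₀ (by positivity)] at h2
    refine (bound h h1.le).trans_lt ?_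
    nlinarith [norm_nonneg h]
  rw [continuous_iff_continuousAt]
  intro x
  have h1 : Filter.Tendsto (fun y : Rn n => y - x) (nhds x) (nhds 0) := by
    have : Continuous fun y : Rn n => y - x := by fun_prop
    simpa using this.tendsto x
  have h2 := ((compSubConstCLM ℂ x).continuous.tendsto ψ).comp ((key ψ).comp h1)
  refine h2.congr fun y => ?_
  ext z
  simp

/-- A series in the Schwartz space which converges pointwise and absolutely with respect to all
seminorms converges in the Schwartz space. -/
theorem hasSum_schwartz {ι : Type*} {u : ι → 𝓢(Rn n, ℂ)} {g : 𝓢(Rn n, ℂ)}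
    (hu : ∀ k, Summable fun i => schwartzNorm k (u i)) (hg : ∀ x, HasSum (fun i => u i x) (g x)) :
    HasSum u g := by
  have hD : ∀ (l : ℕ) (x : Rn n), HasSum (fun i => iteratedFDeriv ℝ l (u i) x) (iteratedFDeriv ℝ l g x) := by
    intro l x
    have hgt : ⇑g = fun y => ∑' i, u i y := by ext y; exact (hg y).tsum_eq.symm
    have h := iteratedFDeriv_tsum_apply (𝕜 := ℝ) (f := fun i => ⇑(u i)) (N := (⊤ : ℕ∞))
      (v := fun k i => schwartzNorm k (u i)) (fun i => (u i).smooth ⊤) (fun k _ => hu k)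
      (fun k i x _ => (norm_iteratedFDeriv_le_seminorm ℂ (u i) k x).trans
        (seminorm_le_schwartzNorm (Nat.zero_le k) le_rfl _)) (k := l) le_top x
    rw [hgt, h]
    refine Summable.hasSum (Summable.of_norm_bounded (hu l) fun i => ?_)
    exact (norm_iteratedFDeriv_le_seminorm ℂ (u i) l x).trans
        (seminorm_le_schwartzNorm (Nat.zero_le l) le_rfl _)
  rw [HasSum, (schwartz_withSeminorms ℂ (Rn n) ℂ).tendsto_nhds]
  rintro ⟨k, l⟩ ε hε
  have hs : Summable fun i => schwartzNorm (max k l) (u i) := hu _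
  have htail := (tendsto_order.1 (tendsto_tsum_compl_atTop_zero
    fun i => schwartzNorm (max k l) (u i))).2 ε hε
  filter_upwards [htail] with s hs'
  refine lt_of_le_of_lt ?_ hs'
  rw [schwartzSeminormFamily_apply]
  refine SchwartzMap.seminorm_le_bound ℂ k l _ (tsum_nonneg fun i => apply_nonneg _ _) fun x => ?_
  have e : iteratedFDeriv ℝ l (⇑(∑ i ∈ s, u i - g)) x =
      -(∑' i : {i // i ∉ s}, iteratedFDeriv ℝ l (u i) x) := by
    have h1 := ((hD l x).summable.sum_add_tsum_compl (s := s)).trans (hD l x).tsum_eq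
    rw [FunLike.coe_sub, iteratedFDeriv_sub_apply ((∑ i ∈ s, u i).contDiffAt _) (g.contDiffAt _),
      ← h1]
    have h2 : iteratedFDeriv ℝ l (⇑(∑ i ∈ s, u i)) x = ∑ i ∈ s, iteratedFDeriv ℝ l (u i) x := by
      have h3 : ⇑(∑ i ∈ s, u i) = fun y => ∑ i ∈ s, u i y := by ext y; simp
      rw [h3, iteratedFDeriv_sum (fun i _ => (u i).smooth _)]
      simp
    rw [h2]
    abel_nf
    rfl
  rw [e, norm_neg]
  have hsum : Summable fun i : {i // i ∉ s} => ‖x‖ ^ k * ‖iteratedFDeriv ℝ l (u i) x‖ :=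
    Summable.of_nonneg_of_le (fun i => by positivity)
      (fun i => (le_seminorm ℂ k l (u i) x).trans
        (seminorm_le_schwartzNorm (le_max_left _ _) (le_max_right _ _) _)) (hs.subtype _)
  rcases eq_or_ne (‖x‖ ^ k) 0 with h0 | h0
  · rw [h0, zero_mul]
    exact tsum_nonneg fun i => apply_nonneg _ _
  have hsum' : Summable fun i : {i // i ∉ s} => ‖iteratedFDeriv ℝ l (u i) x‖ :=
    (summable_mul_left_iff h0).1 hsum
  calc _ ≤ ‖x‖ ^ k * ∑' i : {i // i ∉ s}, ‖iteratedFDeriv ℝ l (u i) x‖ := by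
        gcongr
        exact norm_tsum_le_tsum_norm hsum'
    _ = ∑' i : {i // i ∉ s}, ‖x‖ ^ k * ‖iteratedFDeriv ℝ l (u i) x‖ := by rw [tsum_mul_left]
    _ ≤ _ := by
        refine Summable.tsum_le_tsum (fun i => ?_) hsum (hs.subtype _)
        exact (le_seminorm ℂ k l (u i) x).trans
          (seminorm_le_schwartzNorm (le_max_left _ _) (le_max_right _ _) _)

variable {n : ℕ}

/-! ### Translates of inverse Fourier transforms -/

/-- The normalising constant `(2π)^{-n/2}` of the Fourier transform. -/
def fourierConst (n : ℕ) : ℂ := (((2 * Real.pi) ^ (-(n : ℝ) / 2) : ℝ) : ℂ)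

/-- The operator sending `φ` to `y ↦ φ̌(x - y)`. -/
def waveCLM (x : Rn n) : 𝓢(Rn n, ℂ) →L[ℂ] 𝓢(Rn n, ℂ) :=
  compSubConstCLM ℂ x ∘L compCLMOfContinuousLinearEquiv ℂ (ContinuousLinearEquiv.neg ℝ) ∘L
    (fourierConst n • (compCLMOfContinuousLinearEquiv ℂ (dilTwoPi n) ∘L
      FourierTransform.fourierInvCLM ℂ 𝓢(Rn n, ℂ)))

theorem waveCLM_apply (x : Rn n) (φ : 𝓢(Rn n, ℂ)) :
    waveCLM x φ = reflTranslate (invFourier φ) x := rfl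

theorem waveCLM_apply_eq_invFourier (x y : Rn n) (φ : 𝓢(Rn n, ℂ)) :
    waveCLM x φ y = invFourier φ (x - y) := by
  rw [waveCLM_apply, reflTranslate_apply]

theorem waveCLM_apply_apply (x y : Rn n) (φ : 𝓢(Rn n, ℂ)) :
    waveCLM x φ y = fourierConst n *
      ∫ ξ : Rn n, Complex.exp (((inner ℝ (x - y) ξ : ℝ) : ℂ) * Complex.I) * φ ξ := by
  rw [waveCLM_apply_eq_invFourier, invFourier_apply, fourierConst]

theorem hasTemperateGrowth_inner (v : Rn n) (a : ℂ) :
    Function.HasTemperateGrowth fun ξ : Rn n => a * ((inner ℝ ξ v : ℝ) : ℂ) := by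
  have h := (Complex.ofRealCLM.comp ((innerSL ℝ).flip v)).hasTemperateGrowth
  exact (Function.HasTemperateGrowth.const a).mul h

theorem lineDerivOp_compSubConstCLM (v x : Rn n) (ψ : 𝓢(Rn n, ℂ)) :
    ∂_{v} (compSubConstCLM ℂ x ψ) = compSubConstCLM ℂ x (∂_{v} ψ) := by
  ext y
  have : ⇑(compSubConstCLM ℂ x ψ) = fun z => ψ (z - x) := by ext z; simp
  rw [lineDerivOp_apply_eq_fderiv, this, fderiv_comp_sub, compSubConstCLM_apply,
    lineDerivOp_apply_eq_fderiv]

theorem lineDerivOp_waveCLM (v x : Rn n) (φ : 𝓢(Rn n, ℂ)) :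
    ∂_{v} (waveCLM x φ) =
      waveCLM x (smulLeftCLM ℂ (fun ξ : Rn n => -Complex.I * ((inner ℝ ξ v : ℝ) : ℂ)) φ) := by
  have hv := hasTemperateGrowth_inner v (-Complex.I)
  have hv' : Function.HasTemperateGrowth fun ξ : Rn n => inner ℝ ξ (dilTwoPi n (-v)) :=
    ((innerSL ℝ).flip _).hasTemperateGrowth
  have e1 : ∀ φ : 𝓢(Rn n, ℂ), waveCLM x φ = compSubConstCLM ℂ x
      (compCLMOfContinuousLinearEquiv ℂ (ContinuousLinearEquiv.neg ℝ)
        (fourierConst n • compCLMOfContinuousLinearEquiv ℂ (dilTwoPi n) (𝓕⁻ φ))) := fun _ => rfl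
  have e2 : (2 * Real.pi * Complex.I) •
      smulLeftCLM ℂ (fun ξ : Rn n => inner ℝ ξ (dilTwoPi n (-v))) φ =
      smulLeftCLM ℂ (fun ξ : Rn n => -Complex.I * ((inner ℝ ξ v : ℝ) : ℂ)) φ := by
    ext ξ
    rw [smulLeftCLM_apply_apply hv, smul_apply, smulLeftCLM_apply_apply hv']
    have : (dilTwoPi n) (-v) = -(((2 * Real.pi)⁻¹ : ℝ) • v) := by
      rw [map_neg]; rfl
    rw [this, inner_neg_right, inner_smul_right]
    simp only [smul_eq_mul, Complex.real_smul]
    push_cast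
    have : (Real.pi : ℂ) ≠ 0 := by exact_mod_cast Real.pi_ne_zero
    field_simp
  rw [e1, lineDerivOp_compSubConstCLM, lineDerivOp_compCLMOfContinuousLinearEquiv,
    LineDeriv.lineDerivOp_smul, lineDerivOp_compCLMOfContinuousLinearEquiv, lineDerivOp_fourierInv_eq]
  rw [e1]
  congr 5

theorem hasTemperateGrowth_prod_inner {l : ℕ} (m : Fin l → Rn n) :
    Function.HasTemperateGrowth fun ξ : Rn n => ∏ j, (-Complex.I * ((inner ℝ ξ (m j) : ℝ) : ℂ)) := by
  induction l with
  | zero => simp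
  | succ l ih =>
    simp_rw [Fin.prod_univ_succ]
    exact (hasTemperateGrowth_inner (m 0) _).mul (ih fun j => m j.succ)

/-- Differentiation in space is multiplication by monomials in frequency. This is used twice: to
identify whole jets of an integral, and to read the moments of φ̌_j off the derivatives of φ_j at 0.
-/
theorem iteratedFDeriv_waveCLM {l : ℕ} (m : Fin l → Rn n) (x y : Rn n) (φ : 𝓢(Rn n, ℂ)) :
    iteratedFDeriv ℝ l (waveCLM x φ) y m =
      waveCLM x (smulLeftCLM ℂ (fun ξ : Rn n => ∏ j, (-Complex.I * ((inner ℝ ξ (m j) : ℝ) : ℂ))) φ)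
        y := by
  rw [← iteratedLineDerivOp_eq_iteratedFDeriv]
  congr 1
  induction l with
  | zero =>
    simp only [LineDeriv.iteratedLineDerivOp_fin_zero]
    congr 1
    ext ξ
    rw [smulLeftCLM_apply_apply (hasTemperateGrowth_prod_inner m)]
    simp
  | succ l ih =>
    rw [LineDeriv.iteratedLineDerivOp_succ_left, ih, lineDerivOp_waveCLM]
    congr 1
    ext ξ
    rw [smulLeftCLM_apply_apply (hasTemperateGrowth_prod_inner m),
      smulLeftCLM_apply_apply (hasTemperateGrowth_inner _ _),
      smulLeftCLM_apply_apply (hasTemperateGrowth_prod_inner _), Fin.prod_univ_succ, smul_smul]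
    rfl

theorem continuous_waveCLM (φ : 𝓢(Rn n, ℂ)) : Continuous fun x : Rn n => waveCLM x φ :=
  continuous_compSubConstCLM _

theorem exists_schwartzNorm_waveCLM_le (k : ℕ) : ∃ (k' : ℕ) (C : ℝ), 0 ≤ C ∧
    ∀ (x : Rn n) (φ : 𝓢(Rn n, ℂ)),
      schwartzNorm k (waveCLM x φ) ≤ C * schwartzNorm k' φ * (1 + ‖x‖) ^ k := by
  obtain ⟨k', C, hC, h⟩ := exists_schwartzNorm_le (waveCLM (0 : Rn n)) k
  refine ⟨k', 2 ^ k * C, by positivity, fun x φ => ?_⟩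
  have e : waveCLM x φ = compSubConstCLM ℂ x (waveCLM 0 φ) := by
    ext y
    rw [compSubConstCLM_apply, waveCLM_apply_eq_invFourier, waveCLM_apply_eq_invFourier]
    congr 1
    abel
  rw [e]
  refine (schwartzNorm_compSubConstCLM_le k _ x).trans ?_
  rw [mul_assoc (2 ^ k) C]
  exact mul_le_mul_of_nonneg_right (mul_le_mul_of_nonneg_left (h φ) (by positivity))
    (by positivity)

/-! ### Interchanging a tempered distribution with an integral -/

/-- The inverse Fourier transform without its normalising constant,
`ξ ↦ ∫ θ(x) e^{i⟨x,ξ⟩} dx`. -/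
def expIntegral (θ : 𝓢(Rn n, ℂ)) : 𝓢(Rn n, ℂ) := (fourierConst n)⁻¹ • invFourier θ

theorem fourierConst_ne_zero : fourierConst n ≠ 0 := by
  unfold fourierConst
  norm_cast
  positivity

theorem expIntegral_apply (θ : 𝓢(Rn n, ℂ)) (ξ : Rn n) :
    expIntegral θ ξ = ∫ x : Rn n, Complex.exp (((inner ℝ x ξ : ℝ) : ℂ) * Complex.I) * θ x := by
  rw [expIntegral, smul_apply, invFourier_apply, ← fourierConst, smul_eq_mul,
    inv_mul_cancel_left₀ fourierConst_ne_zero]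
  simp_rw [real_inner_comm]

theorem norm_exp_inner (x ξ : Rn n) :
    ‖Complex.exp (((inner ℝ x ξ : ℝ) : ℂ) * Complex.I)‖ = 1 :=
  Complex.norm_exp_ofReal_mul_I _

/-- Pointwise Fubini. The multiplier t is carried along so that monomials may be inserted later and
all derivatives in y are covered at once. -/
theorem integral_mul_waveCLM_apply (θ φ : 𝓢(Rn n, ℂ)) (t : Rn n → ℂ) (ht : t.HasTemperateGrowth)
    (y : Rn n) : ∫ x, θ x * waveCLM x (smulLeftCLM ℂ t φ) y =
      waveCLM 0 (smulLeftCLM ℂ t (smulLeftCLM ℂ (expIntegral θ) φ)) y := by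
  simp_rw [waveCLM_apply_apply]
  have hθ := (expIntegral θ).hasTemperateGrowth
  have e1 : ∀ x : Rn n, θ x * (fourierConst n * ∫ ξ : Rn n,
      Complex.exp (((inner ℝ (x - y) ξ : ℝ) : ℂ) * Complex.I) * smulLeftCLM ℂ t φ ξ) =
      fourierConst n * ∫ ξ : Rn n,
        (Complex.exp (((inner ℝ (x - y) ξ : ℝ) : ℂ) * Complex.I) * (θ x * smulLeftCLM ℂ t φ ξ)) := by
    intro x
    rw [mul_left_comm, ← integral_const_mul]
    congr 2
    ext ξ
    ring
  simp_rw [e1]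
  rw [integral_const_mul]
  congr 1
  rw [integral_integral_swap]
  · congr 1
    ext ξ
    rw [smulLeftCLM_apply_apply ht, smulLeftCLM_apply_apply ht, smulLeftCLM_apply_apply hθ,
      expIntegral_apply]
    have : ∀ x, Complex.exp (((inner ℝ (x - y) ξ : ℝ) : ℂ) * Complex.I) * (θ x * t ξ • φ ξ) =
        (Complex.exp (((inner ℝ (0 - y) ξ : ℝ) : ℂ) * Complex.I) * t ξ * φ ξ) *
          (Complex.exp (((inner ℝ x ξ : ℝ) : ℂ) * Complex.I) * θ x) := by
      intro x
      have : Complex.exp (((inner ℝ (x - y) ξ : ℝ) : ℂ) * Complex.I) =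
          Complex.exp (((inner ℝ (0 - y) ξ : ℝ) : ℂ) * Complex.I) *
            Complex.exp (((inner ℝ x ξ : ℝ) : ℂ) * Complex.I) := by
        rw [← Complex.exp_add, inner_sub_left, inner_sub_left, inner_zero_left]
        push_cast
        ring_nf
      rw [this, smul_eq_mul]
      ring
    simp_rw [this]
    rw [integral_const_mul]
    simp only [smul_eq_mul]
    ring
  · have hprod : Integrable (fun z : Rn n × Rn n => θ z.1 * smulLeftCLM ℂ t φ z.2)
        (volume.prod volume) := θ.integrable.mul_prod (smulLeftCLM ℂ t φ).integrable
    refine hprod.bdd_mul (c := 1) ?_ (Filter.Eventually.of_forall fun z => ?_)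
    · exact Continuous.aestronglyMeasurable (by fun_prop)
    · rw [norm_exp_inner]

/-- The space of jets of order `k`. -/
def Jet (n k : ℕ) : Type :=
  ∀ l : Fin (k + 1), ContinuousMultilinearMap ℝ (fun _ : Fin l => Rn n) ℂ

instance (k : ℕ) : NormedAddCommGroup (Jet n k) :=
  inferInstanceAs (NormedAddCommGroup
    (∀ l : Fin (k + 1), ContinuousMultilinearMap ℝ (fun _ : Fin l => Rn n) ℂ))

instance (k : ℕ) : NormedSpace ℂ (Jet n k) :=
  inferInstanceAs (NormedSpace ℂ
    (∀ l : Fin (k + 1), ContinuousMultilinearMap ℝ (fun _ : Fin l => Rn n) ℂ))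

instance (k : ℕ) : CompleteSpace (Jet n k) :=
  inferInstanceAs (CompleteSpace
    (∀ l : Fin (k + 1), ContinuousMultilinearMap ℝ (fun _ : Fin l => Rn n) ℂ))

/-- The value of a component of a jet at a tuple of vectors. -/
def Jet.eval {k : ℕ} (l : Fin (k + 1)) (m : Fin l → Rn n) : Jet n k →L[ℂ] ℂ :=
  LinearMap.mkContinuous (𝕜 := ℂ) (E := Jet n k)
    { toFun := fun v => (v l) m
      map_add' := fun _ _ => rfl
      map_smul' := fun _ _ => rfl } (∏ i, ‖m i‖) fun v => by
    have h1 : ‖v l‖ ≤ ‖v‖ := norm_le_pi_norm (G := fun l : Fin (k + 1) =>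
      ContinuousMultilinearMap ℝ (fun _ : Fin l => Rn n) ℂ) v l
    rw [mul_comm]
    exact ((v l).le_opNorm m).trans (mul_le_mul_of_nonneg_right h1 (by positivity))

/-- The weighted derivatives of order at most `k` of a Schwartz function. -/
def jetFun (k : ℕ) (φ : 𝓢(Rn n, ℂ)) (y : Rn n) : Jet n k :=
  fun l => (1 + ‖y‖ ^ 2) ^ k • iteratedFDeriv ℝ l φ y

theorem norm_jetFun_le (k : ℕ) (φ : 𝓢(Rn n, ℂ)) (y : Rn n) :
    ‖jetFun k φ y‖ ≤ 2 ^ (2 * k) * schwartzNorm (2 * k) φ := by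
  have h0 : 0 ≤ schwartzNorm (2 * k) φ := apply_nonneg _ _
  refine (pi_norm_le_iff_of_nonneg (G := fun l : Fin (k + 1) =>
    ContinuousMultilinearMap ℝ (fun _ : Fin l => Rn n) ℂ) (by positivity)).2 fun l => ?_
  have hl : (l : ℕ) ≤ 2 * k := by have := l.2; omega
  have h1 := one_add_pow_mul_le (2 * k) l φ y
  rw [max_eq_left hl] at h1
  refine le_trans ?_ h1
  rw [jetFun, norm_smul, Real.norm_of_nonneg (by positivity), pow_mul]
  gcongr
  nlinarith [norm_nonneg y]

/-- The weighted jet of a Schwartz function, as an element of a Banach space. -/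
def jet (k : ℕ) : 𝓢(Rn n, ℂ) →ₗ[ℂ] BoundedContinuousFunction (Rn n) (Jet n k) where
  toFun φ := BoundedContinuousFunction.ofNormedAddCommGroup (jetFun k φ)
    (continuous_pi (A := fun l : Fin (k + 1) =>
        ContinuousMultilinearMap ℝ (fun _ : Fin l => Rn n) ℂ) fun l => by
      have h1 : Continuous fun y : Rn n => (1 + ‖y‖ ^ 2) ^ k := by fun_prop
      have h2 : Continuous (iteratedFDeriv ℝ l φ) :=
        (φ.smooth ⊤).continuous_iteratedFDeriv (mod_cast le_top)
      exact h1.smul h2)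
    _ (norm_jetFun_le k φ)
  map_add' φ ψ := by
    ext y
    funext l
    change (1 + ‖y‖ ^ 2) ^ k • iteratedFDeriv ℝ l (⇑φ + ⇑ψ) y =
      (1 + ‖y‖ ^ 2) ^ k • iteratedFDeriv ℝ l φ y + (1 + ‖y‖ ^ 2) ^ k • iteratedFDeriv ℝ l ψ y
    rw [iteratedFDeriv_add_apply (φ.contDiffAt _) (ψ.contDiffAt _), smul_add]
  map_smul' c φ := by
    ext y
    funext l
    change (1 + ‖y‖ ^ 2) ^ k • iteratedFDeriv ℝ l (c • ⇑φ) y =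
      c • (1 + ‖y‖ ^ 2) ^ k • iteratedFDeriv ℝ l φ y
    rw [iteratedFDeriv_const_smul_apply (φ.contDiffAt _), smul_comm]

theorem jet_apply (k : ℕ) (φ : 𝓢(Rn n, ℂ)) (y : Rn n) (l : Fin (k + 1)) :
    jet k φ y l = (1 + ‖y‖ ^ 2) ^ k • iteratedFDeriv ℝ l φ y := rfl

theorem norm_jet_le (k : ℕ) (φ : 𝓢(Rn n, ℂ)) :
    ‖jet k φ‖ ≤ 2 ^ (2 * k) * schwartzNorm (2 * k) φ := by
  have h0 : 0 ≤ schwartzNorm (2 * k) φ := apply_nonneg _ _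
  exact (BoundedContinuousFunction.norm_le (by positivity)).2 fun y => norm_jetFun_le k φ y

theorem schwartzNorm_le_norm_jet (k : ℕ) (φ : 𝓢(Rn n, ℂ)) : schwartzNorm k φ ≤ ‖jet k φ‖ := by
  refine schwartzNorm_le (norm_nonneg _) fun a ha b hb =>
    SchwartzMap.seminorm_le_bound ℂ a b _ (norm_nonneg _) fun y => ?_
  refine le_trans ?_ ((norm_le_pi_norm (G := fun l : Fin (k + 1) =>
    ContinuousMultilinearMap ℝ (fun _ : Fin l => Rn n) ℂ) (jet k φ y) ⟨b, by omega⟩).trans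
    ((jet k φ).norm_coe_le_norm y))
  rw [jet_apply, norm_smul, Real.norm_of_nonneg (by positivity)]
  gcongr
  rcases le_or_gt ‖y‖ 1 with h | h
  · exact (pow_le_one₀ (norm_nonneg _) h).trans (one_le_pow₀ (by nlinarith [norm_nonneg y]))
  · exact (pow_le_pow_right₀ h.le ha).trans (pow_le_pow_left₀ (norm_nonneg _) (by nlinarith) _)

theorem continuous_jet (k : ℕ) : Continuous (jet (n := n) k) := by
  refine (schwartz_withSeminorms ℂ (Rn n) ℂ).continuous_of_isBounded
    (norm_withSeminorms ℂ (BoundedContinuousFunction (Rn n) (Jet n k))) _ fun _ => ?_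
  exact ⟨Finset.Iic (2 * k, 2 * k), 2 ^ (2 * k), fun φ => norm_jet_le k φ⟩

/-- A continuous functional on the Schwartz space extends to a Banach space of jets. -/
theorem exists_eq_comp_jet (f : 𝓢(Rn n, ℂ) →L[ℂ] ℂ) :
    ∃ (k : ℕ) (F : BoundedContinuousFunction (Rn n) (Jet n k) →L[ℂ] ℂ),
      ∀ φ, f φ = F (jet k φ) := by
  obtain ⟨k, C, hC, h⟩ := exists_norm_le_schwartzNorm f
  have hb : ∀ φ, ‖f φ‖ ≤ C * ‖jet k φ‖ := fun φ =>
    (h φ).trans (mul_le_mul_of_nonneg_left (schwartzNorm_le_norm_jet k φ) hC)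
  -- Injectivity lets f be transported to the range of the jet map, where it is bounded; Hahn–Banach
  -- then extends it.
  have hinj : Function.Injective (jet (n := n) k) := by
    rw [← LinearMap.ker_eq_bot, LinearMap.ker_eq_bot']
    intro φ hφ
    ext y
    have h1 := (seminorm_le_schwartzNorm (Nat.zero_le k) (Nat.zero_le k) φ).trans
      (schwartzNorm_le_norm_jet k φ)
    rw [hφ, norm_zero] at h1
    exact norm_le_zero_iff.1 ((norm_le_seminorm ℂ φ y).trans h1)
  let e := LinearEquiv.ofInjective _ hinj
  let g : LinearMap.range (jet (n := n) k) →L[ℂ] ℂ :=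
    (f.toLinearMap ∘ₗ e.symm.toLinearMap).mkContinuous C fun z => by
      have := hb (e.symm z)
      have h2 : jet k (e.symm z) = (z : BoundedContinuousFunction (Rn n) _) :=
        congrArg Subtype.val (e.apply_symm_apply z)
      rw [h2] at this
      exact this
  obtain ⟨F, hF, -⟩ := exists_extension_norm_eq _ g
  refine ⟨k, F, fun φ => ?_⟩
  have := hF (e φ)
  have h3 : ((e φ : LinearMap.range (jet (n := n) k)) : BoundedContinuousFunction (Rn n) _) =
    jet k φ := rfl
  rw [h3] at this
  rw [this]
  change f φ = f (e.symm (e φ))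
  rw [e.symm_apply_apply]

/-- Schwartz functions are integrable against polynomial weights. -/
theorem integrable_norm_mul_one_add_pow (θ : 𝓢(Rn n, ℂ)) (k : ℕ) :
    Integrable fun x : Rn n => ‖θ x‖ * (1 + ‖x‖) ^ k := by
  have h1 : Integrable fun x : Rn n => 2 ^ k * (‖θ x‖ + ‖x‖ ^ k * ‖θ x‖) :=
    (θ.integrable.norm.add (θ.integrable_pow_mul volume k)).const_mul _
  refine h1.mono' (Continuous.aestronglyMeasurable (by fun_prop)) (Filter.Eventually.of_forall ?_)
  intro x
  rw [Real.norm_of_nonneg (by positivity)]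
  have : (1 + ‖x‖) ^ k ≤ 2 ^ k * (1 + ‖x‖ ^ k) := by
    have := add_pow_le (zero_le_one' ℝ) (norm_nonneg x) k
    rw [one_pow] at this
    refine this.trans ?_
    gcongr
    · norm_num
    · omega
  nlinarith [norm_nonneg (θ x)]

/-- The functional factors through a Banach space of weighted jets, in which the integral of θ(x)
times the jet of the translate is a Bochner integral and commutes with bounded functionals. The
value of that integral is checked component by component, where it is the pointwise identity above.
-/
theorem integral_mul_functional_waveCLM (f : 𝓢(Rn n, ℂ) →L[ℂ] ℂ) (θ φ : 𝓢(Rn n, ℂ)) :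
    ∫ x, θ x * f (waveCLM x φ) = f (waveCLM 0 (smulLeftCLM ℂ (expIntegral θ) φ)) := by
  obtain ⟨k, F, hF⟩ := exists_eq_comp_jet f
  have hint : Integrable fun x : Rn n => θ x • jet k (waveCLM x φ) := by
    obtain ⟨k', C, hC, hk⟩ := exists_schwartzNorm_waveCLM_le (n := n) (2 * k)
    refine ((integrable_norm_mul_one_add_pow θ (2 * k)).const_mul
      (2 ^ (2 * k) * (C * schwartzNorm k' φ))).mono'
      (Continuous.aestronglyMeasurable
        (θ.continuous.smul ((continuous_jet k).comp (continuous_waveCLM φ))))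
      (Filter.Eventually.of_forall fun x => ?_)
    rw [norm_smul]
    have := (norm_jet_le k (waveCLM x φ)).trans
      (mul_le_mul_of_nonneg_left (hk x φ) (by positivity))
    calc _ ≤ ‖θ x‖ * _ := mul_le_mul_of_nonneg_left this (norm_nonneg _)
      _ = _ := by ring
  have key : ∫ x : Rn n, θ x • jet k (waveCLM x φ) =
      jet k (waveCLM 0 (smulLeftCLM ℂ (expIntegral θ) φ)) := by
    ext y
    funext l
    ext m
    have h4 : (∫ x : Rn n, θ x • jet k (waveCLM x φ)) y l m =
        ∫ x : Rn n, θ x * ((1 + ‖y‖ ^ 2) ^ k • iteratedFDeriv ℝ l (waveCLM x φ) y m) :=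
      ((Jet.eval l m ∘L BoundedContinuousFunction.evalCLM ℂ y).integral_comp_comm hint).symm
    rw [h4, jet_apply, FunLike.coe_smul, Pi.smul_apply, iteratedFDeriv_waveCLM m,
      ← integral_mul_waveCLM_apply _ _ _ (hasTemperateGrowth_prod_inner m)]
    simp_rw [iteratedFDeriv_waveCLM m, mul_smul_comm]
    rw [integral_smul]
  rw [hF, ← key, ← F.integral_comp_comm hint]
  congr 1
  ext x
  rw [map_smul, smul_eq_mul, ← hF]

/-! ### The interchange for vector-valued distributions -/

section

variable {E : Type*} [NormedAddCommGroup E] [NormedSpace ℂ E]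

/-- `f(φ̌(x - ·))` grows at most polynomially in `x`. -/
theorem exists_norm_waveCLM_le (f : 𝓢(Rn n, ℂ) →L[ℂ] E) : ∃ (k k' : ℕ) (C : ℝ), 0 ≤ C ∧
    ∀ (x : Rn n) (φ : 𝓢(Rn n, ℂ)),
      ‖f (waveCLM x φ)‖ ≤ C * schwartzNorm k' φ * (1 + ‖x‖) ^ k := by
  obtain ⟨k, C, hC, h⟩ := exists_norm_le_schwartzNorm f
  obtain ⟨k', C', hC', h'⟩ := exists_schwartzNorm_waveCLM_le (n := n) k
  refine ⟨k, k', C * C', by positivity, fun x φ => (h _).trans ?_⟩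
  refine (mul_le_mul_of_nonneg_left (h' x φ) hC).trans (le_of_eq ?_)
  ring

theorem integrable_smul_waveCLM (f : 𝓢(Rn n, ℂ) →L[ℂ] E) (θ φ : 𝓢(Rn n, ℂ)) :
    Integrable fun x : Rn n => θ x • f (waveCLM x φ) := by
  obtain ⟨k, k', C, hC, h⟩ := exists_norm_waveCLM_le f
  refine ((integrable_norm_mul_one_add_pow θ k).const_mul (C * schwartzNorm k' φ)).mono'
    (Continuous.aestronglyMeasurable
      (θ.continuous.smul (f.continuous.comp (continuous_waveCLM φ))))
    (Filter.Eventually.of_forall fun x => ?_)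
  rw [norm_smul]
  calc _ ≤ ‖θ x‖ * _ := mul_le_mul_of_nonneg_left (h x φ) (norm_nonneg _)
    _ = _ := by ring

/-- Continuous functionals separate the points of E, so the scalar case suffices. -/
theorem integral_smul_waveCLM [CompleteSpace E] (f : 𝓢(Rn n, ℂ) →L[ℂ] E) (θ φ : 𝓢(Rn n, ℂ)) :
    ∫ x, θ x • f (waveCLM x φ) = f (waveCLM 0 (smulLeftCLM ℂ (expIntegral θ) φ)) := by
  refine (SeparatingDual.eq_iff_forall_dual_eq (R := ℂ)).2 fun g => ?_
  rw [← g.integral_comp_comm (integrable_smul_waveCLM f θ φ)]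
  have := integral_mul_functional_waveCLM (g ∘L f) θ φ
  simpa using this

end

variable {n : ℕ}

/-! ### Fourier inversion and the reproducing formula -/

theorem fourierConst_mul_self : fourierConst n * fourierConst n * ((2 * Real.pi) ^ n : ℝ) = 1 := by
  unfold fourierConst
  have h : (0 : ℝ) < 2 * Real.pi := by positivity
  rw [← Complex.ofReal_mul, ← Complex.ofReal_mul, ← Real.rpow_natCast, ← Real.rpow_add h,
    ← Real.rpow_add h]
  norm_num

theorem invFourier_eq (φ : 𝓢(Rn n, ℂ)) (x : Rn n) :
    invFourier φ x = fourierConst n * 𝓕⁻ φ ((2 * Real.pi)⁻¹ • x) := rfl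

/-- Fourier inversion in the present normalisation: the Jacobian (2π)^n of the dilation cancels
against the square of the constant (2π)^{-n/2}. -/
theorem expIntegral_waveCLM (x ξ : Rn n) (g : 𝓢(Rn n, ℂ)) :
    fourierConst n * expIntegral (waveCLM x g) ξ =
      Complex.exp (((inner ℝ x ξ : ℝ) : ℂ) * Complex.I) * g ξ := by
  rw [expIntegral_apply]
  simp_rw [waveCLM_apply_eq_invFourier, invFourier_eq]
  have h1 : ∫ y : Rn n, Complex.exp (((inner ℝ y ξ : ℝ) : ℂ) * Complex.I) *
      (fourierConst n * 𝓕⁻ g ((2 * Real.pi)⁻¹ • (x - y))) =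
      ∫ z : Rn n, Complex.exp (((inner ℝ (x - z) ξ : ℝ) : ℂ) * Complex.I) *
      (fourierConst n * 𝓕⁻ g ((2 * Real.pi)⁻¹ • z)) := by
    rw [← integral_sub_left_eq_self _ volume x]
    simp
  have hpi : (2 * Real.pi : ℝ) ≠ 0 := by positivity
  obtain ⟨F, hF⟩ : ∃ F : Rn n → ℂ, F = fun w : Rn n =>
    Complex.exp (((-2 * Real.pi * inner ℝ w ξ : ℝ) : ℂ) * Complex.I) • (𝓕⁻ g : 𝓢(Rn n, ℂ)) w :=
    ⟨_, rfl⟩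
  have h2 : ∀ z : Rn n, Complex.exp (((inner ℝ (x - z) ξ : ℝ) : ℂ) * Complex.I) *
      (fourierConst n * 𝓕⁻ g ((2 * Real.pi)⁻¹ • z)) =
      (fourierConst n * Complex.exp (((inner ℝ x ξ : ℝ) : ℂ) * Complex.I)) *
        F ((2 * Real.pi)⁻¹ • z) := by
    intro z
    rw [hF]
    have e : Complex.exp (((inner ℝ (x - z) ξ : ℝ) : ℂ) * Complex.I) =
        Complex.exp (((inner ℝ x ξ : ℝ) : ℂ) * Complex.I) *
        Complex.exp (((-2 * Real.pi * inner ℝ ((2 * Real.pi)⁻¹ • z) ξ : ℝ) : ℂ) * Complex.I) := by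
      rw [← Complex.exp_add, real_inner_smul_left, inner_sub_left]
      have : -2 * Real.pi * ((2 * Real.pi)⁻¹ * inner ℝ z ξ) = - inner ℝ z ξ := by field_simp
      rw [this]
      push_cast
      ring_nf
    simp only [smul_eq_mul]
    rw [e]
    ring
  rw [h1]
  simp_rw [h2]
  rw [integral_const_mul, Measure.integral_comp_smul volume F, hF, ← Real.fourier_eq', ← SchwartzMap.fourier_coe,
    FourierTransform.fourier_fourierInv_eq]
  have h3 : |(((2 * Real.pi)⁻¹ ^ Module.finrank ℝ (Rn n))⁻¹ : ℝ)| = (2 * Real.pi) ^ n := by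
    rw [abs_of_pos (by positivity), inv_pow, inv_inv, finrank_euclideanSpace_fin]
  rw [h3, Complex.real_smul]
  linear_combination (Complex.exp (((inner ℝ x ξ : ℝ) : ℂ) * Complex.I) * g ξ) *
    fourierConst_mul_self (n := n)

theorem fourierConst_smul_waveCLM_expIntegral (θ : 𝓢(Rn n, ℂ)) :
    fourierConst n • waveCLM 0 (expIntegral θ) = θ := by
  ext y
  have h := expIntegral_waveCLM 0 y θ
  rw [inner_zero_left, Complex.ofReal_zero, zero_mul, Complex.exp_zero, one_mul] at h
  rw [← h, smul_apply, smul_eq_mul, waveCLM_apply_apply, expIntegral_apply]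
  congr 1
  rw [← integral_const_mul, ← integral_neg_eq_self]
  congr 1
  ext ξ
  rw [waveCLM_apply_eq_invFourier, expIntegral, smul_apply, smul_eq_mul, zero_sub, zero_sub,
    inner_neg_neg, real_inner_comm, mul_left_comm, mul_inv_cancel_left₀ fourierConst_ne_zero]

theorem waveCLM_exp_mul {x h : Rn n} {φ g : 𝓢(Rn n, ℂ)}
    (hg : ∀ ξ, g ξ = Complex.exp (((inner ℝ h ξ : ℝ) : ℂ) * Complex.I) * φ ξ) :
    waveCLM x g = waveCLM (x + h) φ := by
  ext y
  rw [waveCLM_apply_apply, waveCLM_apply_apply]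
  congr 2
  ext ξ
  rw [hg, ← mul_assoc, ← Complex.exp_add]
  congr 2
  rw [← add_mul, ← Complex.ofReal_add, ← inner_add_left]
  congr 3
  abel

section

variable {E : Type*} [NormedAddCommGroup E] [NormedSpace ℂ E] [CompleteSpace E]

/-- The reproducing formula: a frequency cut-off acts by convolution. -/
theorem waveCLM_smulLeftCLM_eq_integral (f : 𝓢(Rn n, ℂ) →L[ℂ] E) (g φ : 𝓢(Rn n, ℂ)) (x : Rn n) :
    f (waveCLM x (smulLeftCLM ℂ g φ)) =
      fourierConst n • ∫ y, invFourier g (x - y) • f (waveCLM y φ) := by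
  have h := integral_smul_waveCLM f (waveCLM x g) φ
  simp_rw [waveCLM_apply_eq_invFourier] at h
  rw [h, ← map_smul, ← map_smul]
  congr 1
  rw [← zero_add x]
  refine (waveCLM_exp_mul fun ξ => ?_).symm
  rw [smul_apply, smulLeftCLM_apply_apply (expIntegral _).hasTemperateGrowth,
    smulLeftCLM_apply_apply g.hasTemperateGrowth, smul_eq_mul, smul_eq_mul, smul_eq_mul,
    ← mul_assoc, zero_add, expIntegral_waveCLM, mul_assoc]

theorem integral_smul_dyadicBlock (φ : ℕ → 𝓢(Rn n, ℂ)) (f : 𝓢'(Rn n, E)) (θ : 𝓢(Rn n, ℂ)) (j : ℕ) :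
    ∫ x, θ x • dyadicBlock φ f j x =
      f (fourierConst n • waveCLM 0 (smulLeftCLM ℂ (φ j) (expIntegral θ))) := by
  have h := integral_smul_waveCLM (f : 𝓢(Rn n, ℂ) →L[ℂ] E) θ (φ j)
  have e : smulLeftCLM ℂ (φ j) (expIntegral θ) = smulLeftCLM ℂ (expIntegral θ) (φ j) := by
    ext ξ
    rw [smulLeftCLM_apply_apply (expIntegral _).hasTemperateGrowth,
      smulLeftCLM_apply_apply (φ j).hasTemperateGrowth, smul_eq_mul, smul_eq_mul, mul_comm]
  rw [e]
  refine Eq.trans ?_ ((congrArg (fun z => fourierConst n • z) h).trans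
    (map_smul f (fourierConst n) _).symm)
  rw [← integral_smul]
  congr 1
  ext x
  exact smul_comm _ _ _

end

/-! ### Derivatives and partial derivatives -/

theorem norm_le_sum_single {F : Type*} [NormedAddCommGroup F] [NormedSpace ℝ F] {k : ℕ}
    (A : ContinuousMultilinearMap ℝ (fun _ : Fin k => Rn n) F) :
    ‖A‖ ≤ ∑ i : Fin k → Fin n, ‖A fun j => EuclideanSpace.single (i j) (1 : ℝ)‖ := by
  refine A.opNorm_le_bound (Finset.sum_nonneg fun i _ => norm_nonneg _) fun v => ?_
  have hv : v = fun j => ∑ i : Fin n, v j i • EuclideanSpace.single i (1 : ℝ) := by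
    funext j
    ext l
    simp [Finset.sum_apply, Pi.single_apply]
  conv_lhs => rw [hv, A.map_sum]
  refine (norm_sum_le _ _).trans ?_
  rw [Finset.sum_mul]
  refine Finset.sum_le_sum fun i _ => ?_
  rw [A.map_smul_univ, norm_smul, mul_comm, norm_prod]
  gcongr with j
  exact PiLp.norm_apply_le (v j) (i j)

theorem norm_iteratedFDeriv_le_sum_pderiv {F : Type*} [NormedAddCommGroup F] [NormedSpace ℝ F]
    (k : ℕ) (g : Rn n → F) (x : Rn n) :
    ‖iteratedFDeriv ℝ k g x‖ ≤ ∑ i : Fin k → Fin n, ‖pderiv i g x‖ :=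
  norm_le_sum_single _

theorem norm_pderiv_le {F : Type*} [NormedAddCommGroup F] [NormedSpace ℝ F]
    {k : ℕ} (i : Fin k → Fin n) (g : Rn n → F) (x : Rn n) :
    ‖pderiv i g x‖ ≤ ‖iteratedFDeriv ℝ k g x‖ := by
  refine ((iteratedFDeriv ℝ k g x).le_opNorm _).trans (le_of_eq ?_)
  simp

theorem IsDyadicResolution.exists_norm_iteratedFDeriv_le {φ : ℕ → 𝓢(Rn n, ℂ)}
    (hφ : IsDyadicResolution φ) (k : ℕ) : ∃ C : ℝ, 0 ≤ C ∧ ∀ (j : ℕ) (ξ : Rn n),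
      ‖iteratedFDeriv ℝ k (φ j) ξ‖ ≤ C * (2 : ℝ) ^ (-((j : ℤ) * (k : ℤ))) := by
  choose c hc using hφ.deriv_le k
  refine ⟨∑ i, |c i|, Finset.sum_nonneg fun i _ => abs_nonneg _, fun j ξ => ?_⟩
  refine (norm_iteratedFDeriv_le_sum_pderiv k _ ξ).trans ?_
  rw [Finset.sum_mul]
  refine Finset.sum_le_sum fun i _ => (hc i j ξ).trans ?_
  gcongr
  exact le_abs_self _

/-- Leibniz' rule for a product of Schwartz functions. -/
theorem pow_mul_norm_iteratedFDeriv_smulLeftCLM_le {g φ : 𝓢(Rn n, ℂ)} {k a l : ℕ} (hl : l ≤ k)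
    {G P : ℝ} (x : Rn n) (hG : ∀ i ≤ k, ‖iteratedFDeriv ℝ i g x‖ ≤ G)
    (hP : ∀ i ≤ k, ‖x‖ ^ a * ‖iteratedFDeriv ℝ i φ x‖ ≤ P) :
    ‖x‖ ^ a * ‖iteratedFDeriv ℝ l (smulLeftCLM ℂ g φ) x‖ ≤ 2 ^ k * G * P := by
  have hG0 : 0 ≤ G := (norm_nonneg _).trans (hG 0 (Nat.zero_le _))
  have hP0 : 0 ≤ P := (by positivity : (0:ℝ) ≤ _).trans (hP 0 (Nat.zero_le _))
  have e : ⇑(smulLeftCLM ℂ g φ) = fun x => g x * φ x := by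
    ext x; rw [smulLeftCLM_apply_apply g.hasTemperateGrowth, smul_eq_mul]
  have h := norm_iteratedFDeriv_mul_le (𝕜 := ℝ) (n := l) (N := (⊤ : ℕ∞)) (g.smooth ⊤)
    (φ.smooth ⊤) x (mod_cast le_top)
  rw [e]
  calc _ ≤ ‖x‖ ^ a * ∑ i ∈ Finset.range (l + 1), (l.choose i : ℝ) * ‖iteratedFDeriv ℝ i g x‖ *
        ‖iteratedFDeriv ℝ (l - i) φ x‖ := by gcongr
    _ ≤ ∑ i ∈ Finset.range (l + 1), (l.choose i : ℝ) * (G * P) := by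
        rw [Finset.mul_sum]
        refine Finset.sum_le_sum fun i hi => ?_
        have hi' : i ≤ l := Nat.lt_succ_iff.1 (Finset.mem_range.1 hi)
        calc _ = (l.choose i : ℝ) * (‖iteratedFDeriv ℝ i g x‖ *
              (‖x‖ ^ a * ‖iteratedFDeriv ℝ (l - i) φ x‖)) := by ring
          _ ≤ _ := by
            gcongr
            · exact hG i (hi'.trans hl)
            · exact hP _ ((Nat.sub_le _ _).trans hl)
    _ = 2 ^ l * G * P := by
        rw [← Finset.sum_mul]
        have := Nat.sum_range_choose l
        have h2 : ∑ i ∈ Finset.range (l + 1), (l.choose i : ℝ) = 2 ^ l := by exact_mod_cast this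
        rw [h2]; ring
    _ ≤ _ := by gcongr; norm_num

theorem schwartzNorm_smulLeftCLM_le (k : ℕ) (g φ : 𝓢(Rn n, ℂ)) :
    schwartzNorm k (smulLeftCLM ℂ g φ) ≤ 2 ^ k * schwartzNorm k g * schwartzNorm k φ := by
  have h1 : 0 ≤ schwartzNorm k φ := apply_nonneg _ _
  have h2 : 0 ≤ schwartzNorm k g := apply_nonneg _ _
  refine schwartzNorm_le (by positivity) fun a ha b hb =>
    SchwartzMap.seminorm_le_bound ℂ a b _ (by positivity) fun x => ?_
  refine pow_mul_norm_iteratedFDeriv_smulLeftCLM_le hb x (fun i hi => ?_) (fun i hi => ?_)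
  · exact (norm_iteratedFDeriv_le_seminorm ℂ g i x).trans
      (seminorm_le_schwartzNorm (Nat.zero_le _) hi _)
  · exact (le_seminorm ℂ a i φ x).trans (seminorm_le_schwartzNorm ha hi _)

theorem IsDyadicResolution.norm_le {φ : ℕ → 𝓢(Rn n, ℂ)} (hφ : IsDyadicResolution φ) {j : ℕ}
    {ξ : Rn n} (hξ : ξ ∈ tsupport (φ j)) : ‖ξ‖ ≤ 2 ^ (j + 1) := by
  rcases Nat.eq_zero_or_pos j with rfl | hj
  · simpa using hφ.supp_zero hξ
  · exact (hφ.supp_succ j hj hξ).2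

theorem IsDyadicResolution.le_norm {φ : ℕ → 𝓢(Rn n, ℂ)} (hφ : IsDyadicResolution φ) {j : ℕ}
    (hj : 1 ≤ j) {ξ : Rn n} (hξ : ξ ∈ tsupport (φ j)) : 2 ^ j / 2 ≤ ‖ξ‖ := by
  have := (hφ.supp_succ j hj hξ).1
  rwa [zpow_sub_one₀ two_ne_zero, zpow_natCast, ← div_eq_mul_inv] at this

/-- On the support of φ_{j+1} one has |ξ| ≥ 2^j, so one extra power of |ξ| in the seminorm of g buys
a factor 2^{-j}; the derivatives of the φ_j are uniformly bounded. Hence the series converges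
absolutely in every Schwartz seminorm. -/
theorem IsDyadicResolution.hasSum_smulLeftCLM {φ : ℕ → 𝓢(Rn n, ℂ)} (hφ : IsDyadicResolution φ)
    (g : 𝓢(Rn n, ℂ)) : HasSum (fun j => smulLeftCLM ℂ (φ j) g) g := by
  refine hasSum_schwartz (fun k => ?_) fun x => ?_
  · choose C hC h using hφ.exists_norm_iteratedFDeriv_le
    set D := ∑ i ∈ Finset.range (k + 2), C i with hD
    have hD0 : 0 ≤ D := Finset.sum_nonneg fun i _ => hC i
    have hDi : ∀ i ≤ k + 1, ∀ j ξ, ‖iteratedFDeriv ℝ i (φ j) ξ‖ ≤ D := by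
      intro i hi j ξ
      have h1 : C i ≤ D := Finset.single_le_sum (fun i _ => hC i)
        (Finset.mem_range.2 (Nat.lt_succ_of_le hi))
      refine (h i j ξ).trans ((mul_le_of_le_one_right (hC i) ?_).trans h1)
      exact zpow_le_one_of_nonpos₀ one_le_two (neg_nonpos.2 (by positivity))
    set S := schwartzNorm (k + 1) g
    have hS : 0 ≤ S := apply_nonneg _ _
    rw [← summable_nat_add_iff 1]
    refine Summable.of_nonneg_of_le (fun j => apply_nonneg _ _)
      (fun j => ?_) ((summable_geometric_two).mul_left (2 ^ (k + 1) * D * S))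
    refine schwartzNorm_le (by positivity) fun a ha b hb =>
      SchwartzMap.seminorm_le_bound ℂ a b _ (by positivity) fun x => ?_
    by_cases hx : x ∈ tsupport (φ (j + 1))
    · have h1 := hφ.le_norm (by omega) hx
      rw [pow_succ, mul_div_assoc, div_self two_ne_zero, mul_one] at h1
      have h2 := pow_mul_norm_iteratedFDeriv_smulLeftCLM_le (k := k + 1) (a := a + 1)
        (g := φ (j + 1)) (φ := g) (l := b) (by omega) (G := D) (P := S)
        x (fun i hi => hDi i hi _ x)
        (fun i hi => (le_seminorm ℂ _ i g x).trans (seminorm_le_schwartzNorm (by omega) hi _))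
      rw [one_div, inv_pow, ← div_eq_mul_inv, le_div_iff₀ (by positivity), mul_comm]
      refine le_trans ?_ h2
      rw [pow_succ' ‖x‖, mul_assoc]
      exact mul_le_mul_of_nonneg_right h1 (by positivity)
    · have : iteratedFDeriv ℝ b (smulLeftCLM ℂ (φ (j + 1)) g) x = 0 := by
        by_contra h0
        have := support_iteratedFDeriv_subset (𝕜 := ℝ) b (Function.mem_support.2 h0)
        exact hx ((tsupport_smulLeftCLM_subset _ _ this).2)
      rw [this, norm_zero, mul_zero]
      positivity
  · simp_rw [smulLeftCLM_apply_apply (φ _).hasTemperateGrowth, smul_eq_mul]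
    simpa using (hφ.sum_eq_one x).mul_right (g x)

section

variable {E : Type*} [NormedAddCommGroup E] [NormedSpace ℂ E] [CompleteSpace E]

theorem IsDyadicResolution.hasSum_integral_dyadicBlock {φ : ℕ → 𝓢(Rn n, ℂ)}
    (hφ : IsDyadicResolution φ) (f : 𝓢'(Rn n, E)) (θ : 𝓢(Rn n, ℂ)) :
    HasSum (fun j => ∫ x, θ x • dyadicBlock φ f j x) (f θ) := by
  simp_rw [integral_smul_dyadicBlock]
  have h := (hφ.hasSum_smulLeftCLM (expIntegral θ)).mapL
    ((f : 𝓢(Rn n, ℂ) →L[ℂ] E) ∘L (fourierConst n • waveCLM 0))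
  have e : (f : 𝓢(Rn n, ℂ) →L[ℂ] E) (fourierConst n • waveCLM 0 (expIntegral θ)) = f θ :=
    congrArg f (fourierConst_smul_waveCLM_expIntegral θ)
  exact e ▸ h

end

variable {n : ℕ}

/-! ### Dilations -/

/-- The dilation operator `h ↦ h(2^j ·)` on Schwartz functions. -/
def dilCLM (j : ℤ) : 𝓢(Rn n, ℂ) →L[ℂ] 𝓢(Rn n, ℂ) :=
  compCLMOfContinuousLinearEquiv ℂ
    (ContinuousLinearEquiv.smulLeft (Units.mk0 ((2 : ℝ) ^ j) (by positivity)))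

theorem dilCLM_apply (j : ℤ) (h : 𝓢(Rn n, ℂ)) (x : Rn n) : dilCLM j h x = h ((2 : ℝ) ^ j • x) := rfl

theorem dilCLM_dilCLM (i j : ℤ) (h : 𝓢(Rn n, ℂ)) : dilCLM i (dilCLM j h) = dilCLM (i + j) h := by
  ext x
  rw [dilCLM_apply, dilCLM_apply, dilCLM_apply, smul_smul, ← zpow_add₀ two_ne_zero, add_comm]

theorem dilCLM_zero (h : 𝓢(Rn n, ℂ)) : dilCLM 0 h = h := by
  ext x
  simp [dilCLM_apply]

theorem dilCLM_smulLeftCLM (j : ℤ) (g h : 𝓢(Rn n, ℂ)) :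
    dilCLM j (smulLeftCLM ℂ g h) = smulLeftCLM ℂ (dilCLM j g) (dilCLM j h) := by
  ext x
  rw [dilCLM_apply, smulLeftCLM_apply_apply g.hasTemperateGrowth,
    smulLeftCLM_apply_apply (dilCLM j g).hasTemperateGrowth, dilCLM_apply, dilCLM_apply]

theorem iteratedFDeriv_dilCLM (j : ℤ) (h : 𝓢(Rn n, ℂ)) (l : ℕ) (x : Rn n) :
    iteratedFDeriv ℝ l (dilCLM j h) x =
      ((2 : ℝ) ^ j) ^ l • iteratedFDeriv ℝ l h ((2 : ℝ) ^ j • x) := by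
  have : ⇑(dilCLM j h) = fun z => h ((2 : ℝ) ^ j • z) := rfl
  rw [this, iteratedFDeriv_comp_const_smul _ (h.smooth l)]

theorem invFourier_dilCLM (j : ℤ) (h : 𝓢(Rn n, ℂ)) :
    invFourier (dilCLM (-j) h) = (((2 : ℝ) ^ j) ^ n : ℝ) • dilCLM j (invFourier h) := by
  ext x
  rw [smul_apply, dilCLM_apply, invFourier_apply, invFourier_apply, Complex.real_smul,
    mul_left_comm]
  congr 1
  have := Measure.integral_comp_smul volume (fun ξ : Rn n =>
    Complex.exp (((inner ℝ ((2 : ℝ) ^ j • x) ξ : ℝ) : ℂ) * Complex.I) * h ξ) ((2 : ℝ) ^ (-j))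
  rw [finrank_euclideanSpace_fin, abs_of_pos (by positivity), zpow_neg, inv_pow, inv_inv,
    Complex.real_smul] at this
  rw [← this]
  congr 1
  ext ξ
  rw [dilCLM_apply, inner_smul_left, inner_smul_right, zpow_neg, RCLike.conj_to_real,
    mul_inv_cancel_left₀ (by positivity)]

/-- The kernels of dilated frequency cut-offs are localised at scale `2^{-j}`. -/
theorem exists_norm_iteratedFDeriv_invFourier_dilCLM_le (A l : ℕ) : ∃ (k : ℕ) (C : ℝ), 0 ≤ C ∧
    ∀ (h : 𝓢(Rn n, ℂ)) (j : ℕ) (x : Rn n),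
      ‖iteratedFDeriv ℝ l (invFourier (dilCLM (-(j : ℤ)) h)) x‖ ≤
        C * schwartzNorm k h * (((2 : ℝ) ^ j) ^ (n + l) * ((1 + 2 ^ j * ‖x‖) ^ A)⁻¹) := by
  obtain ⟨k, C, hC, hk⟩ := exists_schwartzNorm_le
    (fourierConst n • (compCLMOfContinuousLinearEquiv ℂ (dilTwoPi n) ∘L
      FourierTransform.fourierInvCLM ℂ 𝓢(Rn n, ℂ))) (max A l)
  refine ⟨k, 2 ^ max A l * C, by positivity, fun h j x => ?_⟩
  have hh : schwartzNorm (max A l) (invFourier h) ≤ C * schwartzNorm k h := hk h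
  have h1 := one_add_pow_mul_le A l (invFourier h) ((2 : ℝ) ^ (j : ℤ) • x)
  rw [norm_smul, Real.norm_of_nonneg (by positivity), zpow_natCast] at h1
  have e : ⇑(invFourier (dilCLM (-(j : ℤ)) h)) =
      (((2 : ℝ) ^ (j : ℤ)) ^ n : ℝ) • ⇑(dilCLM j (invFourier h)) := by
    rw [invFourier_dilCLM]; rfl
  rw [e, iteratedFDeriv_const_smul_apply ((dilCLM j (invFourier h)).contDiffAt _),
    iteratedFDeriv_dilCLM, smul_smul, ← pow_add, norm_smul, Real.norm_of_nonneg (by positivity),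
    zpow_natCast]
  have h2 : ‖iteratedFDeriv ℝ l (invFourier h) ((2 : ℝ) ^ j • x)‖ ≤
      2 ^ max A l * (C * schwartzNorm k h) * ((1 + 2 ^ j * ‖x‖) ^ A)⁻¹ := by
    rw [← div_eq_mul_inv, le_div_iff₀ (by positivity), mul_comm]
    exact h1.trans (mul_le_mul_of_nonneg_left hh (by positivity))
  calc _ ≤ ((2 : ℝ) ^ j) ^ (n + l) *
        (2 ^ max A l * (C * schwartzNorm k h) * ((1 + 2 ^ j * ‖x‖) ^ A)⁻¹) := by gcongr
    _ = _ := by ring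

theorem exists_norm_invFourier_dilCLM_le (A : ℕ) : ∃ (k : ℕ) (C : ℝ), 0 ≤ C ∧
    ∀ (h : 𝓢(Rn n, ℂ)) (j : ℕ) (x : Rn n),
      ‖invFourier (dilCLM (-(j : ℤ)) h) x‖ ≤
        C * schwartzNorm k h * (((2 : ℝ) ^ j) ^ n * ((1 + 2 ^ j * ‖x‖) ^ A)⁻¹) := by
  obtain ⟨k, C, hC, h⟩ := exists_norm_iteratedFDeriv_invFourier_dilCLM_le (n := n) A 0
  exact ⟨k, C, hC, fun g j x => by simpa using h g j x⟩

/-! ### Normalised dyadic pieces -/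

section

variable {φ : ℕ → 𝓢(Rn n, ℂ)}

theorem IsDyadicResolution.dilCLM_eq_zero (hφ : IsDyadicResolution φ) {j : ℕ} {ξ : Rn n} (hξ : 2 < ‖ξ‖) :
    dilCLM j (φ j) ξ = 0 := by
  rw [dilCLM_apply]
  by_contra h
  have := hφ.norm_le (subset_tsupport _ (Function.mem_support.2 h))
  rw [norm_smul, Real.norm_of_nonneg (by positivity), zpow_natCast, pow_succ] at this
  exact absurd (le_of_mul_le_mul_left this (by positivity)) (not_le.2 hξ)

theorem IsDyadicResolution.dilCLM_eq_zero' (hφ : IsDyadicResolution φ) {j : ℕ} (hj : 1 ≤ j) {ξ : Rn n} (hξ : ‖ξ‖ < 1 / 2) :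
    dilCLM j (φ j) ξ = 0 := by
  rw [dilCLM_apply]
  by_contra h
  have := hφ.le_norm hj (subset_tsupport _ (Function.mem_support.2 h))
  rw [norm_smul, Real.norm_of_nonneg (by positivity), zpow_natCast, div_eq_mul_one_div] at this
  exact absurd (le_of_mul_le_mul_left this (by positivity)) (not_le.2 hξ)

/-- The chain rule factor 2^{jb} cancels the assumed decay of the b-th derivatives, and the support
in the ball of radius 2 bounds the polynomial weights. -/
theorem IsDyadicResolution.exists_schwartzNorm_dilCLM_le (hφ : IsDyadicResolution φ) (k : ℕ) :
    ∃ C : ℝ, 0 ≤ C ∧ ∀ j : ℕ, schwartzNorm k (dilCLM j (φ j)) ≤ C := by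
  choose C hC h using hφ.exists_norm_iteratedFDeriv_le
  have hD0 : 0 ≤ ∑ i ∈ Finset.range (k + 1), C i := Finset.sum_nonneg fun i _ => hC i
  refine ⟨2 ^ k * ∑ i ∈ Finset.range (k + 1), C i, by positivity, fun j => ?_⟩
  refine schwartzNorm_le (by positivity) fun a ha b hb =>
    SchwartzMap.seminorm_le_bound ℂ a b _ (by positivity) fun x => ?_
  have h1 : C b ≤ ∑ i ∈ Finset.range (k + 1), C i := Finset.single_le_sum (fun i _ => hC i)
    (Finset.mem_range.2 (Nat.lt_succ_of_le hb))
  rcases le_or_gt ‖x‖ 2 with hx | hx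
  · have h2 : ‖iteratedFDeriv ℝ b (dilCLM j (φ j)) x‖ ≤ C b := by
      rw [iteratedFDeriv_dilCLM, norm_smul, Real.norm_of_nonneg (by positivity)]
      have h3 := h b j ((2 : ℝ) ^ (j : ℤ) • x)
      rw [zpow_neg, ← div_eq_mul_inv, le_div_iff₀ (by positivity), mul_comm, zpow_mul] at h3
      exact_mod_cast h3
    have h4 : ‖x‖ ^ a ≤ 2 ^ k :=
      (pow_le_pow_left₀ (norm_nonneg _) hx a).trans (pow_le_pow_right₀ one_le_two ha)
    exact mul_le_mul h4 (h2.trans h1) (norm_nonneg _) (by positivity)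
  · have : iteratedFDeriv ℝ b (dilCLM j (φ j)) x = 0 := by
      have h0 : ⇑(dilCLM j (φ j)) =ᶠ[nhds x] fun _ => 0 := by
        filter_upwards [(isOpen_lt continuous_const continuous_norm).mem_nhds hx] with y hy
        exact hφ.dilCLM_eq_zero hy
      rw [(h0.iteratedFDeriv ℝ b).eq_of_nhds]
      simp
    rw [this, norm_zero, mul_zero]
    positivity

end

theorem dilCLM_neg_dilCLM (j : ℤ) (h : 𝓢(Rn n, ℂ)) : dilCLM (-j) (dilCLM j h) = h := by
  rw [dilCLM_dilCLM, neg_add_cancel, dilCLM_zero]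

/-! ### Cut-off functions -/

/-- A cut-off function which is `1` on the ball of radius `2`. -/
def freqCutoff (n : ℕ) : ContDiffBump (0 : Rn n) := ⟨2, 3, by norm_num, by norm_num⟩

/-- A smooth cut-off multiplied by a smooth function, as a Schwartz function. -/
theorem exists_schwartz_mul_freqCutoff {g : Rn n → ℂ} (hg : ContDiff ℝ (⊤ : ℕ∞) g) :
    ∃ h : 𝓢(Rn n, ℂ), ∀ ξ, h ξ = (freqCutoff n ξ : ℂ) * g ξ := by
  have hc : HasCompactSupport fun ξ : Rn n => (freqCutoff n ξ : ℂ) * g ξ := by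
    have h1 : HasCompactSupport fun ξ : Rn n => (freqCutoff n ξ : ℂ) :=
      (freqCutoff n).hasCompactSupport.comp_left (g := fun t : ℝ => (t : ℂ)) Complex.ofReal_zero
    exact h1.mul_right
  have hs : ContDiff ℝ (⊤ : ℕ∞) fun ξ : Rn n => (freqCutoff n ξ : ℂ) * g ξ :=
    (Complex.ofRealCLM.contDiff.comp (freqCutoff n).contDiff).mul hg
  exact ⟨hc.toSchwartzMap hs, fun ξ => rfl⟩

theorem freqCutoff_eq_one {ξ : Rn n} (h : ‖ξ‖ ≤ 2) : freqCutoff n ξ = 1 :=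
  (freqCutoff n).one_of_mem_closedBall (by simpa [freqCutoff] using h)

/-- Smooth frequency cut-offs inverting a power of the symbol of the Laplacian. -/
theorem exists_inverse_symbol (n r : ℕ) : ∃ σ : 𝓢(Rn n, ℂ), ∀ ξ : Rn n, ‖ξ‖ ≤ 2 →
    (1 / 2 ≤ ‖ξ‖ ∨ r = 0) → (-(‖ξ‖ : ℂ) ^ 2) ^ r * σ ξ = 1 := by
  rcases Nat.eq_zero_or_pos r with rfl | hr
  · obtain ⟨h, hh⟩ := exists_schwartz_mul_freqCutoff (n := n) (g := fun _ => 1) contDiff_const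
    refine ⟨h, fun ξ hξ _ => ?_⟩
    rw [hh, freqCutoff_eq_one hξ]
    simp
  -- This bump removes the singularity of |ξ|^{-2r} at the origin and vanishes where |ξ| ≥ 1/2, so
  -- it does not disturb the identity claimed there.
  let b : ContDiffBump (0 : Rn n) := ⟨1 / 8, 1 / 4, by norm_num, by norm_num⟩
  have hsm : ContDiff ℝ (⊤ : ℕ∞) fun ξ : Rn n =>
      ((1 - b ξ : ℝ) : ℂ) * ((((-‖ξ‖ ^ 2) ^ r)⁻¹ : ℝ) : ℂ) := by
    rw [contDiff_iff_contDiffAt]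
    intro ξ
    by_cases h0 : ξ = 0
    · subst h0
      have : (fun ξ : Rn n => ((1 - b ξ : ℝ) : ℂ) * ((((-‖ξ‖ ^ 2) ^ r)⁻¹ : ℝ) : ℂ)) =ᶠ[nhds 0]
          fun _ => 0 := by
        filter_upwards [b.eventuallyEq_one] with ξ hξ
        rw [hξ]
        simp
      exact contDiffAt_const.congr_of_eventuallyEq this
    · have h1 : ContDiffAt ℝ (⊤ : ℕ∞) (fun ξ : Rn n => (-‖ξ‖ ^ 2) ^ r) ξ :=
        (((contDiff_norm_sq ℝ).neg).pow r).contDiffAt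
      have h2 : (-‖ξ‖ ^ 2) ^ r ≠ 0 := pow_ne_zero _ (neg_ne_zero.2 (by positivity))
      have h3 : ContDiffAt ℝ (⊤ : ℕ∞) (fun ξ : Rn n => (1 - b ξ) * ((-‖ξ‖ ^ 2) ^ r)⁻¹) ξ :=
        (contDiffAt_const.sub b.contDiff.contDiffAt).mul (h1.inv h2)
      have h4 := Complex.ofRealCLM.contDiff.contDiffAt.comp ξ h3
      refine h4.congr_of_eventuallyEq (Filter.Eventually.of_forall fun ξ => ?_)
      simp
  obtain ⟨h, hh⟩ := exists_schwartz_mul_freqCutoff hsm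
  refine ⟨h, fun ξ hξ h2 => ?_⟩
  have h3 : 1 / 2 ≤ ‖ξ‖ := h2.resolve_right hr.ne'
  have h4 : b ξ = 0 := b.zero_of_le_dist (by rw [dist_zero_right]; exact le_trans (by norm_num) h3)
  have h5 : (-(‖ξ‖ : ℂ) ^ 2) ^ r ≠ 0 := by
    refine pow_ne_zero _ (neg_ne_zero.2 (pow_ne_zero _ ?_))
    have : ‖ξ‖ ≠ 0 := by linarith
    exact_mod_cast this
  rw [hh, freqCutoff_eq_one hξ, h4]
  push_cast
  simp [h5]

/-! ### Multiplication by monomials in the frequency variable -/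

theorem exists_freqCoord (k : Fin n) : ∃ h : 𝓢(Rn n, ℂ), ∀ ξ, h ξ =
    (freqCutoff n ξ : ℂ) * (Complex.I * (ξ k : ℂ)) := by
  refine exists_schwartz_mul_freqCutoff ?_
  have h1 : ContDiff ℝ (⊤ : ℕ∞) fun ξ : Rn n => ξ k := by fun_prop
  exact contDiff_const.mul (Complex.ofRealCLM.contDiff.comp h1)

/-- The truncated frequency coordinate `i ξ_k`. -/
def freqCoord (k : Fin n) : 𝓢(Rn n, ℂ) := (exists_freqCoord k).choose

theorem freqCoord_apply {k : Fin n} {ξ : Rn n} (h : ‖ξ‖ ≤ 2) :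
    freqCoord k ξ = Complex.I * (ξ k : ℂ) := by
  rw [freqCoord, (exists_freqCoord k).choose_spec, freqCutoff_eq_one h]
  simp

theorem hasTemperateGrowth_prod_freqCoord (β : Fin n → ℕ) (s : Finset (Fin n)) :
    Function.HasTemperateGrowth fun ξ : Rn n => ∏ k ∈ s, freqCoord k ξ ^ β k := by
  induction s using Finset.induction_on with
  | empty => simp
  | insert a s ha ih =>
    simp_rw [Finset.prod_insert ha]
    exact ((freqCoord a).hasTemperateGrowth.pow _).mul ih

/-- Multiplication by the truncated monomial `(iξ)^β`. -/
def freqMonomial (β : Fin n → ℕ) : 𝓢(Rn n, ℂ) →L[ℂ] 𝓢(Rn n, ℂ) :=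
  smulLeftCLM ℂ fun ξ : Rn n => ∏ k, freqCoord k ξ ^ β k

theorem freqMonomial_apply (β : Fin n → ℕ) (h : 𝓢(Rn n, ℂ)) (ξ : Rn n) :
    freqMonomial β h ξ = (∏ k, freqCoord k ξ ^ β k) * h ξ := by
  rw [freqMonomial, smulLeftCLM_apply_apply (hasTemperateGrowth_prod_freqCoord β _), smul_eq_mul]

/-- The truncated coordinates are fixed Schwartz functions, so each multiplication by one of them
costs a constant factor. The growth is therefore only exponential in |β|, which division by β! turns
into convergence of Taylor series with room to spare. -/
theorem exists_schwartzNorm_freqMonomial_le (n l : ℕ) : ∃ B : ℝ, 1 ≤ B ∧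
    ∀ (β : Fin n → ℕ) (h : 𝓢(Rn n, ℂ)),
      schwartzNorm l (freqMonomial β h) ≤ B ^ (∑ k, β k) * schwartzNorm l h := by
  set B : ℝ := 1 + ∑ k : Fin n, 2 ^ l * schwartzNorm l (freqCoord k) with hB
  have hnn : ∀ k : Fin n, 0 ≤ 2 ^ l * schwartzNorm l (freqCoord k) := fun k => by
    have : 0 ≤ schwartzNorm l (freqCoord k) := apply_nonneg _ _
    positivity
  have hB1 : 1 ≤ B := by
    have := Finset.sum_nonneg fun k (_ : k ∈ Finset.univ) => hnn k
    linarith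
  have hk : ∀ k, 2 ^ l * schwartzNorm l (freqCoord k) ≤ B := fun k => by
    have := Finset.single_le_sum (fun k _ => hnn k) (Finset.mem_univ k)
    linarith
  refine ⟨B, hB1, fun β h => ?_⟩
  have hpow : ∀ (k : Fin n) (b : ℕ) (h : 𝓢(Rn n, ℂ)),
      schwartzNorm l (smulLeftCLM ℂ (fun ξ => freqCoord k ξ ^ b) h) ≤ B ^ b * schwartzNorm l h := by
    intro k b h
    induction b with
    | zero => simp [smulLeftCLM_const]
    | succ b ih =>
      have e : smulLeftCLM ℂ (fun ξ => freqCoord k ξ ^ (b + 1)) h =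
          smulLeftCLM ℂ (freqCoord k) (smulLeftCLM ℂ (fun ξ => freqCoord k ξ ^ b) h) := by
        rw [smulLeftCLM_smulLeftCLM_apply (freqCoord k).hasTemperateGrowth
          (g₂ := fun ξ => freqCoord k ξ ^ b) ((freqCoord k).hasTemperateGrowth.pow b)]
        congr 2
        ext ξ
        exact pow_succ' _ _
      rw [e]
      refine (schwartzNorm_smulLeftCLM_le l _ _).trans ?_
      rw [pow_succ', mul_assoc B]
      exact mul_le_mul (hk k) ih (apply_nonneg _ _) (zero_le_one.trans hB1)
  have hs : ∀ s : Finset (Fin n), schwartzNorm l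
      (smulLeftCLM ℂ (fun ξ : Rn n => ∏ k ∈ s, freqCoord k ξ ^ β k) h) ≤
        B ^ (∑ k ∈ s, β k) * schwartzNorm l h := by
    intro s
    induction s using Finset.induction_on with
    | empty => simp [smulLeftCLM_const]
    | insert a s ha ih =>
      have e : smulLeftCLM ℂ (fun ξ : Rn n => ∏ k ∈ insert a s, freqCoord k ξ ^ β k) h =
          smulLeftCLM ℂ (fun ξ => freqCoord a ξ ^ β a)
            (smulLeftCLM ℂ (fun ξ : Rn n => ∏ k ∈ s, freqCoord k ξ ^ β k) h) := by
        rw [smulLeftCLM_smulLeftCLM_apply (g₁ := fun ξ => freqCoord a ξ ^ β a)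
          ((freqCoord a).hasTemperateGrowth.pow _)
          (hasTemperateGrowth_prod_freqCoord β s)]
        congr 2
        ext ξ
        exact Finset.prod_insert ha
      rw [e, Finset.sum_insert ha, pow_add, mul_assoc]
      exact (hpow a _ _).trans (mul_le_mul_of_nonneg_left ih (by positivity))
  exact hs Finset.univ

/-! ### Taylor expansion of band-limited functions -/

theorem hasSum_prod_pi {n : ℕ} {a : Fin n → ℕ → ℂ} {s : Fin n → ℂ} (ha : ∀ k, HasSum (a k) (s k))
    (hn : ∀ k, Summable fun i => ‖a k i‖) :
    (Summable fun β : Fin n → ℕ => ‖∏ k, a k (β k)‖) ∧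
      HasSum (fun β : Fin n → ℕ => ∏ k, a k (β k)) (∏ k, s k) := by
  induction n with
  | zero =>
    refine ⟨Summable.of_finite, ?_⟩
    convert hasSum_fintype (fun β : Fin 0 → ℕ => ∏ k, a k (β k)) using 1
    simp
  | succ n ih =>
    obtain ⟨h1, h2⟩ := ih (fun k => ha k.succ) (fun k => hn k.succ)
    have h3 : Summable fun x : ℕ × (Fin n → ℕ) => ‖a 0 x.1 * ∏ k : Fin n, a k.succ (x.2 k)‖ := by
      simp_rw [norm_mul]
      exact (hn 0).mul_of_nonneg h1 (fun _ => norm_nonneg _) (fun _ => norm_nonneg _)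
    have h4 := (ha 0).mul h2 h3.of_norm
    rw [← (Fin.consEquiv fun _ => ℕ).summable_iff, ← (Fin.consEquiv fun _ => ℕ).hasSum_iff]
    refine ⟨h3.congr fun x => ?_, ?_⟩
    · simp [Fin.prod_univ_succ, Fin.consEquiv]
    · rw [Fin.prod_univ_succ]
      refine h4.congr_fun fun x => ?_
      simp [Fin.prod_univ_succ, Fin.consEquiv]

/-- The coefficient `u^β / β!`. -/
def taylorCoeff (u : Rn n) (β : Fin n → ℕ) : ℂ := ∏ k, ((u k : ℂ) ^ β k / (β k).factorial)

theorem hasSum_pow_div_factorial (z : ℂ) :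
    HasSum (fun b : ℕ => z ^ b / b.factorial) (Complex.exp z) := by
  rw [Complex.exp_eq_exp_ℂ]
  exact NormedSpace.expSeries_div_hasSum_exp z

theorem summable_pow_div_factorial (z : ℂ) : Summable fun b : ℕ => ‖z ^ b / b.factorial‖ :=
  NormedSpace.norm_expSeries_div_summable z

theorem summable_pow_mul_norm_taylorCoeff (u : Rn n) (B : ℝ) :
    Summable fun β : Fin n → ℕ => ‖taylorCoeff u β‖ * |B| ^ (∑ k, β k) := by
  have h := (hasSum_prod_pi (a := fun k b => ((B : ℂ) * (u k : ℂ)) ^ b / b.factorial)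
    (fun k => hasSum_pow_div_factorial _) (fun k => summable_pow_div_factorial _)).1
  refine h.congr fun β => ?_
  rw [taylorCoeff, ← Finset.prod_pow_eq_pow_sum, norm_prod, norm_prod, ← Finset.prod_mul_distrib]
  refine Finset.prod_congr rfl fun k _ => ?_
  rw [mul_pow, norm_div, norm_div, norm_mul, norm_pow, norm_pow, Complex.norm_real B,
    Real.norm_eq_abs]
  ring

/-- Taylor expansion of a translate with compactly supported frequencies. -/
theorem hasSum_taylorCoeff_waveCLM {h : 𝓢(Rn n, ℂ)} (hh : ∀ ξ, 2 < ‖ξ‖ → h ξ = 0) (j : ℤ)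
    (x u : Rn n) :
    HasSum (fun β => taylorCoeff u β • waveCLM x (dilCLM (-j) (freqMonomial β h)))
      (waveCLM (x + (2 : ℝ) ^ (-j) • u) (dilCLM (-j) h)) := by
  -- The cut-off makes the character e^{i⟨u,ξ⟩} a Schwartz multiplier and is invisible on the ball
  -- of radius 2, outside which h vanishes. The expansion is then the exponential series in
  -- frequency, summed in the Schwartz topology.
  obtain ⟨e, he⟩ := exists_schwartz_mul_freqCutoff (n := n)
    (g := fun ξ => Complex.exp (((inner ℝ u ξ : ℝ) : ℂ) * Complex.I)) (by
      have h1 : ContDiff ℝ (⊤ : ℕ∞) fun ξ : Rn n => inner ℝ u ξ :=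
        contDiff_const.inner ℝ contDiff_id
      exact ((Complex.ofRealCLM.contDiff.comp h1).mul contDiff_const).cexp)
  set g := smulLeftCLM ℂ e h with hg
  have hgx : ∀ ξ, g ξ = Complex.exp (((inner ℝ u ξ : ℝ) : ℂ) * Complex.I) * h ξ := by
    intro ξ
    rw [hg, smulLeftCLM_apply_apply e.hasTemperateGrowth, smul_eq_mul, he]
    rcases le_or_gt ‖ξ‖ 2 with hξ | hξ
    · rw [freqCutoff_eq_one hξ]
      simp
    · rw [hh ξ hξ, mul_zero, mul_zero]
  have hsum : HasSum (fun β => taylorCoeff u β • freqMonomial β h) g := by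
    refine hasSum_schwartz (fun l => ?_) fun ξ => ?_
    · obtain ⟨B, hB1, hB⟩ := exists_schwartzNorm_freqMonomial_le n l
      refine Summable.of_nonneg_of_le (fun _ => apply_nonneg _ _) (fun β => ?_)
        ((summable_pow_mul_norm_taylorCoeff u B).mul_right (schwartzNorm l h))
      rw [map_smul_eq_mul, abs_of_nonneg (zero_le_one.trans hB1), mul_assoc]
      exact mul_le_mul_of_nonneg_left (hB β h) (norm_nonneg _)
    · rw [hgx]
      simp_rw [smul_apply, freqMonomial_apply]
      rcases le_or_gt ‖ξ‖ 2 with hξ | hξ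
      · have h1 := (hasSum_prod_pi (a := fun k b => ((u k : ℂ) * (Complex.I * (ξ k : ℂ))) ^ b /
          b.factorial) (fun k => hasSum_pow_div_factorial _)
          (fun k => summable_pow_div_factorial _)).2.mul_right (h ξ)
        have h2 : ∏ k, Complex.exp ((u k : ℂ) * (Complex.I * (ξ k : ℂ))) =
            Complex.exp (((inner ℝ u ξ : ℝ) : ℂ) * Complex.I) := by
          rw [← Complex.exp_sum]
          congr 1
          simp only [PiLp.inner_apply, RCLike.inner_apply, conj_trivial]
          push_cast
          rw [Finset.sum_mul]
          refine Finset.sum_congr rfl fun k _ => ?_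
          ring
        rw [h2] at h1
        refine h1.congr_fun fun β => ?_
        rw [smul_eq_mul, ← mul_assoc, taylorCoeff, ← Finset.prod_mul_distrib]
        congr 1
        refine Finset.prod_congr rfl fun k _ => ?_
        rw [freqCoord_apply hξ, mul_pow (u k : ℂ)]
        ring
      · simp [hh ξ hξ]
  have h1 := hsum.mapL (waveCLM x ∘L dilCLM (-j))
  have h2 : waveCLM x (dilCLM (-j) g) = waveCLM (x + (2 : ℝ) ^ (-j) • u) (dilCLM (-j) h) := by
    refine waveCLM_exp_mul fun ξ => ?_
    rw [dilCLM_apply, dilCLM_apply, hgx, inner_smul_right, inner_smul_left]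
    simp
  rw [← h2]
  refine h1.congr_fun fun β => ?_
  simp

variable {n : ℕ}

/-! ### Sub-mean value property of band-limited functions -/

/-- The weight `1 + 2^j |z|`. -/
def weight (j : ℕ) (z : Rn n) : ℝ≥0∞ := ENNReal.ofReal (1 + 2 ^ j * ‖z‖)

theorem one_le_weight (j : ℕ) (z : Rn n) : 1 ≤ weight j z := by
  rw [weight, ENNReal.one_le_ofReal]
  have : 0 ≤ (2 : ℝ) ^ j * ‖z‖ := by positivity
  linarith

theorem weight_ne_zero (j : ℕ) (z : Rn n) : weight j z ≠ 0 :=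
  (zero_lt_one.trans_le (one_le_weight j z)).ne'

theorem weight_ne_top (j : ℕ) (z : Rn n) : weight j z ≠ ∞ := ENNReal.ofReal_ne_top

theorem measurable_weight (j : ℕ) : Measurable (weight (n := n) j) :=
  ENNReal.measurable_ofReal.comp (by fun_prop)

theorem weight_neg (j : ℕ) (z : Rn n) : weight j (-z) = weight j z := by
  rw [weight, weight, norm_neg]

theorem weight_sub_le (j : ℕ) (x y z : Rn n) :
    weight j (x - z) ≤ weight j (x - y) * weight j (y - z) := by
  rw [weight, weight, weight, ← ENNReal.ofReal_mul (by positivity)]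
  apply ENNReal.ofReal_le_ofReal
  have h : ‖x - z‖ ≤ ‖x - y‖ + ‖y - z‖ := norm_sub_le_norm_sub_add_norm_sub x y z
  have h2 : (0 : ℝ) ≤ 2 ^ j := by positivity
  nlinarith [mul_nonneg (mul_nonneg h2 (norm_nonneg (x - y))) (mul_nonneg h2 (norm_nonneg (y - z)))]

theorem weight_pow_inv_mul_le (j N : ℕ) (x y z : Rn n) :
    (weight j (y - z) ^ N)⁻¹ * (weight j (x - y) ^ N)⁻¹ ≤ (weight j (x - z) ^ N)⁻¹ := by
  rw [← ENNReal.mul_inv (Or.inl (pow_ne_zero _ (weight_ne_zero _ _)))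
    (Or.inl (ENNReal.pow_ne_top (weight_ne_top _ _))), ← mul_pow, mul_comm]
  exact ENNReal.inv_le_inv.2 (pow_le_pow_left₀ zero_le (weight_sub_le j x y z) N)

theorem eta_eq_weight (j : ℕ) (z : Rn n) :
    eta j z = ENNReal.ofReal ((2 ^ j) ^ n) * (weight j z ^ (n + 1))⁻¹ := by
  rw [eta, ENNReal.ofReal_mul (by positivity), weight, ← ENNReal.ofReal_pow (by positivity),
    ENNReal.ofReal_inv_of_pos (by positivity)]

/-- Convolution with the kernel `2^{jn} (1 + 2^j |·|)^{-N}`. -/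
def polyConv (j N : ℕ) (u : Rn n → ℝ≥0∞) (x : Rn n) : ℝ≥0∞ :=
  ∫⁻ y, ENNReal.ofReal ((2 ^ j) ^ n) * ((weight j (x - y) ^ N)⁻¹ * u y)

/-- The convolution of `u^r` with the `r`-th power of the weight. -/
def polyConvPow (r : ℝ) (j N : ℕ) (u : Rn n → ℝ≥0∞) (x : Rn n) : ℝ≥0∞ :=
  ∫⁻ y, ENNReal.ofReal ((2 ^ j) ^ n) * ((weight j (x - y) ^ N)⁻¹ * u y) ^ r

theorem polyConv_mul_le (j N : ℕ) (u : Rn n → ℝ≥0∞) (x y : Rn n) :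
    polyConv j N u y * (weight j (x - y) ^ N)⁻¹ ≤ polyConv j N u x := by
  have hc : (weight j (x - y) ^ N)⁻¹ ≠ ∞ :=
    ENNReal.inv_ne_top.2 (pow_ne_zero _ (weight_ne_zero _ _))
  rw [polyConv, ← lintegral_mul_const' _ _ hc]
  refine lintegral_mono fun z => ?_
  dsimp only
  calc _ = ENNReal.ofReal ((2 ^ j) ^ n) *
        (((weight j (y - z) ^ N)⁻¹ * (weight j (x - y) ^ N)⁻¹) * u z) := by ring
    _ ≤ _ := by gcongr; exact weight_pow_inv_mul_le j N x y z

theorem polyConvPow_mul_le {r : ℝ} (hr : 0 ≤ r) (j N : ℕ) (u : Rn n → ℝ≥0∞) (x y : Rn n) :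
    polyConvPow r j N u y * ((weight j (x - y) ^ N)⁻¹) ^ r ≤ polyConvPow r j N u x := by
  have hc : ((weight j (x - y) ^ N)⁻¹) ^ r ≠ ∞ :=
    ENNReal.rpow_ne_top_of_nonneg hr (ENNReal.inv_ne_top.2 (pow_ne_zero _ (weight_ne_zero _ _)))
  rw [polyConvPow, ← lintegral_mul_const' _ _ hc]
  refine lintegral_mono fun z => ?_
  dsimp only
  rw [mul_assoc, ← ENNReal.mul_rpow_of_nonneg _ _ hr]
  refine mul_le_mul' le_rfl (ENNReal.rpow_le_rpow ?_ hr)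
  calc _ = ((weight j (y - z) ^ N)⁻¹ * (weight j (x - y) ^ N)⁻¹) * u z := by ring
    _ ≤ _ := by gcongr; exact weight_pow_inv_mul_le j N x y z

theorem weight_pow_inv_anti (j : ℕ) (z : Rn n) {N N' : ℕ} (h : N ≤ N') :
    (weight j z ^ N')⁻¹ ≤ (weight j z ^ N)⁻¹ :=
  ENNReal.inv_le_inv.2 (pow_le_pow_right₀ (one_le_weight j z) h)

theorem polyConvPow_anti {r : ℝ} (hr : 0 ≤ r) (j : ℕ) {N N' : ℕ} (h : N ≤ N') (u : Rn n → ℝ≥0∞)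
    (x : Rn n) : polyConvPow r j N' u x ≤ polyConvPow r j N u x := by
  refine lintegral_mono fun z => ?_
  exact mul_le_mul' le_rfl
    (ENNReal.rpow_le_rpow (mul_le_mul' (weight_pow_inv_anti j _ h) le_rfl) hr)

theorem polyConvPow_le_avg {r : ℝ} (hr : 0 < r) (j : ℕ) {N : ℕ} (hN : (n + 1 : ℝ) ≤ N * r)
    (u : Rn n → ℝ≥0∞) (x : Rn n) : polyConvPow r j N u x ≤ avg r j u x ^ r := by
  rw [avg_rpow hr, etaConv]
  refine lintegral_mono fun z => ?_
  dsimp only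
  rw [ENNReal.mul_rpow_of_nonneg _ _ hr.le, eta_eq_weight, ← mul_assoc]
  gcongr
  rw [ENNReal.inv_rpow, ENNReal.inv_le_inv, ← ENNReal.rpow_natCast, ← ENNReal.rpow_natCast,
    ← ENNReal.rpow_mul]
  refine ENNReal.rpow_le_rpow_of_exponent_le (one_le_weight j _) ?_
  push_cast
  exact hN

/-- The maximal function of Peetre. -/
def peetreMax (j N : ℕ) (u : Rn n → ℝ≥0∞) (x : Rn n) : ℝ≥0∞ :=
  ⨆ y, (weight j (x - y) ^ N)⁻¹ * u y

theorem le_peetreMax (j N : ℕ) (u : Rn n → ℝ≥0∞) (x : Rn n) : u x ≤ peetreMax j N u x := by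
  refine le_trans ?_ (le_iSup _ x)
  simp [weight]

theorem peetreMax_le {j N : ℕ} {u : Rn n → ℝ≥0∞} {C : ℝ≥0∞} (h : ∀ x, u x ≤ C * polyConv j N u x)
    (x : Rn n) : peetreMax j N u x ≤ C * polyConv j N u x := by
  refine iSup_le fun y => ?_
  calc _ ≤ (weight j (x - y) ^ N)⁻¹ * (C * polyConv j N u y) := by gcongr; exact h y
    _ = C * (polyConv j N u y * (weight j (x - y) ^ N)⁻¹) := by ring
    _ ≤ _ := by gcongr; exact polyConv_mul_le j N u x y

/-- Split the weighted integrand into its powers 1-r and r, and estimate the first by its supremum,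
which is the Peetre maximal function. -/
theorem polyConv_le {r : ℝ} (hr : 0 < r) (hr1 : r ≤ 1) (j N : ℕ) {u : Rn n → ℝ≥0∞}
    (hu : Measurable u) (x : Rn n) :
    polyConv j N u x ≤ peetreMax j N u x ^ (1 - r) * polyConvPow r j N u x := by
  have hm : Measurable fun y => ENNReal.ofReal ((2 ^ j) ^ n) *
      ((weight j (x - y) ^ N)⁻¹ * u y) ^ r := by
    have h1 : Measurable fun y => weight j (x - y) :=
      (measurable_weight j).comp (by fun_prop)
    exact ((((h1.pow_const N).inv).mul hu).pow_const r).const_mul _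
  rw [polyConvPow, ← lintegral_const_mul _ hm]
  refine lintegral_mono fun y => ?_
  dsimp only
  rw [mul_left_comm (_ ^ (1 - r))]
  refine mul_le_mul' le_rfl ?_
  have h2 : (weight j (x - y) ^ N)⁻¹ * u y ≤ peetreMax j N u x :=
    le_iSup (fun y => (weight j (x - y) ^ N)⁻¹ * u y) y
  calc (weight j (x - y) ^ N)⁻¹ * u y = ((weight j (x - y) ^ N)⁻¹ * u y) ^ ((1 - r) + r) := by simp
    _ = ((weight j (x - y) ^ N)⁻¹ * u y) ^ (1 - r) * ((weight j (x - y) ^ N)⁻¹ * u y) ^ r :=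
        ENNReal.rpow_add_of_nonneg _ _ (by linarith) hr.le
    _ ≤ _ := mul_le_mul' (ENNReal.rpow_le_rpow h2 (by linarith)) le_rfl

/-- The reproducing estimate gives M ≤ C M^{1-r} I for the maximal function M, and one divides by
M^{1-r}. The division requires M to be finite, which must be known beforehand. -/
theorem peetreMax_rpow_le {r : ℝ} (hr : 0 < r) (hr1 : r ≤ 1) {j N : ℕ} {u : Rn n → ℝ≥0∞}
    (hu : Measurable u) {C : ℝ≥0∞} (h : ∀ x, u x ≤ C * polyConv j N u x) (x : Rn n)
    (hM : peetreMax j N u x ≠ ∞) : peetreMax j N u x ^ r ≤ C * polyConvPow r j N u x := by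
  rcases eq_or_ne (peetreMax j N u x) 0 with h0 | h0
  · rw [h0, ENNReal.zero_rpow_of_pos hr]
    exact zero_le
  have h1 := (peetreMax_le h x).trans (mul_le_mul_right (polyConv_le hr hr1 j N hu x) C)
  set M := peetreMax j N u x
  have h2 : M ^ (1 - r) * M ^ r ≤ M ^ (1 - r) * (C * polyConvPow r j N u x) := by
    rw [← ENNReal.rpow_add_of_nonneg _ _ (by linarith) hr.le, sub_add_cancel, ENNReal.rpow_one]
    refine h1.trans (le_of_eq ?_)
    ring
  refine (ENNReal.mul_le_mul_iff_right ?_ ?_).1 h2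
  · exact (ENNReal.rpow_pos (pos_iff_ne_zero.2 h0) hM).ne'
  · exact ENNReal.rpow_ne_top_of_nonneg (by linarith) hM

/-- A function satisfying a reproducing estimate with rapidly decaying kernels is controlled by its
`r`-averages for every `0 < r ≤ 1`. -/
theorem polyConv_le_avg {r : ℝ} (hr : 0 < r) (hr1 : r ≤ 1) {j N : ℕ} (hN : (n + 1 : ℝ) ≤ N * r)
    {u : Rn n → ℝ≥0∞} (hu : Measurable u) {C : ℕ → ℝ≥0∞} (hC : ∀ N, C N ≠ ∞)
    (h : ∀ N x, u x ≤ C N * polyConv j N u x) {k : ℕ} {K : ℝ≥0∞} (hK : K ≠ ∞)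
    (hgrowth : ∀ x, u x ≤ K * weight j x ^ k) (x : Rn n) :
    polyConv j N u x ≤ C N ^ ((1 - r) / r) * avg r j u x := by
  have hI : polyConvPow r j N u x ≤ avg r j u x ^ r := polyConvPow_le_avg hr j hN u x
  rcases eq_or_ne (avg r j u x) ∞ with hA | hA
  · rcases eq_or_ne (C N) 0 with h0 | h0
    -- Degenerate case: a vanishing constant forces u = 0, so the product with an infinite average
    -- causes no trouble.
    · have hu0 : ∀ y, u y = 0 := fun y => by simpa [h0] using h N y
      simp [polyConv, hu0]
    · rw [hA, ENNReal.mul_top]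
      · exact le_top
      · exact (ENNReal.rpow_pos (pos_iff_ne_zero.2 h0) (hC N)).ne'
  have hI' : polyConvPow r j N u x ≠ ∞ :=
    (hI.trans_lt (ENNReal.rpow_lt_top_of_nonneg hr.le hA)).ne
  -- Finiteness for the given N by a bootstrap. Polynomial growth makes the maximal function finite
  -- for N' = max N k, so u^r is bounded by the convolution with parameter N', hence with N. Taking
  -- the weighted supremum with the original N bounds the maximal function by a finite quantity.
  have hM : peetreMax j N u x ≠ ∞ := by
    set N' := max N k
    have h1 : ∀ y, u y ^ r ≤ C N' * polyConvPow r j N u y := by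
      intro y
      have hMy : peetreMax j N' u y ≠ ∞ := by
        refine ne_top_of_le_ne_top (b := K * weight j y ^ k)
          (ENNReal.mul_ne_top hK (ENNReal.pow_ne_top (weight_ne_top _ _))) (iSup_le fun z => ?_)
        have hz : weight j z ≤ weight j y * weight j (y - z) := by
          have := weight_sub_le j (0 : Rn n) y z
          rwa [zero_sub, zero_sub, weight_neg, weight_neg] at this
        have hw0 : weight j (y - z) ^ k ≠ 0 := pow_ne_zero _ (weight_ne_zero _ _)
        have hw1 : weight j (y - z) ^ k ≠ ∞ := ENNReal.pow_ne_top (weight_ne_top _ _)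
        calc _ ≤ (weight j (y - z) ^ k)⁻¹ * (K * (weight j y * weight j (y - z)) ^ k) := mul_le_mul'
              (weight_pow_inv_anti j _ (le_max_right _ _))
              ((hgrowth z).trans (mul_le_mul' le_rfl (pow_le_pow_left₀ zero_le hz k)))
          _ = K * weight j y ^ k * ((weight j (y - z) ^ k)⁻¹ * weight j (y - z) ^ k) := by
              rw [mul_pow]; ring
          _ = _ := by rw [ENNReal.inv_mul_cancel hw0 hw1, mul_one]
      calc u y ^ r ≤ peetreMax j N' u y ^ r := by gcongr; exact le_peetreMax j N' u y
        _ ≤ C N' * polyConvPow r j N' u y := peetreMax_rpow_le hr hr1 hu (h N') y hMy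
        _ ≤ _ := by gcongr; exact polyConvPow_anti hr.le j (le_max_left _ _) u y
    have h2 : peetreMax j N u x ^ r ≤ C N' * polyConvPow r j N u x := by
      rw [peetreMax, iSup_rpow _ hr]
      refine iSup_le fun y => ?_
      rw [ENNReal.mul_rpow_of_nonneg _ _ hr.le]
      calc _ ≤ ((weight j (x - y) ^ N)⁻¹) ^ r * (C N' * polyConvPow r j N u y) := by
            gcongr; exact h1 y
        _ = C N' * (polyConvPow r j N u y * ((weight j (x - y) ^ N)⁻¹) ^ r) := by ring
        _ ≤ _ := by gcongr; exact polyConvPow_mul_le hr.le j N u x y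
    intro htop
    rw [htop, ENNReal.top_rpow_of_pos hr, top_le_iff] at h2
    exact ENNReal.mul_ne_top (hC N') hI' h2
  have h3 := peetreMax_rpow_le hr hr1 hu (h N) x hM
  have h4 : peetreMax j N u x ≤ (C N * avg r j u x ^ r) ^ (1 / r) := by
    have h5 : peetreMax j N u x = (peetreMax j N u x ^ r) ^ (1 / r) := by
      rw [← ENNReal.rpow_mul, mul_one_div_cancel hr.ne', ENNReal.rpow_one]
    rw [h5]
    exact ENNReal.rpow_le_rpow (h3.trans (mul_le_mul' le_rfl hI)) (by positivity)
  calc polyConv j N u x ≤ peetreMax j N u x ^ (1 - r) * polyConvPow r j N u x :=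
        polyConv_le hr hr1 j N hu x
    _ ≤ ((C N * avg r j u x ^ r) ^ (1 / r)) ^ (1 - r) * avg r j u x ^ r := 
        mul_le_mul' (ENNReal.rpow_le_rpow h4 (by linarith)) hI
    _ = C N ^ ((1 - r) / r) * (avg r j u x ^ (1 - r) * avg r j u x ^ r) := by
        have h1r : 0 ≤ 1 - r := by linarith
        rw [← ENNReal.rpow_mul, ENNReal.mul_rpow_of_nonneg _ _ (by positivity), ← ENNReal.rpow_mul,
          mul_assoc]
        congr 2
        · ring_nf
        · congr 1
          field_simp
    _ = _ := by
        rw [← ENNReal.rpow_add_of_nonneg _ _ (by linarith) hr.le, sub_add_cancel, ENNReal.rpow_one]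

/-- The kernel η_j varies slowly at scale 2^{-j}, so an average at the centre of a cube may be
replaced by the average at any of its points. -/
theorem avg_le_of_norm_sub_le {r : ℝ} (hr : 0 < r) {j : ℕ} {R : ℝ} {x x' : Rn n}
    (h : 2 ^ j * ‖x - x'‖ ≤ R) (G : Rn n → ℝ≥0∞) :
    avg r j G x' ≤ (ENNReal.ofReal (1 + R) ^ (n + 1)) ^ (1 / r) * avg r j G x := by
  rw [avg, avg, ← ENNReal.mul_rpow_of_nonneg _ _ (by positivity)]
  gcongr
  rw [etaConv, etaConv, ← lintegral_const_mul' _ _ (ENNReal.pow_ne_top ENNReal.ofReal_ne_top)]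
  refine lintegral_mono fun y => ?_
  dsimp only
  rw [← mul_assoc]
  gcongr
  rw [eta_eq_weight, eta_eq_weight, mul_left_comm]
  gcongr
  have hw : weight j (x - x') ≤ ENNReal.ofReal (1 + R) := ENNReal.ofReal_le_ofReal (by linarith)
  have h0 : weight j (x - x') ^ (n + 1) ≠ 0 := pow_ne_zero _ (weight_ne_zero _ _)
  have h1 : weight j (x - x') ^ (n + 1) ≠ ∞ := ENNReal.pow_ne_top (weight_ne_top _ _)
  calc (weight j (x' - y) ^ (n + 1))⁻¹ = weight j (x - x') ^ (n + 1) *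
        ((weight j (x' - y) ^ (n + 1))⁻¹ * (weight j (x - x') ^ (n + 1))⁻¹) := by
          rw [mul_left_comm, ENNReal.mul_inv_cancel h0 h1, mul_one]
    _ ≤ _ := mul_le_mul' (pow_le_pow_left₀ zero_le hw _) (weight_pow_inv_mul_le j _ x x' y)

variable {n : ℕ}

/-! ### Taylor's formula for functions which are merely differentiable -/

/-- Induction on K with the mean value inequality instead of an integral remainder. Only boundedness
of the top derivative is used, not its continuity, which fits atoms that are merely K times
differentiable; the missing factor 1/K! is irrelevant. -/
theorem norm_sub_taylorSum_le {F : Type*} [NormedAddCommGroup F] [NormedSpace ℝ F] {B : ℝ} :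
    ∀ (K : ℕ) (g : ℕ → ℝ → F), (∀ k < K, ∀ t, HasDerivAt (g k) (g (k + 1) t) t) →
      (∀ t ∈ Set.Icc (0 : ℝ) 1, ‖g K t‖ ≤ B) → ∀ t ∈ Set.Icc (0 : ℝ) 1,
      ‖g 0 t - ∑ k ∈ Finset.range K, (t ^ k / k.factorial) • g k 0‖ ≤ B * t ^ K := by
  intro K
  induction K with
  | zero => intro g _ hB t ht; simpa using hB t ht
  | succ K ih =>
    intro g hg hB t ht
    have hB0 : 0 ≤ B := (norm_nonneg _).trans (hB 0 ⟨le_rfl, zero_le_one⟩)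
    have h1 := ih (fun k => g (k + 1)) (fun k hk t => hg (k + 1) (by omega) t) hB
    set R : ℝ → F := fun t => g 0 t - ∑ k ∈ Finset.range (K + 1), (t ^ k / k.factorial) • g k 0
    set R' : ℝ → F := fun t => g 1 t - ∑ k ∈ Finset.range K, (t ^ k / k.factorial) • g (k + 1) 0
    have hR : ∀ t, HasDerivAt R (R' t) t := by
      intro t
      refine (hg 0 (by omega) t).sub ?_
      have e : ∀ t : ℝ, ∑ k ∈ Finset.range (K + 1), (t ^ k / k.factorial) • g k 0 =
          g 0 0 + ∑ k ∈ Finset.range K, (t ^ (k + 1) / (k + 1).factorial) • g (k + 1) 0 := by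
        intro t
        rw [Finset.sum_range_succ']
        simp [add_comm]
      have e2 : (fun t : ℝ => ∑ k ∈ Finset.range (K + 1), (t ^ k / k.factorial) • g k 0) =
          fun t : ℝ => g 0 0 + ∑ k ∈ Finset.range K, (t ^ (k + 1) / (k + 1).factorial) • g (k + 1) 0 :=
        funext e
      rw [e2]
      refine HasDerivAt.const_add _ (HasDerivAt.fun_sum fun k _ => ?_)
      refine HasDerivAt.smul_const ?_ _
      have := (hasDerivAt_pow (k + 1) t).div_const ((k + 1).factorial : ℝ)
      convert this using 1
      rw [Nat.factorial_succ, Nat.add_sub_cancel]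
      push_cast
      field_simp
    have hR0 : R 0 = 0 := by
      simp only [R]
      rw [Finset.sum_range_succ']
      simp
    have h2 := norm_image_sub_le_of_norm_deriv_le_segment' (f := R) (f' := R') (C := B * t ^ K)
      (a := 0) (b := t) (fun x _ => (hR x).hasDerivWithinAt) (fun x hx =>
        (h1 x ⟨hx.1, hx.2.le.trans ht.2⟩).trans (mul_le_mul_of_nonneg_left
          (pow_le_pow_left₀ hx.1 hx.2.le K) hB0)) t ⟨ht.1, le_rfl⟩
    rw [hR0, sub_zero, sub_zero, mul_assoc, ← pow_succ] at h2
    exact h2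

theorem norm_sub_taylorPolynomial_le {F : Type*} [NormedAddCommGroup F] [NormedSpace ℝ F]
    {a : Rn n → F} {K : ℕ} (ha : ∀ k < K, Differentiable ℝ (iteratedFDeriv ℝ k a)) {x v : Rn n}
    {B : ℝ} (hB : ∀ t ∈ Set.Icc (0 : ℝ) 1, ‖iteratedFDeriv ℝ K a (x + t • v)‖ ≤ B) :
    ‖a (x + v) - ∑ k ∈ Finset.range K, ((k.factorial : ℝ)⁻¹) • iteratedFDeriv ℝ k a x fun _ => v‖ ≤
      B * ‖v‖ ^ K := by
  have h := norm_sub_taylorSum_le (B := B * ‖v‖ ^ K) K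
    (fun k t => iteratedFDeriv ℝ k a (x + t • v) fun _ => v) (fun k hk t => ?_) (fun t ht => ?_)
    1 ⟨zero_le_one, le_rfl⟩
  · simpa [one_div] using h
  · have h1 : HasDerivAt (fun t : ℝ => x + t • v) v t := by
      simpa using ((hasDerivAt_id t).smul_const v).const_add x
    have h2 := ((ha k hk (x + t • v)).hasFDerivAt.comp_hasDerivAt t h1)
    have h3 := ((ContinuousMultilinearMap.apply ℝ (fun _ : Fin k => Rn n) F
      (fun _ => v)).hasFDerivAt.comp_hasDerivAt t h2)
    refine h3.congr_deriv ?_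
    rw [iteratedFDeriv_succ_apply_left]
    rfl
  · refine ((iteratedFDeriv ℝ K a (x + t • v)).le_opNorm _).trans ?_
    simp only [Finset.prod_const, Finset.card_univ, Fintype.card_fin]
    exact mul_le_mul_of_nonneg_right (hB t ht) (by positivity)

theorem multilinear_apply_eq_sum {F : Type*} [NormedAddCommGroup F] [NormedSpace ℝ F] {k : ℕ}
    (A : ContinuousMultilinearMap ℝ (fun _ : Fin k => Rn n) F) (v : Rn n) :
    A (fun _ => v) = ∑ i : Fin k → Fin n, (∏ t, v (i t)) •
      A fun t => EuclideanSpace.single (i t) (1 : ℝ) := by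
  have hv : (fun _ : Fin k => v) =
      fun _ => ∑ i : Fin n, v i • EuclideanSpace.single i (1 : ℝ) := by
    funext j
    ext l
    simp [Finset.sum_apply, Pi.single_apply]
  conv_lhs => rw [hv, A.map_sum]
  exact Finset.sum_congr rfl fun i _ => A.map_smul_univ _ _

/-! ### Moments -/

/-- Vanishing of the moments with respect to all monomials of degree less than `N`. -/
def HasZeroMoments (N : ℕ) (g : Rn n → ℂ) : Prop :=
  ∀ k < N, ∀ i : Fin k → Fin n, ∫ y : Rn n, ((∏ t, y (i t) : ℝ) : ℂ) * g y = 0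

theorem integral_multilinear_mul_eq_zero {N k : ℕ} {g : Rn n → ℂ} (hg : HasZeroMoments N g)
    (hint : ∀ i : Fin k → Fin n, Integrable fun y : Rn n => ((∏ t, y (i t) : ℝ) : ℂ) * g y)
    (hk : k < N) (A : ContinuousMultilinearMap ℝ (fun _ : Fin k => Rn n) ℂ) :
    ∫ y, A (fun _ => y) * g y = 0 := by
  have e : ∀ y : Rn n, A (fun _ => y) * g y = ∑ i : Fin k → Fin n,
      (A fun t => EuclideanSpace.single (i t) (1 : ℝ)) * (((∏ t, y (i t) : ℝ) : ℂ) * g y) := by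
    intro y
    rw [multilinear_apply_eq_sum, Finset.sum_mul]
    refine Finset.sum_congr rfl fun i _ => ?_
    rw [Complex.real_smul]
    ring
  simp_rw [e]
  rw [integral_finsetSum _ fun i _ => (hint i).const_mul _]
  refine Finset.sum_eq_zero fun i _ => ?_
  rw [integral_const_mul, hg k hk i, mul_zero]

/-- The centre of the cube `Q_{ν,m}`. -/
def cubeCenter (ν : ℕ) (m : Fin n → ℤ) : Rn n := WithLp.toLp 2 fun i => (2 : ℝ) ^ (-(ν : ℤ)) * m i

theorem norm_le_sum_abs (v : Rn n) : ‖v‖ ≤ ∑ i, |v i| := by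
  have hv : v = ∑ i : Fin n, v i • EuclideanSpace.single i (1 : ℝ) := by
    ext l
    simp [Finset.sum_apply, Pi.single_apply]
  conv_lhs => rw [hv]
  refine (norm_sum_le _ _).trans (Finset.sum_le_sum fun i _ => ?_)
  rw [norm_smul, PiLp.norm_single, norm_one, mul_one, Real.norm_eq_abs]

theorem norm_le_of_mem_cube {d : ℝ} (hd : 0 ≤ d) {ν : ℕ} {m : Fin n → ℤ} {x : Rn n}
    (hx : x ∈ cube d ν m) : 2 ^ ν * ‖x - cubeCenter ν m‖ ≤ n * d := by
  rw [mem_cube_iff] at hx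
  calc 2 ^ ν * ‖x - cubeCenter ν m‖ ≤ 2 ^ ν * ∑ i, |(x - cubeCenter ν m) i| := by
        gcongr; exact norm_le_sum_abs _
    _ = ∑ i : Fin n, |2 ^ ν * x i - m i| := by
        rw [Finset.mul_sum]
        refine Finset.sum_congr rfl fun i _ => ?_
        have h2 : (0 : ℝ) < 2 ^ ν := by positivity
        rw [← abs_of_pos h2, ← abs_mul, abs_of_pos h2]
        congr 1
        change 2 ^ ν * (x i - (2 : ℝ) ^ (-(ν : ℤ)) * m i) = _
        rw [mul_sub, zpow_neg, zpow_natCast, mul_inv_cancel_left₀ h2.ne']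
    _ ≤ ∑ i : Fin n, d := Finset.sum_le_sum fun i _ => (hx i).trans (by linarith)
    _ = n * d := by simp

theorem cube_subset_closedBall {d : ℝ} (hd : 0 ≤ d) (ν : ℕ) (m : Fin n → ℤ) :
    cube d ν m ⊆ Metric.closedBall (cubeCenter ν m) (n * d / 2 ^ ν) := by
  intro x hx
  rw [mem_closedBall_iff_norm, le_div_iff₀ (by positivity), mul_comm]
  exact norm_le_of_mem_cube hd hx

theorem IsAtom.hasCompactSupport {d s : ℝ} (hd : 0 ≤ d) {p : ℝ≥0∞} {K : ℕ} {L : ℤ} {ν : ℕ} {m : Fin n → ℤ}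
    {a : Rn n → ℂ} (ha : IsAtom d s p K L ν m a) : HasCompactSupport a := by
  exact HasCompactSupport.of_support_subset_isCompact (isCompact_closedBall _ _)
    ((subset_tsupport _).trans (ha.supp.trans (cube_subset_closedBall hd ν m)))

/-- Recentring the moments: the factors x₀ - y are expanded one at a time. The induction keeps a
residual monomial y^β and bounds the total degree |β| + k by L. -/
theorem IsAtom.hasZeroMoments {d s : ℝ} (hd : 0 ≤ d) {p : ℝ≥0∞} {K N : ℕ} {L : ℤ} {ν : ℕ} {m : Fin n → ℤ}
    {a : Rn n → ℂ} (ha : IsAtom d s p K L ν m a) (hN : (N : ℤ) ≤ L + 1) (x₀ : Rn n) :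
    HasZeroMoments N fun y => a (x₀ - y) := by
  have key : ∀ (k : ℕ) (i : Fin k → Fin n) (β : Fin n → ℕ), ((∑ i, β i : ℕ) + k : ℤ) ≤ L →
      ∫ y : Rn n, ((∏ t, (x₀ (i t) - y (i t)) : ℝ) : ℂ) * ((∏ i, y i ^ β i : ℝ) • a y) = 0 := by
    intro k
    induction k with
    | zero => intro i β hβ; simpa using ha.moments β (by simpa using hβ)
    | succ k ih =>
      intro i β hβ
      have hc : ∀ β' : Fin n → ℕ, Integrable fun y : Rn n =>
          ((∏ t : Fin k, (x₀ (i t.succ) - y (i t.succ)) : ℝ) : ℂ) * ((∏ i, y i ^ β' i : ℝ) • a y) := by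
        intro β'
        refine Continuous.integrable_of_hasCompactSupport ?_ ?_
        · have := ha.continuous
          fun_prop
        · exact ((ha.hasCompactSupport hd).smul_left (f := fun y : Rn n => ∏ i, y i ^ β' i)).mul_left
      have e : ∀ y : Rn n, ((∏ t, (x₀ (i t) - y (i t)) : ℝ) : ℂ) * ((∏ i, y i ^ β i : ℝ) • a y) =
          (x₀ (i 0) : ℂ) * (((∏ t : Fin k, (x₀ (i t.succ) - y (i t.succ)) : ℝ) : ℂ) *
            ((∏ i, y i ^ β i : ℝ) • a y)) -
          ((∏ t : Fin k, (x₀ (i t.succ) - y (i t.succ)) : ℝ) : ℂ) *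
            ((∏ l, y l ^ (β + Pi.single (i 0) 1 : Fin n → ℕ) l : ℝ) • a y) := by
        intro y
        have h1 : ∏ l, y l ^ (β + Pi.single (i 0) 1 : Fin n → ℕ) l = (∏ l, y l ^ β l) * y (i 0) := by
          simp_rw [Pi.add_apply, pow_add, Finset.prod_mul_distrib]
          congr 1
          rw [Finset.prod_eq_single (i 0)]
          · simp
          · intro b _ hb; simp [hb]
          · simp
        rw [h1, Fin.prod_univ_succ, Complex.real_smul, Complex.real_smul]
        push_cast
        ring
      simp_rw [e]
      rw [integral_sub ((hc β).const_mul _) (hc _), integral_const_mul, ih _ β (by push_cast at hβ ⊢; linarith),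
        ih _ (β + Pi.single (i 0) 1) (by
          simp_rw [Pi.add_apply, Finset.sum_add_distrib]
          simp only [Finset.sum_pi_single', Finset.mem_univ, if_true]
          push_cast at hβ ⊢
          linarith)]
      simp
  intro k hk i
  have h := key k i 0 (by simp; omega)
  rw [← integral_sub_left_eq_self _ volume x₀] at h
  simpa using h

open scoped Pointwise

variable {n : ℕ}

/-! ### Dyadic kernels acting on atoms -/

/-- Families of kernels localised at scale `2^{-j}`, with vanishing moments for `j ≥ 1`. -/
structure IsKernelFamily (ψ : ℕ → 𝓢(Rn n, ℂ)) : Prop where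
  decay : ∀ A l : ℕ, ∃ C : ℝ, 0 ≤ C ∧ ∀ (j : ℕ) (x : Rn n),
    ‖iteratedFDeriv ℝ l (ψ j) x‖ ≤ C * ((2 ^ j) ^ (n + l) * ((1 + 2 ^ j * ‖x‖) ^ A)⁻¹)
  moments : ∀ j, 1 ≤ j → ∀ N, HasZeroMoments N (ψ j)

/-- The decay comes from the uniform bounds for the rescaled pieces φ_j(2^j·). For j ≥ 1 the
function φ_j vanishes near the origin, and its derivatives there are, up to nonzero constants, the
moments of φ̌_j. -/
theorem IsDyadicResolution.isKernelFamily {φ : ℕ → 𝓢(Rn n, ℂ)} (hφ : IsDyadicResolution φ) :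
    IsKernelFamily fun j => invFourier (φ j) where
  decay A l := by
    obtain ⟨k, C, hC, h⟩ := exists_norm_iteratedFDeriv_invFourier_dilCLM_le (n := n) A l
    obtain ⟨D, hD, h'⟩ := hφ.exists_schwartzNorm_dilCLM_le k
    refine ⟨C * D, by positivity, fun j x => ?_⟩
    have := h (dilCLM j (φ j)) j x
    rw [dilCLM_neg_dilCLM] at this
    refine this.trans ?_
    gcongr
    exact h' j
  moments j hj N k _ i := by
    have h1 : waveCLM 0 (invFourier (φ j)) = φ j := by
      have := fourierConst_smul_waveCLM_expIntegral (φ j)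
      rw [expIntegral, map_smul, smul_smul, mul_inv_cancel₀ fourierConst_ne_zero, one_smul] at this
      exact this
    have h2 := iteratedFDeriv_waveCLM (fun t => EuclideanSpace.single (i t) (1 : ℝ)) 0 0
      (invFourier (φ j))
    have h3 : iteratedFDeriv ℝ k (φ j) 0 = 0 := by
      have h0 : ⇑(φ j) =ᶠ[nhds 0] fun _ => 0 := by
        have h4 : (0 : Rn n) ∉ tsupport (φ j) := fun h => by
          have := hφ.le_norm hj h
          rw [norm_zero] at this
          have : (0 : ℝ) < 2 ^ j / 2 := by positivity
          linarith
        exact notMem_tsupport_iff_eventuallyEq.1 h4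
      rw [(h0.iteratedFDeriv ℝ k).eq_of_nhds]
      simp
    rw [h1, h3, waveCLM_apply_apply] at h2
    have h5 := (mul_eq_zero.1 h2.symm).resolve_left fourierConst_ne_zero
    have h6 : ∀ ξ : Rn n, Complex.exp (((inner ℝ ((0 : Rn n) - 0) ξ : ℝ) : ℂ) * Complex.I) *
        (smulLeftCLM ℂ (fun ξ : Rn n => ∏ t, (-Complex.I *
          ((inner ℝ ξ (EuclideanSpace.single (i t) (1 : ℝ)) : ℝ) : ℂ))) (invFourier (φ j))) ξ =
        (-Complex.I) ^ k * (((∏ t, ξ (i t) : ℝ) : ℂ) * invFourier (φ j) ξ) := by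
      intro ξ
      rw [smulLeftCLM_apply_apply (hasTemperateGrowth_prod_inner _), sub_zero, inner_zero_left,
        Finset.prod_mul_distrib, smul_eq_mul]
      simp [EuclideanSpace.inner_single_right, mul_assoc]
    simp_rw [h6] at h5
    rw [integral_const_mul] at h5
    exact (mul_eq_zero.1 h5).resolve_left (pow_ne_zero _ (neg_ne_zero.2 Complex.I_ne_zero))

theorem one_add_le_mul_of_le {t R a b : ℝ} (ht : 0 ≤ t) (hb : 0 ≤ b) (hR : 0 ≤ R)
    (h : t * a ≤ t * b + R) : 1 + t * a ≤ (1 + R) * (1 + t * b) := by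
  nlinarith [mul_nonneg ht hb, mul_nonneg (mul_nonneg ht hb) hR]

theorem inv_pow_le_mul_inv_pow {a b c : ℝ} (ha : 0 < a) (hb : 0 < b) (h : a ≤ c * b) (A : ℕ) :
    (b ^ A)⁻¹ ≤ c ^ A * (a ^ A)⁻¹ := by
  rw [← div_eq_mul_inv, le_div_iff₀ (by positivity), ← div_eq_inv_mul, div_le_iff₀ (by positivity),
    ← mul_pow]
  exact pow_le_pow_left₀ ha.le h A

theorem integrable_prod_mul_of_hasCompactSupport {k : ℕ} {g : Rn n → ℂ} (hg : Continuous g)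
    (hc : HasCompactSupport g) (i : Fin k → Fin n) :
    Integrable fun y : Rn n => ((∏ t, y (i t) : ℝ) : ℂ) * g y :=
  Continuous.integrable_of_hasCompactSupport (by fun_prop) hc.mul_left

/-- Kernels at a coarse scale acting on a function with vanishing moments at a fine scale. -/
theorem IsKernelFamily.exists_norm_integral_le_of_moments {ψ : ℕ → 𝓢(Rn n, ℂ)}
    (hψ : IsKernelFamily ψ) {R : ℝ} (hR : 0 ≤ R) (N A : ℕ) : ∃ C : ℝ, 0 ≤ C ∧
      ∀ (j k : ℕ) (x : Rn n) (b : Rn n → ℂ) (α : ℝ), Continuous b → (∀ z, ‖b z‖ ≤ α) →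
        (∀ z, b z ≠ 0 → 2 ^ (j + k) * ‖z‖ ≤ R) → HasZeroMoments N b →
        ‖∫ z, ψ j (x + z) * b z‖ ≤
          C * (α * ((2 ^ k) ^ (N + n))⁻¹ * ((1 + 2 ^ j * ‖x‖) ^ A)⁻¹) := by
  obtain ⟨C, hC, hψd⟩ := hψ.decay A N
  set V : ℝ := volume.real (Metric.closedBall (0 : Rn n) R) with hV
  refine ⟨C * (1 + R) ^ A * R ^ N * V, by positivity, fun j k x b α hb hα hsupp hm => ?_⟩
  have hα0 : 0 ≤ α := (norm_nonneg _).trans (hα 0)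
  set S := Metric.closedBall (0 : Rn n) (R / 2 ^ (j + k)) with hS
  have hmem : ∀ z, z ∈ S ↔ 2 ^ (j + k) * ‖z‖ ≤ R := fun z => by
    rw [hS, mem_closedBall_zero_iff, le_div_iff₀ (by positivity), mul_comm]
  have hc : HasCompactSupport b := HasCompactSupport.intro (isCompact_closedBall 0 _)
    fun z hz => by
      by_contra h
      exact hz ((hmem z).2 (hsupp z h))
  -- The moments of b allow the Taylor polynomial of the kernel at x to be subtracted; the remainder
  -- of order N is small because b lives at the finer scale 2^{-(j+k)}.
  set T : Rn n → ℂ := fun z => ∑ k ∈ Finset.range N, ((k.factorial : ℝ)⁻¹) •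
    iteratedFDeriv ℝ k (ψ j) x fun _ => z with hT
  have hTint : ∀ i, Integrable fun z => iteratedFDeriv ℝ i (ψ j) x (fun _ => z) * b z := fun i =>
    Continuous.integrable_of_hasCompactSupport (by fun_prop) hc.mul_left
  have e0 : ∫ z, T z * b z = 0 := by
    have : ∀ z, T z * b z = ∑ k ∈ Finset.range N, ((k.factorial : ℝ)⁻¹) •
        (iteratedFDeriv ℝ k (ψ j) x (fun _ => z) * b z) := fun z => by
      rw [hT, Finset.sum_mul]
      simp_rw [smul_mul_assoc]
    simp_rw [this]
    have hTs : ∀ i : ℕ, Integrable fun z => ((i.factorial : ℝ)⁻¹) •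
        (iteratedFDeriv ℝ i (ψ j) x (fun _ => z) * b z) := fun i =>
      (hTint i).smul ((i.factorial : ℝ)⁻¹)
    rw [integral_finsetSum _ fun i _ => hTs i]
    refine Finset.sum_eq_zero fun i hi => ?_
    rw [integral_smul, integral_multilinear_mul_eq_zero hm
      (integrable_prod_mul_of_hasCompactSupport hb hc) (Finset.mem_range.1 hi), smul_zero]
  have hI1 : Integrable fun z => ψ j (x + z) * b z :=
    Continuous.integrable_of_hasCompactSupport
      (((ψ j).continuous.comp (by fun_prop)).mul hb) hc.mul_left
  have hI2 : Integrable fun z => T z * b z :=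
    Continuous.integrable_of_hasCompactSupport (by fun_prop) hc.mul_left
  have e1 : ∫ z, ψ j (x + z) * b z = ∫ z in S, (ψ j (x + z) - T z) * b z := by
    rw [setIntegral_eq_integral_of_forall_compl_eq_zero]
    · simp_rw [sub_mul]
      rw [integral_sub hI1 hI2, e0, sub_zero]
    · intro z hz
      by_contra h
      exact hz ((hmem z).2 (hsupp z (right_ne_zero_of_mul h)))
  rw [e1]
  set w := ((1 + 2 ^ j * ‖x‖) ^ A)⁻¹ with hw
  have hw0 : 0 ≤ w := by positivity
  have bound : ∀ z ∈ S, ‖(ψ j (x + z) - T z) * b z‖ ≤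
      C * ((2 ^ j) ^ (n + N) * ((1 + R) ^ A * w)) * (R / 2 ^ (j + k)) ^ N * α := by
    intro z hz
    rw [norm_mul]
    refine mul_le_mul ?_ (hα z) (norm_nonneg _) (by positivity)
    refine (norm_sub_taylorPolynomial_le (K := N) (a := ψ j) (B := C * ((2 ^ j) ^ (n + N) *
      ((1 + R) ^ A * w))) (fun i _ => ((ψ j).smooth ⊤).differentiable_iteratedFDeriv
        (mod_cast ENat.natCast_lt_top i)) fun t ht => ?_).trans ?_
    · refine (hψd j _).trans ?_
      gcongr
      refine inv_pow_le_mul_inv_pow (by positivity) (by positivity) ?_ A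
      refine one_add_le_mul_of_le (by positivity) (norm_nonneg _) hR ?_
      have h1 : ‖x‖ ≤ ‖x + t • z‖ + ‖z‖ := by
        have h2 : ‖t • z‖ ≤ ‖z‖ := by
          rw [norm_smul, Real.norm_of_nonneg ht.1]
          exact mul_le_of_le_one_left (norm_nonneg _) ht.2
        have := norm_sub_le (x + t • z) (t • z)
        rw [add_sub_cancel_right] at this
        linarith
      have h3 : (2 : ℝ) ^ j * ‖z‖ ≤ R := by
        refine le_trans ?_ ((hmem z).1 hz)
        gcongr
        · exact one_le_two
        · omega
      calc (2 : ℝ) ^ j * ‖x‖ ≤ 2 ^ j * (‖x + t • z‖ + ‖z‖) := by gcongr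
        _ ≤ _ := by rw [mul_add]; linarith
    · gcongr
      simpa [hS] using hz
  have hfin : volume S < ∞ := measure_closedBall_lt_top
  refine (norm_setIntegral_le_of_norm_le_const hfin bound).trans (le_of_eq ?_)
  -- Powers of two: 2^{j(n+N)} from the derivatives, 2^{-(j+k)N} from the remainder and 2^{-(j+k)n}
  -- from the volume leave 2^{-k(N+n)}.
  have hvol : volume.real S = (2 ^ (j + k))⁻¹ ^ n * V := by
    have h1 : S = ((2 : ℝ) ^ (j + k))⁻¹ • Metric.closedBall (0 : Rn n) R := by
      rw [smul_closedBall _ _ hR, smul_zero, Real.norm_of_nonneg (by positivity), hS,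
        div_eq_inv_mul]
    rw [h1, measureReal_def, Measure.addHaar_smul, finrank_euclideanSpace_fin,
      ENNReal.toReal_mul, ENNReal.toReal_ofReal (by positivity), abs_of_nonneg (by positivity)]
    rfl
  have h2j : (2 : ℝ) ^ j ≠ 0 := by positivity
  have h2k : (2 : ℝ) ^ k ≠ 0 := by positivity
  rw [hvol, pow_add 2 j k]
  clear_value w
  generalize (2 : ℝ) ^ j = P at h2j ⊢
  generalize (2 : ℝ) ^ k = Q at h2k ⊢
  rw [div_pow, inv_pow, mul_pow, mul_pow, pow_add, pow_add]
  field_simp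

/-- Kernels at a fine scale acting on a smooth function at a coarse scale. -/
theorem IsKernelFamily.exists_enorm_integral_le_of_smooth {ψ : ℕ → 𝓢(Rn n, ℂ)}
    (hψ : IsKernelFamily ψ) {R : ℝ} (hR : 0 ≤ R) (K A : ℕ) : ∃ C : ℝ, 0 ≤ C ∧
      ∀ (ν k : ℕ) (x x₀ : Rn n) (a : Rn n → ℂ) (B : ℝ), 1 ≤ k → Continuous a →
        (∀ i < K, Differentiable ℝ (iteratedFDeriv ℝ i a)) →
        (∀ z, ‖iteratedFDeriv ℝ K a z‖ ≤ B) → (∀ z ∈ tsupport a, 2 ^ ν * ‖z - x₀‖ ≤ R) →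
        ‖∫ z, ψ (ν + k) z * a (x - z)‖ₑ ≤ ENNReal.ofReal
          (C * (B * ((2 ^ (ν + k)) ^ K)⁻¹ * ((1 + 2 ^ ν * ‖x - x₀‖) ^ A)⁻¹)) * etaMass n := by
  -- The decay is spent in three portions: A for localisation around x₀, K to absorb |z|^K from the
  -- Taylor remainder, and n+1 for an integrable factor η_j.
  obtain ⟨C, hC, hψd⟩ := hψ.decay (A + (K + (n + 1))) 0
  refine ⟨C * (1 + R) ^ A, by positivity, fun ν k x x₀ a B hk ha hd hB hs => ?_⟩
  have hB0 : 0 ≤ B := (norm_nonneg _).trans (hB 0)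
  have hc : HasCompactSupport a := HasCompactSupport.intro
    (isCompact_closedBall x₀ (R / 2 ^ ν)) fun z hz => by
      by_contra h
      apply hz
      rw [mem_closedBall_iff_norm, le_div_iff₀ (by positivity), mul_comm]
      exact hs z (subset_tsupport _ h)
  set j := ν + k with hj
  clear_value j
  set T : Rn n → ℂ := fun z => ∑ i ∈ Finset.range K, ((i.factorial : ℝ)⁻¹) •
    iteratedFDeriv ℝ i a x fun _ => -z with hT
  have hpoly : ∀ (i : ℕ) (σ : Fin i → Fin n),
      Integrable fun z : Rn n => ((∏ t, z (σ t) : ℝ) : ℂ) * ψ j z := by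
    intro i σ
    refine ((ψ j).integrable_pow_mul volume i).mono' ?_ (Filter.Eventually.of_forall fun z => ?_)
    · have := (ψ j).continuous
      exact Continuous.aestronglyMeasurable (by fun_prop)
    · rw [norm_mul, Complex.norm_real, norm_prod]
      gcongr
      calc ∏ t, ‖z (σ t)‖ ≤ ∏ _t : Fin i, ‖z‖ := by
            gcongr with t
            exact PiLp.norm_apply_le z (σ t)
        _ = ‖z‖ ^ i := by simp
  have hneg : ∀ (i : ℕ) (z : Rn n), (iteratedFDeriv ℝ i a x fun _ => -z) =
      ((iteratedFDeriv ℝ i a x).compContinuousLinearMap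
        fun _ => -(ContinuousLinearMap.id ℝ (Rn n))) fun _ => z := fun i z => rfl
  have hTint : ∀ i, Integrable fun z => (iteratedFDeriv ℝ i a x fun _ => -z) * ψ j z := by
    intro i
    simp_rw [hneg, multilinear_apply_eq_sum, Finset.sum_mul]
    refine integrable_finsetSum _ fun σ _ => ?_
    refine ((hpoly i σ).const_mul (((iteratedFDeriv ℝ i a x).compContinuousLinearMap
      fun _ => -(ContinuousLinearMap.id ℝ (Rn n)))
        fun t => EuclideanSpace.single (σ t) (1 : ℝ))).congr (Filter.Eventually.of_forall fun z => ?_)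
    dsimp only
    rw [Complex.real_smul]
    ring
  have eT : ∀ z, ψ j z * T z = ∑ i ∈ Finset.range K, ((i.factorial : ℝ)⁻¹) •
      ((iteratedFDeriv ℝ i a x fun _ => -z) * ψ j z) := fun z => by
    rw [hT, mul_comm, Finset.sum_mul]
    simp_rw [smul_mul_assoc]
  have hTs : ∀ i : ℕ, Integrable fun z => ((i.factorial : ℝ)⁻¹) •
      ((iteratedFDeriv ℝ i a x fun _ => -z) * ψ j z) := fun i =>
    (hTint i).smul ((i.factorial : ℝ)⁻¹)
  have hI2 : Integrable fun z => ψ j z * T z := by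
    simp_rw [eT]
    exact integrable_finsetSum _ fun i _ => hTs i
  have e0 : ∫ z, ψ j z * T z = 0 := by
    simp_rw [eT]
    rw [integral_finsetSum _ fun i _ => hTs i]
    refine Finset.sum_eq_zero fun i hi => ?_
    simp_rw [hneg]
    rw [integral_smul, integral_multilinear_mul_eq_zero (hψ.moments j (by omega) (i + 1))
      (hpoly i) (Nat.lt_succ_self i), smul_zero]
  have hI1 : Integrable fun z => ψ j z * a (x - z) := by
    have h1 : HasCompactSupport fun z => a (x - z) :=
      hc.comp_homeomorph (Homeomorph.subLeft x)
    exact Continuous.integrable_of_hasCompactSupport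
      ((ψ j).continuous.mul (ha.comp (by fun_prop))) h1.mul_left
  have e1 : ∫ z, ψ j z * a (x - z) = ∫ z, ψ j z * (a (x - z) - T z) := by
    simp_rw [mul_sub]
    rw [integral_sub hI1 hI2, e0, sub_zero]
  rw [e1, ← lintegral_eta (n := n) j, ← lintegral_const_mul' _ _ ENNReal.ofReal_ne_top]
  refine (enorm_integral_le_lintegral_enorm _).trans (lintegral_mono fun z => ?_)
  rw [eta, ← ENNReal.ofReal_mul (by positivity), ← ofReal_norm]
  refine ENNReal.ofReal_le_ofReal ?_
  rw [norm_mul]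
  have hrem : ‖a (x - z) - T z‖ ≤ B * ‖z‖ ^ K := by
    have := norm_sub_taylorPolynomial_le (x := x) (v := -z) hd (B := B) (fun t _ => hB _)
    rwa [norm_neg, ← sub_eq_add_neg] at this
  have hz : ‖ψ j z‖ ≤ C * ((2 ^ j) ^ n * ((1 + 2 ^ j * ‖z‖) ^ (A + (K + (n + 1))))⁻¹) := by
    simpa using hψd j z
  rcases eq_or_ne (a (x - z) - T z) 0 with h0 | h0
  · rw [h0, norm_zero, mul_zero]
    positivity
  have hloc : 1 + 2 ^ ν * ‖x - x₀‖ ≤ (1 + R) * (1 + 2 ^ j * ‖z‖) := by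
    have h2 : (2 : ℝ) ^ ν * ‖z‖ ≤ 2 ^ j * ‖z‖ := by
      gcongr
      · exact one_le_two
      · omega
    -- Outside the support of a the Taylor polynomial at x vanishes, so a nonzero difference places
    -- x - z in the support; otherwise x itself is close to x₀.
    have key : (2 : ℝ) ^ ν * ‖x - x₀‖ ≤ 2 ^ ν * ‖z‖ + R := by
      by_cases hx : x ∈ tsupport a
      · have := hs x hx
        have : (0 : ℝ) ≤ 2 ^ ν * ‖z‖ := by positivity
        linarith
      · have hTz : T z = 0 := by
          refine Finset.sum_eq_zero fun i _ => ?_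
          have : iteratedFDeriv ℝ i a x = 0 := by
            by_contra h
            exact hx (support_iteratedFDeriv_subset (𝕜 := ℝ) i (Function.mem_support.2 h))
          rw [this]
          simp
        rw [hTz, sub_zero] at h0
        have h3 := hs _ (subset_tsupport _ h0)
        have h4 : ‖x - x₀‖ ≤ ‖z‖ + ‖x - z - x₀‖ := by
          have := norm_add_le z (x - z - x₀)
          rwa [show z + (x - z - x₀) = x - x₀ by abel] at this
        calc (2 : ℝ) ^ ν * ‖x - x₀‖ ≤ 2 ^ ν * (‖z‖ + ‖x - z - x₀‖) := by gcongr
          _ ≤ _ := by rw [mul_add]; linarith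
    refine (one_add_le_mul_of_le (by positivity) (norm_nonneg z) hR key).trans ?_
    gcongr
  have hA := inv_pow_le_mul_inv_pow (by positivity) (by positivity) hloc A
  have hK : ((1 + 2 ^ j * ‖z‖) ^ K)⁻¹ * ‖z‖ ^ K ≤ ((2 ^ j) ^ K)⁻¹ := by
    rw [← div_eq_inv_mul, div_le_iff₀ (by positivity), ← div_eq_inv_mul, le_div_iff₀ (by positivity),
      ← mul_pow]
    refine pow_le_pow_left₀ (by positivity) ?_ K
    linarith [mul_comm ((2 : ℝ) ^ j) ‖z‖]
  calc ‖ψ j z‖ * ‖a (x - z) - T z‖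
      ≤ (C * ((2 ^ j) ^ n * ((1 + 2 ^ j * ‖z‖) ^ (A + (K + (n + 1))))⁻¹)) * (B * ‖z‖ ^ K) := by
        gcongr
    _ = C * B * ((2 ^ j) ^ n * ((1 + 2 ^ j * ‖z‖) ^ (n + 1))⁻¹) *
        (((1 + 2 ^ j * ‖z‖) ^ A)⁻¹ * (((1 + 2 ^ j * ‖z‖) ^ K)⁻¹ * ‖z‖ ^ K)) := by
        rw [pow_add, pow_add, mul_inv, mul_inv]
        ring
    _ ≤ C * B * ((2 ^ j) ^ n * ((1 + 2 ^ j * ‖z‖) ^ (n + 1))⁻¹) *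
        (((1 + R) ^ A * ((1 + 2 ^ ν * ‖x - x₀‖) ^ A)⁻¹) * ((2 ^ j) ^ K)⁻¹) := by
        gcongr
    _ = _ := by ring

variable {n : ℕ}

/-! ### Powers of two -/

/-- `2^t` as an extended non-negative real. -/
def twoPow (t : ℝ) : ℝ≥0∞ := ENNReal.ofReal ((2 : ℝ) ^ t)

theorem twoPow_add (a b : ℝ) : twoPow (a + b) = twoPow a * twoPow b := by
  rw [twoPow, Real.rpow_add two_pos, ENNReal.ofReal_mul (by positivity), twoPow, twoPow]

theorem twoPow_zero : twoPow 0 = 1 := by simp [twoPow]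

theorem twoPow_ne_top (t : ℝ) : twoPow t ≠ ∞ := ENNReal.ofReal_ne_top

theorem twoPow_mono {a b : ℝ} (h : a ≤ b) : twoPow a ≤ twoPow b :=
  ENNReal.ofReal_le_ofReal (Real.rpow_le_rpow_of_exponent_le one_le_two h)

theorem twoPow_rpow (a b : ℝ) : twoPow a ^ b = twoPow (a * b) := by
  rw [twoPow, twoPow, ENNReal.ofReal_rpow_of_pos (by positivity), ← Real.rpow_mul two_pos.le]

theorem ofReal_two_pow_pow (k N : ℕ) : ENNReal.ofReal (((2 : ℝ) ^ k) ^ N) = twoPow (k * N) := by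
  rw [twoPow, Real.rpow_mul two_pos.le, Real.rpow_natCast, Real.rpow_natCast]

theorem two_pow_pow_inv (k N : ℕ) : (((2 : ℝ) ^ k) ^ N)⁻¹ = 2 ^ (-((k : ℝ) * N)) := by
  rw [Real.rpow_neg two_pos.le, Real.rpow_mul two_pos.le, Real.rpow_natCast, Real.rpow_natCast]

theorem ofReal_weight_inv (j A : ℕ) (x : Rn n) :
    ENNReal.ofReal ((1 + 2 ^ j * ‖x‖) ^ A)⁻¹ = (weight j x ^ A)⁻¹ := by
  rw [ENNReal.ofReal_inv_of_pos (by positivity), ENNReal.ofReal_pow (by positivity), weight]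

theorem tsum_twoPow_ne_top {δ : ℝ} (hδ : 0 < δ) : ∑' k : ℕ, twoPow (-(δ * k)) ≠ ∞ := by
  have h : ∀ k : ℕ, twoPow (-(δ * k)) = twoPow (-δ) ^ k := fun k => by
    rw [← ENNReal.rpow_natCast, twoPow_rpow, neg_mul]
  simp_rw [h]
  rw [ENNReal.tsum_geometric, ENNReal.inv_ne_top, Ne, tsub_eq_zero_iff_le, not_le, twoPow,
    ENNReal.ofReal_lt_one]
  exact Real.rpow_lt_one_of_one_lt_of_neg one_lt_two (by linarith)

/-! ### Convolutions of atoms with the dyadic kernels -/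

variable {ψ : ℕ → 𝓢(Rn n, ℂ)}

theorem IsAtom.norm_le {d σ : ℝ} {p : ℝ≥0∞} {K : ℕ} {L : ℤ} {ν : ℕ} {m : Fin n → ℤ}
    {a : Rn n → ℂ} (ha : IsAtom d σ p K L ν m a) (x : Rn n) :
    ‖a x‖ ≤ 2 ^ (-(ν : ℝ) * (σ - n * (p⁻¹).toReal)) := by
  simpa [pderiv] using ha.deriv_le 0 (Nat.zero_le K) Fin.elim0 x

theorem IsAtom.norm_iteratedFDeriv_le {d σ : ℝ} {p : ℝ≥0∞} {K : ℕ} {L : ℤ} {ν : ℕ}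
    {m : Fin n → ℤ} {a : Rn n → ℂ} (ha : IsAtom d σ p K L ν m a) (x : Rn n) :
    ‖iteratedFDeriv ℝ K a x‖ ≤ n ^ K * 2 ^ (-(ν : ℝ) * (σ - n * (p⁻¹).toReal) + K * ν) := by
  refine (norm_iteratedFDeriv_le_sum_pderiv K a x).trans
    ((Finset.sum_le_sum fun i _ => ha.deriv_le K le_rfl i x).trans (le_of_eq ?_))
  simp

theorem IsKernelFamily.exists_enorm_integral_atom_le_of_moments (hψ : IsKernelFamily ψ) {d : ℝ}
    (hd : 0 ≤ d) (σ : ℝ) (p : ℝ≥0∞) (K N A : ℕ) : ∃ C : ℝ≥0∞, C ≠ ∞ ∧ ∀ (L : ℤ), (N : ℤ) ≤ L + 1 →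
      ∀ (j k : ℕ) (m : Fin n → ℤ) (a : Rn n → ℂ) (x : Rn n), IsAtom d σ p K L (j + k) m a →
        ‖∫ y, ψ j (x - y) * a y‖ₑ ≤ C * (twoPow (-((j + k : ℕ) * σ) - k * (N + n)) *
          amplitude n p (j + k) * (weight j (x - cubeCenter (j + k) m) ^ A)⁻¹) := by
  obtain ⟨C, hC, h⟩ := hψ.exists_norm_integral_le_of_moments
    (R := n * d) (by positivity) N A
  refine ⟨ENNReal.ofReal C, ENNReal.ofReal_ne_top, fun L hN j k m a x ha => ?_⟩
  set c := cubeCenter (j + k) m with hc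
  have hcont := ha.continuous
  have h1 := h j k (x - c) (fun z => a (c - z)) _ (by fun_prop) (fun z => ha.norm_le _)
    (fun z hz => by
      have := norm_le_of_mem_cube hd (ha.supp (subset_tsupport _ hz))
      rwa [← hc, sub_sub_cancel_left, norm_neg] at this) (ha.hasZeroMoments hd hN c)
  have e : ∫ y, ψ j (x - y) * a y = ∫ z, ψ j (x - c + z) * a (c - z) := by
    rw [← integral_sub_left_eq_self (fun y => ψ j (x - y) * a y) volume c]
    refine integral_congr_ae (Filter.Eventually.of_forall fun z => ?_)
    dsimp only
    congr 2
    abel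
  rw [e, ← ofReal_norm]
  refine (ENNReal.ofReal_le_ofReal h1).trans (le_of_eq ?_)
  rw [ENNReal.ofReal_mul hC, ENNReal.ofReal_mul (by positivity), ofReal_weight_inv, amplitude,
    two_pow_pow_inv, ← Real.rpow_add two_pos]
  congr 2
  change twoPow _ = _ * twoPow _
  rw [← twoPow_add]
  congr 1
  push_cast
  ring

theorem IsKernelFamily.exists_enorm_integral_atom_le_of_smooth (hψ : IsKernelFamily ψ) {d : ℝ}
    (hd : 0 ≤ d) (σ : ℝ) (p : ℝ≥0∞) (K A : ℕ) : ∃ C : ℝ≥0∞, C ≠ ∞ ∧ ∀ (L : ℤ)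
      (ν k : ℕ) (m : Fin n → ℤ) (a : Rn n → ℂ) (x : Rn n), 1 ≤ k → IsAtom d σ p K L ν m a →
        ‖∫ y, ψ (ν + k) (x - y) * a y‖ₑ ≤ C * (twoPow (-(ν * σ) - k * K) *
          amplitude n p ν * (weight ν (x - cubeCenter ν m) ^ A)⁻¹) := by
  obtain ⟨C, hC, h⟩ := hψ.exists_enorm_integral_le_of_smooth
    (R := n * d) (by positivity) K A
  refine ⟨ENNReal.ofReal (C * n ^ K) * etaMass n,
    ENNReal.mul_ne_top ENNReal.ofReal_ne_top etaMass_ne_top, fun L ν k m a x hk ha => ?_⟩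
  have h1 := h ν k x (cubeCenter ν m) a _ hk ha.continuous ha.differentiable
    (fun z => ha.norm_iteratedFDeriv_le z)
    (fun z hz => norm_le_of_mem_cube hd (ha.supp hz))
  have e : ∫ y, ψ (ν + k) (x - y) * a y = ∫ z, ψ (ν + k) z * a (x - z) := by
    rw [← integral_sub_left_eq_self (fun y => ψ (ν + k) (x - y) * a y) volume x]
    simp
  rw [e]
  refine h1.trans (le_of_eq ?_)
  rw [mul_right_comm _ (etaMass n)]
  congr 1
  rw [two_pow_pow_inv, mul_assoc _ ((2 : ℝ) ^ _) ((2 : ℝ) ^ _), ← Real.rpow_add two_pos, mul_assoc,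
    ← mul_assoc C, ENNReal.ofReal_mul (by positivity), ENNReal.ofReal_mul (by positivity),
    ENNReal.ofReal_mul (by positivity), ofReal_weight_inv, amplitude]
  congr 2
  change twoPow _ = _ * twoPow _
  rw [← twoPow_add]
  congr 1
  push_cast
  ring

/-! ### Sums over the cubes of one generation -/

theorem avg_step_rpow {r : ℝ} (hr : 0 < r) (p : ℝ≥0∞) (l : ℕ → (Fin n → ℤ) → ℂ) (i ν : ℕ)
    (x : Rn n) : avg r i (step p l ν) x ^ r =
      ∑' m, ∫⁻ y in cubeIndex ν ⁻¹' {m}, eta i (x - y) * (‖l ν m‖ₑ * amplitude n p ν) ^ r := by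
  rw [avg_rpow hr, etaConv, ← setLIntegral_univ]
  have hU : (Set.univ : Set (Rn n)) = ⋃ m, cubeIndex ν ⁻¹' {m} := by ext; simp
  rw [hU, lintegral_iUnion (fun m => measurable_cubeIndex ν (measurableSet_singleton m))]
  · refine tsum_congr fun m => setLIntegral_congr_fun
      (measurable_cubeIndex ν (measurableSet_singleton m)) fun y hy => ?_
    have : cubeIndex ν y = m := hy
    simp only [step, this]
  · intro m m' hm
    rw [Function.onFun, Set.disjoint_left]
    rintro y rfl h
    exact hm h

theorem weight_sub_center_le (i k : ℕ) {m : Fin n → ℤ} {y : Rn n}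
    (hy : y ∈ cube 1 (i + k) m) (x : Rn n) :
    (weight i (x - cubeCenter (i + k) m) ^ (n + 1))⁻¹ ≤
      (n + 1) ^ (n + 1) * (weight i (x - y) ^ (n + 1))⁻¹ := by
  have h1 := weight_pow_inv_mul_le i (n + 1) (x) (cubeCenter (i + k) m) y
  have h2 : weight i (cubeCenter (i + k) m - y) ≤ n + 1 := by
    have := norm_le_of_mem_cube zero_le_one hy
    rw [norm_sub_rev, mul_one] at this
    have h3 : (2 : ℝ) ^ i ≤ 2 ^ (i + k) := pow_le_pow_right₀ one_le_two (Nat.le_add_right i k)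
    calc weight i (cubeCenter (i + k) m - y) ≤ ENNReal.ofReal (n + 1) := by
          refine ENNReal.ofReal_le_ofReal ?_
          nlinarith [mul_le_mul_of_nonneg_right h3 (norm_nonneg (cubeCenter (i + k) m - y))]
      _ = n + 1 := by rw [ENNReal.ofReal_add (by positivity) zero_le_one]; simp
  have hz : (weight i (cubeCenter (i + k) m - y) ^ (n + 1)) ≠ 0 := pow_ne_zero _ (weight_ne_zero _ _)
  have ht : (weight i (cubeCenter (i + k) m - y) ^ (n + 1)) ≠ ∞ := ENNReal.pow_ne_top (weight_ne_top _ _)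
  calc (weight i (x - cubeCenter (i + k) m) ^ (n + 1))⁻¹
      = weight i (cubeCenter (i + k) m - y) ^ (n + 1) *
        ((weight i (cubeCenter (i + k) m - y) ^ (n + 1))⁻¹ *
          (weight i (x - cubeCenter (i + k) m) ^ (n + 1))⁻¹) := by
        rw [← mul_assoc, ENNReal.mul_inv_cancel hz ht, one_mul]
    _ ≤ _ := mul_le_mul' (pow_le_pow_left₀ zero_le h2 _) h1

/-- Sums of polynomially decaying kernels over the cubes of one generation are dominated by
averages of the step function. -/
theorem tsum_weight_le_avg {r : ℝ} (hr : 0 < r) (hr1 : r ≤ 1) {A : ℕ} (hA : (n + 1 : ℝ) ≤ A * r)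
    (p : ℝ≥0∞) (l : ℕ → (Fin n → ℤ) → ℂ) (i k : ℕ) (x : Rn n) :
    ∑' m, ‖l (i + k) m‖ₑ * amplitude n p (i + k) *
        (weight i (x - cubeCenter (i + k) m) ^ A)⁻¹ ≤
      ((n + 1 : ℝ≥0∞) ^ (n + 1)) ^ (1 / r) *
        (twoPow (k * (n / r)) * avg r i (step p l (i + k)) x) := by
  have key : (∑' m, ‖l (i + k) m‖ₑ * amplitude n p (i + k) *
      (weight i (x - cubeCenter (i + k) m) ^ A)⁻¹) ^ r ≤
      ((n + 1 : ℝ≥0∞) ^ (n + 1)) * ((twoPow (k * n)) * avg r i (step p l (i + k)) x ^ r) := by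
    refine (tsum_rpow_le _ hr hr1).trans ?_
    rw [avg_step_rpow hr, ← ENNReal.tsum_mul_left, ← ENNReal.tsum_mul_left]
    refine ENNReal.tsum_le_tsum fun m => ?_
    set B := ‖l (i + k) m‖ₑ * amplitude n p (i + k) with hB
    set c := cubeCenter (i + k) m
    have hBt : B ^ r ≠ ∞ := ENNReal.rpow_ne_top_of_nonneg hr.le
      (ENNReal.mul_ne_top enorm_ne_top ENNReal.ofReal_ne_top)
    rw [ENNReal.mul_rpow_of_nonneg _ _ hr.le]
    have h1 : ((weight i (x - c) ^ A)⁻¹) ^ r ≤ (weight i (x - c) ^ (n + 1))⁻¹ := by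
      rw [ENNReal.inv_rpow, ENNReal.inv_le_inv, ← ENNReal.rpow_natCast, ← ENNReal.rpow_natCast,
        ← ENNReal.rpow_mul]
      refine ENNReal.rpow_le_rpow_of_exponent_le (one_le_weight _ _) ?_
      push_cast
      exact hA
    have hmeas := measurable_cubeIndex (n := n) (i + k) (measurableSet_singleton m)
    -- The factor 2^{kn} is the number of cubes of side 2^{-(i+k)} in a cube of side 2^{-i}. Taking
    -- the root of order r turns it into the loss 2^{kn/r}.
    have hvol : twoPow (k * n) * ENNReal.ofReal ((2 ^ i) ^ n) *
        volume (cubeIndex (n := n) (i + k) ⁻¹' {m}) = 1 := by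
      rw [volume_cubeIndex_preimage, two_pow_pow_inv, ofReal_two_pow_pow]
      change _ * twoPow _ = 1
      rw [← twoPow_add, ← twoPow_add, ← twoPow_zero]
      congr 1
      push_cast
      ring
    calc B ^ r * ((weight i (x - c) ^ A)⁻¹) ^ r
        ≤ B ^ r * (weight i (x - c) ^ (n + 1))⁻¹ := mul_le_mul' le_rfl h1
      _ = B ^ r * (weight i (x - c) ^ (n + 1))⁻¹ * (twoPow (k * n) *
            ENNReal.ofReal ((2 ^ i) ^ n) * volume (cubeIndex (n := n) (i + k) ⁻¹' {m})) := by
          rw [hvol, mul_one]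
      _ = (twoPow (k * n) * ENNReal.ofReal ((2 ^ i) ^ n) * B ^ r) *
            ∫⁻ y in cubeIndex (n := n) (i + k) ⁻¹' {m}, (weight i (x - c) ^ (n + 1))⁻¹ := by
          rw [setLIntegral_const]; ring
      _ ≤ (twoPow (k * n) * ENNReal.ofReal ((2 ^ i) ^ n) * B ^ r) *
            ∫⁻ y in cubeIndex (n := n) (i + k) ⁻¹' {m},
              (n + 1) ^ (n + 1) * (weight i (x - y) ^ (n + 1))⁻¹ := by
          refine mul_le_mul' le_rfl (setLIntegral_mono' hmeas fun y hy => ?_)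
          refine weight_sub_center_le i k ?_ x
          have : cubeIndex (i + k) y = m := hy
          exact this ▸ mem_cube_cubeIndex _ _
      _ = _ := by
          simp_rw [eta_eq_weight]
          rw [lintegral_mul_const' _ _ hBt, lintegral_const_mul' _ _ ENNReal.ofReal_ne_top,
            lintegral_const_mul' _ _ (ENNReal.pow_ne_top (by simp))]
          ring
  have h2 := ENNReal.rpow_le_rpow key (by positivity : 0 ≤ 1 / r)
  rw [← ENNReal.rpow_mul, mul_one_div_cancel hr.ne', ENNReal.rpow_one,
    ENNReal.mul_rpow_of_nonneg _ _ (by positivity), ENNReal.mul_rpow_of_nonneg _ _ (by positivity),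
    ← ENNReal.rpow_mul, mul_one_div_cancel hr.ne', ENNReal.rpow_one, twoPow_rpow] at h2
  convert h2 using 4
  ring

theorem sum_range_le_tsum_shift (g B : ℕ → ℝ≥0∞) (j : ℕ)
    (hB : ∀ k, 1 ≤ k → k ≤ j → g (j - k) ≤ B k) : ∑ ν ∈ Finset.range j, g ν ≤ ∑' k, B k := by
  calc ∑ ν ∈ Finset.range j, g ν = ∑ ν ∈ Finset.range j, g (j - (ν + 1)) := by
        rw [← Finset.sum_range_reflect]
        refine Finset.sum_congr rfl fun ν _ => by congr 1; omega
    _ ≤ ∑ ν ∈ Finset.range j, B (ν + 1) := by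
        refine Finset.sum_le_sum fun ν hν => ?_
        have := Finset.mem_range.1 hν
        exact hB _ (by omega) (by omega)
    _ ≤ ∑' ν, B (ν + 1) := ENNReal.sum_le_tsum _
    _ ≤ ∑' k, B k := ENNReal.tsum_comp_le_tsum_of_injective (add_left_injective 1) B

/-- The sum over the generations is reindexed by the distance k to the diagonal ν = j, the diagonal
itself being counted with the finer generations. -/
theorem tsum_le_tsum_add_shift (g A B : ℕ → ℝ≥0∞) (j : ℕ) (hA : ∀ k, g (j + k) ≤ A k)
    (hB : ∀ k, 1 ≤ k → k ≤ j → g (j - k) ≤ B k) : ∑' ν, g ν ≤ ∑' k, (A k + if k ≤ j then B k else 0) := by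
  have h1 : ∑' ν, g ν = ∑ ν ∈ Finset.range j, g ν + ∑' ν, g (ν + j) :=
    (ENNReal.summable.sum_add_tsum_nat_add' (k := j)).symm
  rw [h1, ENNReal.tsum_add, add_comm]
  refine add_le_add (ENNReal.tsum_le_tsum fun k => by rw [add_comm]; exact hA k) ?_
  refine sum_range_le_tsum_shift g _ j fun k hk hkj => ?_
  rw [if_pos hkj]
  exact hB k hk hkj

/-- Convolution of a series of atoms with the dyadic kernels. -/
theorem IsKernelFamily.exists_tsum_enorm_integral_atom_le (hψ : IsKernelFamily ψ) {d : ℝ}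
    (hd : 0 ≤ d) {s σ r : ℝ} (hr : 0 < r) (hr1 : r ≤ 1) (p : ℝ≥0∞) {K N : ℕ} (hsσ : s ≤ σ)
    (hsK : s < K) (hN : n * (1 / r - 1) < σ + N) :
    ∃ (C : ℝ≥0∞) (δ : ℝ), C ≠ ∞ ∧ 0 < δ ∧ ∀ (L : ℤ), (N : ℤ) ≤ L + 1 →
      ∀ (l : ℕ → (Fin n → ℤ) → ℂ) (a : ℕ → (Fin n → ℤ) → Rn n → ℂ),
        (∀ ν m, IsAtom d σ p K L ν m (a ν m)) → ∀ (j : ℕ) (x : Rn n),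
          twoPow (j * s) * ∑' ν, ∑' m, ‖l ν m‖ₑ * ‖∫ y, ψ j (x - y) * a ν m y‖ₑ ≤
            ∑' k : ℕ, C * twoPow (-(δ * k)) * (avg r j (step p l (j + k)) x +
              if k ≤ j then avg r (j - k) (step p l (j - k)) x else 0) := by
  obtain ⟨A, hA⟩ : ∃ A : ℕ, (n + 1 : ℝ) ≤ A * r := by
    obtain ⟨A, hA⟩ := exists_nat_ge ((n + 1 : ℝ) / r)
    exact ⟨A, (div_le_iff₀ hr).1 hA⟩
  obtain ⟨C₁, hC₁, h₁⟩ := hψ.exists_enorm_integral_atom_le_of_moments hd σ p K N A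
  obtain ⟨C₂, hC₂, h₂⟩ := hψ.exists_enorm_integral_atom_le_of_smooth hd σ p K A
  -- The two gains per generation. For finer atoms, σ+N+n from size and moments minus the loss n/r
  -- of summing over cubes; for coarser atoms, K from smoothness minus the weight s.
  set δ := min (σ + N - n * (1 / r - 1)) (K - s) with hδ
  set D := ((n + 1 : ℝ≥0∞) ^ (n + 1)) ^ (1 / r) with hD
  have hDt : D ≠ ∞ := ENNReal.rpow_ne_top_of_nonneg (by positivity) (ENNReal.pow_ne_top (by simp))
  refine ⟨(C₁ + C₂) * D, δ, ENNReal.mul_ne_top (ENNReal.add_ne_top.2 ⟨hC₁, hC₂⟩) hDt,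
    lt_min (by linarith) (by linarith), fun L hL l a ha j x => ?_⟩
  clear_value D
  rw [← ENNReal.tsum_mul_left]
  have h3 : ∀ k : ℕ, C₁ * D * twoPow (-(δ * k)) * avg r j (step p l (j + k)) x +
      (if k ≤ j then C₂ * D * twoPow (-(δ * k)) * avg r (j - k) (step p l (j - k)) x else 0) ≤
      (C₁ + C₂) * D * twoPow (-(δ * k)) * (avg r j (step p l (j + k)) x +
              if k ≤ j then avg r (j - k) (step p l (j - k)) x else 0) := fun k => by
    rw [mul_add]
    refine add_le_add ?_ ?_
    · gcongr; exact le_self_add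
    · split_ifs
      · gcongr; exact le_add_self
      · simp
  refine le_trans (tsum_le_tsum_add_shift _ _ _ j (fun k => ?_) (fun k hk hkj => ?_))
    (ENNReal.tsum_le_tsum h3)
  · calc twoPow (j * s) * ∑' m, ‖l (j + k) m‖ₑ * ‖∫ y, ψ j (x - y) * a (j + k) m y‖ₑ
        ≤ twoPow (j * s) * ∑' m, ‖l (j + k) m‖ₑ * (C₁ * (twoPow (-((j + k : ℕ) * σ) - k * (N + n)) *
          amplitude n p (j + k) * (weight j (x - cubeCenter (j + k) m) ^ A)⁻¹)) := by
          refine mul_le_mul' le_rfl (ENNReal.tsum_le_tsum fun m => mul_le_mul' le_rfl ?_)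
          exact h₁ L hL j k m _ x (ha _ _)
      _ = C₁ * (twoPow (j * s) * twoPow (-((j + k : ℕ) * σ) - k * (N + n))) *
            ∑' m, ‖l (j + k) m‖ₑ * amplitude n p (j + k) *
              (weight j (x - cubeCenter (j + k) m) ^ A)⁻¹ := by
          rw [← ENNReal.tsum_mul_left, ← ENNReal.tsum_mul_left]
          refine tsum_congr fun m => by ring
      _ ≤ C₁ * (twoPow (j * s) * twoPow (-((j + k : ℕ) * σ) - k * (N + n))) *
            (D * (twoPow (k * (n / r)) * avg r j (step p l (j + k)) x)) := by
          rw [hD]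
          exact mul_le_mul' le_rfl (tsum_weight_le_avg hr hr1 hA p l j k x)
      _ = C₁ * D * (twoPow (j * s) * twoPow (-((j + k : ℕ) * σ) - k * (N + n)) *
            twoPow (k * (n / r))) * avg r j (step p l (j + k)) x := by ring
      _ ≤ _ := by
          rw [← twoPow_add, ← twoPow_add]
          refine mul_le_mul' (mul_le_mul' le_rfl (twoPow_mono ?_)) le_rfl
          have h4 : δ ≤ σ + N - n * (1 / r - 1) := min_le_left _ _
          have h5 := mul_le_mul_of_nonneg_right h4 (Nat.cast_nonneg (α := ℝ) k)
          have h6 := mul_le_mul_of_nonneg_left hsσ (Nat.cast_nonneg (α := ℝ) j)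
          have h7 : (n : ℝ) * (1 / r - 1) = n / r - n := by ring
          rw [h7] at h5
          push_cast
          nlinarith
  · obtain ⟨ν, rfl⟩ : ∃ ν, j = ν + k := ⟨j - k, by omega⟩
    rw [Nat.add_sub_cancel]
    calc twoPow ((ν + k : ℕ) * s) * ∑' m, ‖l ν m‖ₑ * ‖∫ y, ψ (ν + k) (x - y) * a ν m y‖ₑ
        ≤ twoPow ((ν + k : ℕ) * s) * ∑' m, ‖l ν m‖ₑ * (C₂ * (twoPow (-(ν * σ) - k * K) *
          amplitude n p ν * (weight ν (x - cubeCenter ν m) ^ A)⁻¹)) := by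
          refine mul_le_mul' le_rfl (ENNReal.tsum_le_tsum fun m => mul_le_mul' le_rfl ?_)
          exact h₂ L ν k m _ x hk (ha _ _)
      _ = C₂ * (twoPow ((ν + k : ℕ) * s) * twoPow (-(ν * σ) - k * K)) *
            ∑' m, ‖l (ν + 0) m‖ₑ * amplitude n p (ν + 0) *
              (weight ν (x - cubeCenter (ν + 0) m) ^ A)⁻¹ := by
          rw [← ENNReal.tsum_mul_left, ← ENNReal.tsum_mul_left]
          refine tsum_congr fun m => by simp only [add_zero]; ring
      _ ≤ C₂ * (twoPow ((ν + k : ℕ) * s) * twoPow (-(ν * σ) - k * K)) *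
            (D * (twoPow ((0 : ℕ) * (n / r)) * avg r ν (step p l (ν + 0)) x)) := by
          rw [hD]
          exact mul_le_mul' le_rfl (tsum_weight_le_avg hr hr1 hA p l ν 0 x)
      _ = C₂ * D * (twoPow ((ν + k : ℕ) * s) * twoPow (-(ν * σ) - k * K)) *
            avg r ν (step p l ν) x := by
          rw [Nat.cast_zero, zero_mul, twoPow_zero, add_zero]; ring
      _ ≤ _ := by
          rw [← twoPow_add]
          refine mul_le_mul' (mul_le_mul' le_rfl (twoPow_mono ?_)) le_rfl
          have h4 : δ ≤ K - s := min_le_right _ _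
          have h5 := mul_le_mul_of_nonneg_right h4 (Nat.cast_nonneg (α := ℝ) k)
          have h6 := mul_le_mul_of_nonneg_left hsσ (Nat.cast_nonneg (α := ℝ) ν)
          push_cast
          nlinarith

variable {n : ℕ}

/-! ### Quasi-norm estimates for sums -/

theorem tsum_prod_pi (a : ℕ → ℝ≥0∞) :
    ∀ n : ℕ, ∑' γ : Fin n → ℕ, ∏ k, a (γ k) = (∑' b, a b) ^ n
  | 0 => by simp
  | n + 1 => by
    rw [← (Fin.consEquiv fun _ : Fin (n + 1) => ℕ).tsum_eq, ENNReal.tsum_prod', pow_succ,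
      mul_comm, ← ENNReal.tsum_mul_right]
    refine tsum_congr fun b => ?_
    rw [← tsum_prod_pi a n, ← ENNReal.tsum_mul_left]
    refine tsum_congr fun γ => ?_
    simp [Fin.consEquiv, Fin.prod_univ_succ]

theorem tsum_twoPow_multi_ne_top {δ : ℝ} (hδ : 0 < δ) :
    ∑' γ : Fin n → ℕ, twoPow (-(δ * (∑ i, γ i : ℕ))) ≠ ∞ := by
  have h : ∀ γ : Fin n → ℕ, twoPow (-(δ * (∑ i, γ i : ℕ))) = ∏ i, twoPow (-(δ * γ i)) := fun γ => by
    simp only [twoPow]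
    rw [← ENNReal.ofReal_prod_of_nonneg fun i _ => by positivity,
      ← Real.rpow_sum_of_pos two_pos, Finset.sum_neg_distrib, Nat.cast_sum, Finset.mul_sum]
  simp_rw [h]
  rw [tsum_prod_pi fun b : ℕ => twoPow (-(δ * b))]
  exact ENNReal.pow_ne_top (tsum_twoPow_ne_top hδ)

variable {p : ℝ≥0∞} {r : ℝ} {N : (ℕ → Rn n → ℝ≥0∞) → ℝ≥0∞}
  {S : (ℕ → (Fin n → ℤ) → ℂ) → ℝ≥0∞}

theorem IsFunctionNorm.exists_add_le (hN : IsFunctionNorm n p r N S) : ∃ C : ℝ≥0∞, C ≠ ∞ ∧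
    ∀ G H : ℕ → Rn n → ℝ≥0∞, (∀ j, Measurable (G j)) → (∀ j, Measurable (H j)) →
      N (fun j x => G j x + H j x) ≤ C * (N G + N H) := by
  obtain ⟨t, ht, ht1, h⟩ := hN.tsum_le
  refine ⟨2 ^ (1 / t), ENNReal.rpow_ne_top_of_nonneg (by positivity) (by simp), fun G H hG hH => ?_⟩
  refine le_rpow_mul_of_rpow_le ht ?_
  have h1 := h (ι := Bool) (fun b => if b then H else G) (by rintro (_ | _) j <;> simp [hG, hH])
  have e : (fun (j : ℕ) (x : Rn n) => ∑' b : Bool, (if b then H else G) j x) =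
      fun j x => G j x + H j x := by
    ext j x; rw [tsum_bool]; simp
  rw [e, tsum_bool] at h1
  refine h1.trans ?_
  simp only [Bool.false_eq_true, if_false, if_true]
  rw [two_mul]
  exact add_le_add (ENNReal.rpow_le_rpow le_self_add ht.le) (ENNReal.rpow_le_rpow le_add_self ht.le)

/-- The estimate of a double series which decays away from the diagonal. -/
theorem IsFunctionNorm.exists_offDiagonal_le (hN : IsFunctionNorm n p r N S)
    {c : ℝ≥0∞} (hc : c ≠ ∞) {δ : ℝ} (hδ : 0 < δ) : ∃ C : ℝ≥0∞, C ≠ ∞ ∧ ∀ G : ℕ → Rn n → ℝ≥0∞,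
      (∀ j, Measurable (G j)) →
      N (fun j x => ∑' k : ℕ, c * twoPow (-(δ * k)) *
        (avg r j (G (j + k)) x + if k ≤ j then avg r (j - k) (G (j - k)) x else 0)) ≤ C * N G := by
  obtain ⟨t, ht, ht1, h⟩ := hN.tsum_le
  obtain ⟨A, hA, hadd⟩ := hN.exists_add_le
  obtain ⟨B, hB, havg⟩ := hN.avg_le
  refine ⟨((∑' k : ℕ, twoPow (-(δ * t * k))) * (c * A * (2 * B)) ^ t) ^ (1 / t),
    ENNReal.rpow_ne_top_of_nonneg (by positivity) (ENNReal.mul_ne_top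
      (tsum_twoPow_ne_top (by positivity)) (ENNReal.rpow_ne_top_of_nonneg ht.le
        (by finiteness))), fun G hG => le_rpow_mul_of_rpow_le ht ?_⟩
  have hm1 : ∀ k j : ℕ, Measurable fun x => avg r j (G (j + k)) x :=
    fun k j => measurable_avg _ _ (hG _)
  have hm2 : ∀ k j : ℕ, Measurable (if k ≤ j then avg r (j - k) (G (j - k)) else 0) := fun k j => by
    split_ifs
    exacts [measurable_avg _ _ (hG _), measurable_const]
  have e : ∀ k j x, (if k ≤ j then avg r (j - k) (G (j - k)) x else 0) =
      (if k ≤ j then avg r (j - k) (G (j - k)) else 0) x := fun k j x => by split_ifs <;> rfl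
  simp_rw [e]
  refine (h _ fun k j => ((hm1 k j).add (hm2 k j)).const_mul _).trans ?_
  rw [mul_assoc, ← ENNReal.tsum_mul_right]
  refine ENNReal.tsum_le_tsum fun k => ?_
  -- For fixed k both terms are index shifts combined with averages, bounded uniformly in k; the
  -- decay 2^{-δk} then sums them through the t-triangle inequality.
  have h1 : N (fun j => avg r j (G (j + k))) ≤ B * N G :=
    (havg (fun j => G (j + k)) fun j => hG _).trans
      (mul_le_mul' le_rfl (hN.shift_left_le G k))
  have h2 : N (fun j => if k ≤ j then avg r (j - k) (G (j - k)) else 0) ≤ B * N G :=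
    (hN.shift_right_le (fun j => avg r j (G j)) k).trans (havg G hG)
  calc N (fun j x => c * twoPow (-(δ * k)) * (avg r j (G (j + k)) x +
        (if k ≤ j then avg r (j - k) (G (j - k)) else 0) x)) ^ t
      ≤ (c * twoPow (-(δ * k)) * (A * (B * N G + B * N G))) ^ t := by
        refine ENNReal.rpow_le_rpow ?_ ht.le
        refine (hN.const_mul_le _ (ENNReal.mul_ne_top hc (twoPow_ne_top _))).trans
          (mul_le_mul' le_rfl ?_)
        exact (hadd _ _ (hm1 k) (hm2 k)).trans (mul_le_mul' le_rfl (add_le_add h1 h2))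
    _ = (twoPow (-(δ * k)) * (c * A * (2 * B)) * N G) ^ t := by congr 1; ring
    _ = _ := by
        rw [ENNReal.mul_rpow_of_nonneg _ _ ht.le, ENNReal.mul_rpow_of_nonneg _ _ ht.le, twoPow_rpow,
          mul_assoc]
        congr 3
        ring

/-! ### The dyadic blocks of an atomic series -/

theorem le_twoPow_mul_size {E : Type*} (R : AtomicSeries n E) (μ : ℝ) (γ : Fin n → ℕ) :
    S (R.rho γ) + S (R.lam γ) ≤ twoPow (-(μ * (∑ i, γ i : ℕ))) * R.size S μ := by
  have h8 : twoPow (μ * (∑ i, γ i : ℕ)) * (S (R.rho γ) + S (R.lam γ)) ≤ R.size S μ :=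
    le_iSup (fun γ : Fin n → ℕ => twoPow (μ * (∑ i, γ i : ℕ)) *
      (S (R.rho γ) + S (R.lam γ))) γ
  calc S (R.rho γ) + S (R.lam γ) = twoPow (-(μ * (∑ i, γ i : ℕ))) *
        (twoPow (μ * (∑ i, γ i : ℕ)) * (S (R.rho γ) + S (R.lam γ))) := by
        rw [← mul_assoc, ← twoPow_add, neg_add_cancel, twoPow_zero, one_mul]
    _ ≤ _ := mul_le_mul' le_rfl h8

variable {E : Type*} [NormedAddCommGroup E] [NormedSpace ℂ E]

theorem enorm_dyadicBlock (φ : ℕ → 𝓢(Rn n, ℂ)) (f : 𝓢'(Rn n, E)) (j : ℕ) (x : Rn n) :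
    ‖dyadicBlock φ f j x‖ₑ = ‖fourierConst n‖ₑ * ‖f (reflTranslate (invFourier (φ j)) x)‖ₑ := by
  rw [dyadicBlock, conv, enorm_smul]
  rfl

theorem integral_smul_term [CompleteSpace E] {d σ σ' : ℝ} (hd : 0 ≤ d) {p : ℝ≥0∞} {K : ℕ}
    {L L' : ℤ} {ν : ℕ} {m : Fin n → ℤ} {a b : Rn n → ℂ} (ha : IsAtom d σ p K L ν m a)
    (hb : IsAtom d σ' p K L' ν m b) (θ : 𝓢(Rn n, ℂ)) (u v : ℂ) (e e' : E) :
    ∫ x, θ x • ((u * a x) • e + (v * b x) • e') =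
      (u * ∫ x, θ x * a x) • e + (v * ∫ x, θ x * b x) • e' := by
  have hia : Integrable fun x => θ x * a x :=
    (θ.continuous.mul ha.continuous).integrable_of_hasCompactSupport
      (ha.hasCompactSupport hd).mul_left
  have hib : Integrable fun x => θ x * b x :=
    (θ.continuous.mul hb.continuous).integrable_of_hasCompactSupport
      (hb.hasCompactSupport hd).mul_left
  have e1 : ∀ x, θ x • ((u * a x) • e + (v * b x) • e') =
      (u * (θ x * a x)) • e + (v * (θ x * b x)) • e' := fun x => by
    rw [smul_add, smul_smul, smul_smul]
    congr 2 <;> ring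
  simp_rw [e1]
  rw [integral_add ((hia.const_mul u).smul_const e) ((hib.const_mul v).smul_const e'),
    integral_smul_const, integral_smul_const, integral_const_mul, integral_const_mul]

theorem AtomicSeries.Represents.enorm_apply_le [CompleteSpace E] {R : AtomicSeries n E} {d : ℝ}
    (hd : 0 ≤ d) {M K : ℕ} {s : ℝ} {p : ℝ≥0∞} {L : ℤ} {f : 𝓢'(Rn n, E)}
    (hR : R.Represents d M s p K L f) (θ : 𝓢(Rn n, ℂ)) :
    ‖f θ‖ₑ ≤ ∑' γ, ((∑' ν, ∑' m, ‖R.rho γ ν m‖ₑ * ‖∫ y, θ y * R.a γ ν m y‖ₑ) +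
      ∑' ν, ∑' m, ‖R.lam γ ν m‖ₑ * ‖∫ y, θ y * R.aL γ ν m y‖ₑ) := by
  rw [← (hR.hasSum θ).tsum_eq]
  refine enorm_tsum_le_tsum_enorm.trans ?_
  rw [ENNReal.tsum_prod']
  refine ENNReal.tsum_le_tsum fun γ => ?_
  rw [ENNReal.tsum_prod', ← ENNReal.tsum_add]
  refine ENNReal.tsum_le_tsum fun ν => ?_
  rw [← ENNReal.tsum_add]
  refine ENNReal.tsum_le_tsum fun m => ?_
  have h0 := integral_smul_term hd (hR.atom γ ν m) (hR.atomL γ ν m) θ (R.rho γ ν m) (R.lam γ ν m)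
    (R.e γ ν m) (R.eL γ ν m)
  dsimp only [AtomicSeries.term]
  rw [h0]
  refine (enorm_add_le _ _).trans (le_of_eq ?_)
  have h1 : ∀ e : E, ‖e‖ = 1 → ‖e‖ₑ = 1 := fun e he => by rw [← ofReal_norm, he]; simp
  rw [enorm_smul, enorm_smul, enorm_mul, enorm_mul, h1 _ (hR.norm_e γ ν m),
    h1 _ (hR.norm_eL γ ν m), mul_one, mul_one]

/-- A distribution represented by a series of atoms of finite size belongs to the function
space. -/
theorem IsFunctionNorm.exists_synthesis_le [CompleteSpace E] (hN : IsFunctionNorm n p r N S)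
    (hr : 0 < r) (hr1 : r ≤ 1) {d : ℝ} (hd : 0 ≤ d) {s : ℝ} {M K l : ℕ} {L : ℤ}
    (hL : L + 1 = l) (hMs : s < M) (hKs : s < K) (hM : n * (1 / r - 1) < M)
    (hl : n * (1 / r - 1) < s + l) {μ : ℝ} (hμ : 0 < μ) {φ : ℕ → 𝓢(Rn n, ℂ)}
    (hφ : IsDyadicResolution φ) : ∃ C : ℝ≥0∞, C ≠ ∞ ∧ ∀ (f : 𝓢'(Rn n, E)) (R : AtomicSeries n E),
      R.Represents d M s p K L f →
      N (fun j x => twoPow (j * s) * ‖dyadicBlock φ f j x‖ₑ) ≤ C * R.size S μ := by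
  have hψ := hφ.isKernelFamily
  set ψ : ℕ → 𝓢(Rn n, ℂ) := fun j => invFourier (φ j) with hψdef
  obtain ⟨t, ht, ht1, h⟩ := hN.tsum_le
  obtain ⟨A, hA, hadd⟩ := hN.exists_add_le
  -- The first family has no moments but the higher index σ = M; the second has σ = s and l = L+1
  -- orders of vanishing moments.
  obtain ⟨C₁, δ₁, hC₁, hδ₁, h₁⟩ := hψ.exists_tsum_enorm_integral_atom_le hd hr hr1 p
    (s := s) (σ := M) (K := K) (N := 0) hMs.le hKs (by simpa using hM)
  obtain ⟨C₂, δ₂, hC₂, hδ₂, h₂⟩ := hψ.exists_tsum_enorm_integral_atom_le hd hr hr1 p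
    (s := s) (σ := s) (K := K) (N := l) le_rfl hKs hl
  obtain ⟨D₁, hD₁, h₃⟩ := hN.exists_offDiagonal_le hC₁ hδ₁
  obtain ⟨D₂, hD₂, h₄⟩ := hN.exists_offDiagonal_le hC₂ hδ₂
  set c := ‖fourierConst n‖ₑ with hc
  have hct : c ≠ ∞ := enorm_ne_top
  set D := c * (A * (D₁ + D₂)) with hD
  have hDt : D ≠ ∞ := by finiteness
  refine ⟨((∑' γ : Fin n → ℕ, twoPow (-(μ * t * (∑ i, γ i : ℕ)))) * D ^ t) ^ (1 / t),
    ENNReal.rpow_ne_top_of_nonneg (by positivity) (ENNReal.mul_ne_top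
      (tsum_twoPow_multi_ne_top (by positivity)) (ENNReal.rpow_ne_top_of_nonneg ht.le hDt)),
    fun f R hR => le_rpow_mul_of_rpow_le ht ?_⟩
  set T₁ : (Fin n → ℕ) → ℕ → Rn n → ℝ≥0∞ := fun γ j x => ∑' k : ℕ, C₁ * twoPow (-(δ₁ * k)) *
    (avg r j (step p (R.rho γ) (j + k)) x +
      if k ≤ j then avg r (j - k) (step p (R.rho γ) (j - k)) x else 0) with hT₁
  set T₂ : (Fin n → ℕ) → ℕ → Rn n → ℝ≥0∞ := fun γ j x => ∑' k : ℕ, C₂ * twoPow (-(δ₂ * k)) *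
    (avg r j (step p (R.lam γ) (j + k)) x +
      if k ≤ j then avg r (j - k) (step p (R.lam γ) (j - k)) x else 0) with hT₂
  have hmeas : ∀ (l : ℕ → (Fin n → ℤ) → ℂ) (a : ℝ≥0∞) (δ : ℝ) (j : ℕ), Measurable fun x =>
      ∑' k : ℕ, a * twoPow (-(δ * k)) * (avg r j (step p l (j + k)) x +
        if k ≤ j then avg r (j - k) (step p l (j - k)) x else 0) := fun l a δ j => by
    refine Measurable.tsum fun k => ((measurable_avg _ _ (measurable_step _ _ _)).add ?_).const_mul _
    split_ifs
    exacts [measurable_avg _ _ (measurable_step _ _ _), measurable_const]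
  have hm₁ : ∀ γ j, Measurable (T₁ γ j) := fun γ j => hmeas _ _ _ _
  have hm₂ : ∀ γ j, Measurable (T₂ γ j) := fun γ j => hmeas _ _ _ _
  have hpt : ∀ (j : ℕ) (x : Rn n), twoPow (j * s) * ‖dyadicBlock φ f j x‖ₑ ≤ ∑' γ, c * (T₁ γ j x + T₂ γ j x) := by
    intro j x
    rw [enorm_dyadicBlock, ← hc, mul_left_comm, ENNReal.tsum_mul_left]
    refine mul_le_mul' le_rfl ((mul_le_mul' le_rfl (hR.enorm_apply_le hd _)).trans ?_)
    rw [← ENNReal.tsum_mul_left]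
    refine ENNReal.tsum_le_tsum fun γ => ?_
    rw [mul_add]
    have e : ∀ y, reflTranslate (invFourier (φ j)) x y = ψ j (x - y) := fun y =>
      reflTranslate_apply _ _ _
    simp_rw [e]
    exact add_le_add (h₁ (-1) (by simp) (R.rho γ) (R.a γ) (hR.atom γ) j x)
      (h₂ L hL.ge (R.lam γ) (R.aL γ) (hR.atomL γ) j x)
  refine (ENNReal.rpow_le_rpow (hN.mono hpt) ht.le).trans ?_
  refine (h _ fun γ j => ((hm₁ γ j).add (hm₂ γ j)).const_mul _).trans ?_
  rw [mul_assoc, ← ENNReal.tsum_mul_right]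
  refine ENNReal.tsum_le_tsum fun γ => ?_
  have h5 : N (T₁ γ) ≤ D₁ * S (R.rho γ) := (h₃ (step p (R.rho γ)) (measurable_step p _)).trans
    (mul_le_mul' le_rfl (hN.step_le _))
  have h6 : N (T₂ γ) ≤ D₂ * S (R.lam γ) := (h₄ (step p (R.lam γ)) (measurable_step p _)).trans
    (mul_le_mul' le_rfl (hN.step_le _))
  have h7 := le_twoPow_mul_size (S := S) R μ γ
  calc N (fun j x => c * (T₁ γ j x + T₂ γ j x)) ^ t
      ≤ (D * (twoPow (-(μ * (∑ i, γ i : ℕ))) * R.size S μ)) ^ t := by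
        refine ENNReal.rpow_le_rpow ((hN.const_mul_le _ hct).trans ?_) ht.le
        rw [hD, mul_assoc, mul_assoc]
        refine mul_le_mul' le_rfl ((hadd _ _ (hm₁ γ) (hm₂ γ)).trans (mul_le_mul' le_rfl ?_))
        calc N (T₁ γ) + N (T₂ γ) ≤ D₁ * S (R.rho γ) + D₂ * S (R.lam γ) := add_le_add h5 h6
          _ ≤ (D₁ + D₂) * (S (R.rho γ) + S (R.lam γ)) := by
              rw [mul_add]
              exact add_le_add (mul_le_mul' le_self_add le_rfl) (mul_le_mul' le_add_self le_rfl)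
          _ ≤ _ := mul_le_mul' le_rfl h7
    _ = _ := by
        clear_value D
        rw [ENNReal.mul_rpow_of_nonneg _ _ ht.le, ENNReal.mul_rpow_of_nonneg _ _ ht.le, twoPow_rpow,
          mul_left_comm]
        congr 2
        ring

variable {n : ℕ} {E : Type*} [NormedAddCommGroup E] [NormedSpace ℂ E] {φ : ℕ → 𝓢(Rn n, ℂ)}

/-! ### The dyadic blocks are dominated by their averages -/

theorem measurable_enorm_waveCLM (f : 𝓢(Rn n, ℂ) →L[ℂ] E) (φ : 𝓢(Rn n, ℂ)) :
    Measurable fun x : Rn n => ‖f (waveCLM x φ)‖ₑ :=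
  (f.continuous.comp (continuous_waveCLM φ)).enorm.measurable

/-- A dilated frequency multiplier h acts by convolution with a kernel at scale 2^{-j} that decays
to any order. Its dependence on h is recorded by one Schwartz norm, because h will later carry
monomials of arbitrary degree. -/
theorem enorm_waveCLM_smul_le_polyConv [CompleteSpace E] (N : ℕ) : ∃ (k : ℕ) (C : ℝ≥0∞), C ≠ ∞ ∧
    ∀ (φ : ℕ → 𝓢(Rn n, ℂ)) (f : 𝓢(Rn n, ℂ) →L[ℂ] E) (h : 𝓢(Rn n, ℂ)) (j : ℕ) (x : Rn n),
      ‖f (waveCLM x (dilCLM (-(j : ℤ)) (smulLeftCLM ℂ h (dilCLM j (φ j)))))‖ₑ ≤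
        C * ENNReal.ofReal (schwartzNorm k h) *
          polyConv j N (fun y => ‖f (waveCLM y (φ j))‖ₑ) x := by
  obtain ⟨k, C, hC, hk⟩ := exists_norm_invFourier_dilCLM_le (n := n) N
  refine ⟨k, ‖fourierConst n‖ₑ * ENNReal.ofReal C, by finiteness, fun φ f h j x => ?_⟩
  rw [dilCLM_smulLeftCLM, dilCLM_neg_dilCLM, waveCLM_smulLeftCLM_eq_integral, enorm_smul,
    mul_assoc, mul_assoc]
  refine mul_le_mul' le_rfl ((enorm_integral_le_lintegral_enorm _).trans ?_)
  have hS : 0 ≤ schwartzNorm k h := apply_nonneg _ _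
  rw [← mul_assoc, ← ENNReal.ofReal_mul hC, polyConv, ← lintegral_const_mul' _ _ ENNReal.ofReal_ne_top]
  refine lintegral_mono fun y => ?_
  rw [enorm_smul, ← mul_assoc, ← mul_assoc]
  refine mul_le_mul' ?_ le_rfl
  rw [← ofReal_norm, ← ofReal_weight_inv, ← ENNReal.ofReal_mul (by positivity),
    ← ENNReal.ofReal_mul (by positivity)]
  refine ENNReal.ofReal_le_ofReal ((hk h j (x - y)).trans (le_of_eq ?_))
  ring

/-- A cut-off equal to 1 on the ball of radius 2 reproduces the block itself, so Peetre's argument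
applies to it. The a priori polynomial growth it requires is that of a tempered distribution. -/
theorem IsDyadicResolution.exists_enorm_waveCLM_smul_le_avg [CompleteSpace E]
    (hφ : IsDyadicResolution φ) {r : ℝ} (hr : 0 < r) (hr1 : r ≤ 1) : ∃ (k : ℕ) (C : ℝ≥0∞), C ≠ ∞ ∧
    ∀ (f : 𝓢(Rn n, ℂ) →L[ℂ] E) (h : 𝓢(Rn n, ℂ)) (j : ℕ) (x : Rn n),
      ‖f (waveCLM x (dilCLM (-(j : ℤ)) (smulLeftCLM ℂ h (dilCLM j (φ j)))))‖ₑ ≤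
        C * ENNReal.ofReal (schwartzNorm k h) *
          avg r j (fun y => ‖f (waveCLM y (φ j))‖ₑ) x := by
  obtain ⟨N, hN⟩ : ∃ N : ℕ, (n + 1 : ℝ) ≤ N * r := by
    obtain ⟨A, hA⟩ := exists_nat_ge ((n + 1 : ℝ) / r)
    exact ⟨A, (div_le_iff₀ hr).1 hA⟩
  obtain ⟨σ, hσ⟩ := exists_inverse_symbol n 0
  choose k C hC hk using fun N => enorm_waveCLM_smul_le_polyConv (n := n) (E := E) N
  have hrepr : ∀ j : ℕ, dilCLM (-(j : ℤ)) (smulLeftCLM ℂ σ (dilCLM j (φ j))) = φ j := fun j => by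
    have h1 : smulLeftCLM ℂ σ (dilCLM j (φ j)) = dilCLM j (φ j) := by
      ext ξ
      rw [smulLeftCLM_apply_apply σ.hasTemperateGrowth]
      by_cases hξ : ‖ξ‖ ≤ 2
      · have := hσ ξ hξ (Or.inr rfl)
        rw [pow_zero, one_mul] at this
        rw [this, one_smul]
      · rw [hφ.dilCLM_eq_zero (not_le.1 hξ), smul_zero]
    rw [h1, dilCLM_neg_dilCLM]
  set D : ℕ → ℝ≥0∞ := fun N => C N * ENNReal.ofReal (schwartzNorm (k N) σ) with hD
  have hDt : ∀ N, D N ≠ ∞ := fun N => ENNReal.mul_ne_top (hC N) ENNReal.ofReal_ne_top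
  refine ⟨k N, C N * D N ^ ((1 - r) / r), ENNReal.mul_ne_top (hC N)
    (ENNReal.rpow_ne_top_of_nonneg (div_nonneg (by linarith) hr.le) (hDt N)), fun f h j x => ?_⟩
  obtain ⟨l, l', B, hB, hgrowth⟩ := exists_norm_waveCLM_le f
  have hu : ∀ N x, ‖f (waveCLM x (φ j))‖ₑ ≤ D N * polyConv j N (fun y => ‖f (waveCLM y (φ j))‖ₑ) x :=
    fun N x => by
      have := hk N φ f σ j x
      rwa [hrepr] at this
  have hpoly := polyConv_le_avg hr hr1 (j := j) hN (measurable_enorm_waveCLM f (φ j)) hDt hu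
    (k := l) (K := ENNReal.ofReal (B * schwartzNorm l' (φ j))) ENNReal.ofReal_ne_top
    (fun x => by
      have hS : 0 ≤ schwartzNorm l' (φ j) := apply_nonneg _ _
      rw [← ofReal_norm, weight, ← ENNReal.ofReal_pow (by positivity),
        ← ENNReal.ofReal_mul (by positivity)]
      refine ENNReal.ofReal_le_ofReal ((hgrowth x (φ j)).trans ?_)
      gcongr
      exact le_mul_of_one_le_left (norm_nonneg _) (one_le_pow₀ one_le_two)) x
  refine (hk N φ f h j x).trans ((mul_le_mul' le_rfl hpoly).trans (le_of_eq ?_))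
  ring

variable {n : ℕ}

/-! ### Smooth partitions of unity by translates -/

/-- Take g(t) = G(t) - G(t-1) for a smooth step G rising from 0 to 1 within ε of -1/2; its integer
translates telescope. As ε < 1/2, the translates by ⌊t⌋ and ⌊t⌋+1 already sum to 1. -/
theorem exists_partition_real {ε : ℝ} (hε : 0 < ε) (hε2 : ε < 1 / 2) : ∃ g : ℝ → ℝ, ContDiff ℝ (⊤ : ℕ∞) g ∧
    (∀ t, 1 / 2 + ε < |t| → g t = 0) ∧
    ∀ t : ℝ, ∑ m ∈ {⌊t⌋, ⌊t⌋ + 1}, g (t - (m : ℤ)) = 1 := by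
  set G : ℝ → ℝ := fun t => Real.smoothTransition ((t + (1 / 2 + ε)) / (2 * ε)) with hG
  have hG0 : ∀ t, t ≤ -(1 / 2 + ε) → G t = 0 := fun t ht =>
    Real.smoothTransition.zero_of_nonpos (div_nonpos_of_nonpos_of_nonneg (by linarith) (by linarith))
  have hG1 : ∀ t, -(1 / 2) + ε ≤ t → G t = 1 := fun t ht =>
    Real.smoothTransition.one_of_one_le ((one_le_div (by linarith)).2 (by linarith))
  refine ⟨fun t => G t - G (t - 1), ?_, fun t ht => ?_, fun t => ?_⟩
  · have h : ContDiff ℝ (⊤ : ℕ∞) G := Real.smoothTransition.contDiff.comp (by fun_prop)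
    exact h.sub (h.comp (by fun_prop))
  · dsimp only
    rcases lt_abs.1 ht with h | h
    · rw [hG1 t (by linarith), hG1 (t - 1) (by linarith), sub_self]
    · rw [hG0 t (by linarith), hG0 (t - 1) (by linarith), sub_self]
  · rw [Finset.sum_pair (by omega)]
    have h1 := Int.floor_le t
    have h2 := Int.lt_floor_add_one t
    have e : t - (⌊t⌋ : ℝ) - 1 = t - ((⌊t⌋ + 1 : ℤ) : ℝ) := by push_cast; ring
    dsimp only
    rw [e, hG1 (t - (⌊t⌋ : ℝ)) (by linarith), hG0 (t - ((⌊t⌋ + 1 : ℤ) : ℝ) - 1) (by push_cast; linarith)]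
    ring

theorem isClosed_cube (d : ℝ) (ν : ℕ) (m : Fin n → ℤ) : IsClosed (cube d ν m) := by
  have : cube d ν m = ⋂ i, {x : Rn n | |x i - (2 : ℝ) ^ (-(ν : ℤ)) * m i| ≤
      d * (2 : ℝ) ^ (-(ν : ℤ) - 1)} := by
    ext x; simp [cube]
  rw [this]
  exact isClosed_iInter fun i => isClosed_le (by fun_prop) continuous_const

theorem hasCompactSupport_of_cube {d : ℝ} (hd : 0 ≤ d) {ν : ℕ} {m : Fin n → ℤ} {g : Rn n → ℂ}
    (hg : ∀ x, g x ≠ 0 → x ∈ cube d ν m) : HasCompactSupport g :=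
  HasCompactSupport.of_support_subset_isCompact (isCompact_closedBall _ _)
    (Set.Subset.trans (fun x hx => hg x hx) (cube_subset_closedBall hd ν m))

theorem cubeCenter_zero_apply (m : Fin n → ℤ) (i : Fin n) : cubeCenter 0 m i = m i := by
  simp [cubeCenter]

/-- A smooth partition of unity by the integer translates of a function supported in the
cube `d Q`. -/
theorem exists_partition (n : ℕ) {d : ℝ} (hd : 1 < d) : ∃ ψ : 𝓢(Rn n, ℂ),
    (∀ x, ψ x ≠ 0 → x ∈ cube d 0 0) ∧
    ∀ x : Rn n, HasSum (fun m : Fin n → ℤ => ψ (x - cubeCenter 0 m)) 1 := by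
  -- With this ε the support satisfies |x_i| ≤ 1/2 + ε ≤ d/2; positivity of ε is where d > 1 enters.
  obtain ⟨g, hg, hg0, hg1⟩ := exists_partition_real (ε := min (1 / 4) ((d - 1) / 2))
    (lt_min (by norm_num) (by linarith)) ((min_le_left _ _).trans_lt (by norm_num))
  have hsupp : ∀ x : Rn n, (∏ i, (g (x i) : ℂ)) ≠ 0 → ∀ i, |x i| ≤ 1 / 2 + min (1 / 4) ((d - 1) / 2) :=
    fun x hx i => by
      by_contra h
      exact hx (Finset.prod_eq_zero (Finset.mem_univ i) (by rw [hg0 _ (not_le.1 h)]; simp))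
  have hcube : ∀ x : Rn n, (∏ i, (g (x i) : ℂ)) ≠ 0 → x ∈ cube d 0 0 := fun x hx => by
    rw [mem_cube_iff]
    intro i
    have h1 := hsupp x hx i
    have h2 := min_le_right (1 / 4) ((d - 1) / 2)
    simp only [pow_zero, one_mul, Pi.zero_apply, Int.cast_zero, sub_zero]
    linarith
  have hs : ContDiff ℝ (⊤ : ℕ∞) fun x : Rn n => ∏ i, (g (x i) : ℂ) :=
    contDiff_prod fun i _ => Complex.ofRealCLM.contDiff.comp (hg.comp (by fun_prop))
  refine ⟨(hasCompactSupport_of_cube (by linarith) hcube).toSchwartzMap hs, hcube, fun x => ?_⟩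
  set T : Fin n → Finset ℤ := fun i => {⌊x i⌋, ⌊x i⌋ + 1} with hT
  have e : ∑ m ∈ Fintype.piFinset T, ∏ i, (g (x i - m i) : ℂ) = 1 := by
    rw [← Finset.prod_univ_sum T fun i m => (g (x i - (m : ℤ)) : ℂ)]
    refine Finset.prod_eq_one fun i _ => ?_
    exact_mod_cast hg1 (x i)
  have e2 : ∀ m : Fin n → ℤ, ((hasCompactSupport_of_cube (by linarith) hcube).toSchwartzMap hs)
      (x - cubeCenter 0 m) = ∏ i, (g (x i - m i) : ℂ) := fun m => by
    change ∏ i, (g ((x - cubeCenter 0 m) i) : ℂ) = _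
    simp_rw [PiLp.sub_apply, cubeCenter_zero_apply]
  simp_rw [e2]
  rw [← e]
  refine hasSum_sum_of_ne_finset_zero fun m hm => ?_
  rw [Fintype.mem_piFinset, not_forall] at hm
  obtain ⟨i, hi⟩ := hm
  refine Finset.prod_eq_zero (Finset.mem_univ i) ?_
  rw [hg0, Complex.ofReal_zero]
  have h3 := min_le_left (1 / 4) ((d - 1) / 2)
  rw [lt_abs]
  simp only [hT, Finset.mem_insert, Finset.mem_singleton, not_or] at hi
  rcases lt_or_ge (m i) ⌊x i⌋ with h | h
  · left
    have h4 : (m i : ℝ) + 1 ≤ ⌊x i⌋ := by exact_mod_cast h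
    linarith [Int.floor_le (x i)]
  · right
    have h4 : (⌊x i⌋ : ℝ) + 2 ≤ m i := by
      have : ⌊x i⌋ + 2 ≤ m i := by omega
      exact_mod_cast this
    linarith [Int.lt_floor_add_one (x i)]

/-! ### Quarks -/

/-- The functions `x^β / β! ψ` together with bounds of their Schwartz seminorms. -/
theorem exists_quarks {d : ℝ} (hd : 0 ≤ d) {ψ : 𝓢(Rn n, ℂ)} (hψ : ∀ x, ψ x ≠ 0 → x ∈ cube d 0 0) :
    ∃ b : (Fin n → ℕ) → 𝓢(Rn n, ℂ), (∀ β x, b β x = taylorCoeff x β * ψ x) ∧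
      ∀ l : ℕ, ∃ B C : ℝ, 1 ≤ B ∧ 0 < C ∧ ∀ β, schwartzNorm l (b β) ≤
        C * (B ^ (∑ k, β k) * ∏ k, ((β k).factorial : ℝ)⁻¹) := by
  -- Shrinking by 2^{-J} brings the cube into the ball where the truncated coordinates are exact.
  -- Space monomials can then be written with `freqMonomial`, whose exponential bound is reused, and
  -- a = 2^J/i undoes the dilation and the factor i.
  obtain ⟨J, hJ⟩ := pow_unbounded_of_one_lt (n * d) (one_lt_two (α := ℝ))
  set a : ℂ := (2 : ℂ) ^ J / Complex.I with ha
  refine ⟨fun β => ((∏ k, ((β k).factorial : ℂ)⁻¹) * a ^ (∑ k, β k)) •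
    dilCLM (-(J : ℤ)) (freqMonomial β (dilCLM J ψ)), fun β x => ?_, fun l => ?_⟩
  · rw [smul_apply, dilCLM_apply, freqMonomial_apply, ← dilCLM_apply, dilCLM_neg_dilCLM]
    by_cases hx : ψ x = 0
    · rw [hx]; simp
    have h1 := norm_le_of_mem_cube hd (hψ x hx)
    have h0 : cubeCenter 0 (0 : Fin n → ℤ) = 0 := by ext i; simp [cubeCenter]
    rw [h0, sub_zero, pow_zero, one_mul] at h1
    have h2 : ‖(2 : ℝ) ^ (-(J : ℤ)) • x‖ ≤ 2 := by
      rw [norm_smul, Real.norm_of_nonneg (by positivity), zpow_neg, zpow_natCast,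
        inv_mul_le_iff₀ (by positivity)]
      linarith [norm_nonneg x]
    simp_rw [freqCoord_apply h2]
    rw [smul_eq_mul, ← mul_assoc]
    congr 1
    rw [taylorCoeff, ← Finset.prod_pow_eq_pow_sum, ← Finset.prod_mul_distrib, ← Finset.prod_mul_distrib]
    refine Finset.prod_congr rfl fun k _ => ?_
    rw [mul_assoc, ← mul_pow, div_eq_inv_mul]
    congr 2
    rw [ha, PiLp.smul_apply, smul_eq_mul, zpow_neg, zpow_natCast]
    push_cast
    field_simp
  · obtain ⟨k, C, hC, h⟩ := exists_schwartzNorm_le (dilCLM (n := n) (-(J : ℤ))) l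
    obtain ⟨B, hB, h'⟩ := exists_schwartzNorm_freqMonomial_le n k
    have hS : 0 ≤ schwartzNorm k (dilCLM J ψ) := apply_nonneg _ _
    have ha1 : ‖a‖ = 2 ^ J := by rw [ha]; simp
    refine ⟨2 ^ J * B, C * schwartzNorm k (dilCLM J ψ) + 1, ?_, by positivity, fun β => ?_⟩
    · have := one_le_pow₀ (one_le_two (α := ℝ)) (n := J)
      nlinarith
    rw [map_smul_eq_mul, norm_mul, norm_pow, ha1, norm_prod, mul_pow]
    simp_rw [norm_inv, Complex.norm_natCast]
    have hP : 0 ≤ ∏ k, ((β k).factorial : ℝ)⁻¹ := Finset.prod_nonneg fun _ _ => by positivity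
    have hB0 : 0 ≤ B := by linarith
    calc (∏ k, ((β k).factorial : ℝ)⁻¹) * (2 ^ J) ^ (∑ k, β k) *
          schwartzNorm l (dilCLM (-(J : ℤ)) (freqMonomial β (dilCLM J ψ)))
        ≤ (∏ k, ((β k).factorial : ℝ)⁻¹) * (2 ^ J) ^ (∑ k, β k) *
          (C * (B ^ (∑ k, β k) * schwartzNorm k (dilCLM J ψ))) := by
          gcongr
          exact (h _).trans (mul_le_mul_of_nonneg_left (h' β _) hC)
      _ = C * schwartzNorm k (dilCLM J ψ) *
            ((2 ^ J) ^ (∑ k, β k) * B ^ (∑ k, β k) * ∏ k, ((β k).factorial : ℝ)⁻¹) := by ring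
      _ ≤ _ := by gcongr; linarith

variable {n : ℕ}

/-! ### The Laplacian of Schwartz functions -/

/-- The Laplacian on Schwartz functions. -/
def lapCLM (n : ℕ) : 𝓢(Rn n, ℂ) →L[ℂ] 𝓢(Rn n, ℂ) :=
  ∑ i : Fin n, LineDeriv.lineDerivOpCLM ℂ 𝓢(Rn n, ℂ) (EuclideanSpace.single i (1 : ℝ)) ∘L
    LineDeriv.lineDerivOpCLM ℂ 𝓢(Rn n, ℂ) (EuclideanSpace.single i (1 : ℝ))

theorem lapCLM_apply (θ : 𝓢(Rn n, ℂ)) : lapCLM n θ =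
    ∑ i : Fin n, ∂_{EuclideanSpace.single i (1 : ℝ)} (∂_{EuclideanSpace.single i (1 : ℝ)} θ) := by
  simp [lapCLM]

theorem lapCLM_pow_succ (r : ℕ) (θ : 𝓢(Rn n, ℂ)) :
    (lapCLM n ^ (r + 1)) θ = (lapCLM n ^ r) (lapCLM n θ) := by
  rw [pow_succ]; rfl

theorem lapCLM_pow_succ' (r : ℕ) (θ : 𝓢(Rn n, ℂ)) :
    (lapCLM n ^ (r + 1)) θ = lapCLM n ((lapCLM n ^ r) θ) := by
  rw [pow_succ']; rfl

theorem expIntegral_lineDerivOp (v : Rn n) (θ : 𝓢(Rn n, ℂ)) (ξ : Rn n) :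
    expIntegral (∂_{v} θ) ξ = -Complex.I * ((inner ℝ ξ v : ℝ) : ℂ) * expIntegral θ ξ := by
  have hv : Function.HasTemperateGrowth fun ξ : Rn n => inner ℝ ξ v :=
    ((innerSL ℝ).flip _).hasTemperateGrowth
  have h : (dilTwoPi n) ξ = ((2 * Real.pi)⁻¹ : ℝ) • ξ := rfl
  simp only [expIntegral, invFourier, smul_apply, compCLMOfContinuousLinearEquiv_apply,
    Function.comp_apply, smul_eq_mul]
  rw [fourierInv_lineDerivOp_eq, smul_apply, smulLeftCLM_apply_apply hv, h, inner_smul_left,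
    smul_eq_mul, Complex.real_smul]
  simp only [conj_trivial]
  push_cast
  have : (Real.pi : ℂ) ≠ 0 := by exact_mod_cast Real.pi_ne_zero
  field_simp

theorem expIntegral_lapCLM_pow (r : ℕ) (θ : 𝓢(Rn n, ℂ)) (ξ : Rn n) :
    expIntegral ((lapCLM n ^ r) θ) ξ = (-(‖ξ‖ : ℂ) ^ 2) ^ r * expIntegral θ ξ := by
  induction r generalizing θ with
  | zero => simp
  | succ r ih =>
    rw [lapCLM_pow_succ, ih, pow_succ (-(‖ξ‖ : ℂ) ^ 2) r, mul_assoc]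
    congr 1
    have hs : ∀ g : Fin n → 𝓢(Rn n, ℂ), expIntegral (∑ i, g i) ξ = ∑ i, expIntegral (g i) ξ := by
      intro g
      have e : ∀ θ : 𝓢(Rn n, ℂ), expIntegral θ =
          ((fourierConst n)⁻¹ • (fourierConst n • (compCLMOfContinuousLinearEquiv ℂ (dilTwoPi n) ∘L
            FourierTransform.fourierInvCLM ℂ 𝓢(Rn n, ℂ)))) θ := fun θ => rfl
      simp_rw [e, map_sum, FunLike.coe_sum, Finset.sum_apply]
    rw [lapCLM_apply, hs]
    simp_rw [expIntegral_lineDerivOp]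
    have h2 : ((‖ξ‖ : ℂ)) ^ 2 = ∑ i, (ξ i : ℂ) ^ 2 := by
      have := EuclideanSpace.real_norm_sq_eq ξ
      exact_mod_cast congrArg (fun t : ℝ => (t : ℂ)) this
    rw [h2, ← Finset.sum_neg_distrib, Finset.sum_mul]
    refine Finset.sum_congr rfl fun i _ => ?_
    rw [EuclideanSpace.inner_single_right]
    simp only [one_mul, conj_trivial]
    linear_combination (ξ i : ℂ) ^ 2 * expIntegral θ ξ * Complex.I_mul_I

theorem integral_lapCLM_pow_mul (r : ℕ) (θ b : 𝓢(Rn n, ℂ)) :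
    ∫ x, (lapCLM n ^ r) θ x * b x = ∫ x, θ x * (lapCLM n ^ r) b x := by
  have h1 : ∀ θ b : 𝓢(Rn n, ℂ), ∫ x, lapCLM n θ x * b x = ∫ x, θ x * lapCLM n b x := by
    intro θ b
    have e : ∀ θ : 𝓢(Rn n, ℂ), lapCLM n θ = Laplacian.laplacian θ := fun θ => by
      rw [lapCLM_apply, SchwartzMap.laplacian_eq_sum (EuclideanSpace.basisFun (Fin n) ℝ)]
      simp
    rw [e, e]
    exact (integral_mul_laplacian_right_eq_left θ b).symm
  induction r generalizing θ b with
  | zero => simp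
  | succ r ih =>
    rw [lapCLM_pow_succ', h1, ih, ← lapCLM_pow_succ]

/-- The function `x ↦ h(2^j (x - a))`. -/
def bump (j : ℕ) (a : Rn n) : 𝓢(Rn n, ℂ) →L[ℂ] 𝓢(Rn n, ℂ) :=
  compSubConstCLM ℂ a ∘L dilCLM j

theorem bump_apply (j : ℕ) (a : Rn n) (h : 𝓢(Rn n, ℂ)) (x : Rn n) :
    bump j a h x = h ((2 : ℝ) ^ j • (x - a)) := by
  simp [bump, dilCLM_apply]

theorem lineDerivOp_bump (v : Rn n) (j : ℕ) (a : Rn n) (h : 𝓢(Rn n, ℂ)) :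
    ∂_{v} (bump j a h) = ((2 : ℝ) ^ j) • bump j a (∂_{v} h) := by
  have e : ∂_{v} (dilCLM j h) = ((2 : ℝ) ^ j) • dilCLM j (∂_{v} h) := by
    have := lineDerivOp_compCLMOfContinuousLinearEquiv (𝕜 := ℂ) v
      (ContinuousLinearEquiv.smulLeft (Units.mk0 ((2 : ℝ) ^ (j : ℤ)) (by positivity))) h
    rw [dilCLM, this]
    have e2 : (ContinuousLinearEquiv.smulLeft (Units.mk0 ((2 : ℝ) ^ (j : ℤ)) (by positivity)) :
        Rn n ≃L[ℝ] Rn n) v = ((2 : ℝ) ^ j) • v := rfl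
    rw [e2, LineDeriv.lineDerivOp_left_smul]
    ext x
    rfl
  rw [bump, ContinuousLinearMap.comp_apply, lineDerivOp_compSubConstCLM, e]
  ext x
  simp [smul_apply]

theorem lapCLM_pow_bump (r j : ℕ) (a : Rn n) (h : 𝓢(Rn n, ℂ)) :
    (lapCLM n ^ r) (bump j a h) = (((2 : ℝ) ^ j) ^ (2 * r)) • bump j a ((lapCLM n ^ r) h) := by
  induction r generalizing h with
  | zero => simp
  | succ r ih =>
    have h1 : lapCLM n (bump j a h) = (((2 : ℝ) ^ j) ^ 2) • bump j a (lapCLM n h) := by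
      rw [lapCLM_apply, lapCLM_apply, map_sum, Finset.smul_sum]
      refine Finset.sum_congr rfl fun i _ => ?_
      rw [lineDerivOp_bump, LineDeriv.lineDerivOp_smul, lineDerivOp_bump, smul_smul, sq]
    rw [lapCLM_pow_succ, h1, lapCLM_pow_succ, ContinuousLinearMap.map_smul_of_tower, ih, smul_smul]
    congr 1
    ring

theorem lapCLM_pow_eq_zero_of_isOpen (r : ℕ) {U : Set (Rn n)} (hU : IsOpen U) {h : 𝓢(Rn n, ℂ)}
    (hh : ∀ x ∈ U, h x = 0) : ∀ x ∈ U, (lapCLM n ^ r) h x = 0 := by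
  have h1 : ∀ (v : Rn n) (g : 𝓢(Rn n, ℂ)), (∀ x ∈ U, g x = 0) → ∀ x ∈ U, (∂_{v} g) x = 0 := by
    intro v g hg x hx
    have : ⇑g =ᶠ[nhds x] fun _ => 0 := Filter.eventually_of_mem (hU.mem_nhds hx) hg
    rw [lineDerivOp_apply_eq_fderiv, this.fderiv_eq]
    simp
  induction r generalizing h with
  | zero => simpa using hh
  | succ r ih =>
    intro x hx
    rw [lapCLM_pow_succ]
    refine ih (fun y hy => ?_) x hx
    rw [lapCLM_apply, sum_apply]
    exact Finset.sum_eq_zero fun i _ => h1 _ _ (h1 _ _ hh) y hy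

theorem hasLineDerivAt_monomial (β : Fin n → ℕ) (i : Fin n) (x : Rn n) :
    HasLineDerivAt ℝ (fun x : Rn n => ∏ l, x l ^ β l)
      (β i * ∏ l, x l ^ (β - Pi.single i 1 : Fin n → ℕ) l) x (EuclideanSpace.single i 1) := by
  have e : ∀ t : ℝ, ∏ l, (x + t • EuclideanSpace.single i (1 : ℝ)) l ^ β l =
      (x i + t) ^ β i * ∏ l ∈ Finset.univ.erase i, x l ^ β l := by
    intro t
    rw [← Finset.mul_prod_erase _ _ (Finset.mem_univ i)]
    congr 1
    · simp
    · refine Finset.prod_congr rfl fun l hl => ?_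
      simp [Finset.ne_of_mem_erase hl]
  unfold HasLineDerivAt
  simp_rw [e]
  have h1 : ∏ l, x l ^ (β - Pi.single i 1 : Fin n → ℕ) l =
      x i ^ (β i - 1) * ∏ l ∈ Finset.univ.erase i, x l ^ β l := by
    rw [← Finset.mul_prod_erase _ _ (Finset.mem_univ i)]
    congr 1
    · simp
    · refine Finset.prod_congr rfl fun l hl => ?_
      simp [Finset.ne_of_mem_erase hl]
  rw [h1, ← mul_assoc]
  have h2 : ∀ (c : ℝ) (k : ℕ), HasDerivAt (fun t : ℝ => (c + t) ^ k) (k * c ^ (k - 1)) 0 := by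
    intro c k
    simpa using ((hasDerivAt_id' (0 : ℝ)).const_add c).fun_pow k
  exact (h2 (x i) (β i)).mul_const _

theorem integral_smul_hasLineDerivAt {f f' : Rn n → ℝ} {g g' : Rn n → ℂ} {v : Rn n}
    (h1 : Integrable fun x => f' x • g x) (h2 : Integrable fun x => f x • g' x)
    (h3 : Integrable fun x => f x • g x) (hf : ∀ x, HasLineDerivAt ℝ f (f' x) x v)
    (hg : ∀ x, HasLineDerivAt ℝ g (g' x) x v) :
    ∫ x, f x • g' x = -∫ x, f' x • g x :=
  integral_bilinear_hasLineDerivAt_right_eq_neg_left_of_integrable (μ := volume)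
    (B := ContinuousLinearMap.lsmul ℝ ℝ) h1 h2 h3 (fun x _ => hf x) (fun x _ => hg x)

theorem integrable_monomial_smul (c : ℝ) (β : Fin n → ℕ) {g : Rn n → ℂ} (hg : Continuous g)
    (hc : HasCompactSupport g) : Integrable fun x : Rn n => (c * ∏ l, x l ^ β l) • g x := by
  refine Continuous.integrable_of_hasCompactSupport ?_ ?_
  · fun_prop
  · exact hc.smul_left (f := fun x : Rn n => c * ∏ l, x l ^ β l)

theorem integral_monomial_lineDerivOp {g : 𝓢(Rn n, ℂ)} (hg : HasCompactSupport g) (β : Fin n → ℕ)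
    (i : Fin n) : ∫ x : Rn n, (∏ l, x l ^ β l) • (∂_{EuclideanSpace.single i (1 : ℝ)} g : 𝓢(Rn n, ℂ)) x =
      -∫ x : Rn n, (β i * ∏ l, x l ^ (β - Pi.single i 1 : Fin n → ℕ) l) • g x := by
  have hg' : HasCompactSupport fun x => (fderiv ℝ g x) (EuclideanSpace.single i (1 : ℝ)) :=
    hg.fderiv_apply (𝕜 := ℝ) _
  have hint := fun (c : ℝ) (β : Fin n → ℕ) (g : 𝓢(Rn n, ℂ)) (hg : HasCompactSupport g) =>
    integrable_monomial_smul c β g.continuous hg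
  have h1 := hint 1 β (∂_{EuclideanSpace.single i (1 : ℝ)} g) hg'
  have h2 := hint 1 β g hg
  have h3 := hint (β i) (β - Pi.single i 1) g hg
  have h4 : ∀ x, HasLineDerivAt ℝ g ((∂_{EuclideanSpace.single i (1 : ℝ)} g : 𝓢(Rn n, ℂ)) x) x
      (EuclideanSpace.single i (1 : ℝ)) := fun x =>
    (g.differentiableAt.hasFDerivAt).hasLineDerivAt _
  simp only [one_mul] at h1 h2
  exact integral_smul_hasLineDerivAt h3 h1 h2 (hasLineDerivAt_monomial β i) h4

/-- Each partial derivative, integrated by parts, lowers the degree of the monomial by one and so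
gains one order of vanishing moments; a Laplacian gains two. -/
theorem integral_monomial_lapCLM_pow {g : 𝓢(Rn n, ℂ)} (hg : HasCompactSupport g) (r : ℕ)
    (β : Fin n → ℕ) (hβ : ∑ i, β i < 2 * r) :
    ∫ x : Rn n, (∏ l, x l ^ β l) • (lapCLM n ^ r) g x = 0 := by
  have step : ∀ (k : ℕ) (g : 𝓢(Rn n, ℂ)), HasCompactSupport g →
      (∀ β : Fin n → ℕ, ∑ i, β i < k → ∫ x : Rn n, (∏ l, x l ^ β l) • g x = 0) → ∀ i : Fin n,
      HasCompactSupport (∂_{EuclideanSpace.single i (1 : ℝ)} g : 𝓢(Rn n, ℂ)) ∧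
      ∀ β : Fin n → ℕ, ∑ i, β i < k + 1 →
        ∫ x : Rn n, (∏ l, x l ^ β l) • (∂_{EuclideanSpace.single i (1 : ℝ)} g : 𝓢(Rn n, ℂ)) x = 0 := by
    intro k g hg h i
    refine ⟨hg.fderiv_apply (𝕜 := ℝ) _, fun β hβ => ?_⟩
    rw [integral_monomial_lineDerivOp hg, neg_eq_zero]
    simp_rw [mul_smul]
    rw [integral_smul]
    rcases Nat.eq_zero_or_pos (β i) with h0 | h0
    · rw [h0]; simp
    rw [h, smul_zero]
    have : ∑ l, β l = ∑ l, (β - Pi.single i 1 : Fin n → ℕ) l + 1 := by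
      rw [← Finset.add_sum_erase _ _ (Finset.mem_univ i),
        ← Finset.add_sum_erase _ (β - Pi.single i 1) (Finset.mem_univ i)]
      have : ∑ l ∈ Finset.univ.erase i, (β - Pi.single i 1 : Fin n → ℕ) l =
          ∑ l ∈ Finset.univ.erase i, β l := by
        refine Finset.sum_congr rfl fun l hl => ?_
        simp [Finset.ne_of_mem_erase hl]
      rw [this]
      simp
      omega
    omega
  have main : ∀ r : ℕ, HasCompactSupport ⇑((lapCLM n ^ r) g) ∧ ∀ β : Fin n → ℕ, ∑ i, β i < 2 * r →
      ∫ x : Rn n, (∏ l, x l ^ β l) • (lapCLM n ^ r) g x = 0 := by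
    intro r
    induction r with
    | zero => exact ⟨by simpa using hg, fun β hβ => absurd hβ (by simp)⟩
    | succ r ih =>
      have h1 := fun i => step _ _ ih.1 ih.2 i
      have h2 := fun i => step _ _ (h1 i).1 (h1 i).2 i
      have e : ∀ x, (lapCLM n ^ (r + 1)) g x = ∑ i : Fin n, (∂_{EuclideanSpace.single i (1 : ℝ)}
          (∂_{EuclideanSpace.single i (1 : ℝ)} ((lapCLM n ^ r) g)) : 𝓢(Rn n, ℂ)) x := fun x => by
        rw [lapCLM_pow_succ', lapCLM_apply, sum_apply]
      constructor
      · refine HasCompactSupport.intro (K := ⋃ i : Fin n, tsupport (∂_{EuclideanSpace.single i (1 : ℝ)}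
          (∂_{EuclideanSpace.single i (1 : ℝ)} ((lapCLM n ^ r) g)) : 𝓢(Rn n, ℂ)))
          (isCompact_iUnion fun i => (h2 i).1) fun x hx => ?_
        rw [e]
        refine Finset.sum_eq_zero fun i _ => image_eq_zero_of_notMem_tsupport fun h => hx ?_
        exact Set.mem_iUnion.2 ⟨i, h⟩
      · intro β hβ
        simp_rw [e, Finset.smul_sum]
        rw [integral_finsetSum]
        · exact Finset.sum_eq_zero fun i _ => (h2 i).2 β (by omega)
        · intro i _
          exact Continuous.integrable_of_hasCompactSupport
            ((by fun_prop : Continuous fun x : Rn n => ∏ l, x l ^ β l).smul (SchwartzMap.continuous _))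
            (h2 i).1.smul_left
  exact (main r).2 β hβ

variable {n : ℕ}

/-! ### Local Taylor expansion of the dyadic blocks -/

theorem two_pow_smul_sub_apply (j : ℕ) (m : Fin n → ℤ) (x : Rn n) (i : Fin n) :
    ((2 : ℝ) ^ j • (x - cubeCenter j m)) i = 2 ^ j * x i - m i := by
  have h2 : (2 : ℝ) ^ j ≠ 0 := by positivity
  change (2 : ℝ) ^ j * (x i - (2 : ℝ) ^ (-(j : ℤ)) * m i) = _
  rw [mul_sub, zpow_neg, zpow_natCast, mul_inv_cancel_left₀ h2]

theorem smul_sub_mem_cube_iff {d : ℝ} {j : ℕ} {m : Fin n → ℤ} {x : Rn n} :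
    (2 : ℝ) ^ j • (x - cubeCenter j m) ∈ cube d 0 0 ↔ x ∈ cube d j m := by
  rw [mem_cube_iff, mem_cube_iff]
  refine forall_congr' fun i => ?_
  rw [two_pow_smul_sub_apply]
  simp

theorem two_pow_smul_sub_eq (j : ℕ) (m : Fin n → ℤ) (x : Rn n) :
    (2 : ℝ) ^ j • (x - cubeCenter j m) = (2 : ℝ) ^ j • x - cubeCenter 0 m := by
  ext i
  rw [two_pow_smul_sub_apply, PiLp.sub_apply, cubeCenter_zero_apply]
  simp

/-- The weights `B^{|β|} / β!`. -/
def quarkWeight (B : ℝ) (β : Fin n → ℕ) : ℝ := B ^ (∑ k, β k) * ∏ k, ((β k).factorial : ℝ)⁻¹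

theorem quarkWeight_eq_prod (B : ℝ) (β : Fin n → ℕ) :
    quarkWeight B β = ∏ k, (B ^ β k / (β k).factorial) := by
  rw [quarkWeight, ← Finset.prod_pow_eq_pow_sum, ← Finset.prod_mul_distrib]
  rfl

theorem quarkWeight_pos {B : ℝ} (hB : 0 < B) (β : Fin n → ℕ) : 0 < quarkWeight B β := by
  rw [quarkWeight_eq_prod]
  exact Finset.prod_pos fun k _ => by positivity

theorem pow_mul_quarkWeight (A B : ℝ) (β : Fin n → ℕ) :
    A ^ (∑ k, β k) * quarkWeight B β = quarkWeight (A * B) β := by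
  rw [quarkWeight, quarkWeight, mul_pow, mul_assoc]

theorem tsum_quarkWeight_ne_top {B : ℝ} (hB : 0 < B) :
    ∑' β : Fin n → ℕ, ENNReal.ofReal (quarkWeight B β) ≠ ∞ := by
  have h : ∀ β : Fin n → ℕ, ENNReal.ofReal (quarkWeight B β) =
      ∏ k, ENNReal.ofReal (B ^ β k / (β k).factorial) := fun β => by
    rw [quarkWeight_eq_prod, ENNReal.ofReal_prod_of_nonneg fun k _ => by positivity]
  simp_rw [h]
  rw [tsum_prod_pi fun b => ENNReal.ofReal (B ^ b / b.factorial)]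
  refine ENNReal.pow_ne_top ?_
  rw [← ENNReal.ofReal_tsum_of_nonneg (fun b => by positivity) (Real.summable_pow_div_factorial B)]
  exact ENNReal.ofReal_ne_top

theorem norm_le_schwartzNorm (h : 𝓢(Rn n, ℂ)) (l : ℕ) (x : Rn n) : ‖h x‖ ≤ schwartzNorm l h :=
  (norm_le_seminorm ℂ h x).trans (seminorm_le_schwartzNorm (Nat.zero_le _) (Nat.zero_le _) h)

theorem summable_of_tsum_enorm_ne_top {F ι : Type*} [NormedAddCommGroup F]
    [CompleteSpace F] {g : ι → F}
    (h : ∑' i, ‖g i‖ₑ ≠ ∞) : Summable g := by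
  refine Summable.of_norm ?_
  have h1 := ENNReal.summable_toReal h
  simpa using h1

variable {E : Type*} [NormedAddCommGroup E] [NormedSpace ℂ E]

/-- The coefficients of the local Taylor expansions. -/
def taylorAt (f : 𝓢(Rn n, ℂ) →L[ℂ] E) (h : 𝓢(Rn n, ℂ)) (j : ℕ) (β : Fin n → ℕ) (m : Fin n → ℤ) : E :=
  f (waveCLM (cubeCenter j m) (dilCLM (-(j : ℤ)) (freqMonomial β h)))

theorem exists_norm_taylorAt_le (f : 𝓢(Rn n, ℂ) →L[ℂ] E) (h : 𝓢(Rn n, ℂ)) (j : ℕ) :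
    ∃ (k : ℕ) (C B : ℝ), 0 ≤ C ∧ 1 ≤ B ∧ ∀ β m,
      ‖taylorAt f h j β m‖ ≤ C * B ^ (∑ k, β k) * (1 + ‖cubeCenter j m‖) ^ k := by
  obtain ⟨k, k', C, hC, h1⟩ := exists_norm_waveCLM_le f
  obtain ⟨l, C', hC', h2⟩ := exists_schwartzNorm_le (dilCLM (n := n) (-(j : ℤ))) k'
  obtain ⟨B, hB, h3⟩ := exists_schwartzNorm_freqMonomial_le n l
  have hS : 0 ≤ schwartzNorm l h := apply_nonneg _ _
  refine ⟨k, C * (C' * schwartzNorm l h), B, by positivity, hB, fun β m => (h1 _ _).trans ?_⟩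
  refine mul_le_mul_of_nonneg_right ?_ (by positivity)
  calc C * schwartzNorm k' (dilCLM (-(j : ℤ)) (freqMonomial β h))
      ≤ C * (C' * (B ^ (∑ k, β k) * schwartzNorm l h)) := by
        gcongr
        exact (h2 _).trans (mul_le_mul_of_nonneg_left (h3 β h) hC')
    _ = _ := by ring

theorem one_add_norm_center_le {d : ℝ} (hd : 0 ≤ d) {j : ℕ} {m : Fin n → ℤ} {x : Rn n}
    (hx : x ∈ cube d j m) : 1 + ‖cubeCenter j m‖ ≤ (1 + n * d) * (1 + ‖x‖) := by
  have h1 := norm_le_of_mem_cube hd hx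
  have h2 : ‖x - cubeCenter j m‖ ≤ 2 ^ j * ‖x - cubeCenter j m‖ :=
    le_mul_of_one_le_left (norm_nonneg _) (one_le_pow₀ one_le_two)
  have h3 : ‖cubeCenter j m‖ ≤ ‖x‖ + ‖x - cubeCenter j m‖ := by
    have := norm_sub_le x (x - cubeCenter j m)
    rwa [sub_sub_cancel] at this
  have h4 : 0 ≤ (n * d) * ‖x‖ := by positivity
  nlinarith

variable {d : ℝ} {ψ : 𝓢(Rn n, ℂ)} {b : (Fin n → ℕ) → 𝓢(Rn n, ℂ)}

theorem bump_quark_eq_zero (hψ : ∀ x, ψ x ≠ 0 → x ∈ cube d 0 0)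
    (hb : ∀ β x, b β x = taylorCoeff x β * ψ x) {j : ℕ} {m : Fin n → ℤ} {x : Rn n}
    (hx : x ∉ cube d j m) (β : Fin n → ℕ) : bump j (cubeCenter j m) (b β) x = 0 := by
  rw [bump_apply, hb]
  by_contra h
  exact hx (smul_sub_mem_cube_iff.1 (hψ _ (right_ne_zero_of_mul h)))

/-- At each x boundedly many cubes contribute, and the weights (BB')^{|β|}/β! are summable.
Temperedness of f leaves polynomial growth in x, which a Schwartz function can integrate. -/
theorem exists_tsum_enorm_bump_taylorAt_le (hd : 0 ≤ d) (hψ : ∀ x, ψ x ≠ 0 → x ∈ cube d 0 0)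
    (hb : ∀ β x, b β x = taylorCoeff x β * ψ x)
    (hbn : ∃ B C : ℝ, 1 ≤ B ∧ 0 < C ∧ ∀ β, schwartzNorm 0 (b β) ≤ C * quarkWeight B β)
    (f : 𝓢(Rn n, ℂ) →L[ℂ] E) (h : 𝓢(Rn n, ℂ)) (j : ℕ) :
    ∃ (k : ℕ) (C : ℝ), 0 ≤ C ∧ ∀ x, ∑' i : (Fin n → ℕ) × (Fin n → ℤ),
      ‖bump j (cubeCenter j i.2) (b i.1) x • taylorAt f h j i.1 i.2‖ₑ ≤
        ENNReal.ofReal (C * (1 + ‖x‖) ^ k) := by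
  obtain ⟨k, C, B, hC, hB, h1⟩ := exists_norm_taylorAt_le f h j
  obtain ⟨B', C', hB', hC', h2⟩ := hbn
  set T := ∑' β : Fin n → ℕ, ENNReal.ofReal (quarkWeight (B * B') β) with hT
  have hTt : T ≠ ∞ := tsum_quarkWeight_ne_top (by positivity)
  set Q : ℝ≥0∞ := ((⌊d⌋₊ + 1 : ℕ) : ℝ≥0∞) ^ n with hQ
  have hQt : Q ≠ ∞ := ENNReal.pow_ne_top (ENNReal.natCast_ne_top _)
  refine ⟨k, (T * Q).toReal * (C' * C * (1 + n * d) ^ k), by positivity, fun x => ?_⟩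
  have hpt : ∀ β m, ‖bump j (cubeCenter j m) (b β) x • taylorAt f h j β m‖ₑ ≤
      ENNReal.ofReal (quarkWeight (B * B') β) * (cube d j m).indicator (1 : Rn n → ℝ≥0∞) x *
        ENNReal.ofReal (C' * C * (1 + n * d) ^ k * (1 + ‖x‖) ^ k) := by
    intro β m
    by_cases hx : x ∈ cube d j m
    · rw [Set.indicator_of_mem hx, Pi.one_apply, mul_one, ← ENNReal.ofReal_mul
        (quarkWeight_pos (by positivity) β).le, ← ofReal_norm, norm_smul]
      refine ENNReal.ofReal_le_ofReal ?_
      have h3 : ‖bump j (cubeCenter j m) (b β) x‖ ≤ C' * quarkWeight B' β := by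
        rw [bump_apply]
        exact (norm_le_schwartzNorm _ 0 _).trans (h2 β)
      have hw : 0 ≤ quarkWeight B' β := (quarkWeight_pos (by positivity) β).le
      calc ‖bump j (cubeCenter j m) (b β) x‖ * ‖taylorAt f h j β m‖
          ≤ (C' * quarkWeight B' β) *
              (C * B ^ (∑ k, β k) * ((1 + n * d) * (1 + ‖x‖)) ^ k) := by
            refine mul_le_mul h3 ((h1 β m).trans ?_) (norm_nonneg _) (by positivity)
            gcongr
            exact one_add_norm_center_le hd hx
        _ = _ := by rw [← pow_mul_quarkWeight, mul_pow]; ring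
    · rw [bump_quark_eq_zero hψ hb hx]
      simp
  calc ∑' i : (Fin n → ℕ) × (Fin n → ℤ),
        ‖bump j (cubeCenter j i.2) (b i.1) x • taylorAt f h j i.1 i.2‖ₑ
      ≤ ∑' i : (Fin n → ℕ) × (Fin n → ℤ), ENNReal.ofReal (quarkWeight (B * B') i.1) *
          (cube d j i.2).indicator (1 : Rn n → ℝ≥0∞) x *
          ENNReal.ofReal (C' * C * (1 + n * d) ^ k * (1 + ‖x‖) ^ k) :=
        ENNReal.tsum_le_tsum fun i => hpt i.1 i.2
    _ = T * (∑' m, (cube d j m).indicator (1 : Rn n → ℝ≥0∞) x) *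
          ENNReal.ofReal (C' * C * (1 + n * d) ^ k * (1 + ‖x‖) ^ k) := by
        rw [ENNReal.tsum_mul_right]
        congr 1
        rw [ENNReal.tsum_prod', hT, ← ENNReal.tsum_mul_right]
        refine tsum_congr fun β => ?_
        dsimp only
        exact ENNReal.tsum_mul_left
    _ ≤ T * Q * ENNReal.ofReal (C' * C * (1 + n * d) ^ k * (1 + ‖x‖) ^ k) := by
        gcongr
        exact card_cube_le hd j x
    _ = _ := by
        rw [mul_assoc (T * Q).toReal, ENNReal.ofReal_mul ENNReal.toReal_nonneg,
          ENNReal.ofReal_toReal (ENNReal.mul_ne_top hTt hQt)]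

/-- For fixed m the sum over β is the Taylor expansion around the centre of the cube, multiplied by
ψ(2^j x - m); the partition of unity then sums over m. Absolute convergence makes the order of
summation irrelevant. -/
theorem hasSum_bump_taylorAt [CompleteSpace E] (hd : 0 ≤ d)
    (hψ : ∀ x, ψ x ≠ 0 → x ∈ cube d 0 0)
    (hψ1 : ∀ x : Rn n, HasSum (fun m : Fin n → ℤ => ψ (x - cubeCenter 0 m)) 1)
    (hb : ∀ β x, b β x = taylorCoeff x β * ψ x)
    (hbn : ∃ B C : ℝ, 1 ≤ B ∧ 0 < C ∧ ∀ β, schwartzNorm 0 (b β) ≤ C * quarkWeight B β)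
    (f : 𝓢(Rn n, ℂ) →L[ℂ] E) {h : 𝓢(Rn n, ℂ)} (hh : ∀ ξ, 2 < ‖ξ‖ → h ξ = 0) (j : ℕ) (x : Rn n) :
    HasSum (fun i : (Fin n → ℕ) × (Fin n → ℤ) =>
      bump j (cubeCenter j i.2) (b i.1) x • taylorAt f h j i.1 i.2)
      (f (waveCLM x (dilCLM (-(j : ℤ)) h))) := by
  obtain ⟨k, C, -, hle⟩ := exists_tsum_enorm_bump_taylorAt_le hd hψ hb hbn f h j
  have hs := summable_of_tsum_enorm_ne_top (ne_top_of_le_ne_top ENNReal.ofReal_ne_top (hle x))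
  set G : (Fin n → ℕ) × (Fin n → ℤ) → E := fun i =>
    bump j (cubeCenter j i.2) (b i.1) x • taylorAt f h j i.1 i.2 with hG
  set g := f (waveCLM x (dilCLM (-(j : ℤ)) h)) with hg
  have h1 : ∀ m : Fin n → ℤ, HasSum (fun β => G (β, m)) (ψ ((2 : ℝ) ^ j • x - cubeCenter 0 m) • g) := by
    intro m
    set u := (2 : ℝ) ^ j • (x - cubeCenter j m) with hu
    have h2 := ((hasSum_taylorCoeff_waveCLM hh j (cubeCenter j m) u).mapL f).const_smul (ψ u)
    have h3 : cubeCenter j m + (2 : ℝ) ^ (-(j : ℤ)) • u = x := by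
      rw [hu, smul_smul, zpow_neg, zpow_natCast, inv_mul_cancel₀ (by positivity), one_smul]
      abel
    rw [h3] at h2
    rw [← two_pow_smul_sub_eq]
    refine h2.congr_fun fun β => ?_
    simp only [hG, bump_apply, hb, ← hu, map_smul, smul_smul, taylorAt]
    rw [mul_comm]
  have h4 : HasSum (fun m : Fin n → ℤ => ψ ((2 : ℝ) ^ j • x - cubeCenter 0 m) • g) g := by
    simpa using (hψ1 ((2 : ℝ) ^ j • x)).smul_const g
  have h5 : HasSum (fun i : (Fin n → ℤ) × (Fin n → ℕ) => G i.swap) (∑' i, G i) :=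
    ((Equiv.prodComm _ _).hasSum_iff (f := G)).2 hs.hasSum
  have h6 := h5.prod_fiberwise h1
  rw [h4.unique h6]
  exact hs.hasSum

theorem hasSum_integral_bump_taylorAt [CompleteSpace E] (hd : 0 ≤ d)
    (hψ : ∀ x, ψ x ≠ 0 → x ∈ cube d 0 0)
    (hψ1 : ∀ x : Rn n, HasSum (fun m : Fin n → ℤ => ψ (x - cubeCenter 0 m)) 1)
    (hb : ∀ β x, b β x = taylorCoeff x β * ψ x)
    (hbn : ∃ B C : ℝ, 1 ≤ B ∧ 0 < C ∧ ∀ β, schwartzNorm 0 (b β) ≤ C * quarkWeight B β)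
    (f : 𝓢(Rn n, ℂ) →L[ℂ] E) {h : 𝓢(Rn n, ℂ)} (hh : ∀ ξ, 2 < ‖ξ‖ → h ξ = 0) (j : ℕ)
    (θ : 𝓢(Rn n, ℂ)) :
    HasSum (fun i : (Fin n → ℕ) × (Fin n → ℤ) =>
      (∫ x, θ x * bump j (cubeCenter j i.2) (b i.1) x) • taylorAt f h j i.1 i.2)
      (∫ x, θ x • f (waveCLM x (dilCLM (-(j : ℤ)) h))) := by
  obtain ⟨k, C, hC, hle⟩ := exists_tsum_enorm_bump_taylorAt_le hd hψ hb hbn f h j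
  set F : (Fin n → ℕ) × (Fin n → ℤ) → Rn n → E := fun i x =>
    θ x • (bump j (cubeCenter j i.2) (b i.1) x • taylorAt f h j i.1 i.2) with hF
  have hFc : ∀ i, Continuous (F i) := fun i =>
    θ.continuous.smul ((SchwartzMap.continuous _).smul continuous_const)
  have hfin : ∑' i, ∫⁻ x, ‖F i x‖ₑ ≠ ∞ := by
    rw [← lintegral_tsum fun i => (hFc i).enorm.measurable.aemeasurable]
    have hint := ((integrable_norm_mul_one_add_pow θ k).const_mul C).hasFiniteIntegral
    refine ne_top_of_le_ne_top hint.ne (lintegral_mono fun x => ?_)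
    have hsm : ∀ i, ‖F i x‖ₑ = ‖θ x‖ₑ *
        ‖bump j (cubeCenter j i.2) (b i.1) x • taylorAt f h j i.1 i.2‖ₑ := fun i => enorm_smul _ _
    simp_rw [hsm]
    rw [ENNReal.tsum_mul_left, ← ofReal_norm (E := ℝ), Real.norm_of_nonneg (by positivity),
      mul_left_comm, ENNReal.ofReal_mul (norm_nonneg _), ofReal_norm]
    exact mul_le_mul' le_rfl (hle x)
  have hval : ∫ x, ∑' i, F i x = ∫ x, θ x • f (waveCLM x (dilCLM (-(j : ℤ)) h)) := by
    refine integral_congr_ae (Filter.Eventually.of_forall fun x => ?_)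
    exact ((hasSum_bump_taylorAt hd hψ hψ1 hb hbn f hh j x).const_smul (θ x)).tsum_eq
  have hterm : ∀ i, ∫ x, F i x =
      (∫ x, θ x * bump j (cubeCenter j i.2) (b i.1) x) • taylorAt f h j i.1 i.2 := fun i => by
    rw [← integral_smul_const]
    refine integral_congr_ae (Filter.Eventually.of_forall fun x => ?_)
    simp only [hF, smul_smul]
  have hsum : Summable fun i => ∫ x, F i x :=
    summable_of_tsum_enorm_ne_top (ne_top_of_le_ne_top hfin
      (ENNReal.tsum_le_tsum fun i => enorm_integral_le_lintegral_enorm _))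
  rw [← hval, integral_tsum (fun i => (hFc i).aestronglyMeasurable) hfin]
  simp_rw [hterm] at hsum ⊢
  exact hsum.hasSum

/-! ### The atomic decomposition of one dyadic block -/

variable {φ : ℕ → 𝓢(Rn n, ℂ)}

/-- In frequency the Laplacian contributes (-|ξ|²)^r = 2^{2jr}(-|2^{-j}ξ|²)^r, and on the support of
φ_j the multiplier σ(2^{-j}ξ) is its inverse up to 2^{2jr}. For r > 0 this needs frequencies away
from 0, hence j ≥ 1. -/
theorem IsDyadicResolution.integral_lapCLM_pow_smul [CompleteSpace E] (hφ : IsDyadicResolution φ)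
    {r j : ℕ} (hrj : 1 ≤ j ∨ r = 0) {σ : 𝓢(Rn n, ℂ)}
    (hσ : ∀ ξ : Rn n, ‖ξ‖ ≤ 2 → (1 / 2 ≤ ‖ξ‖ ∨ r = 0) → (-(‖ξ‖ : ℂ) ^ 2) ^ r * σ ξ = 1)
    (f : 𝓢'(Rn n, E)) (θ : 𝓢(Rn n, ℂ)) :
    fourierConst n • ((((2 : ℝ) ^ j) ^ (2 * r))⁻¹ : ℂ) • ∫ x, (lapCLM n ^ r) θ x •
      (f : 𝓢(Rn n, ℂ) →L[ℂ] E) (waveCLM x (dilCLM (-(j : ℤ))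
        (smulLeftCLM ℂ σ (dilCLM j (φ j))))) = ∫ x, θ x • dyadicBlock φ f j x := by
  have h0 := integral_smul_waveCLM (f : 𝓢(Rn n, ℂ) →L[ℂ] E) ((lapCLM n ^ r) θ)
    (dilCLM (-(j : ℤ)) (smulLeftCLM ℂ σ (dilCLM j (φ j))))
  refine (congrArg (fun v => fourierConst n • ((((2 : ℝ) ^ j) ^ (2 * r))⁻¹ : ℂ) • v) h0).trans ?_
  rw [integral_smul_dyadicBlock]
  have e : ((((2 : ℝ) ^ j) ^ (2 * r))⁻¹ : ℂ) • smulLeftCLM ℂ (expIntegral ((lapCLM n ^ r) θ))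
      (dilCLM (-(j : ℤ)) (smulLeftCLM ℂ σ (dilCLM j (φ j)))) =
      smulLeftCLM ℂ (φ j) (expIntegral θ) := by
    ext ξ
    rw [smul_apply, smulLeftCLM_apply_apply (expIntegral _).hasTemperateGrowth,
      smulLeftCLM_apply_apply (φ j).hasTemperateGrowth, dilCLM_apply,
      smulLeftCLM_apply_apply σ.hasTemperateGrowth, ← dilCLM_apply (-(j : ℤ)) (dilCLM j (φ j)),
      dilCLM_neg_dilCLM, expIntegral_lapCLM_pow]
    by_cases h0 : φ j ξ = 0
    · simp [h0]
    set η := (2 : ℝ) ^ (-(j : ℤ)) • ξ with hη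
    have h1 : dilCLM j (φ j) η = φ j ξ := by rw [hη, ← dilCLM_apply, dilCLM_neg_dilCLM]
    have h2 : ‖η‖ ≤ 2 := by
      by_contra h
      exact h0 (h1 ▸ hφ.dilCLM_eq_zero (not_le.1 h))
    have h3 : 1 / 2 ≤ ‖η‖ ∨ r = 0 := by
      rcases hrj with hj | hr
      · left
        by_contra h
        exact h0 (h1 ▸ hφ.dilCLM_eq_zero' hj (not_le.1 h))
      · exact Or.inr hr
    have h4 : ‖ξ‖ = 2 ^ j * ‖η‖ := by
      rw [hη, norm_smul, Real.norm_of_nonneg (by positivity), zpow_neg, zpow_natCast,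
        mul_inv_cancel_left₀ (by positivity)]
    have h5 := hσ η h2 h3
    have h6 : (-(‖ξ‖ : ℂ) ^ 2) ^ r = (((2 : ℝ) ^ j : ℝ) : ℂ) ^ (2 * r) * (-(‖η‖ : ℂ) ^ 2) ^ r := by
      rw [h4, pow_mul, ← mul_pow]
      push_cast
      congr 1
      ring
    have h7 : (((2 : ℝ) ^ j : ℝ) : ℂ) ^ (2 * r) ≠ 0 := by
      refine pow_ne_zero _ ?_
      exact_mod_cast (by positivity : ((2 : ℝ) ^ j) ≠ 0)
    rw [h6]
    simp only [smul_eq_mul]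
    push_cast at h7 ⊢
    calc _ = (((2 : ℂ) ^ j) ^ (2 * r))⁻¹ * ((2 : ℂ) ^ j) ^ (2 * r) *
          ((-(‖η‖ : ℂ) ^ 2) ^ r * σ η) * (φ j ξ * expIntegral θ ξ) := by ring
      _ = _ := by rw [h5, inv_mul_cancel₀ h7]; ring
  have lin : ∀ (g : 𝓢(Rn n, ℂ) →L[ℂ] E) (a b : ℂ) (w : 𝓢(Rn n, ℂ)),
      a • b • g (waveCLM 0 w) = g (a • waveCLM 0 (b • w)) := fun g a b w => by
    simp only [map_smul]
  rw [← e]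
  exact lin f _ _ _

/-- The expansion is tested against the Laplacian power of θ, and only afterwards is that power
moved onto each quark. The Taylor series is thus never differentiated term by term, and the dilation
factor 2^{2jr} cancels. -/
theorem IsDyadicResolution.hasSum_integral_dyadicBlock_atoms [CompleteSpace E]
    (hφ : IsDyadicResolution φ) (hd : 0 ≤ d) (hψ : ∀ x, ψ x ≠ 0 → x ∈ cube d 0 0)
    (hψ1 : ∀ x : Rn n, HasSum (fun m : Fin n → ℤ => ψ (x - cubeCenter 0 m)) 1)
    (hb : ∀ β x, b β x = taylorCoeff x β * ψ x)
    (hbn : ∃ B C : ℝ, 1 ≤ B ∧ 0 < C ∧ ∀ β, schwartzNorm 0 (b β) ≤ C * quarkWeight B β)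
    {r j : ℕ} (hrj : 1 ≤ j ∨ r = 0) {σ : 𝓢(Rn n, ℂ)}
    (hσ : ∀ ξ : Rn n, ‖ξ‖ ≤ 2 → (1 / 2 ≤ ‖ξ‖ ∨ r = 0) → (-(‖ξ‖ : ℂ) ^ 2) ^ r * σ ξ = 1)
    (f : 𝓢'(Rn n, E)) (θ : 𝓢(Rn n, ℂ)) :
    HasSum (fun i : (Fin n → ℕ) × (Fin n → ℤ) =>
      (∫ x, θ x * bump j (cubeCenter j i.2) ((lapCLM n ^ r) (b i.1)) x) •
        (fourierConst n • taylorAt (f : 𝓢(Rn n, ℂ) →L[ℂ] E) (smulLeftCLM ℂ σ (dilCLM j (φ j)))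
          j i.1 i.2)) (∫ x, θ x • dyadicBlock φ f j x) := by
  rw [← hφ.integral_lapCLM_pow_smul hrj hσ]
  have hh : ∀ ξ, 2 < ‖ξ‖ → smulLeftCLM ℂ σ (dilCLM j (φ j)) ξ = 0 := fun ξ hξ => by
    rw [smulLeftCLM_apply_apply σ.hasTemperateGrowth, hφ.dilCLM_eq_zero hξ, smul_zero]
  have h := ((hasSum_integral_bump_taylorAt hd hψ hψ1 hb hbn (f : 𝓢(Rn n, ℂ) →L[ℂ] E) hh j
    ((lapCLM n ^ r) θ)).const_smul ((((2 : ℝ) ^ j) ^ (2 * r))⁻¹ : ℂ)).const_smul (fourierConst n)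
  refine h.congr_fun fun i => ?_
  have e : ∫ x, (lapCLM n ^ r) θ x * bump j (cubeCenter j i.2) (b i.1) x =
      ((((2 : ℝ) ^ j) ^ (2 * r)) : ℂ) *
        ∫ x, θ x * bump j (cubeCenter j i.2) ((lapCLM n ^ r) (b i.1)) x := by
    rw [integral_lapCLM_pow_mul, lapCLM_pow_bump, ← integral_const_mul]
    refine integral_congr_ae (Filter.Eventually.of_forall fun x => ?_)
    simp only [smul_apply, Complex.real_smul]
    push_cast
    ring
  have h7 : ((((2 : ℝ) ^ j : ℝ) : ℂ)) ^ (2 * r) ≠ 0 := by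
    refine pow_ne_zero _ ?_
    exact_mod_cast (by positivity : ((2 : ℝ) ^ j) ≠ 0)
  push_cast at h7 e ⊢
  rw [e, smul_smul, smul_smul, smul_smul]
  congr 1
  field_simp

variable {n : ℕ} {p : ℝ≥0∞} {r : ℝ} {N : (ℕ → Rn n → ℝ≥0∞) → ℝ≥0∞}
  {S : (ℕ → (Fin n → ℤ) → ℂ) → ℝ≥0∞}

/-! ### Absolute convergence of atomic series -/

/-- An arbitrary test function becomes the member j = 0 of a kernel family whose other members
vanish. The convolution estimates then also bound the integrals of atoms against θ; no moments are
asked of the member j = 0. -/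
theorem isKernelFamily_single (θ : 𝓢(Rn n, ℂ)) :
    IsKernelFamily fun j => if j = 0 then reflTranslate θ 0 else 0 where
  decay A l := by
    set g := reflTranslate θ 0
    refine ⟨2 ^ (max A l) * schwartzNorm (max A l) g,
      mul_nonneg (by positivity) (apply_nonneg _ _), fun j x => ?_⟩
    have hS : 0 ≤ 2 ^ (max A l) * schwartzNorm (max A l) g :=
      mul_nonneg (by positivity) (apply_nonneg _ _)
    rcases Nat.eq_zero_or_pos j with rfl | hj
    · simp only [if_true, pow_zero, one_pow, one_mul]
      rw [← div_eq_mul_inv, le_div_iff₀ (by positivity), mul_comm]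
      exact one_add_pow_mul_le A l g x
    · rw [if_neg hj.ne']
      have h0 : ⇑(0 : 𝓢(Rn n, ℂ)) = fun _ => 0 := rfl
      rw [h0, iteratedFDeriv_fun_zero]
      simp only [Pi.zero_apply, norm_zero]
      positivity
  moments j hj N k _ i := by
    rw [if_neg (by omega)]
    simp

theorem exists_le_eLpNorm_of_le_on_ball (n : ℕ) (hp : p ≠ 0) : ∃ C : ℝ≥0∞, C ≠ ∞ ∧
    ∀ (a : ℝ≥0∞) (G : Rn n → ℝ≥0∞), (∀ y, ‖y‖ ≤ 1 → a ≤ G y) → a ≤ C * eLpNorm G p volume := by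
  set B := Metric.closedBall (0 : Rn n) 1 with hB
  have hvol : volume B ≠ 0 := (Metric.measure_closedBall_pos volume _ one_pos).ne'
  have hvolt : volume B ≠ ∞ := measure_closedBall_lt_top.ne
  set V := volume B ^ (1 / p.toReal) with hV
  have hV0 : V ≠ 0 := by
    rw [hV]; exact (ENNReal.rpow_pos (pos_iff_ne_zero.2 hvol) hvolt).ne'
  have hVt : V ≠ ∞ := ENNReal.rpow_ne_top_of_nonneg (by positivity) hvolt
  refine ⟨V⁻¹, ENNReal.inv_ne_top.2 hV0, fun a G h => ?_⟩
  have h1 : eLpNorm (B.indicator fun _ => a) p volume = a * V := by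
    rw [eLpNorm_indicator_const' measurableSet_closedBall hvol hp]
    rfl
  have h2 : eLpNorm (B.indicator fun _ => a) p volume ≤ eLpNorm G p volume := by
    refine eLpNorm_ennreal_mono fun y => ?_
    by_cases hy : y ∈ B
    · rw [Set.indicator_of_mem hy]
      exact h y (by simpa [hB] using hy)
    · rw [Set.indicator_of_notMem hy]
      exact zero_le
  calc a = V⁻¹ * (a * V) := by
        rw [mul_left_comm, ENNReal.inv_mul_cancel hV0 hVt, mul_one]
    _ ≤ _ := mul_le_mul' le_rfl (h1 ▸ h2)

/-- The pairings with θ are convolution values at the origin. The dominating averages at scale 1 are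
comparable throughout the unit ball, so their value at 0 is bounded by an L_p norm and hence by the
function quasi-norm. -/
theorem IsFunctionNorm.exists_tsum_enorm_integral_atom_le (hN : IsFunctionNorm n p r N S)
    (hr : 0 < r) (hr1 : r ≤ 1) (hp : p ≠ 0) {d : ℝ} (hd : 0 ≤ d) {s σ : ℝ} {K l : ℕ} {L : ℤ}
    (hL : (l : ℤ) ≤ L + 1) (hsσ : s ≤ σ) (hsK : s < K) (hl : n * (1 / r - 1) < σ + l)
    (θ : 𝓢(Rn n, ℂ)) : ∃ C : ℝ≥0∞, C ≠ ∞ ∧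
      ∀ (c : ℕ → (Fin n → ℤ) → ℂ) (a : ℕ → (Fin n → ℤ) → Rn n → ℂ),
        (∀ ν m, IsAtom d σ p K L ν m (a ν m)) →
          ∑' ν, ∑' m, ‖c ν m‖ₑ * ‖∫ y, θ y * a ν m y‖ₑ ≤ C * S c := by
  obtain ⟨C₁, δ, hC₁, hδ, h₁⟩ := (isKernelFamily_single θ).exists_tsum_enorm_integral_atom_le hd hr
    hr1 p hsσ hsK hl
  obtain ⟨D, hD, h₂⟩ := hN.exists_offDiagonal_le hC₁ hδ
  obtain ⟨V, hV, h₃⟩ := exists_le_eLpNorm_of_le_on_ball n hp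
  set Q : ℝ≥0∞ := (ENNReal.ofReal (1 + 1) ^ (n + 1)) ^ (1 / r) with hQ
  have hQt : Q ≠ ∞ := ENNReal.rpow_ne_top_of_nonneg (by positivity)
    (ENNReal.pow_ne_top ENNReal.ofReal_ne_top)
  refine ⟨V * (Q * D), by finiteness, fun c a ha => ?_⟩
  have h4 := h₁ L hL c a ha 0 0
  change twoPow ((0 : ℕ) * s) * ∑' ν, ∑' m, ‖c ν m‖ₑ *
    ‖∫ y, reflTranslate θ 0 (0 - y) * a ν m y‖ₑ ≤ _ at h4
  have e : ∀ y : Rn n, reflTranslate θ 0 (0 - y) = θ y := fun y => by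
    rw [reflTranslate_apply]; simp
  simp_rw [e] at h4
  rw [Nat.cast_zero, zero_mul, twoPow_zero, one_mul] at h4
  set T : ℕ → Rn n → ℝ≥0∞ := fun j x => ∑' k : ℕ, C₁ * twoPow (-(δ * k)) *
    (avg r j (step p c (j + k)) x + if k ≤ j then avg r (j - k) (step p c (j - k)) x else 0) with hT
  have h5 : ∀ y, ‖y‖ ≤ 1 → T 0 0 ≤ Q * T 0 y := by
    intro y hy
    have hav : ∀ G : Rn n → ℝ≥0∞, avg r 0 G 0 ≤ Q * avg r 0 G y := fun G =>
      avg_le_of_norm_sub_le hr (by simpa using hy) G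
    rw [hT, ← ENNReal.tsum_mul_left]
    refine ENNReal.tsum_le_tsum fun k => ?_
    rw [mul_left_comm, mul_add Q]
    refine mul_le_mul' le_rfl (add_le_add (hav _) ?_)
    rw [Nat.zero_sub]
    split_ifs
    · exact hav _
    · exact zero_le
  refine h4.trans ((h₃ (T 0 0) (fun y => Q * T 0 y) h5).trans ?_)
  rw [mul_assoc, mul_assoc]
  refine mul_le_mul' le_rfl ((eLpNorm_ennreal_const_mul _ hQt).trans (mul_le_mul' le_rfl ?_))
  exact (hN.eLpNorm_le T 0).trans ((h₂ (step p c) (measurable_step p c)).trans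
    (mul_le_mul' le_rfl (hN.step_le c)))

variable {E : Type*} [NormedAddCommGroup E] [NormedSpace ℂ E]

/-- Atomic series of finite size converge absolutely. -/
theorem IsFunctionNorm.tsum_enorm_integral_term_ne_top [CompleteSpace E]
    (hN : IsFunctionNorm n p r N S) (hr : 0 < r) (hr1 : r ≤ 1) (hp : p ≠ 0) {d : ℝ} (hd : 0 ≤ d)
    {s : ℝ} {M K l : ℕ} {L : ℤ} (hL : L + 1 = l) (hMs : s < M) (hKs : s < K)
    (hM : n * (1 / r - 1) < M) (hl : n * (1 / r - 1) < s + l) {μ : ℝ} (hμ : 0 < μ)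
    {R : AtomicSeries n E} (he : ∀ γ ν m, ‖R.e γ ν m‖ = 1) (heL : ∀ γ ν m, ‖R.eL γ ν m‖ = 1)
    (ha : ∀ γ ν m, IsAtom d (M : ℝ) p K (-1) ν m (R.a γ ν m))
    (haL : ∀ γ ν m, IsAtom d s p K L ν m (R.aL γ ν m)) (hR : R.size S μ ≠ ∞) (θ : 𝓢(Rn n, ℂ)) :
    ∑' i : (Fin n → ℕ) × ℕ × (Fin n → ℤ), ‖∫ x, θ x • R.term i.1 i.2.1 i.2.2 x‖ₑ ≠ ∞ := by
  obtain ⟨C₁, hC₁, h₁⟩ := hN.exists_tsum_enorm_integral_atom_le hr hr1 hp hd (s := s) (σ := M)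
    (K := K) (l := 0) (L := -1) (by simp) hMs.le hKs (by simpa using hM) θ
  obtain ⟨C₂, hC₂, h₂⟩ := hN.exists_tsum_enorm_integral_atom_le hr hr1 hp hd (s := s) (σ := s)
    (K := K) (l := l) (L := L) hL.ge le_rfl hKs hl θ
  refine ne_top_of_le_ne_top (b := (∑' γ : Fin n → ℕ, twoPow (-(μ * (∑ i, γ i : ℕ)))) *
    ((C₁ + C₂) * R.size S μ)) (ENNReal.mul_ne_top (tsum_twoPow_multi_ne_top hμ) (by finiteness)) ?_
  rw [ENNReal.tsum_prod', ← ENNReal.tsum_mul_right]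
  refine ENNReal.tsum_le_tsum fun γ => ?_
  have h3 : ∑' i : ℕ × (Fin n → ℤ), ‖∫ x, θ x • R.term γ i.1 i.2 x‖ₑ ≤
      (∑' ν, ∑' m, ‖R.rho γ ν m‖ₑ * ‖∫ y, θ y * R.a γ ν m y‖ₑ) +
      ∑' ν, ∑' m, ‖R.lam γ ν m‖ₑ * ‖∫ y, θ y * R.aL γ ν m y‖ₑ := by
    rw [ENNReal.tsum_prod', ← ENNReal.tsum_add]
    refine ENNReal.tsum_le_tsum fun ν => ?_
    rw [← ENNReal.tsum_add]
    refine ENNReal.tsum_le_tsum fun m => ?_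
    have h0 := integral_smul_term hd (ha γ ν m) (haL γ ν m) θ (R.rho γ ν m) (R.lam γ ν m)
      (R.e γ ν m) (R.eL γ ν m)
    dsimp only [AtomicSeries.term]
    rw [h0]
    refine (enorm_add_le _ _).trans (le_of_eq ?_)
    have h1 : ∀ e : E, ‖e‖ = 1 → ‖e‖ₑ = 1 := fun e he => by rw [← ofReal_norm, he]; simp
    rw [enorm_smul, enorm_smul, enorm_mul, enorm_mul, h1 _ (he γ ν m), h1 _ (heL γ ν m), mul_one,
      mul_one]
  refine h3.trans ((add_le_add (h₁ _ _ (ha γ)) (h₂ _ _ (haL γ))).trans ?_)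
  rw [mul_left_comm]
  calc C₁ * S (R.rho γ) + C₂ * S (R.lam γ) ≤ (C₁ + C₂) * (S (R.rho γ) + S (R.lam γ)) := by
        rw [mul_add]
        exact add_le_add (mul_le_mul' le_self_add le_rfl) (mul_le_mul' le_add_self le_rfl)
    _ ≤ _ := mul_le_mul' le_rfl (le_twoPow_mul_size R μ γ)

/-! ### Smooth atoms -/

theorem isAtom_zero (d σ : ℝ) (p : ℝ≥0∞) (K : ℕ) (L : ℤ) (ν : ℕ) (m : Fin n → ℤ) :
    IsAtom d σ p K L ν m (0 : Rn n → ℂ) where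
  continuous := continuous_zero
  differentiable k _ := by
    rw [Pi.zero_def, iteratedFDeriv_fun_zero]
    exact differentiable_const _
  supp := by simp [tsupport]
  deriv_le k _ i x := by
    rw [pderiv, Pi.zero_def, iteratedFDeriv_fun_zero]
    simp only [Pi.zero_apply, zero_apply, norm_zero]
    positivity
  moments β _ := by simp

theorem iteratedFDeriv_bump (j k : ℕ) (a : Rn n) (h : 𝓢(Rn n, ℂ)) (x : Rn n) :
    iteratedFDeriv ℝ k (bump j a h) x =
      ((2 : ℝ) ^ j) ^ k • iteratedFDeriv ℝ k h ((2 : ℝ) ^ j • (x - a)) := by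
  have e : ⇑(bump j a h) = fun y => dilCLM j h (y - a) := by
    ext y; rw [bump_apply, dilCLM_apply, zpow_natCast]
  rw [e, iteratedFDeriv_comp_sub']
  dsimp only
  rw [iteratedFDeriv_dilCLM, zpow_natCast]

theorem isAtom_bump {d σ : ℝ} {p : ℝ≥0∞} {K : ℕ} {L : ℤ} {j : ℕ} {m : Fin n → ℤ}
    {h : 𝓢(Rn n, ℂ)} (hsupp : ∀ x, h x ≠ 0 → x ∈ cube d 0 0)
    (hS : schwartzNorm K h ≤ 2 ^ (-(j : ℝ) * (σ - n * (p⁻¹).toReal)))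
    (hmom : ∀ β : Fin n → ℕ, ((∑ i, β i : ℕ) : ℤ) ≤ L →
      ∫ x : Rn n, (∏ i, x i ^ β i) • bump j (cubeCenter j m) h x = 0) :
    IsAtom d σ p K L j m (bump j (cubeCenter j m) h) where
  continuous := SchwartzMap.continuous _
  differentiable k _ := ((bump j (cubeCenter j m) h).smooth ⊤).differentiable_iteratedFDeriv
    (mod_cast ENat.natCast_lt_top k)
  supp := by
    refine closure_minimal (fun x hx => ?_) (isClosed_cube d j m)
    rw [Function.mem_support, bump_apply] at hx
    exact smul_sub_mem_cube_iff.1 (hsupp _ hx)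
  deriv_le k hk i x := by
    refine (norm_pderiv_le i _ x).trans ?_
    rw [iteratedFDeriv_bump, norm_smul, Real.norm_of_nonneg (by positivity), Real.rpow_add two_pos,
      mul_comm]
    refine mul_le_mul ?_ (le_of_eq ?_) (by positivity) (by positivity)
    · refine le_trans ?_ hS
      exact (norm_iteratedFDeriv_le_seminorm ℂ h k _).trans
        (seminorm_le_schwartzNorm (Nat.zero_le _) hk h)
    · rw [mul_comm, Real.rpow_mul two_pos.le, Real.rpow_natCast, Real.rpow_natCast]
  moments := hmom

variable {n : ℕ}

/-! ### Estimates of the Taylor coefficients -/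

theorem avg_const_mul {r : ℝ} (hr : 0 < r) (j : ℕ) {c : ℝ≥0∞} (hc : c ≠ ∞) (G : Rn n → ℝ≥0∞)
    (x : Rn n) : avg r j (fun y => c * G y) x = c * avg r j G x := by
  have h : etaConv j (fun y => (c * G y) ^ r) x = c ^ r * etaConv j (fun y => G y ^ r) x := by
    rw [etaConv, etaConv, ← lintegral_const_mul' _ _ (ENNReal.rpow_ne_top_of_nonneg hr.le hc)]
    refine lintegral_congr fun y => ?_
    rw [ENNReal.mul_rpow_of_nonneg _ _ hr.le]
    ring
  rw [avg, h, ENNReal.mul_rpow_of_nonneg _ _ (by positivity), ← ENNReal.rpow_mul,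
    mul_one_div_cancel hr.ne', ENNReal.rpow_one, avg]

theorem freqMonomial_smulLeftCLM (β : Fin n → ℕ) (g h : 𝓢(Rn n, ℂ)) :
    freqMonomial β (smulLeftCLM ℂ g h) = smulLeftCLM ℂ (freqMonomial β g) h := by
  ext ξ
  rw [freqMonomial_apply, smulLeftCLM_apply_apply g.hasTemperateGrowth,
    smulLeftCLM_apply_apply (freqMonomial β g).hasTemperateGrowth, freqMonomial_apply, smul_eq_mul,
    smul_eq_mul, mul_assoc]

variable {E : Type*} [NormedAddCommGroup E] [NormedSpace ℂ E] {φ : ℕ → 𝓢(Rn n, ℂ)}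

/-- A Taylor coefficient is a value of the block with the extra multiplier `freqMonomial β (σ j)`,
whose Schwartz norm is at most B^{|β|} times a constant. Moving the average from the centre to any
point of the cube costs another constant. -/
theorem IsDyadicResolution.exists_enorm_taylorAt_le [CompleteSpace E] (hφ : IsDyadicResolution φ)
    {r : ℝ} (hr : 0 < r) (hr1 : r ≤ 1) {σ : ℕ → 𝓢(Rn n, ℂ)}
    (hσ : ∀ k, ∃ Z, ∀ j, schwartzNorm k (σ j) ≤ Z) : ∃ (B : ℝ) (C : ℝ≥0∞), 1 ≤ B ∧ C ≠ ∞ ∧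
      ∀ (f : 𝓢(Rn n, ℂ) →L[ℂ] E) (j : ℕ) (β : Fin n → ℕ) (m : Fin n → ℤ), ∀ x ∈ cube 1 j m,
        ‖taylorAt f (smulLeftCLM ℂ (σ j) (dilCLM j (φ j))) j β m‖ₑ ≤
          C * ENNReal.ofReal (B ^ (∑ k, β k)) * avg r j (fun y => ‖f (waveCLM y (φ j))‖ₑ) x := by
  obtain ⟨k, C, hC, h⟩ := hφ.exists_enorm_waveCLM_smul_le_avg (E := E) hr hr1
  obtain ⟨B, hB, hB'⟩ := exists_schwartzNorm_freqMonomial_le n k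
  obtain ⟨Z, hZ⟩ := hσ k
  set Q : ℝ≥0∞ := (ENNReal.ofReal (1 + n) ^ (n + 1)) ^ (1 / r) with hQ
  have hQt : Q ≠ ∞ := ENNReal.rpow_ne_top_of_nonneg (by positivity)
    (ENNReal.pow_ne_top ENNReal.ofReal_ne_top)
  refine ⟨B, C * ENNReal.ofReal Z * Q, hB, by finiteness, fun f j β m x hx => ?_⟩
  have h1 := h f (freqMonomial β (σ j)) j (cubeCenter j m)
  have h2 : avg r j (fun y => ‖f (waveCLM y (φ j))‖ₑ) (cubeCenter j m) ≤
      Q * avg r j (fun y => ‖f (waveCLM y (φ j))‖ₑ) x :=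
    avg_le_of_norm_sub_le hr (by simpa using norm_le_of_mem_cube zero_le_one hx) _
  have h3 : ENNReal.ofReal (schwartzNorm k (freqMonomial β (σ j))) ≤
      ENNReal.ofReal (B ^ (∑ k, β k)) * ENNReal.ofReal Z := by
    rw [← ENNReal.ofReal_mul (by positivity)]
    refine ENNReal.ofReal_le_ofReal ((hB' β _).trans ?_)
    gcongr
    exact hZ j
  rw [taylorAt, freqMonomial_smulLeftCLM]
  calc _ ≤ _ := h1
    _ ≤ C * (ENNReal.ofReal (B ^ (∑ k, β k)) * ENNReal.ofReal Z) *
        (Q * avg r j (fun y => ‖f (waveCLM y (φ j))‖ₑ) x) :=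
      mul_le_mul' (mul_le_mul' le_rfl h3) h2
    _ = _ := by ring

/-! ### The building blocks -/

theorem quarkWeight_mono {A B : ℝ} (hA : 0 ≤ A) (h : A ≤ B) (β : Fin n → ℕ) :
    quarkWeight A β ≤ quarkWeight B β := by
  have : 0 ≤ ∏ k, ((β k).factorial : ℝ)⁻¹ := Finset.prod_nonneg fun _ _ => by positivity
  rw [quarkWeight, quarkWeight]
  gcongr

/-- The frequency cut-offs and the space-localised building blocks of the decomposition. -/
theorem exists_buildingBlocks [CompleteSpace E] {d : ℝ} (hd : 1 < d) (K r : ℕ) :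
    ∃ (σ : ℕ → 𝓢(Rn n, ℂ)) (h : ℕ → (Fin n → ℕ) → 𝓢(Rn n, ℂ)) (B C : ℝ), 1 ≤ B ∧ 0 < C ∧
      (∀ k, ∃ Z, ∀ j, schwartzNorm k (σ j) ≤ Z) ∧
      (∀ j β x, h j β x ≠ 0 → x ∈ cube d 0 0) ∧
      (∀ j β, schwartzNorm K (h j β) ≤ C * quarkWeight B β) ∧
      (∀ j m γ, 1 ≤ j → ∀ β : Fin n → ℕ, ∑ i, β i < 2 * r →
        ∫ x : Rn n, (∏ i, x i ^ β i) • bump j (cubeCenter j m) (h j γ) x = 0) ∧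
      ∀ φ : ℕ → 𝓢(Rn n, ℂ), IsDyadicResolution φ → ∀ (f : 𝓢'(Rn n, E)) (θ : 𝓢(Rn n, ℂ)) (j : ℕ),
        HasSum (fun i : (Fin n → ℕ) × (Fin n → ℤ) =>
          (∫ x, θ x * bump j (cubeCenter j i.2) (h j i.1) x) • (fourierConst n •
            taylorAt (f : 𝓢(Rn n, ℂ) →L[ℂ] E) (smulLeftCLM ℂ (σ j) (dilCLM j (φ j))) j i.1 i.2))
          (∫ x, θ x • dyadicBlock φ f j x) := by
  have hd0 : 0 ≤ d := by linarith
  obtain ⟨ψ, hψ, hψ1⟩ := exists_partition n hd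
  obtain ⟨b, hb, hbn⟩ := exists_quarks hd0 hψ
  choose σ hσ using exists_inverse_symbol n
  -- The block j = 0 contains the frequency 0, where the Laplacian cannot be inverted; there the
  -- power 0 is used and no moments are claimed.
  set t : ℕ → ℕ := fun j => if j = 0 then 0 else r with ht
  have htj : ∀ j, 1 ≤ j ∨ t j = 0 := fun j => by
    rcases Nat.eq_zero_or_pos j with rfl | hj
    · right; simp [ht]
    · left; exact hj
  have ht01 : ∀ j, t j = 0 ∨ t j = r := fun j => by
    simp only [ht]; split_ifs <;> simp
  have hbound : ∀ r : ℕ, ∃ B C : ℝ, 1 ≤ B ∧ 0 < C ∧ ∀ β,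
      schwartzNorm K ((lapCLM n ^ r) (b β)) ≤ C * quarkWeight B β := by
    intro r
    obtain ⟨k, C, hC, h⟩ := exists_schwartzNorm_le (lapCLM n ^ r) K
    obtain ⟨B', C', hB', hC', h'⟩ := hbn k
    refine ⟨B', C * C' + 1, hB', by positivity, fun β => (h _).trans ?_⟩
    have hq := (quarkWeight_pos (by linarith : 0 < B') β).le
    calc C * schwartzNorm k (b β) ≤ C * (C' * quarkWeight B' β) :=
          mul_le_mul_of_nonneg_left (h' β) hC
      _ ≤ _ := by nlinarith
  have hsupp : ∀ r β x, (lapCLM n ^ r) (b β) x ≠ 0 → x ∈ cube d 0 0 := fun r β x hx => by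
    by_contra h
    refine hx (lapCLM_pow_eq_zero_of_isOpen r (isClosed_cube d 0 0).isOpen_compl (fun y hy => ?_) x h)
    rw [hb]
    by_contra h'
    exact hy (hψ y (right_ne_zero_of_mul h'))
  obtain ⟨B₀, C₀, hB₀, hC₀, h₀⟩ := hbound 0
  obtain ⟨B₁, C₁, hB₁, hC₁, h₁⟩ := hbound r
  refine ⟨fun j => σ (t j), fun j β => (lapCLM n ^ t j) (b β), max B₀ B₁, C₀ + C₁,
    hB₀.trans (le_max_left _ _), by positivity, fun k => ?_, fun j β x => hsupp _ β x,
    fun j β => ?_, fun j m γ hj β hβ => ?_, fun φ hφ f θ j => ?_⟩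
  · refine ⟨schwartzNorm k (σ 0) + schwartzNorm k (σ r), fun j => ?_⟩
    have h0 : 0 ≤ schwartzNorm k (σ 0) := apply_nonneg _ _
    have h1 : 0 ≤ schwartzNorm k (σ r) := apply_nonneg _ _
    dsimp only
    rcases ht01 j with h | h <;> rw [h] <;> linarith
  · have hq0 := quarkWeight_mono (by linarith) (le_max_left B₀ B₁) β
    have hq1 := quarkWeight_mono (by linarith) (le_max_right B₀ B₁) β
    have hq := (quarkWeight_pos (by positivity : 0 < max B₀ B₁) β).le
    dsimp only
    rcases ht01 j with h | h <;> rw [h]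
    · refine (h₀ β).trans ((mul_le_mul_of_nonneg_left hq0 hC₀.le).trans ?_)
      gcongr
      linarith
    · refine (h₁ β).trans ((mul_le_mul_of_nonneg_left hq1 hC₁.le).trans ?_)
      gcongr
      linarith
  · have h1 : t j = r := by simp [ht]; omega
    have hc : HasCompactSupport (bump j (cubeCenter j m) (b γ)) :=
      hasCompactSupport_of_cube hd0 (ν := j) (m := m) fun x hx => by
        by_contra h
        exact hx (bump_quark_eq_zero hψ hb h γ)
    have h2 := integral_monomial_lapCLM_pow hc r β hβ
    rw [lapCLM_pow_bump] at h2
    simp only [smul_apply] at h2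
    simp_rw [smul_comm _ (((2 : ℝ) ^ j) ^ (2 * r))] at h2
    rw [integral_smul, smul_eq_zero] at h2
    simp only [h1]
    exact h2.resolve_left (by positivity)
  · exact hφ.hasSum_integral_dyadicBlock_atoms hd0 hψ hψ1 hb (hbn 0) (htj j) (hσ (t j)) f θ

theorem exists_unit_smul_eq [Nontrivial E] (v : E) : ∃ e : E, ‖e‖ = 1 ∧ (‖v‖ : ℂ) • e = v := by
  by_cases hv : v = 0
  · obtain ⟨e, he⟩ := exists_norm_eq E zero_le_one
    exact ⟨e, he, by simp [hv]⟩
  · have h : (‖v‖ : ℂ) ≠ 0 := by exact_mod_cast norm_ne_zero_iff.2 hv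
    refine ⟨(‖v‖ : ℂ)⁻¹ • v, ?_, by rw [smul_smul, mul_inv_cancel₀ h, one_smul]⟩
    rw [norm_smul, norm_inv, Complex.norm_real, norm_norm, inv_mul_cancel₀ (norm_ne_zero_iff.2 hv)]

variable {n : ℕ} {E : Type*} [NormedAddCommGroup E] [NormedSpace ℂ E]

/-! ### The analysis estimate -/

/-- The building block `h` normalised to an atom at `Q_{ν,m}`. -/
def blockAtom (σ : ℝ) (κ : ℝ) (h : 𝓢(Rn n, ℂ)) (ν : ℕ) (m : Fin n → ℤ) : 𝓢(Rn n, ℂ) :=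
  bump ν (cubeCenter ν m) (((κ⁻¹ * 2 ^ (-(ν : ℝ) * σ) : ℝ) : ℂ) • h)

/-- The coefficient compensating the normalisation of `blockAtom`. -/
def blockCoeff (σ : ℝ) (κ : ℝ) (ν : ℕ) (v : E) : ℂ := ((κ * 2 ^ ((ν : ℝ) * σ) * ‖v‖ : ℝ) : ℂ)

theorem blockCoeff_mul_integral_smul {κ : ℝ} (hκ : 0 < κ) (σ : ℝ) (h : 𝓢(Rn n, ℂ)) (ν : ℕ)
    (m : Fin n → ℤ) {v e : E} (he : (‖v‖ : ℂ) • e = v) (θ : 𝓢(Rn n, ℂ)) :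
    (blockCoeff σ κ ν v * ∫ x, θ x * blockAtom σ κ h ν m x) • e =
      (∫ x, θ x * bump ν (cubeCenter ν m) h x) • v := by
  have h1 : κ * 2 ^ ((ν : ℝ) * σ) * (κ⁻¹ * 2 ^ (-(ν : ℝ) * σ)) = 1 := by
    rw [neg_mul, Real.rpow_neg two_pos.le]
    field_simp
  have h2 : ∀ x, θ x * blockAtom σ κ h ν m x =
      ((κ⁻¹ * 2 ^ (-(ν : ℝ) * σ) : ℝ) : ℂ) * (θ x * bump ν (cubeCenter ν m) h x) := fun x => by
    rw [blockAtom, map_smul, smul_apply, smul_eq_mul]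
    ring
  conv_rhs => rw [← he, smul_smul]
  congr 1
  simp_rw [h2]
  rw [integral_const_mul, blockCoeff]
  calc _ = ((κ * 2 ^ ((ν : ℝ) * σ) * (κ⁻¹ * 2 ^ (-(ν : ℝ) * σ)) : ℝ) : ℂ) *
        ((∫ x, θ x * bump ν (cubeCenter ν m) h x) * (‖v‖ : ℂ)) := by push_cast; ring
    _ = _ := by rw [h1]; simp

theorem isAtom_blockAtom {d s κ : ℝ} (hκ : 0 < κ) {p : ℝ≥0∞} {K : ℕ} {L : ℤ} {ν : ℕ}
    {m : Fin n → ℤ} {h : 𝓢(Rn n, ℂ)} (hsupp : ∀ x, h x ≠ 0 → x ∈ cube d 0 0)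
    (hS : schwartzNorm K h ≤ κ)
    (hmom : ∀ β : Fin n → ℕ, ((∑ i, β i : ℕ) : ℤ) ≤ L →
      ∫ x : Rn n, (∏ i, x i ^ β i) • bump ν (cubeCenter ν m) h x = 0) :
    IsAtom d s p K L ν m (blockAtom (s - n * (p⁻¹).toReal) κ h ν m) := by
  refine isAtom_bump (fun x hx => hsupp x ?_) ?_ fun β hβ => ?_
  · rw [smul_apply] at hx
    exact right_ne_zero_of_mul hx
  · rw [map_smul_eq_mul, Complex.norm_real, Real.norm_of_nonneg (by positivity)]
    calc κ⁻¹ * 2 ^ (-(ν : ℝ) * (s - n * (p⁻¹).toReal)) * schwartzNorm K h ≤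
          κ⁻¹ * 2 ^ (-(ν : ℝ) * (s - n * (p⁻¹).toReal)) * κ := by gcongr
      _ = _ := by field_simp
  · rw [map_smul]
    simp only [smul_apply]
    simp_rw [smul_comm _ (((κ⁻¹ * 2 ^ (-(ν : ℝ) * (s - n * (p⁻¹).toReal)) : ℝ)) : ℂ)]
    rw [integral_smul, hmom β hβ, smul_zero]

theorem enorm_blockCoeff_mul_amplitude {κ : ℝ} (hκ : 0 < κ) (s : ℝ) (p : ℝ≥0∞) (ν : ℕ) (v : E) :
    ‖blockCoeff (s - n * (p⁻¹).toReal) κ ν v‖ₑ * amplitude n p ν =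
      ENNReal.ofReal κ * (twoPow (ν * s) * ‖v‖ₑ) := by
  have h1 : amplitude n p ν = twoPow (ν * (n * (p⁻¹).toReal)) := rfl
  have h2 : ‖blockCoeff (s - n * (p⁻¹).toReal) κ ν v‖ₑ =
      ENNReal.ofReal κ * twoPow (ν * (s - n * (p⁻¹).toReal)) * ‖v‖ₑ := by
    rw [blockCoeff, ← ofReal_norm, Complex.norm_real, Real.norm_of_nonneg (by positivity),
      ENNReal.ofReal_mul (by positivity), ENNReal.ofReal_mul hκ.le, ofReal_norm]
    rfl
  rw [h1, h2]
  calc _ = ENNReal.ofReal κ * ((twoPow (ν * (s - n * (p⁻¹).toReal)) *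
        twoPow (ν * (n * (p⁻¹).toReal))) * ‖v‖ₑ) := by ring
    _ = _ := by rw [← twoPow_add]; ring_nf

/-- The atomic series with the terms `bump ν (cubeCenter ν m) (h ν γ) • V γ ν m`, those with
`ν = 0` in the first family. -/
def blockSeries (M : ℕ) (s : ℝ) (p : ℝ≥0∞) (κ : (Fin n → ℕ) → ℝ)
    (h : ℕ → (Fin n → ℕ) → 𝓢(Rn n, ℂ)) (V e : (Fin n → ℕ) → ℕ → (Fin n → ℤ) → E) :
    AtomicSeries n E where
  rho γ ν m := if ν = 0 then blockCoeff (M - n * (p⁻¹).toReal) (κ γ) ν (V γ ν m) else 0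
  lam γ ν m := if ν = 0 then 0 else blockCoeff (s - n * (p⁻¹).toReal) (κ γ) ν (V γ ν m)
  e := e
  eL := e
  a γ ν m := if ν = 0 then blockAtom (M - n * (p⁻¹).toReal) (κ γ) (h ν γ) ν m else 0
  aL γ ν m := if ν = 0 then 0 else blockAtom (s - n * (p⁻¹).toReal) (κ γ) (h ν γ) ν m

/-! ### The series assembled from normalised building blocks -/

section

variable {M K r : ℕ} {d s : ℝ} {p : ℝ≥0∞} {L : ℤ} {κ : (Fin n → ℕ) → ℝ}
  {h : ℕ → (Fin n → ℕ) → 𝓢(Rn n, ℂ)} {V e : (Fin n → ℕ) → ℕ → (Fin n → ℤ) → E}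

theorem isAtom_blockSeries_a (hκ : ∀ γ, 0 < κ γ) (hsupp : ∀ j β x, h j β x ≠ 0 → x ∈ cube d 0 0)
    (hS : ∀ j β, schwartzNorm K (h j β) ≤ κ β) (γ : Fin n → ℕ) (ν : ℕ) (m : Fin n → ℤ) :
    IsAtom d (M : ℝ) p K (-1) ν m ((blockSeries M s p κ h V e).a γ ν m) := by
  by_cases hν : ν = 0
  · simp only [blockSeries, if_pos hν]
    exact isAtom_blockAtom (hκ γ) (hsupp ν γ) (hS ν γ) fun β hβ => by omega
  · simp only [blockSeries, if_neg hν]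
    exact isAtom_zero d (M : ℝ) p K (-1) ν m

theorem isAtom_blockSeries_aL (hκ : ∀ γ, 0 < κ γ) (hL : L + 1 = 2 * (r : ℤ))
    (hsupp : ∀ j β x, h j β x ≠ 0 → x ∈ cube d 0 0)
    (hS : ∀ j β, schwartzNorm K (h j β) ≤ κ β)
    (hmom : ∀ j m γ, 1 ≤ j → ∀ β : Fin n → ℕ, ∑ i, β i < 2 * r →
        ∫ x : Rn n, (∏ i, x i ^ β i) • bump j (cubeCenter j m) (h j γ) x = 0)
    (γ : Fin n → ℕ) (ν : ℕ) (m : Fin n → ℤ) :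
    IsAtom d s p K L ν m ((blockSeries M s p κ h V e).aL γ ν m) := by
  by_cases hν : ν = 0
  · simp only [blockSeries, if_pos hν]
    exact isAtom_zero d s p K L ν m
  · simp only [blockSeries, if_neg hν]
    exact isAtom_blockAtom (hκ γ) (hsupp ν γ) (hS ν γ)
      fun β hβ => hmom ν m γ (by omega) β (by omega)

theorem integral_smul_blockSeries_term [CompleteSpace E] (hd : 0 ≤ d) (hκ : ∀ γ, 0 < κ γ)
    (hL : L + 1 = 2 * (r : ℤ)) (hsupp : ∀ j β x, h j β x ≠ 0 → x ∈ cube d 0 0)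
    (hS : ∀ j β, schwartzNorm K (h j β) ≤ κ β)
    (hmom : ∀ j m γ, 1 ≤ j → ∀ β : Fin n → ℕ, ∑ i, β i < 2 * r →
        ∫ x : Rn n, (∏ i, x i ^ β i) • bump j (cubeCenter j m) (h j γ) x = 0)
    (he : ∀ γ ν m, (‖V γ ν m‖ : ℂ) • e γ ν m = V γ ν m) (θ : 𝓢(Rn n, ℂ))
    (γ : Fin n → ℕ) (ν : ℕ) (m : Fin n → ℤ) :
    ∫ x, θ x • (blockSeries M s p κ h V e).term γ ν m x =
      (∫ x, θ x * bump ν (cubeCenter ν m) (h ν γ) x) • V γ ν m := by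
  have h0 := integral_smul_term hd
    (isAtom_blockSeries_a (p := p) (M := M) (s := s) (V := V) (e := e) hκ hsupp hS γ ν m)
    (isAtom_blockSeries_aL (p := p) (M := M) (s := s) (V := V) (e := e) hκ hL hsupp hS hmom γ ν m) θ
    ((blockSeries M s p κ h V e).rho γ ν m) ((blockSeries M s p κ h V e).lam γ ν m)
    (e γ ν m) (e γ ν m)
  refine h0.trans ?_
  by_cases hν : ν = 0
  · simp only [blockSeries, if_pos hν, zero_mul, zero_smul, add_zero]
    exact blockCoeff_mul_integral_smul (hκ γ) _ _ _ _ (he γ ν m) θ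
  · simp only [blockSeries, if_neg hν, zero_mul, zero_smul, zero_add]
    exact blockCoeff_mul_integral_smul (hκ γ) _ _ _ _ (he γ ν m) θ

/-- The first family is nonzero only for ν = 0, where 2^{νs} = 2^{νM} = 1. It can therefore be
measured with the weight s although it is normalised with M. -/
theorem enorm_blockSeries_mul_amplitude_le (hκ : ∀ γ, 0 < κ γ) (γ : Fin n → ℕ) (ν : ℕ)
    (m : Fin n → ℤ) :
    ‖(blockSeries M s p κ h V e).rho γ ν m‖ₑ * amplitude n p ν ≤
        ENNReal.ofReal (κ γ) * (twoPow (ν * s) * ‖V γ ν m‖ₑ) ∧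
      ‖(blockSeries M s p κ h V e).lam γ ν m‖ₑ * amplitude n p ν ≤
        ENNReal.ofReal (κ γ) * (twoPow (ν * s) * ‖V γ ν m‖ₑ) := by
  by_cases hν : ν = 0
  · simp only [blockSeries, if_pos hν, enorm_zero, zero_mul, zero_le, and_true]
    rw [enorm_blockCoeff_mul_amplitude (hκ γ), hν]
    simp
  · simp only [blockSeries, if_neg hν, enorm_zero, zero_mul, zero_le, true_and]
    exact (enorm_blockCoeff_mul_amplitude (hκ γ) _ _ _ _).le

end

/-! ### Size of the series and existence of decompositions -/

variable {n : ℕ} {E : Type*} [NormedAddCommGroup E] [NormedSpace ℂ E] {p : ℝ≥0∞} {r : ℝ}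
  {N : (ℕ → Rn n → ℝ≥0∞) → ℝ≥0∞} {S : (ℕ → (Fin n → ℤ) → ℂ) → ℝ≥0∞}

/-- For each γ the factors 2^{μ|γ|}, B^{|γ|} and B₀^{|γ|}/γ! combine to a quark weight with base 2^μ
B B₀. Its supremum over γ is bounded by its finite sum, for every real μ. -/
theorem IsFunctionNorm.exists_size_blockSeries_le (hN : IsFunctionNorm n p r N S) (hr : 0 < r)
    (M : ℕ) (s μ : ℝ) {B B₀ C₀ : ℝ} (hB : 1 ≤ B) (hB₀ : 1 ≤ B₀) (hC₀ : 0 < C₀) {D : ℝ≥0∞}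
    (hD : D ≠ ∞) : ∃ C : ℝ≥0∞, C ≠ ∞ ∧ ∀ (u : ℕ → Rn n → ℝ≥0∞), (∀ j, Measurable (u j)) →
      ∀ (h : ℕ → (Fin n → ℕ) → 𝓢(Rn n, ℂ)) (V e : (Fin n → ℕ) → ℕ → (Fin n → ℤ) → E),
        (∀ γ ν m, ∀ x ∈ cube 1 ν m,
          ‖V γ ν m‖ₑ ≤ D * ENNReal.ofReal (B ^ (∑ k, γ k)) * avg r ν (u ν) x) →
        (blockSeries M s p (fun γ => C₀ * quarkWeight B₀ γ) h V e).size S μ ≤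
          C * N (fun (j : ℕ) x => twoPow (j * s) * u j x) := by
  obtain ⟨C₁, hC₁, h₁⟩ := hN.le_step
  obtain ⟨C₂, hC₂, h₂⟩ := hN.avg_le
  have hB00 : 0 < B₀ := by linarith
  have hB0 : 0 < B := by linarith
  have hT := tsum_quarkWeight_ne_top (n := n) (B := 2 ^ μ * (B * B₀)) (by positivity)
  set T := ∑' β : Fin n → ℕ, ENNReal.ofReal (quarkWeight (2 ^ μ * (B * B₀)) β)
  refine ⟨2 * C₁ * C₂ * D * ENNReal.ofReal C₀ * T, by finiteness, fun u hu h V e hV => ?_⟩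
  have hκ : ∀ γ : Fin n → ℕ, 0 < C₀ * quarkWeight B₀ γ := fun γ =>
    mul_pos hC₀ (quarkWeight_pos hB00 γ)
  set W := N (fun (j : ℕ) x => twoPow (j * s) * u j x) with hW
  have key : ∀ (γ : Fin n → ℕ) (l : ℕ → (Fin n → ℤ) → ℂ),
      (∀ ν m, ‖l ν m‖ₑ * amplitude n p ν ≤
        ENNReal.ofReal (C₀ * quarkWeight B₀ γ) * (twoPow (ν * s) * ‖V γ ν m‖ₑ)) →
      S l ≤ C₁ * (ENNReal.ofReal (C₀ * quarkWeight B₀ γ) * D *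
        ENNReal.ofReal (B ^ (∑ k, γ k)) * (C₂ * W)) := fun γ l hl => by
    set A := ENNReal.ofReal (C₀ * quarkWeight B₀ γ) * D * ENNReal.ofReal (B ^ (∑ k, γ k)) with hA
    have hAt : A ≠ ∞ := by rw [hA]; finiteness
    refine (h₁ l (fun ν x => A * avg r ν (fun y => twoPow (ν * s) * u ν y) x)
      fun ν m x hx => (hl ν m).trans ?_).trans (mul_le_mul' le_rfl ?_)
    · rw [avg_const_mul hr ν (twoPow_ne_top _)]
      calc _ ≤ ENNReal.ofReal (C₀ * quarkWeight B₀ γ) * (twoPow (ν * s) *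
            (D * ENNReal.ofReal (B ^ (∑ k, γ k)) * avg r ν (u ν) x)) :=
          mul_le_mul' le_rfl (mul_le_mul' le_rfl (hV γ ν m x hx))
        _ = _ := by rw [hA]; ring
    · exact (hN.const_mul_le _ hAt).trans
        (mul_le_mul' le_rfl (h₂ _ fun j => (hu j).const_mul _))
  refine iSup_le fun γ => ?_
  have hw : ENNReal.ofReal ((2 : ℝ) ^ (μ * ((∑ i, γ i : ℕ) : ℝ))) *
      (ENNReal.ofReal (C₀ * quarkWeight B₀ γ) * ENNReal.ofReal (B ^ (∑ k, γ k))) ≤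
        ENNReal.ofReal C₀ * T := by
    have hq := (quarkWeight_pos hB00 γ).le
    rw [← ENNReal.ofReal_mul (by positivity), ← ENNReal.ofReal_mul (by positivity),
      Real.rpow_mul two_pos.le, Real.rpow_natCast]
    have e1 : ((2 : ℝ) ^ μ) ^ (∑ i, γ i) * (C₀ * quarkWeight B₀ γ * B ^ (∑ k, γ k)) =
        C₀ * quarkWeight (2 ^ μ * (B * B₀)) γ := by
      rw [← pow_mul_quarkWeight, ← pow_mul_quarkWeight]
      ring
    rw [e1, ENNReal.ofReal_mul hC₀.le]
    exact mul_le_mul' le_rfl (ENNReal.le_tsum γ)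
  calc _ ≤ ENNReal.ofReal ((2 : ℝ) ^ (μ * ((∑ i, γ i : ℕ) : ℝ))) *
        (C₁ * (ENNReal.ofReal (C₀ * quarkWeight B₀ γ) * D *
          ENNReal.ofReal (B ^ (∑ k, γ k)) * (C₂ * W)) +
        C₁ * (ENNReal.ofReal (C₀ * quarkWeight B₀ γ) * D *
          ENNReal.ofReal (B ^ (∑ k, γ k)) * (C₂ * W))) :=
      mul_le_mul' le_rfl (add_le_add
        (key γ _ fun ν m => (enorm_blockSeries_mul_amplitude_le hκ γ ν m).1)
        (key γ _ fun ν m => (enorm_blockSeries_mul_amplitude_le hκ γ ν m).2))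
    _ = ENNReal.ofReal ((2 : ℝ) ^ (μ * ((∑ i, γ i : ℕ) : ℝ))) *
      (ENNReal.ofReal (C₀ * quarkWeight B₀ γ) * ENNReal.ofReal (B ^ (∑ k, γ k))) *
        (2 * C₁ * C₂ * D * W) := by ring
    _ ≤ ENNReal.ofReal C₀ * T * (2 * C₁ * C₂ * D * W) := mul_le_mul' hw le_rfl
    _ = _ := by ring

/-- Every distribution in the function space has an atomic decomposition. -/
theorem IsFunctionNorm.exists_analysis_le [CompleteSpace E] [Nontrivial E]
    (hN : IsFunctionNorm n p r N S) (hr : 0 < r) (hr1 : r ≤ 1) (hp : p ≠ 0) {d : ℝ} (hd : 1 < d)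
    {s : ℝ} {M K k : ℕ} {L : ℤ} (hL : L + 1 = 2 * (k : ℤ)) (hMs : s < M) (hKs : s < K)
    (hM : n * (1 / r - 1) < M) (hl : n * (1 / r - 1) < s + (2 * k : ℕ)) {μ : ℝ} (hμ : 0 < μ)
    {φ : ℕ → 𝓢(Rn n, ℂ)} (hφ : IsDyadicResolution φ) :
    ∃ C : ℝ≥0∞, C ≠ ∞ ∧ ∀ f : 𝓢'(Rn n, E),
      N (fun (j : ℕ) x => twoPow (j * s) * ‖dyadicBlock φ f j x‖ₑ) ≠ ∞ →
      ∃ R : AtomicSeries n E, R.Represents d M s p K L f ∧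
        R.size S μ ≤ C * N (fun (j : ℕ) x => twoPow (j * s) * ‖dyadicBlock φ f j x‖ₑ) := by
  have hd0 : 0 ≤ d := by linarith
  obtain ⟨σ, h, B₀, C₀, hB₀, hC₀, hσ, hsupp, hS, hmom, hsum⟩ :=
    exists_buildingBlocks (n := n) (E := E) hd K k
  obtain ⟨B, D, hB, hD, hT⟩ := hφ.exists_enorm_taylorAt_le (E := E) hr hr1 hσ
  obtain ⟨C, hC, hsize⟩ := hN.exists_size_blockSeries_le (E := E) hr M s μ hB hB₀ hC₀ hD
  refine ⟨C, hC, fun f hf => ?_⟩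
  set V : (Fin n → ℕ) → ℕ → (Fin n → ℤ) → E := fun γ j m => fourierConst n •
    taylorAt (f : 𝓢(Rn n, ℂ) →L[ℂ] E) (smulLeftCLM ℂ (σ j) (dilCLM j (φ j))) j γ m with hV
  choose e he1 he using fun γ ν m => exists_unit_smul_eq (V γ ν m)
  have hκ : ∀ γ : Fin n → ℕ, 0 < C₀ * quarkWeight B₀ γ := fun γ =>
    mul_pos hC₀ (quarkWeight_pos (by linarith) γ)
  have hu : ∀ (j : ℕ) (x : Rn n), ‖dyadicBlock φ f j x‖ₑ =
      ‖fourierConst n‖ₑ * ‖(f : 𝓢(Rn n, ℂ) →L[ℂ] E) (waveCLM x (φ j))‖ₑ := fun j x =>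
    enorm_dyadicBlock φ f j x
  have hum : ∀ j : ℕ, Measurable fun x : Rn n => ‖dyadicBlock φ f j x‖ₑ := fun j => by
    simp_rw [hu]
    exact (measurable_enorm_waveCLM _ _).const_mul _
  have hVle : ∀ γ ν m, ∀ x ∈ cube 1 ν m, ‖V γ ν m‖ₑ ≤ D * ENNReal.ofReal (B ^ (∑ k, γ k)) *
      avg r ν (fun y => ‖dyadicBlock φ f ν y‖ₑ) x := fun γ ν m x hx => by
    have h3 := avg_const_mul hr ν (c := ‖fourierConst n‖ₑ) enorm_ne_top
      (fun y : Rn n => ‖(f : 𝓢(Rn n, ℂ) →L[ℂ] E) (waveCLM y (φ ν))‖ₑ) x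
    simp_rw [← hu] at h3
    rw [h3, hV, enorm_smul]
    refine (mul_le_mul' le_rfl (hT (f : 𝓢(Rn n, ℂ) →L[ℂ] E) ν γ m x hx)).trans (le_of_eq ?_)
    exact mul_left_comm _ _ _
  set R := blockSeries M s p (fun γ => C₀ * quarkWeight B₀ γ) h V e with hR
  have hRs := hsize _ hum h V e hVle
  have ha := fun γ ν m => isAtom_blockSeries_a (p := p) (M := M) (s := s) (V := V) (e := e)
    hκ hsupp hS γ ν m
  have haL := fun γ ν m => isAtom_blockSeries_aL (p := p) (M := M) (s := s) (V := V) (e := e)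
    hκ hL hsupp hS hmom γ ν m
  refine ⟨R, ⟨he1, he1, ha, haL, fun θ => ?_⟩, hRs⟩
  -- Finite size first gives unconditional convergence in all indices. The limit is then identified
  -- by summing over γ and m for fixed j, which yields the dyadic blocks, and finally over j.
  have hsm := summable_of_tsum_enorm_ne_top (hN.tsum_enorm_integral_term_ne_top hr hr1 hp hd0
    (L := L) (l := 2 * k) (by push_cast; exact hL) hMs hKs hM hl hμ (R := R) he1 he1 ha haL
    (ne_top_of_le_ne_top (ENNReal.mul_ne_top hC hf) hRs) θ)
  have hterm : ∀ γ ν m, ∫ x, θ x • R.term γ ν m x =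
      (∫ x, θ x * bump ν (cubeCenter ν m) (h ν γ) x) • V γ ν m :=
    integral_smul_blockSeries_term hd0 hκ hL hsupp hS hmom he θ
  set eq : ℕ × (Fin n → ℕ) × (Fin n → ℤ) ≃ (Fin n → ℕ) × ℕ × (Fin n → ℤ) :=
    ⟨fun i => (i.2.1, i.1, i.2.2), fun i => (i.2.1, i.1, i.2.2), fun _ => rfl, fun _ => rfl⟩ with heq
  have h1 := (eq.hasSum_iff.2 hsm.hasSum).prod_fiberwise (g := fun j =>
    ∫ x, θ x • dyadicBlock φ f j x) fun j => by
      simp only [Function.comp_def, heq, Equiv.coe_fn_mk]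
      simp_rw [hterm]
      exact hsum φ hφ f θ j
  have h2 := h1.unique (hφ.hasSum_integral_dyadicBlock f θ)
  rw [← h2]
  exact hsm.hasSum

variable {n : ℕ} {E : Type*} [NormedAddCommGroup E] [NormedSpace ℂ E] {p : ℝ≥0∞} {r : ℝ}
  {N : (ℕ → Rn n → ℝ≥0∞) → ℝ≥0∞} {S : (ℕ → (Fin n → ℤ) → ℂ) → ℝ≥0∞}

/-! ### The atomic characterisation -/

/-- The atomic characterisation of the space of distributions given by a function quasi-norm. -/
theorem IsFunctionNorm.atomic_characterization [CompleteSpace E] [Nontrivial E]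
    (hN : IsFunctionNorm n p r N S) (hr : 0 < r) (hr1 : r ≤ 1) (hp : p ≠ 0) {d : ℝ} (hd : 1 < d)
    {s : ℝ} {M K k : ℕ} {L : ℤ} (hL : L + 1 = 2 * (k : ℤ)) (hMs : s < M) (hKs : s < K)
    (hM : n * (1 / r - 1) < M) (hl : n * (1 / r - 1) < s + (2 * k : ℕ)) {μ : ℝ} (hμ : 0 < μ)
    {φ : ℕ → 𝓢(Rn n, ℂ)} (hφ : IsDyadicResolution φ) {W : 𝓢'(Rn n, E) → ℝ≥0∞}
    (hW : ∀ f, W f = N (fun (j : ℕ) x => twoPow (j * s) * ‖dyadicBlock φ f j x‖ₑ)) :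
    (∀ f : 𝓢'(Rn n, E), W f < ∞ ↔ (AtomicSeries.admissible S μ d M s p K L f).Nonempty) ∧
      ∃ c C : ℝ, 0 < c ∧ 0 < C ∧ ∀ f : 𝓢'(Rn n, E), W f < ∞ →
        ENNReal.ofReal c * W f ≤ AtomicSeries.infSize S μ d M s p K L f ∧
        AtomicSeries.infSize S μ d M s p K L f ≤ ENNReal.ofReal C * W f := by
  obtain ⟨A, hA, hsyn⟩ := hN.exists_synthesis_le (E := E) hr hr1 (by linarith : 0 ≤ d) (L := L)
    (l := 2 * k) (by push_cast; exact hL) hMs hKs hM hl hμ hφ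
  obtain ⟨C, hC, hana⟩ := hN.exists_analysis_le (E := E) hr hr1 hp hd hL hMs hKs hM hl hμ hφ
  simp_rw [← hW] at hsyn hana
  -- Adding 1 keeps the constants strictly positive, since A and C are only known to be finite.
  refine ⟨fun f => ⟨fun hf => ?_, ?_⟩, (A + 1).toReal⁻¹, (C + 1).toReal, ?_, ?_, fun f hf => ⟨?_, ?_⟩⟩
  · obtain ⟨R, hR, hRs⟩ := hana f hf.ne
    exact ⟨R, hR, hRs.trans_lt (ENNReal.mul_lt_top hC.lt_top hf)⟩
  · rintro ⟨R, hR, hRs⟩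
    exact (hsyn f R hR).trans_lt (ENNReal.mul_lt_top hA.lt_top hRs)
  · exact inv_pos.2 (ENNReal.toReal_pos (by simp) (by finiteness))
  · exact ENNReal.toReal_pos (by simp) (by finiteness)
  · refine le_iInf₂ fun R hR => ?_
    rw [ENNReal.ofReal_inv_of_pos (ENNReal.toReal_pos (by simp) (by finiteness)),
      ENNReal.ofReal_toReal (by finiteness), mul_comm, ← div_eq_mul_inv]
    refine ENNReal.div_le_of_le_mul' ((hsyn f R hR.1).trans ?_)
    exact mul_le_mul' le_self_add le_rfl
  · obtain ⟨R, hR, hRs⟩ := hana f hf.ne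
    refine (iInf₂_le R ⟨hR, hRs.trans_lt (ENNReal.mul_lt_top hC.lt_top hf)⟩).trans (hRs.trans ?_)
    rw [ENNReal.ofReal_toReal (by finiteness)]
    exact mul_le_mul' le_self_add le_rfl

/-- An exponent slightly below `min 1 t` which still satisfies the conditions imposed on `M` and
`L` by `sigma n t`. -/
theorem exists_exponent_lt {t : ℝ≥0∞} (ht : t ≠ 0) {s : ℝ} {M k : ℕ} {L : ℤ}
    (hL : L + 1 = 2 * (k : ℤ)) (hM : sigma n t < M) (hLs : ⌊sigma n t - s⌋ ≤ L) :
    ∃ r : ℝ, 0 < r ∧ r ≤ 1 ∧ ENNReal.ofReal r < t ∧ n * (1 / r - 1) < M ∧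
      n * (1 / r - 1) < s + (2 * k : ℕ) := by
  have h1 : sigma n t < s + (2 * k : ℕ) := by
    have h2 := Int.lt_floor_add_one (sigma n t - s)
    -- Integrality of L turns the bound on the floor into the strict inequality σ - s < L + 1 = 2k,
    -- which leaves room for the loss ε.
    have h3 : (⌊sigma n t - s⌋ : ℝ) + 1 ≤ (2 * k : ℕ) := by
      have : ⌊sigma n t - s⌋ + 1 ≤ ((2 * k : ℕ) : ℤ) := by push_cast; omega
      exact_mod_cast this
    linarith
  set x := max ((t⁻¹).toReal - 1) 0 with hx
  have hx0 : 0 ≤ x := le_max_right _ _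
  have hs : sigma n t = n * x := rfl
  rw [hs] at hM h1
  obtain ⟨ε, hε, hε'⟩ : ∃ ε : ℝ, 0 < ε ∧ n * ε < min ((M : ℝ) - n * x) (s + (2 * k : ℕ) - n * x) := by
    have h2 : 0 < min ((M : ℝ) - n * x) (s + (2 * k : ℕ) - n * x) :=
      lt_min (by linarith) (by linarith)
    refine ⟨_, div_pos h2 (by positivity : (0 : ℝ) < n + 1), ?_⟩
    rw [← mul_div_assoc, div_lt_iff₀ (by positivity)]
    nlinarith
  have h4 := hε'.trans_le (min_le_left _ _)
  have h5 := hε'.trans_le (min_le_right _ _)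
  have h6 : 0 < x + ε + 1 := by positivity
  -- The exponent r = 1/(1+x+ε) exceeds the critical value x of 1/r - 1 by exactly ε, which makes r
  -- strictly smaller than t.
  have h7 : 1 / (x + ε + 1)⁻¹ - 1 = x + ε := by rw [one_div, inv_inv]; ring
  refine ⟨(x + ε + 1)⁻¹, inv_pos.2 h6, inv_le_one_of_one_le₀ (by linarith), ?_, ?_, ?_⟩
  · rcases eq_or_ne t ∞ with rfl | htt
    · exact ENNReal.ofReal_lt_top
    rw [ENNReal.ofReal_lt_iff_lt_toReal (inv_pos.2 h6).le htt]
    have ht0 := ENNReal.toReal_pos ht htt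
    have h8 : (t⁻¹).toReal - 1 ≤ x := le_max_left _ _
    rw [ENNReal.toReal_inv] at h8
    exact inv_lt_of_inv_lt₀ ht0 (by linarith)
  · rw [h7]; linarith
  · rw [h7]; linarith

theorem besovNorm_eq (φ : ℕ → 𝓢(Rn n, ℂ)) (s : ℝ) (p q : ℝ≥0∞) (f : 𝓢'(Rn n, E)) :
    besovNorm φ s p q f =
      lqLpNorm p q (fun (j : ℕ) x => twoPow (j * s) * ‖dyadicBlock φ f j x‖ₑ) := by
  rw [besovNorm, lqLpNorm]
  congr 1
  ext j
  have h := eLpNorm_const_smul (((2 : ℝ) ^ ((j : ℝ) * s) : ℝ)) (fun x => ‖dyadicBlock φ f j x‖) p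
    (volume : Measure (Rn n))
  rw [eLpNorm_norm, Real.enorm_of_nonneg (by positivity)] at h
  rw [← h]
  refine eLpNorm_congr_enorm_ae (Filter.Eventually.of_forall fun x => ?_)
  rw [Pi.smul_apply, enorm_smul, Real.enorm_of_nonneg (by positivity), enorm_norm]
  rfl

end AtomicDecomp

end

/-! ### The theorem for both scales of spaces -/

theorem mainTheorem2 {n : ℕ} (hn : 1 ≤ n)
    {E : Type*} [NormedAddCommGroup E] [NormedSpace ℂ E] [CompleteSpace E] [Nontrivial E]
    (d : ℝ) (hd : 1 < d) (p q : ℝ≥0∞) (hp : (n : ℝ≥0∞) / (n + 1) < p) (hq : 0 < q) (s : ℝ)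
    (M K : ℕ) (hMs : s < M) (hK : ⌊s⌋ + 1 ≤ (K : ℤ))
    (L : ℤ) (hL : ∃ r : ℕ, L + 1 = 2 * (r : ℤ)) :
    (AtomicDecomp.sigma n p < M → ⌊AtomicDecomp.sigma n p - s⌋ ≤ L →
      ∃ κ : ℝ, 0 < κ ∧ ∀ μ : ℝ, κ ≤ μ →
        ∀ φ : ℕ → 𝓢(AtomicDecomp.Rn n, ℂ), AtomicDecomp.IsDyadicResolution φ →
          (∀ f : 𝓢'(AtomicDecomp.Rn n, E), AtomicDecomp.MemBesov φ s p q f ↔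
            (AtomicDecomp.AtomicSeries.admissible (AtomicDecomp.bNorm p q)
              μ d M s p K L f).Nonempty) ∧
          ∃ c C : ℝ, 0 < c ∧ 0 < C ∧
            ∀ f : 𝓢'(AtomicDecomp.Rn n, E), AtomicDecomp.MemBesov φ s p q f →
              ENNReal.ofReal c * AtomicDecomp.besovNorm φ s p q f ≤
                AtomicDecomp.AtomicSeries.infSize (AtomicDecomp.bNorm p q)
                  μ d M s p K L f ∧
              AtomicDecomp.AtomicSeries.infSize (AtomicDecomp.bNorm p q)
                  μ d M s p K L f ≤
                ENNReal.ofReal C * AtomicDecomp.besovNorm φ s p q f) ∧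
    (p < ∞ → AtomicDecomp.sigma n (min p q) < M →
      ⌊AtomicDecomp.sigma n (min p q) - s⌋ ≤ L →
      ∃ κ : ℝ, 0 < κ ∧ ∀ μ : ℝ, κ ≤ μ →
        ∀ φ : ℕ → 𝓢(AtomicDecomp.Rn n, ℂ), AtomicDecomp.IsDyadicResolution φ →
          (∀ f : 𝓢'(AtomicDecomp.Rn n, E), AtomicDecomp.MemTriebelLizorkin φ s p q f ↔
            (AtomicDecomp.AtomicSeries.admissible (AtomicDecomp.fNorm p q)
              μ d M s p K L f).Nonempty) ∧
          ∃ c C : ℝ, 0 < c ∧ 0 < C ∧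
            ∀ f : 𝓢'(AtomicDecomp.Rn n, E), AtomicDecomp.MemTriebelLizorkin φ s p q f →
              ENNReal.ofReal c * AtomicDecomp.triebelLizorkinNorm φ s p q f ≤
                AtomicDecomp.AtomicSeries.infSize (AtomicDecomp.fNorm p q)
                  μ d M s p K L f ∧
              AtomicDecomp.AtomicSeries.infSize (AtomicDecomp.fNorm p q)
                  μ d M s p K L f ≤
                ENNReal.ofReal C * AtomicDecomp.triebelLizorkinNorm φ s p q f) := by
  obtain ⟨k, hk⟩ := hL
  have hp0 : p ≠ 0 := (pos_of_gt hp).ne'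
  have hKs : s < K := by
    have h1 := Int.lt_floor_add_one s
    have h2 : (⌊s⌋ : ℝ) + 1 ≤ K := by exact_mod_cast hK
    linarith
  refine ⟨fun hM hLs => ?_, fun hpt hM hLs => ?_⟩
  · obtain ⟨r, hr, hr1, hrp, hrM, hrl⟩ := AtomicDecomp.exists_exponent_lt hp0 hk hM hLs
    -- Only positivity of μ is needed, so any positive threshold would serve.
    refine ⟨1, one_pos, fun μ hμ φ hφ => ?_⟩
    exact (AtomicDecomp.isFunctionNorm_lqLpNorm hq.ne' hr hrp.le).atomic_characterization hr hr1
      hp0 hd hk hMs hKs hrM hrl (one_pos.trans_le hμ) hφ (AtomicDecomp.besovNorm_eq φ s p q)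
  · obtain ⟨r, hr, hr1, hrt, hrM, hrl⟩ := AtomicDecomp.exists_exponent_lt
      (lt_min (pos_of_gt hp) hq).ne' hk hM hLs
    refine ⟨1, one_pos, fun μ hμ φ hφ => ?_⟩
    exact (AtomicDecomp.isFunctionNorm_lpLqNorm hpt.ne hr (hrt.trans_le (min_le_left _ _))
      (hrt.trans_le (min_le_right _ _))).atomic_characterization hr hr1 hp0 hd hk hMs hKs hrM hrl
        (one_pos.trans_le hμ) hφ fun _ => rfl
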